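/- **Setting.** Let $\Omega\subset\mathbb R^2$ be a bounded open convex set and $n\ge 1$. Let $p_1,q_1,p_2,q_2,\dots,p_n,q_n$ be distinct points of the closed curve $\partial\Omega$, met in this order when $\partial\Omega$ is traversed once (clockwise, say), and put $p_{n+1}:=p_1$. For $i=1,\dots,n$ let $\partial^D_i\Omega$ be the open arc of $\partial\Omega$ from $p_i$ to $q_i$ and $\partial^0_i\Omega$ the open arc from $q_i$ to $p_{i+1}$. Let $\varphi:\partial\Omega\to[0,+\infty)$ be continuous, with $\varphi=0$ on every $\partial^0_i\Omega$ and $\varphi>0$ on every $\partial^D_i\Omega$, and such that the graph of $\varphi$ over each $\partial^D_i\Omega$ is a Lipschitz curve in $\mathbb R^3$. **Admissible pairs.** For $\sigma=(\sigma_1,\dots,\sigma_n)$, where each $\sigma_i:[0,1]\to\overline\Omega$ is Lipschitz and injective with $\sigma_i(0)=q_i$ and $\sigma_i(1)=p_{i+1}$, let $E(\sigma_i)$ be the closed region enclosed between $\partial^0_i\Omega$ and $\sigma_i$, that is, the union of the compact set $\Gamma_i=\overline{\partial^0_i\Omega}\cup\sigma_i([0,1])$ and of the bounded connected components of $\mathbb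 R^2\setminus\Gamma_i$; let $E(\sigma)=\bigcup_{i=1}^nE(\sigma_i)$. Let $\Sigma_{\rm conv}$ be the set of those $\sigma$ for which the interiors of $E(\sigma_1),\dots,E(\sigma_n)$ are pairwise disjoint and every $E(\sigma_i)$ is convex, and let $$\mathcal W_{\rm conv}=\{(\sigma,\psi)\in\Sigma_{\rm conv}\times BV(\Omega):\ \psi=0\ \text{a.e. in } E(\sigma)\}.$$ **Functional.** For $\psi\in BV(\Omega)$ write $D\psi=\nabla\psi\,\mathcal L^2+D^s\psi$ for the decomposition of the distributional gradient into its absolutely continuous and singular parts, and $$\mathcal A(\psi;\Omega)=\int_\Omega\sqrt{1+|\nabla\psi|^2}\,dx+|D^s\psi|(\Omega).$$ For $(\sigma,\psi)\in\mathcal W_{\rm conv}$ let $$\mathcal F(\sigma,\psi)=\mathcal A(\psi;\Omega)-|E(\sigma)|+\int_{\partial\Omega}|\psi-\varphi|\,d\mathcal H^1,$$ where $|E(\sigma)|$ is the Lebesgue measure of $E(\sigma)$ and, in the last integral, $\psi$ is the trace of $\psi$ on $\partial\Omega$: its value at $x$ is the number $z$ with $\lim_{r\to0^+}\frac1{|B_r(x)\cap\Omega|}\int_{B_r(x)\cap\Omega}|\psi(y)-z|\,dy=0$,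 which exists for $\mathcal H^1$-a.e. $x\in\partial\Omega$. **Theorem.** The functional $\mathcal F$ attains its minimum on $\mathcal W_{\rm conv}$: there is $(\sigma,\psi)\in\mathcal W_{\rm conv}$ such that $\mathcal F(\sigma,\psi)$ is a real number and $\mathcal F(\sigma,\psi)\le\mathcal F(\sigma',\psi')$ for all $(\sigma',\psi')\in\mathcal W_{\rm conv}$. -/

import Mathlib

open MeasureTheory Set Filter Topology
open scoped ENNReal NNReal ContDiff

noncomputable section

namespace RelaxedArea

/-- The Euclidean plane. -/
abbrev Plane : Type := EuclideanSpace ℝ (Fin 2)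

/-! ### Functions of bounded variation and the relaxed area functional -/

/-- `μ` is the distributional gradient `Dψ` of `ψ` in the open set `Ω`: a (finite) vector-valued
measure, carried by `Ω`, with `∫_Ω ψ ∇η dx = - ∫_Ω η dDψ` for all `η ∈ C_c^∞(Ω)`.
Such a measure is unique. -/
def IsDistribGradient (Ω : Set Plane) (ψ : Plane → ℝ) (μ : VectorMeasure Plane Plane) : Prop :=
  μ.restrict Ω = μ ∧
    ∀ η : Plane → ℝ, ContDiff ℝ ∞ η → HasCompactSupport η → tsupport η ⊆ Ω →
      ∫ x in Ω, ψ x • gradient η x = - ∫ᵛ x, η x ∂•μ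

/-- `ψ ∈ BV(Ω)`. The values of `ψ` outside `Ω` play no role. -/
def MemBV (Ω : Set Plane) (ψ : Plane → ℝ) : Prop :=
  IntegrableOn ψ Ω ∧ ∃ μ : VectorMeasure Plane Plane, IsDistribGradient Ω ψ μ

open scoped Classical in
/-- The distributional gradient `Dψ` of `ψ ∈ BV(Ω)` (and `0` if `ψ` is not in `BV(Ω)`). -/
def distribGrad (Ω : Set Plane) (ψ : Plane → ℝ) : VectorMeasure Plane Plane :=
  if h : ∃ μ : VectorMeasure Plane Plane, IsDistribGradient Ω ψ μ then h.choose else 0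

/-- The `j`-th component of a vector-valued measure in the plane. -/
def component (μ : VectorMeasure Plane Plane) (j : Fin 2) : SignedMeasure Plane :=
  μ.mapRange (AddMonoidHom.mk' (fun x : Plane => x j) (fun _ _ => PiLp.add_apply _ _ _ _))
    (show Continuous fun x : Plane => x j by fun_prop)

theorem component_apply (μ : VectorMeasure Plane Plane) (j : Fin 2) (A : Set Plane) :
    component μ j A = (μ A) j := rfl

/-- `∇ψ`: the density of the absolutely continuous part of `Dψ` with respect to Lebesgue
measure. -/
def acGrad (Ω : Set Plane) (ψ : Plane → ℝ) (x : Plane) : Plane :=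
  !₂[(component (distribGrad Ω ψ) 0).rnDeriv volume x,
    (component (distribGrad Ω ψ) 1).rnDeriv volume x]

/-- `D^s ψ`: the singular part of `Dψ`, so that `Dψ = ∇ψ ℒ² + D^s ψ`. -/
def singGrad (Ω : Set Plane) (ψ : Plane → ℝ) : VectorMeasure Plane Plane :=
  distribGrad Ω ψ - (volume : Measure Plane).withDensityᵥ (acGrad Ω ψ)

/-- The relaxed area functional `𝒜(ψ; Ω) = ∫_Ω √(1 + |∇ψ|²) dx + |D^s ψ|(Ω)`. -/
def area (Ω : Set Plane) (ψ : Plane → ℝ) : ℝ≥0∞ :=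
  (∫⁻ x in Ω, ENNReal.ofReal (Real.sqrt (1 + ‖acGrad Ω ψ x‖ ^ 2)))
    + (singGrad Ω ψ).variation Ω

/-- `z` is the trace of `ψ` at the boundary point `x` of `Ω`:
the averages of `|ψ - z|` over `B_r(x) ∩ Ω` tend to zero as `r → 0⁺`. -/
def IsTraceAt (Ω : Set Plane) (ψ : Plane → ℝ) (x : Plane) (z : ℝ) : Prop :=
  Tendsto (fun r : ℝ => ⨍ y in Metric.ball x r ∩ Ω, |ψ y - z|) (𝓝[>] 0) (𝓝 0)

open scoped Classical in
/-- The trace of `ψ` on `∂Ω`; for `ψ ∈ BV(Ω)` with `Ω` Lipschitz it exists at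
`ℋ¹`-almost every boundary point (the value `0` is used at the other points). -/
def trace (Ω : Set Plane) (ψ : Plane → ℝ) (x : Plane) : ℝ :=
  if h : ∃ z : ℝ, IsTraceAt Ω ψ x z then h.choose else 0

/-! ### The boundary of the domain -/

/-- `γ` is a `1`-periodic simple parametrization of the closed curve `∂Ω`
(in either orientation). -/
def IsBoundaryParam (Ω : Set Plane) (γ : ℝ → Plane) : Prop :=
  Continuous γ ∧ Function.Periodic γ 1 ∧ InjOn γ (Ico 0 1) ∧ range γ = frontier Ω

/-- The graph of `φ` over `A` is a Lipschitz curve: it is the image of an interval under a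
Lipschitz map into three-dimensional space. -/
def HasLipschitzGraph (φ : Plane → ℝ) (A : Set Plane) : Prop :=
  ∃ (c : ℝ → Plane × ℝ) (K : ℝ≥0), LipschitzOnWith K c (Ioo 0 1) ∧
    c '' Ioo 0 1 = (fun x => (x, φ x)) '' A

/-- The closed region enclosed by a compact set `Γ` of the plane (here a union of two arcs with
common endpoints): `Γ` together with the bounded connected components of its complement. -/
def enclosed (Γ : Set Plane) : Set Plane :=
  Γ ∪ {x | Bornology.IsBounded (connectedComponentIn Γᶜ x)}

/-! ### Admissible pairs

The points are `p_i = γ (s i)` and `q_i = γ (t i)`, and `∂⁰_iΩ` is the image under `γ` of the open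
interval from `t i` to the next `s`. The index type `Fin (n + 1)` of `s` contains the additional
parameter of `p_{n+1} = p_1`. -/

variable {n : ℕ}

/-- `E(σ_i)`, the closed region enclosed between `∂⁰_iΩ` (with its endpoints) and `σ_i`. -/
def region (γ : ℝ → Plane) (s : Fin (n + 1) → ℝ) (t : Fin n → ℝ)
    (σ : Fin n → unitInterval → Plane) (i : Fin n) : Set Plane :=
  enclosed (γ '' Icc (t i) (s i.succ) ∪ range (σ i))

/-- `E(σ)`, the union of the regions `E(σ_i)`. -/
def regionUnion (γ : ℝ → Plane) (s : Fin (n + 1) → ℝ) (t : Fin n → ℝ)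
    (σ : Fin n → unitInterval → Plane) : Set Plane :=
  ⋃ i, region γ s t σ i

/-- The class `Σ` of `n`-tuples of injective Lipschitz curves `σ_i` in the closure of `Ω` which
join `q_i` to `p_{i+1}` and whose regions `E(σ_i)` have mutually disjoint interiors. -/
def Curves (Ω : Set Plane) (γ : ℝ → Plane) (s : Fin (n + 1) → ℝ) (t : Fin n → ℝ) :
    Set (Fin n → unitInterval → Plane) :=
  {σ | (∀ i, (∃ K : ℝ≥0, LipschitzWith K (σ i)) ∧ (∀ τ, σ i τ ∈ closure Ω) ∧
        Function.Injective (σ i) ∧ σ i 0 = γ (t i) ∧ σ i 1 = γ (s i.succ)) ∧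
      ∀ i j, i ≠ j →
        interior (region γ s t σ i) ∩ interior (region γ s t σ j) = ∅}

/-- The class `Σ_conv` of those `σ ∈ Σ` for which every `E(σ_i)` is convex. -/
def CurvesConv (Ω : Set Plane) (γ : ℝ → Plane) (s : Fin (n + 1) → ℝ) (t : Fin n → ℝ) :
    Set (Fin n → unitInterval → Plane) :=
  {σ | σ ∈ Curves Ω γ s t ∧ ∀ i, Convex ℝ (region γ s t σ i)}

/-- The class `𝒲_conv` of pairs `(σ, ψ) ∈ Σ_conv × BV(Ω)` with `ψ = 0` a.e. in `E(σ)`. -/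
def Wconv (Ω : Set Plane) (γ : ℝ → Plane) (s : Fin (n + 1) → ℝ) (t : Fin n → ℝ) :
    Set ((Fin n → unitInterval → Plane) × (Plane → ℝ)) :=
  {w | w.1 ∈ CurvesConv Ω γ s t ∧ MemBV Ω w.2 ∧
      ∀ᵐ x ∂(volume : Measure Plane), x ∈ Ω ∩ regionUnion γ s t w.1 → w.2 x = 0}

/-- The functional `ℱ(σ, ψ) = 𝒜(ψ; Ω) - |E(σ)| + ∫_{∂Ω} |ψ - φ| dℋ¹`, where `ψ` on `∂Ω` is
the trace. The nonnegative terms are computed in `[0, ∞]`, so no value is lost if one of them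
should be infinite; `|E(σ)|` is always finite, as `E(σ)` is bounded. -/
def energy (Ω : Set Plane) (φ : Plane → ℝ) (γ : ℝ → Plane) (s : Fin (n + 1) → ℝ)
    (t : Fin n → ℝ) (w : (Fin n → unitInterval → Plane) × (Plane → ℝ)) : EReal :=
  (area Ω w.2 : EReal) - (volume (regionUnion γ s t w.1) : EReal)
    + ((∫⁻ x in frontier Ω, ENNReal.ofReal |trace Ω w.2 x - φ x| ∂(μH[1]) : ℝ≥0∞) : EReal)

end RelaxedArea

end

noncomputable section

namespace RelaxedArea

/-! ### Plane-valued measures -/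

/-! The proof is the direct method. Up to the subtracted area of `E(σ)`, the functional is
`boundaryArea`, which depends on `ψ` alone. Take a minimizing sequence `(σ_k, ψ_k)`.

Regions. Each `E(σ_{k,i})` is a compact convex subset of the closure of `Ω` containing the `i`-th
arc. Blaschke selection (`exists_limit_regions`) yields Hausdorff limits `K i` which are again
convex with disjoint interiors. The area is upper semicontinuous along the subsequence, and every
interior point of `K i` lies in `E(σ_{k,i})` for all large `k`. Conversely, a compact convex set
between the arc and the closure of `Ω` is, up to a null set, the region of an admissible curve
(`exists_boundingCurve`). If it has interior, the arc lies on its frontier, and the rest of the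
frontier, parametrized radially from an interior point, is the curve. If it has none, the curve is a
segment.

Functions. No compact embedding of `BV` is used. Smooth truncation does not increase `boundaryArea`
(`boundaryArea_comp_le`), so the functions may be taken uniformly bounded, hence bounded in the
Hilbert space `L²(Ω)`. Since `boundaryArea` is convex and lower semicontinuous in `L¹`, its sublevel
sets, with the extra condition of vanishing on `⋂ j ≥ k, E j`, form a decreasing sequence of
nonempty bounded closed convex sets. Such a sequence has a common point
(`nonempty_iInter_of_convex`), and this point is the limit function (`exists_limit_function`).

Lower semicontinuity. On open sets the area is a supremum of pairings with smooth fields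
(`pairing_le`, `exists_pairing_ge`), each continuous in `L¹`. The boundary term alone is not
semicontinuous, as gradient may concentrate at the boundary, but its loss is paid for by that
gradient. On a compact piece `K` of `∂Ω` with normals within `ε` of a direction, `∫_K |v|` is at
most `(1 - ε²)^(-1/2)` times the variation of `v` in a strip along `K` plus `h⁻¹ ∫_Ω |v|`
(`lintegral_trace_flat_le`). Up to small length the boundary consists of finitely many disjoint such
pieces (`exists_flat_decomposition`). The inequality is applied to the difference of the limit and
the `k`-th function. The strips are disjoint from the inner set on which the area is semicontinuous,
so nothing is counted twice; then the strips shrink and `ε` tends to zero.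

Traces. They exist almost everywhere by a Poincaré inequality at dyadic scales, combined with the
linear bound for the length of `∂Ω` in balls (`ae_exists_isTraceAt_of_measurable`). -/

theorem variation_le_component (μ : VectorMeasure Plane Plane) :
    μ.variation ≤ (component μ 0).variation + (component μ 1).variation := by
  refine VectorMeasure.variation_le_of_forall_enorm_le fun E hE => ?_
  rw [Measure.add_apply]
  refine le_trans ?_ (add_le_add (VectorMeasure.enorm_measure_le_variation _ E)
    (VectorMeasure.enorm_measure_le_variation _ E))
  rw [component_apply, component_apply, ← ofReal_norm, ← ofReal_norm, ← ofReal_norm,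
    ← ENNReal.ofReal_add (norm_nonneg _) (norm_nonneg _)]
  refine ENNReal.ofReal_le_ofReal ?_
  rw [EuclideanSpace.norm_eq, Fin.sum_univ_two]
  refine Real.sqrt_le_iff.2 ⟨by positivity, ?_⟩
  nlinarith [norm_nonneg (μ E 0), norm_nonneg (μ E 1)]

instance (μ : SignedMeasure Plane) : IsFiniteMeasure μ.variation := by
  rw [← SignedMeasure.totalVariation_eq_variation]; infer_instance

instance (μ : VectorMeasure Plane Plane) : IsFiniteMeasure μ.variation :=
  isFiniteMeasure_of_le _ (variation_le_component μ)

theorem component_variation_le (μ : VectorMeasure Plane Plane) (j : Fin 2) :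
    (component μ j).variation ≤ μ.variation := by
  refine VectorMeasure.variation_le_of_forall_enorm_le fun E hE => ?_
  refine le_trans ?_ (VectorMeasure.enorm_measure_le_variation _ E)
  rw [component_apply, ← ofReal_norm, ← ofReal_norm]
  exact ENNReal.ofReal_le_ofReal (PiLp.norm_apply_le _ _)

theorem integral_plane_apply {m : Measure Plane} {F : Plane → Plane} (hF : Integrable F m)
    (j : Fin 2) : (∫ x, F x ∂m) j = ∫ x, F x j ∂m :=
  ((EuclideanSpace.proj j : Plane →L[ℝ] ℝ).integral_comp_comm hF).symm

theorem integrable_plane {m : Measure Plane} {f g : Plane → ℝ} (hf : Integrable f m)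
    (hg : Integrable g m) : Integrable (fun x => (!₂[f x, g x] : Plane)) m := by
  refine Integrable.of_eval_piLp fun j => ?_
  fin_cases j
  · simpa using hf
  · simpa using hg

theorem withDensityᵥ_plane {m : Measure Plane} {f g : Plane → ℝ} (hf : Integrable f m)
    (hg : Integrable g m) (j : Fin 2) :
    component (m.withDensityᵥ fun x => (!₂[f x, g x] : Plane)) j
      = m.withDensityᵥ (![f, g] j) := by
  ext A hA
  rw [component_apply, withDensityᵥ_apply (integrable_plane hf hg) hA,
    integral_plane_apply (integrable_plane hf hg).integrableOn]
  fin_cases j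
  · simp [withDensityᵥ_apply hf hA]
  · simp [withDensityᵥ_apply hg hA]

theorem ext_component {μ ν : VectorMeasure Plane Plane}
    (h : ∀ j, component μ j = component ν j) : μ = ν := by
  ext A hA j
  rw [← component_apply, ← component_apply, h]

/-- The total variation dominates each component, so the densities come from the scalar
Radon–Nikodym theorem. With them, integrals against a vector measure become ordinary Bochner
integrals. -/
theorem exists_polar (μ : VectorMeasure Plane Plane) :
    ∃ F : Plane → Plane, Measurable F ∧ Integrable F μ.variation ∧
      μ.variation.withDensityᵥ F = μ := by
  have hi (j) := SignedMeasure.integrable_rnDeriv (component μ j) μ.variation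
  refine ⟨fun x => !₂[(component μ 0).rnDeriv μ.variation x,
    (component μ 1).rnDeriv μ.variation x], ?_, integrable_plane (hi 0) (hi 1), ?_⟩
  · have h0 := SignedMeasure.measurable_rnDeriv (component μ 0) μ.variation
    have h1 := SignedMeasure.measurable_rnDeriv (component μ 1) μ.variation
    refine (WithLp.measurable_toLp 2 _).comp ?_
    refine measurable_pi_lambda _ fun j => ?_
    fin_cases j <;> simpa
  · refine ext_component fun j => ?_
    rw [withDensityᵥ_plane (hi 0) (hi 1)]
    have key : μ.variation.withDensityᵥ ((component μ j).rnDeriv μ.variation) = component μ j := by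
      refine SignedMeasure.withDensityᵥ_rnDeriv_eq _ _ ?_
      refine VectorMeasure.AbsolutelyContinuous.mk fun A hA hA0 => ?_
      rw [Measure.toENNRealVectorMeasure_apply_measurable hA] at hA0
      have := (VectorMeasure.enorm_measure_le_variation (component μ j) A).trans
        (component_variation_le μ j A)
      rw [hA0] at this
      simpa using this
    fin_cases j <;> simpa using key

theorem integral_withDensityᵥ_simpleFunc {m : Measure Plane} {F : Plane → Plane}
    (hF : Integrable F m) (η : SimpleFunc Plane ℝ) :
    ∫ᵛ x, η x ∂•(m.withDensityᵥ F) = ∫ x, η x • F x ∂m := by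
  have hint (f : SimpleFunc Plane ℝ) : (m.withDensityᵥ F).Integrable f :=
    SimpleFunc.integrable_of_isFiniteMeasure f
  have hint' (f : SimpleFunc Plane ℝ) : Integrable (fun x => f x • F x) m := by
    obtain ⟨C, hC⟩ := f.exists_forall_norm_le
    exact hF.bdd_smul C f.aestronglyMeasurable (ae_of_all _ hC)
  induction η using SimpleFunc.induction with
  | const c hs =>
    rename_i A
    have h1 : (fun x => (SimpleFunc.piecewise A hs (SimpleFunc.const Plane c)
        (SimpleFunc.const Plane 0)) x) = A.indicator fun _ => c := by
      ext x; simp [SimpleFunc.piecewise_apply, indicator]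
    have h2 : (fun x => (SimpleFunc.piecewise A hs (SimpleFunc.const Plane c)
        (SimpleFunc.const Plane 0)) x • F x) = A.indicator fun x => c • F x := by
      ext x; by_cases hx : x ∈ A <;> simp [hx]
    rw [h1, h2, VectorMeasure.integral_indicator_const _ hs, MeasureTheory.integral_indicator hs,
      MeasureTheory.integral_smul, withDensityᵥ_apply hF hs]
    rfl
  | add hd hf hg =>
    rename_i f g
    simp only [SimpleFunc.coe_add, Pi.add_apply, add_smul]
    rw [VectorMeasure.integral_fun_add (hint f) (hint g), hf, hg,
      MeasureTheory.integral_add (hint' f) (hint' g)]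

theorem integral_withDensityᵥ {m : Measure Plane} {F : Plane → Plane}
    (hF : Integrable F m) {η : Plane → ℝ} (hη : StronglyMeasurable η) {C : ℝ}
    (hC : ∀ x, ‖η x‖ ≤ C) :
    ∫ᵛ x, η x ∂•(m.withDensityᵥ F) = ∫ x, η x • F x ∂m := by
  have hC0 : 0 ≤ C := (norm_nonneg _).trans (hC 0)
  have hb n x : ‖hη.approxBounded C n x‖ ≤ C := hη.norm_approxBounded_le hC0 n x
  have ht x : Tendsto (fun n => hη.approxBounded C n x) atTop (𝓝 (η x)) :=
    hη.tendsto_approxBounded_of_norm_le (hC x)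
  have h1 : Tendsto (fun n => ∫ᵛ x, hη.approxBounded C n x ∂•(m.withDensityᵥ F)) atTop
      (𝓝 (∫ᵛ x, η x ∂•(m.withDensityᵥ F))) :=
    VectorMeasure.tendsto_integral_of_dominated_convergence (fun _ => C)
      (fun n => (hη.approxBounded C n).aestronglyMeasurable) (integrable_const _)
      (fun n => ae_of_all _ (hb n)) (ae_of_all _ ht)
  have h2 : Tendsto (fun n => ∫ x, hη.approxBounded C n x • F x ∂m) atTop
      (𝓝 (∫ x, η x • F x ∂m)) := by
    refine MeasureTheory.tendsto_integral_of_dominated_convergence (fun x => C * ‖F x‖)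
      (fun n => (hη.approxBounded C n).aestronglyMeasurable.smul hF.aestronglyMeasurable)
      (hF.norm.const_mul C) (fun n => ae_of_all _ fun x => ?_)
      (ae_of_all _ fun x => (ht x).smul_const _)
    rw [norm_smul]
    exact mul_le_mul_of_nonneg_right (hb n x) (norm_nonneg _)
  refine tendsto_nhds_unique h1 (h2.congr fun n => ?_)
  rw [integral_withDensityᵥ_simpleFunc hF]

theorem norm_integral_vectorMeasure_le (μ : VectorMeasure Plane Plane) (η : Plane → ℝ) :
    ‖∫ᵛ x, η x ∂•μ‖ ≤ ∫ x, ‖η x‖ ∂μ.variation := by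
  refine VectorMeasure.norm_integral_le_integral_norm.trans ?_
  exact mul_le_of_le_one_left (by positivity) ContinuousLinearMap.opNorm_lsmul_le

/-! ### The area functional as a supremum over test fields -/

/-- Three-dimensional space, the target of the test fields for the area functional. -/
abbrev Space : Type := EuclideanSpace ℝ (Fin 3)

/-- Smooth compactly supported test fields in `U` with values in the unit ball. -/
structure IsTestField (U : Set Plane) (g : Plane → Space) : Prop where
  contDiff : ContDiff ℝ ∞ g
  hasCompactSupport : HasCompactSupport g
  tsupport_subset : tsupport g ⊆ U
  norm_le (x : Plane) : ‖g x‖ ≤ 1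

/-- The pairing `∫_Ω (g₀ + ψ div (g₁, g₂)) dx`. -/
def pairing (Ω : Set Plane) (ψ : Plane → ℝ) (g : Plane → Space) : ℝ :=
  (∫ x in Ω, g x 0) + (∫ x in Ω, ψ x • gradient (fun y => g y 1) x) 0
    + (∫ x in Ω, ψ x • gradient (fun y => g y 2) x) 1

/-- The measure `U ↦ 𝒜(ψ; U)` for `U ⊆ Ω`. -/
def areaMeasure (Ω : Set Plane) (ψ : Plane → ℝ) : Measure Plane :=
  ((volume : Measure Plane).restrict Ω).withDensity
      (fun x => ENNReal.ofReal (Real.sqrt (1 + ‖acGrad Ω ψ x‖ ^ 2)))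
    + (singGrad Ω ψ).variation

theorem area_eq_areaMeasure {Ω : Set Plane} (hΩ : MeasurableSet Ω) (ψ : Plane → ℝ) :
    area Ω ψ = areaMeasure Ω ψ Ω := by
  rw [area, areaMeasure, Measure.add_apply, withDensity_apply _ hΩ, Measure.restrict_restrict hΩ,
    inter_self]

theorem isDistribGradient_distribGrad {Ω : Set Plane} {ψ : Plane → ℝ} (h : MemBV Ω ψ) :
    IsDistribGradient Ω ψ (distribGrad Ω ψ) := by
  rw [distribGrad, dif_pos h.2]
  exact h.2.choose_spec

theorem integrable_acGrad (Ω : Set Plane) (ψ : Plane → ℝ) : Integrable (acGrad Ω ψ) :=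
  integrable_plane (SignedMeasure.integrable_rnDeriv _ _) (SignedMeasure.integrable_rnDeriv _ _)

theorem measurable_acGrad (Ω : Set Plane) (ψ : Plane → ℝ) : Measurable (acGrad Ω ψ) := by
  have h j := SignedMeasure.measurable_rnDeriv (component (distribGrad Ω ψ) j) volume
  refine (WithLp.measurable_toLp 2 _).comp (measurable_pi_lambda _ fun j => ?_)
  fin_cases j
  · simpa using h 0
  · simpa using h 1

theorem component_sub (μ ν : VectorMeasure Plane Plane) (j : Fin 2) :
    component (μ - ν) j = component μ j - component ν j := by
  ext A _
  simp [component_apply]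

theorem component_singGrad (Ω : Set Plane) (ψ : Plane → ℝ) (j : Fin 2) :
    component (singGrad Ω ψ) j = (component (distribGrad Ω ψ) j).singularPart volume := by
  have h := SignedMeasure.singularPart_add_withDensity_rnDeriv_eq
    (s := component (distribGrad Ω ψ) j) (μ := (volume : Measure Plane))
  rw [singGrad, component_sub]
  unfold acGrad
  rw [withDensityᵥ_plane (SignedMeasure.integrable_rnDeriv _ _)
    (SignedMeasure.integrable_rnDeriv _ _)]
  rw [sub_eq_iff_eq_add]
  fin_cases j <;> exact h.symm

/-- Componentwise this is the Lebesgue decomposition. The set `N` allows one density to describe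
both parts of the gradient, according to whether the point lies in `N`. -/
theorem exists_null_singGrad (Ω : Set Plane) (ψ : Plane → ℝ) :
    ∃ N : Set Plane, MeasurableSet N ∧ volume N = 0 ∧ (singGrad Ω ψ).variation Nᶜ = 0 := by
  have h : (singGrad Ω ψ).variation ⟂ₘ (volume : Measure Plane) := by
    have hj (j : Fin 2) : (component (singGrad Ω ψ) j).variation ⟂ₘ (volume : Measure Plane) := by
      have := SignedMeasure.mutuallySingular_singularPart (component (distribGrad Ω ψ) j)
        (volume : Measure Plane)
      rw [SignedMeasure.mutuallySingular_ennreal_iff,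
        VectorMeasure.ennrealToMeasure_toENNRealVectorMeasure,
        SignedMeasure.totalVariation_eq_variation] at this
      rwa [component_singGrad]
    exact ((hj 0).add_left (hj 1)).mono (variation_le_component _) le_rfl
  obtain ⟨N, hN, h1, h2⟩ := h.symm
  exact ⟨N, hN, h1, h2⟩

theorem distribGrad_eq_add (Ω : Set Plane) (ψ : Plane → ℝ) :
    distribGrad Ω ψ = (volume : Measure Plane).withDensityᵥ (acGrad Ω ψ) + singGrad Ω ψ := by
  rw [singGrad, add_sub_cancel]

theorem norm_space (x : Space) : ‖x‖ = Real.sqrt (x 0 ^ 2 + x 1 ^ 2 + x 2 ^ 2) := by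
  simp [EuclideanSpace.norm_eq, Fin.sum_univ_three]

theorem inner_space (x y : Space) : inner ℝ x y = x 0 * y 0 + x 1 * y 1 + x 2 * y 2 := by
  simp [PiLp.inner_apply, Fin.sum_univ_three, mul_comm]

theorem norm_sq_plane (x : Plane) : ‖x‖ ^ 2 = x 0 ^ 2 + x 1 ^ 2 := by
  simp [EuclideanSpace.norm_sq_eq, Fin.sum_univ_two]

theorem IsTestField.continuous {U : Set Plane} {g : Plane → Space} (hg : IsTestField U g) :
    Continuous g := hg.contDiff.continuous

theorem IsTestField.contDiff_apply {U : Set Plane} {g : Plane → Space} (hg : IsTestField U g)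
    (i : Fin 3) : ContDiff ℝ ∞ fun x => g x i := contDiff_euclidean.1 hg.contDiff i

theorem IsTestField.hasCompactSupport_apply {U : Set Plane} {g : Plane → Space}
    (hg : IsTestField U g) (i : Fin 3) : HasCompactSupport fun x => g x i :=
  hg.hasCompactSupport.comp_left (g := fun v : Space => v i) rfl

theorem IsTestField.tsupport_apply {U : Set Plane} {g : Plane → Space}
    (hg : IsTestField U g) (i : Fin 3) : tsupport (fun x => g x i) ⊆ U :=
  (closure_mono (Function.support_comp_subset (g := fun v : Space => v i) rfl g)).trans
    hg.tsupport_subset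

theorem IsTestField.abs_apply_le {U : Set Plane} {g : Plane → Space} (hg : IsTestField U g)
    (i : Fin 3) (x : Plane) : ‖g x i‖ ≤ 1 := (PiLp.norm_apply_le _ _).trans (hg.norm_le x)

theorem IsTestField.apply_eq_zero {U : Set Plane} {g : Plane → Space} (hg : IsTestField U g)
    {x : Plane} (hx : x ∉ U) : g x = 0 :=
  image_eq_zero_of_notMem_tsupport fun h => hx (hg.tsupport_subset h)

theorem IsTestField.mono {U V : Set Plane} {g : Plane → Space} (hg : IsTestField U g)
    (h : U ⊆ V) : IsTestField V g := ⟨hg.1, hg.2, hg.3.trans h, hg.4⟩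

/-- The area measure and the pairing in terms of one vector-valued density. -/
theorem exists_density {Ω : Set Plane} (hΩ : IsOpen Ω) (hb : Bornology.IsBounded Ω)
    {ψ : Plane → ℝ} (hψ : MemBV Ω ψ) :
    ∃ (Λ : Measure Plane) (H : Plane → Space), IsFiniteMeasure Λ ∧ Integrable H Λ ∧
      (∀ U ⊆ Ω, MeasurableSet U → areaMeasure Ω ψ U = ∫⁻ x in U, ‖H x‖ₑ ∂Λ) ∧
      ∀ g, IsTestField Ω g → pairing Ω ψ g = ∫ x, inner ℝ (g x) (H x) ∂Λ := by
  classical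
  obtain ⟨N, hN, hN0, hNs⟩ := exists_null_singGrad Ω ψ
  obtain ⟨F, hFm, hFi, hF⟩ := exists_polar (singGrad Ω ψ)
  set S := (singGrad Ω ψ).variation with hS
  have hSF : S.withDensity (fun x => ‖F x‖ₑ) = S := by
    rw [← Measure.variation_withDensityᵥ hFi, hF]
  set G := acGrad Ω ψ with hG
  have hGi : Integrable G := integrable_acGrad Ω ψ
  have hGm : Measurable G := measurable_acGrad Ω ψ
  have hfin : IsFiniteMeasure ((volume : Measure Plane).restrict Ω) :=
    ⟨by simpa using hb.measure_lt_top⟩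
  -- `H` is `(1, -∇ψ)` for Lebesgue measure and `(0, -F)` for the singular part, where `F` has norm
  -- one almost everywhere by `hSF`. Its norm is therefore the area integrand; the minus signs come
  -- from integration by parts.
  set H : Plane → Space := fun x => if x ∈ N then !₂[0, -F x 0, -F x 1] else !₂[1, -G x 0, -G x 1]
    with hH
  have hHV : ∀ᵐ x ∂(volume.restrict Ω), H x = !₂[1, -G x 0, -G x 1] := by
    refine ae_restrict_of_ae ?_
    filter_upwards [measure_eq_zero_iff_ae_notMem.1 hN0] with x hx
    simp [hH, hx]
  have hHS : ∀ᵐ x ∂S, H x = !₂[0, -F x 0, -F x 1] := by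
    filter_upwards [measure_eq_zero_iff_ae_notMem.1 hNs] with x hx
    simp only [mem_compl_iff, not_not] at hx
    simp [hH, hx]
  have hcomp {m : Measure Plane} {f : Plane → Plane} (hf : Integrable f m) (j : Fin 2) :
      Integrable (fun x => f x j) m :=
    (EuclideanSpace.proj j : Plane →L[ℝ] ℝ).integrable_comp hf
  have hI1 : Integrable (fun x => (!₂[1, -G x 0, -G x 1] : Space)) (volume.restrict Ω) := by
    refine Integrable.of_eval_piLp fun j => ?_
    fin_cases j
    · simp
    · simpa using! (hcomp hGi 0).restrict.neg
    · simpa using! (hcomp hGi 1).restrict.neg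
  have hI2 : Integrable (fun x => (!₂[0, -F x 0, -F x 1] : Space)) S := by
    refine Integrable.of_eval_piLp fun j => ?_
    fin_cases j
    · simp
    · simpa using (hcomp hFi 0)
    · simpa using (hcomp hFi 1)
  have hHi : Integrable H (volume.restrict Ω + S) :=
    (hI1.congr (hHV.mono fun x hx => hx.symm)).add_measure
      (hI2.congr (hHS.mono fun x hx => hx.symm))
  refine ⟨volume.restrict Ω + S, H, inferInstance, hHi, fun U hU hUm => ?_, fun g hg => ?_⟩
  · rw [areaMeasure, Measure.add_apply, Measure.restrict_add, lintegral_add_measure,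
      withDensity_apply _ hUm]
    congr 1
    · refine lintegral_congr_ae ?_
      filter_upwards [ae_restrict_of_ae hHV] with x hx
      rw [hx, ← ofReal_norm, norm_space]
      congr 2
      rw [norm_sq_plane]
      simp
      ring
    · rw [← hS]
      conv_lhs => rw [← hSF]
      rw [withDensity_apply _ hUm]
      refine lintegral_congr_ae ?_
      filter_upwards [ae_restrict_of_ae hHS] with x hx
      rw [hx, ← ofReal_norm, ← ofReal_norm, norm_space, EuclideanSpace.norm_eq, Fin.sum_univ_two]
      simp
  · have hD := (isDistribGradient_distribGrad hψ).2
    have key (i : Fin 3) : ∫ x in Ω, ψ x • gradient (fun y => g y i) x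
        = -((∫ x in Ω, g x i • G x) + ∫ x, g x i • F x ∂S) := by
      rw [hD _ (hg.contDiff_apply i) (hg.hasCompactSupport_apply i) (hg.tsupport_apply i),
        distribGrad_eq_add]
      have hb' (ν : VectorMeasure Plane Plane) : ν.Integrable fun x => g x i :=
        Integrable.of_bound (hg.contDiff_apply i).continuous.aestronglyMeasurable 1
          (ae_of_all _ (hg.abs_apply_le i))
      rw [VectorMeasure.integral_add_vectorMeasure (hb' _) (hb' _)]
      congr 2
      · rw [integral_withDensityᵥ hGi (hg.contDiff_apply i).continuous.stronglyMeasurable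
          (hg.abs_apply_le i)]
        refine (setIntegral_eq_integral_of_forall_compl_eq_zero fun x hx => ?_).symm
        simp [hg.apply_eq_zero hx]
      · conv_lhs => rw [← hF]
        rw [integral_withDensityᵥ hFi (hg.contDiff_apply i).continuous.stronglyMeasurable
          (hg.abs_apply_le i)]
    have hmul {m : Measure Plane} {f : Plane → Plane} (hf : Integrable f m) (i : Fin 3) :
        Integrable (fun x => g x i • f x) m :=
      hf.bdd_smul 1 (hg.contDiff_apply i).continuous.aestronglyMeasurable
        (ae_of_all _ (hg.abs_apply_le i))
    have hmul' {m : Measure Plane} {f : Plane → Plane} (hf : Integrable f m) (i : Fin 3)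
        (j : Fin 2) : Integrable (fun x => g x i * f x j) m := by
      simpa using hcomp (hmul hf i) j
    have hg0 : Integrable (fun x => g x 0) (volume.restrict Ω) :=
      Integrable.of_bound (hg.contDiff_apply 0).continuous.aestronglyMeasurable 1
          (ae_of_all _ (hg.abs_apply_le 0))
    have hin {m : Measure Plane} {K : Plane → Space} (hK : Integrable K m) :
        Integrable (fun x => inner ℝ (g x) (K x)) m := by
      refine Integrable.mono' hK.norm
        (hg.continuous.aestronglyMeasurable.inner hK.aestronglyMeasurable)
        (ae_of_all _ fun x => ?_)
      exact (norm_inner_le_norm _ _).trans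
        (mul_le_of_le_one_left (norm_nonneg _) (hg.norm_le x))
    rw [integral_add_measure (hin (hHi.mono_measure (Measure.le_add_right le_rfl)))
      (hin (hHi.mono_measure (Measure.le_add_left le_rfl)))]
    have e1 : ∫ x in Ω, inner ℝ (g x) (H x) = (∫ x in Ω, g x 0)
        - (∫ x in Ω, g x 1 * G x 0) - ∫ x in Ω, g x 2 * G x 1 := by
      rw [← integral_sub hg0 (hmul' hGi.integrableOn 1 0),
        ← integral_sub (show Integrable (fun x => g x 0 - g x 1 * G x 0) _ from
          hg0.sub (hmul' hGi.integrableOn 1 0)) (hmul' hGi.integrableOn 2 1)]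
      refine integral_congr_ae ?_
      filter_upwards [hHV] with x hx
      rw [hx, inner_space]
      simp
      ring
    have e2 : ∫ x, inner ℝ (g x) (H x) ∂S = - (∫ x, g x 1 * F x 0 ∂S) - ∫ x, g x 2 * F x 1 ∂S := by
      rw [← integral_neg, ← integral_sub (show Integrable (fun x => -(g x 1 * F x 0)) _ from
          (hmul' hFi 1 0).neg) (hmul' hFi 2 1)]
      refine integral_congr_ae ?_
      filter_upwards [hHS] with x hx
      rw [hx, inner_space]
      simp
      ring
    rw [e1, e2, pairing, key 1, key 2]
    simp only [PiLp.neg_apply, PiLp.add_apply]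
    rw [integral_plane_apply (hmul hGi.integrableOn 1), integral_plane_apply (hmul hFi 1),
      integral_plane_apply (hmul hGi.integrableOn 2), integral_plane_apply (hmul hFi 2)]
    simp only [PiLp.smul_apply, smul_eq_mul]
    ring

/-! ### Density of test fields -/

theorem exists_smooth_cutoff {K U : Set Plane} (hK : IsCompact K) (hU : IsOpen U) (hKU : K ⊆ U) :
    ∃ χ : Plane → ℝ, ContDiff ℝ ∞ χ ∧ HasCompactSupport χ ∧ tsupport χ ⊆ U ∧
      (∀ x, χ x ∈ Icc (0 : ℝ) 1) ∧ ∀ x ∈ K, χ x = 1 := by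
  obtain ⟨L, hL, hKL, hLU⟩ := exists_compact_between hK hU hKU
  obtain ⟨f, hf1, hf0, hf⟩ := exists_contMDiffMap_one_nhds_of_subset_interior
    (modelWithCornersSelf ℝ Plane) (n := ⊤) hK.isClosed hKL
  have hs : tsupport f ⊆ L := by
    refine closure_minimal (fun x hx => ?_) hL.isClosed
    by_contra h
    exact hx (hf0 x h)
  exact ⟨f, f.contMDiff.contDiff, hL.of_isClosed_subset (isClosed_tsupport _) hs, hs.trans hLU, hf,
    fun x hx => (subset_of_mem_nhdsSet hf1 hx)⟩

section Density

variable {W : Type*} [NormedAddCommGroup W] [InnerProductSpace ℝ W]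

theorem norm_truncate_le (v : W) : ‖(max 1 ‖v‖)⁻¹ • v‖ ≤ 1 := by
  rw [norm_smul, norm_inv, Real.norm_of_nonneg (by positivity), inv_mul_le_iff₀ (by positivity),
    mul_one]
  exact le_max_right _ _

/-- The projection onto the unit ball moves `v` by at most the excess of `‖v‖` over one, and this
excess is at most `‖G - v‖` because `G` lies in the ball. -/
theorem norm_truncate_sub_le (v G : W) (hG : ‖G‖ ≤ 1) :
    ‖G - (max 1 ‖v‖)⁻¹ • v‖ ≤ 2 * ‖G - v‖ := by
  have h1 : ‖v - (max 1 ‖v‖)⁻¹ • v‖ ≤ ‖G - v‖ := by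
    rcases le_total ‖v‖ 1 with h | h
    · simp [max_eq_left h]
    · rw [max_eq_right h]
      have hv : 0 < ‖v‖ := by linarith
      have e : v - ‖v‖⁻¹ • v = (1 - ‖v‖⁻¹) • v := by rw [sub_smul, one_smul]
      rw [e, norm_smul, Real.norm_of_nonneg (by
        rw [sub_nonneg]; exact inv_le_one_of_one_le₀ h), sub_mul, inv_mul_cancel₀ hv.ne', one_mul]
      have := norm_sub_norm_le v G
      rw [norm_sub_rev] at this
      linarith
  calc _ = ‖(G - v) + (v - (max 1 ‖v‖)⁻¹ • v)‖ := by congr 1; abel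
    _ ≤ _ := (norm_add_le _ _).trans (by linarith)

variable [FiniteDimensional ℝ W]

/-- A continuous `L¹` approximation is projected to the unit ball, cut off inside `U`, multiplied by
`1 - δ`, and smoothed with uniform error `δ`. The factor `1 - δ` is what keeps the bound one after
smoothing. -/
theorem exists_smooth_approx_unit {m : Measure Plane} [IsFiniteMeasure m] {U : Set Plane}
    (hU : IsOpen U) (hmU : m Uᶜ = 0) {G : Plane → W} (hGm : AEStronglyMeasurable G m)
    (hG : ∀ x, ‖G x‖ ≤ 1) {ε : ℝ} (hε : 0 < ε) :
    ∃ g : Plane → W, ContDiff ℝ ∞ g ∧ HasCompactSupport g ∧ tsupport g ⊆ U ∧ (∀ x, ‖g x‖ ≤ 1) ∧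
      ∫ x, ‖G x - g x‖ ∂m ≤ ε := by
  have hGi : Integrable G m := Integrable.of_bound hGm 1 (ae_of_all _ hG)
  obtain ⟨g1, -, h1, h1c, h1i⟩ := hGi.exists_hasCompactSupport_integral_sub_le
    (ε := ε / 8) (by positivity)
  obtain ⟨K, hKU, hK, hKm⟩ := hU.measurableSet.exists_isCompact_sdiff_lt (measure_ne_top m U)
    (ε := ENNReal.ofReal (ε / 4)) (by simp [hε])
  obtain ⟨χ, hχ, hχc, hχs, hχ01, hχ1⟩ := exists_smooth_cutoff hK hU hKU
  set M := m.real univ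
  obtain ⟨δ, hδ, hδ1, hδM⟩ : ∃ δ : ℝ, 0 < δ ∧ δ ≤ 1 ∧ 2 * δ * M ≤ ε / 4 := by
    have hM : 0 ≤ M := measureReal_nonneg
    refine ⟨min 1 (ε / (8 * (M + 1))), by positivity, min_le_left _ _, ?_⟩
    have : min 1 (ε / (8 * (M + 1))) ≤ ε / (8 * (M + 1)) := min_le_right _ _
    calc 2 * min 1 (ε / (8 * (M + 1))) * M ≤ 2 * (ε / (8 * (M + 1))) * (M + 1) := by
          gcongr; linarith
      _ = ε / 4 := by field_simp; norm_num
  set g2 : Plane → W := fun x => (max 1 ‖g1 x‖)⁻¹ • g1 x with hg2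
  have hg2c : Continuous g2 :=
    Continuous.smul ((continuous_const.max h1c.norm).inv₀ fun x => by positivity) h1c
  set g3 : Plane → W := fun x => ((1 - δ) * χ x) • g2 x with hg3
  have hg3c : Continuous g3 := (continuous_const.mul hχ.continuous).smul hg2c
  obtain ⟨g4, h4, h4a, h4s⟩ := hg3c.exists_contDiff_approx (n := ⊤) (ε := fun _ => δ)
    continuous_const fun _ => hδ
  have hs : Function.support g4 ⊆ Function.support χ := by
    refine h4s.trans fun x hx => ?_
    contrapose! hx
    simp only [Function.mem_support, not_not] at hx
    simp [hg3, hx]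
  have hg3n x : ‖g3 x‖ ≤ 1 - δ := by
    rw [hg3, norm_smul, Real.norm_of_nonneg (mul_nonneg (by linarith) (hχ01 x).1)]
    calc (1 - δ) * χ x * ‖g2 x‖ ≤ (1 - δ) * 1 * 1 := by
          have := (hχ01 x).1
          have := (hχ01 x).2
          have : 0 ≤ 1 - δ := by linarith
          gcongr
          exact norm_truncate_le _
      _ = _ := by ring
  have h4d x : ‖g4 x - g3 x‖ < δ := by rw [← dist_eq_norm]; exact h4a x
  refine ⟨g4, h4, hχc.mono' (hs.trans (subset_tsupport _)), (closure_mono hs).trans hχs, ?_, ?_⟩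
  · intro x
    have := norm_le_norm_add_norm_sub' (g4 x) (g3 x)
    linarith [h4d x, hg3n x]
  · have hpt : ∀ᵐ x ∂m, ‖G x - g4 x‖ ≤ 2 * ‖G x - g1 x‖ + 2 * δ + (U \ K).indicator 1 x := by
      filter_upwards [measure_eq_zero_iff_ae_notMem.1 hmU] with x hx
      have hxU : x ∈ U := by simpa using hx
      have e : G x - g4 x = (G x - g2 x) + (g2 x - χ x • g2 x) + δ • χ x • g2 x
          - (g4 x - g3 x) := by
        simp only [hg3, sub_mul, one_mul, sub_smul, mul_smul]; abel
      have a1 : ‖G x - g2 x‖ ≤ 2 * ‖G x - g1 x‖ := norm_truncate_sub_le _ _ (hG x)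
      have a2 : ‖g2 x - χ x • g2 x‖ ≤ (U \ K).indicator 1 x := by
        by_cases hxK : x ∈ K
        · simp [hχ1 x hxK, hxK]
        · have : x ∈ U \ K := ⟨hxU, hxK⟩
          rw [indicator_of_mem this, show g2 x - χ x • g2 x = (1 - χ x) • g2 x by
            rw [sub_smul, one_smul], norm_smul, Pi.one_apply,
            Real.norm_of_nonneg (by linarith [(hχ01 x).2])]
          exact mul_le_one₀ (by linarith [(hχ01 x).1]) (norm_nonneg _) (norm_truncate_le _)
      have a3 : ‖δ • χ x • g2 x‖ ≤ δ := by
        rw [norm_smul, norm_smul, Real.norm_of_nonneg hδ.le, Real.norm_of_nonneg (hχ01 x).1]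
        exact mul_le_of_le_one_right hδ.le
          (mul_le_one₀ (hχ01 x).2 (norm_nonneg _) (norm_truncate_le _))
      rw [e]
      refine (norm_sub_le _ _).trans ?_
      have := norm_add₃_le (a := G x - g2 x) (b := g2 x - χ x • g2 x) (c := δ • χ x • g2 x)
      linarith [h4d x]
    have hUK : MeasurableSet (U \ K) := hU.measurableSet.diff hK.measurableSet
    have hi1 : Integrable (fun x => 2 * ‖G x - g1 x‖) m := (hGi.sub h1i).norm.const_mul 2
    have hi3 : Integrable ((U \ K).indicator (1 : Plane → ℝ)) m :=
      (integrable_const (1 : ℝ)).indicator hUK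
    have hi2 : Integrable (fun x => 2 * ‖G x - g1 x‖ + 2 * δ) m := hi1.add (integrable_const _)
    calc ∫ x, ‖G x - g4 x‖ ∂m
        ≤ ∫ x, (2 * ‖G x - g1 x‖ + 2 * δ + (U \ K).indicator 1 x) ∂m :=
          integral_mono_of_nonneg (ae_of_all _ fun x => norm_nonneg _) (hi2.add hi3) hpt
      _ = 2 * (∫ x, ‖G x - g1 x‖ ∂m) + M * (2 * δ) + m.real (U \ K) := by
          rw [integral_add hi2 hi3, integral_add hi1 (integrable_const _), integral_const_mul,
            integral_const, integral_indicator_one hUK, smul_eq_mul]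
      _ ≤ ε := by
          have : m.real (U \ K) ≤ ε / 4 := by
            rw [measureReal_def]
            exact ENNReal.toReal_le_of_le_ofReal (by positivity) hKm.le
          nlinarith

/-- The integral of `‖H‖` over an open set is approached by pairing `H` with smooth compactly
supported fields. -/
theorem exists_smooth_pairing {Λ : Measure Plane} {U : Set Plane} (hU : IsOpen U)
    {H : Plane → W} (hH : IntegrableOn H U Λ) {ε : ℝ} (hε : 0 < ε) :
    ∃ g : Plane → W, ContDiff ℝ ∞ g ∧ HasCompactSupport g ∧ tsupport g ⊆ U ∧ (∀ x, ‖g x‖ ≤ 1) ∧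
      (∫ x in U, ‖H x‖ ∂Λ) - ε ≤ ∫ x in U, inner ℝ (g x) (H x) ∂Λ := by
  -- The direction `H / ‖H‖` is approximated in `L¹` of the measure `‖H‖ dΛ`, because the error
  -- measured there is exactly the loss in the pairing.
  have hfin : IsFiniteMeasure ((Λ.restrict U).withDensity fun x => ‖H x‖ₑ) :=
    ⟨by simpa using! hH.2⟩
  have hac : (Λ.restrict U).withDensity (fun x => ‖H x‖ₑ) ≪ Λ.restrict U :=
    withDensity_absolutelyContinuous _ _
  have hGm : AEStronglyMeasurable (fun x => ‖H x‖⁻¹ • H x) (Λ.restrict U) :=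
    (hH.aestronglyMeasurable.norm.aemeasurable.inv.aestronglyMeasurable).smul
      hH.aestronglyMeasurable
  have hG x : ‖‖H x‖⁻¹ • H x‖ ≤ 1 := by
    rw [norm_smul, norm_inv, norm_norm]; exact inv_mul_le_one
  obtain ⟨g, h1, h2, h3, h4, h5⟩ := exists_smooth_approx_unit hU
    (m := (Λ.restrict U).withDensity fun x => ‖H x‖ₑ)
    (hac (by simp [Measure.restrict_apply hU.measurableSet.compl]))
    (hGm.mono_ac hac) hG hε
  refine ⟨g, h1, h2, h3, h4, ?_⟩
  rw [integral_withDensity_eq_integral_toReal_smul₀ hH.aestronglyMeasurable.enorm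
    (ae_of_all _ fun x => enorm_lt_top)] at h5
  have hgi : Integrable (fun x => inner ℝ (g x) (H x)) (Λ.restrict U) := by
    refine Integrable.mono' hH.norm (h1.continuous.aestronglyMeasurable.inner
      hH.aestronglyMeasurable) (ae_of_all _ fun x => ?_)
    exact (norm_inner_le_norm _ _).trans (mul_le_of_le_one_left (norm_nonneg _) (h4 x))
  have hfi : Integrable (fun x => ‖H x‖ₑ.toReal • ‖‖H x‖⁻¹ • H x - g x‖) (Λ.restrict U) := by
    refine Integrable.mono' (hH.norm.mul_const 2) ?_ (ae_of_all _ fun x => ?_)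
    · simp only [toReal_enorm]
      exact hH.aestronglyMeasurable.norm.smul (hGm.sub h1.continuous.aestronglyMeasurable).norm
    · rw [toReal_enorm, norm_smul, norm_norm, norm_norm]
      refine mul_le_mul_of_nonneg_left ?_ (norm_nonneg _)
      exact (norm_sub_le _ _).trans (by linarith [hG x, h4 x])
  have : ∫ x in U, ‖H x‖ ∂Λ ≤ ∫ x in U, (inner ℝ (g x) (H x)
      + ‖H x‖ₑ.toReal • ‖‖H x‖⁻¹ • H x - g x‖) ∂Λ := by
    refine integral_mono hH.norm (hgi.add hfi) fun x => ?_
    rcases eq_or_ne (H x) 0 with h0 | h0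
    · simp [h0]
    have hn : ‖H x‖ ≠ 0 := norm_ne_zero_iff.2 h0
    have e : ‖H x‖ - inner ℝ (g x) (H x) = inner ℝ (‖H x‖⁻¹ • H x - g x) (H x) := by
      rw [inner_sub_left, real_inner_smul_left, real_inner_self_eq_norm_sq]
      field_simp
    have := real_inner_le_norm (‖H x‖⁻¹ • H x - g x) (H x)
    simp only [toReal_enorm, smul_eq_mul]
    nlinarith
  rw [integral_add hgi hfi] at this
  linarith

end Density

/-! ### Duality between the area and test fields -/

theorem integrable_density_inner {Λ : Measure Plane} {H : Plane → Space} (hH : Integrable H Λ)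
    {U : Set Plane} {g : Plane → Space} (hg : IsTestField U g) :
    Integrable (fun x => inner ℝ (g x) (H x)) Λ := by
  refine Integrable.mono' hH.norm
    (hg.continuous.aestronglyMeasurable.inner hH.aestronglyMeasurable) (ae_of_all _ fun x => ?_)
  exact (norm_inner_le_norm _ _).trans (mul_le_of_le_one_left (norm_nonneg _) (hg.norm_le x))

theorem areaMeasure_lt_top {Ω : Set Plane} (hΩ : IsOpen Ω) (hb : Bornology.IsBounded Ω)
    {ψ : Plane → ℝ} (hψ : MemBV Ω ψ) {U : Set Plane} (hU : U ⊆ Ω) : areaMeasure Ω ψ U < (⊤ : ℝ≥0∞) := by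
  obtain ⟨Λ, H, _, hHi, hA, -⟩ := exists_density hΩ hb hψ
  refine (measure_mono hU).trans_lt ?_
  rw [hA Ω subset_rfl hΩ.measurableSet]
  exact hHi.integrableOn.2

theorem pairing_le {Ω : Set Plane} (hΩ : IsOpen Ω) (hb : Bornology.IsBounded Ω)
    {ψ : Plane → ℝ} (hψ : MemBV Ω ψ) {U : Set Plane} (hUo : IsOpen U) (hU : U ⊆ Ω)
    {g : Plane → Space} (hg : IsTestField U g) :
    pairing Ω ψ g ≤ (areaMeasure Ω ψ U).toReal := by
  obtain ⟨Λ, H, _, hHi, hA, hp⟩ := exists_density hΩ hb hψ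
  rw [hp g (hg.mono hU), hA U hU hUo.measurableSet,
    ← integral_norm_eq_lintegral_enorm hHi.aestronglyMeasurable.restrict,
    ← setIntegral_eq_integral_of_forall_compl_eq_zero (s := U)]
  · refine integral_mono (integrable_density_inner hHi hg).integrableOn hHi.norm.integrableOn
      fun x => (real_inner_le_norm _ _).trans (mul_le_of_le_one_left (norm_nonneg _) (hg.norm_le x))
  · intro x hx
    simp [hg.apply_eq_zero hx]

/-- Together with `pairing_le` this identifies the area on every open `U ⊆ Ω` as the supremum of
pairings with fields supported in `U`. A pairing is affine and `L¹`-continuous in `ψ`, which is the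
source of both convexity and semicontinuity. -/
theorem exists_pairing_ge {Ω : Set Plane} (hΩ : IsOpen Ω) (hb : Bornology.IsBounded Ω)
    {ψ : Plane → ℝ} (hψ : MemBV Ω ψ) {U : Set Plane} (hUo : IsOpen U) (hU : U ⊆ Ω)
    {ε : ℝ} (hε : 0 < ε) :
    ∃ g, IsTestField U g ∧ (areaMeasure Ω ψ U).toReal - ε ≤ pairing Ω ψ g := by
  obtain ⟨Λ, H, _, hHi, hA, hp⟩ := exists_density hΩ hb hψ
  obtain ⟨g, h1, h2, h3, h4, h5⟩ := exists_smooth_pairing hUo (hHi.integrableOn (s := U)) hε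
  have hg : IsTestField U g := ⟨h1, h2, h3, h4⟩
  refine ⟨g, hg, ?_⟩
  have e : ∫ x, inner ℝ (g x) (H x) ∂Λ = ∫ x in U, inner ℝ (g x) (H x) ∂Λ := by
    refine (setIntegral_eq_integral_of_forall_compl_eq_zero fun x hx => ?_).symm
    simp [hg.apply_eq_zero hx]
  rw [hp g (hg.mono hU), hA U hU hUo.measurableSet,
    ← integral_norm_eq_lintegral_enorm hHi.aestronglyMeasurable.restrict, e]
  exact h5

/-! ### Compactness and semicontinuity in `BV` -/

/-- Measures of bounded mass on a fixed compact set form a compact space. Taking the limit along a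
given ultrafilter, rather than a subsequence, lets several sequences be treated at once with the
same notion of limit. -/
theorem exists_weak_limit {K : Set Plane} (hK : IsCompact K) (C : ℝ≥0) (p : ℕ → Measure Plane)
    (hp : ∀ k, p k univ ≤ C) (hpK : ∀ k, p k Kᶜ = 0) (f : Ultrafilter ℕ) :
    ∃ P : Measure Plane, IsFiniteMeasure P ∧ ∀ η : Plane → ℝ, Continuous η → HasCompactSupport η →
      Tendsto (fun k => ∫ x, η x ∂(p k)) f (𝓝 (∫ x, η x ∂P)) := by
  have hfin k : IsFiniteMeasure (p k) := ⟨(hp k).trans_lt ENNReal.coe_lt_top⟩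
  set q : ℕ → FiniteMeasure Plane := fun k => ⟨p k, hfin k⟩ with hq
  have hmem k : q k ∈ {μ : FiniteMeasure Plane | μ.mass ≤ C ∧ μ Kᶜ = 0} := by
    refine ⟨?_, ?_⟩
    · rw [← ENNReal.coe_le_coe, FiniteMeasure.ennreal_mass]; exact hp k
    · rw [← ENNReal.coe_eq_zero, FiniteMeasure.ennreal_coeFn_eq_coeFn_toMeasure]; exact hpK k
  obtain ⟨P, -, hP⟩ := (isCompact_setOfPred_finiteMeasure_le_of_isCompact (E := Plane) C
    hK).ultrafilter_le_nhds (f.map q) (by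
      rw [le_principal_iff]; exact Filter.mem_map.2 (Filter.univ_mem' hmem))
  refine ⟨P, inferInstance, fun η hη hηc => ?_⟩
  obtain ⟨B, hB⟩ := hη.bounded_above_of_compact_support hηc
  exact (FiniteMeasure.tendsto_iff_forall_integral_tendsto.1 (show Tendsto q f (𝓝 P) from hP))
    (BoundedContinuousFunction.ofNormedAddCommGroup η hη B hB)

theorem restrict_withDensityᵥ_self {m : Measure Plane} {Ω : Set Plane} (hΩ : MeasurableSet Ω)
    (hm : m Ωᶜ = 0) {F : Plane → Plane} (hF : Integrable F m) :
    (m.withDensityᵥ F).restrict Ω = m.withDensityᵥ F := by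
  ext1 A hA
  rw [VectorMeasure.restrict_apply _ hΩ hA, withDensityᵥ_apply hF (hA.inter hΩ),
    withDensityᵥ_apply hF hA]
  refine setIntegral_congr_set ?_
  filter_upwards [measure_eq_zero_iff_ae_notMem.1 hm] with x hx
  have hx' : x ∈ Ω := by simpa using hx
  have : (x ∈ A ∩ Ω) = (x ∈ A) := by simp [hx']
  exact this

/-- Vector measures with bounded variation have cluster points; if they represent the distributional
gradient of `ψ` in the limit then `ψ` is of bounded variation. -/
theorem memBV_of_tendsto {Ω : Set Plane} (hΩ : IsOpen Ω) (hb : Bornology.IsBounded Ω)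
    {ψ : Plane → ℝ} (hψ : IntegrableOn ψ Ω) (ν : ℕ → VectorMeasure Plane Plane) (C : ℝ≥0)
    (hνC : ∀ k, (ν k).variation univ ≤ C) (hνΩ : ∀ k, (ν k).variation Ωᶜ = 0)
    (hlim : ∀ η : Plane → ℝ, ContDiff ℝ ∞ η → HasCompactSupport η → tsupport η ⊆ Ω →
      Tendsto (fun k => -∫ᵛ x, η x ∂•(ν k)) atTop (𝓝 (∫ x in Ω, ψ x • gradient η x))) :
    MemBV Ω ψ := by
  refine ⟨hψ, ?_⟩
  choose F hFm hFi hF using fun k => exists_polar (ν k)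
  have hcomp {m : Measure Plane} {f : Plane → Plane} (hf : Integrable f m) (j : Fin 2) :
      Integrable (fun x => f x j) m :=
    (EuclideanSpace.proj j : Plane →L[ℝ] ℝ).integrable_comp hf
  have hFm' k (j : Fin 2) : Measurable fun x => F k x j :=
    (EuclideanSpace.proj j : Plane →L[ℝ] ℝ).measurable.comp (hFm k)
  have hνF k : (ν k).variation.withDensity (fun x => ‖F k x‖ₑ) = (ν k).variation := by
    rw [← Measure.variation_withDensityᵥ (hFi k), hF]
  have hmass k (h : Plane → ℝ) (hh : ∀ x, h x ≤ ‖F k x‖) :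
      (ν k).variation.withDensity (fun x => ENNReal.ofReal (h x)) ≤ (ν k).variation := by
    conv_rhs => rw [← hνF]
    refine withDensity_mono (ae_of_all _ fun x => ?_)
    beta_reduce
    rw [← ofReal_norm]
    exact ENNReal.ofReal_le_ofReal (hh x)
  have hsub : (closure Ω)ᶜ ⊆ Ωᶜ := compl_subset_compl.2 subset_closure
  set f : Ultrafilter ℕ := hyperfilter ℕ
  have hf : (f : Filter ℕ) ≤ atTop := by
    rw [← Nat.cofinite_eq_atTop]; exact hyperfilter_le_cofinite
  -- The positive and negative parts of both components are treated separately, since weak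
  -- compactness is available for positive measures.
  have hP (j : Fin 2) := exists_weak_limit hb.isCompact_closure C
    (fun k => (ν k).variation.withDensity (fun x => ENNReal.ofReal (F k x j)))
    (fun k => (hmass k _ (fun x => (Real.le_norm_self _).trans (PiLp.norm_apply_le _ _)) _).trans
      (hνC k))
    (fun k => le_antisymm ((hmass k _ (fun x => (Real.le_norm_self _).trans
      (PiLp.norm_apply_le _ _)) _).trans ((measure_mono hsub).trans (hνΩ k).le)) zero_le) f
  have hN (j : Fin 2) := exists_weak_limit hb.isCompact_closure C
    (fun k => (ν k).variation.withDensity (fun x => ENNReal.ofReal (-F k x j)))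
    (fun k => (hmass k _ (fun x => (Real.le_norm_self _).trans
      ((norm_neg _).trans_le (PiLp.norm_apply_le _ _))) _).trans (hνC k))
    (fun k => le_antisymm ((hmass k _ (fun x => (Real.le_norm_self _).trans
      ((norm_neg _).trans_le (PiLp.norm_apply_le _ _))) _).trans
        ((measure_mono hsub).trans (hνΩ k).le)) zero_le) f
  choose P hPf hP using hP
  choose N hNf hN using hN
  -- The weak limits may charge the boundary of `Ω`. Restricting them to `Ω` is harmless since the
  -- test functions vanish outside. The sum dominates all four limits, so the limit gradient can be
  -- given by a density.
  set m : Measure Plane := (P 0 + P 1 + (N 0 + N 1)).restrict Ω with hm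
  have hmfin : IsFiniteMeasure m := by rw [hm]; infer_instance
  have hPm (j) : (P j).restrict Ω ≪ m := by
    refine Measure.absolutelyContinuous_of_le (Measure.restrict_mono_measure ?_ _)
    fin_cases j
    · exact (Measure.le_add_right le_rfl).trans (Measure.le_add_right le_rfl)
    · exact (Measure.le_add_left le_rfl).trans (Measure.le_add_right le_rfl)
  have hNm (j) : (N j).restrict Ω ≪ m := by
    refine Measure.absolutelyContinuous_of_le (Measure.restrict_mono_measure ?_ _)
    fin_cases j
    · exact (Measure.le_add_right le_rfl).trans (Measure.le_add_left le_rfl)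
    · exact (Measure.le_add_left le_rfl).trans (Measure.le_add_left le_rfl)
  set D : Fin 2 → Plane → ℝ := fun j x =>
    (((P j).restrict Ω).rnDeriv m x).toReal - (((N j).restrict Ω).rnDeriv m x).toReal with hD
  have hDi j : Integrable (D j) m :=
    Measure.integrable_toReal_rnDeriv.sub Measure.integrable_toReal_rnDeriv
  have hG : Integrable (fun x => (!₂[D 0 x, D 1 x] : Plane)) m := integrable_plane (hDi 0) (hDi 1)
  refine ⟨m.withDensityᵥ fun x => !₂[D 0 x, D 1 x],
    restrict_withDensityᵥ_self hΩ.measurableSet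
      (by simp [hm, Measure.restrict_apply hΩ.measurableSet.compl]) hG, fun η hη hηc hηs => ?_⟩
  obtain ⟨B, hB⟩ := hη.continuous.bounded_above_of_compact_support hηc
  have hη0 x (hx : x ∉ Ω) : η x = 0 := image_eq_zero_of_notMem_tsupport fun h => hx (hηs h)
  have hηi (μ : Measure Plane) [IsFiniteMeasure μ] : Integrable η μ :=
    Integrable.of_bound hη.continuous.aestronglyMeasurable B (ae_of_all _ hB)
  rw [integral_withDensityᵥ hG hη.continuous.stronglyMeasurable hB]
  have hlim1 : Tendsto (fun k => -∫ᵛ x, η x ∂•(ν k)) f (𝓝 (∫ x in Ω, ψ x • gradient η x)) :=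
    (hlim η hη hηc hηs).mono_left hf
  have hsm {μ : Measure Plane} {G : Plane → Plane} (h : Integrable G μ) :
      Integrable (fun x => η x • G x) μ :=
    h.bdd_smul B hη.continuous.aestronglyMeasurable (ae_of_all _ hB)
  ext j
  have h1 : Tendsto (fun k => (-∫ᵛ x, η x ∂•(ν k)) j) f
      (𝓝 ((∫ x in Ω, ψ x • gradient η x) j)) :=
    ((EuclideanSpace.proj j : Plane →L[ℝ] ℝ).continuous.tendsto _).comp hlim1
  have h2 : Tendsto (fun k => (-∫ᵛ x, η x ∂•(ν k)) j) f
      (𝓝 (-((∫ x, η x ∂(P j)) - ∫ x, η x ∂(N j)))) := by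
    refine (((hP j η hη.continuous hηc).sub (hN j η hη.continuous hηc)).neg).congr fun k => ?_
    conv_rhs => rw [← hF k]
    rw [integral_withDensityᵥ (hFi k) hη.continuous.stronglyMeasurable hB, PiLp.neg_apply,
      integral_plane_apply (hsm (hFi k)),
      integral_withDensity_eq_integral_toReal_smul₀ (hFm' k j).ennreal_ofReal.aemeasurable
        (ae_of_all _ fun x => ENNReal.ofReal_lt_top),
      integral_withDensity_eq_integral_toReal_smul₀ (show Measurable fun x => -F k x j from
          (hFm' k j).neg).ennreal_ofReal.aemeasurable
        (ae_of_all _ fun x => ENNReal.ofReal_lt_top), ← integral_sub]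
    · congr 2
      ext x
      simp only [ENNReal.toReal_ofReal', smul_eq_mul, PiLp.smul_apply]
      rw [← sub_mul, mul_comm]
      congr 1
      exact max_zero_sub_max_neg_zero_eq_self _
    · refine ((hcomp (hFi k) j).pos_part.mul_bdd (c := B) hη.continuous.aestronglyMeasurable
        (ae_of_all _ hB)).congr (ae_of_all _ fun x => ?_)
      simp [ENNReal.toReal_ofReal']
    · refine ((hcomp (hFi k) j).neg_part.mul_bdd (c := B) hη.continuous.aestronglyMeasurable
        (ae_of_all _ hB)).congr (ae_of_all _ fun x => ?_)
      simp [ENNReal.toReal_ofReal']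
  rw [tendsto_nhds_unique h1 h2, PiLp.neg_apply, integral_plane_apply (hsm hG)]
  congr 1
  have e (Q : Measure Plane) [IsFiniteMeasure Q] (hQ : Q.restrict Ω ≪ m) :
      ∫ x, η x ∂Q = ∫ x, ((Q.restrict Ω).rnDeriv m x).toReal * η x ∂m := by
    rw [← setIntegral_eq_integral_of_forall_compl_eq_zero (s := Ω) fun x hx => hη0 x hx]
    have : (Q.restrict Ω).HaveLebesgueDecomposition m :=
      Measure.haveLebesgueDecomposition_of_sigmaFinite _ _
    exact (integral_rnDeriv_smul hQ).symm
  have i (Q : Measure Plane) [IsFiniteMeasure Q] :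
      Integrable (fun x => ((Q.restrict Ω).rnDeriv m x).toReal * η x) m :=
    Measure.integrable_toReal_rnDeriv.mul_bdd (c := B) hη.continuous.aestronglyMeasurable (ae_of_all _ hB)
  rw [e _ (hPm j), e _ (hNm j), ← integral_sub (i _) (i _)]
  refine integral_congr_ae (ae_of_all _ fun x => ?_)
  fin_cases j <;> simp [hD] <;> ring

theorem variation_distribGrad_le {Ω : Set Plane} (hΩ : MeasurableSet Ω) (ψ : Plane → ℝ)
    {A : Set Plane} (hA : MeasurableSet A) (hAΩ : A ⊆ Ω) :
    (distribGrad Ω ψ).variation A ≤ areaMeasure Ω ψ A := by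
  rw [distribGrad_eq_add, areaMeasure, Measure.add_apply]
  refine (VectorMeasure.variation_add_le A).trans ?_
  rw [Measure.add_apply, Measure.variation_withDensityᵥ (integrable_acGrad Ω ψ),
    withDensity_apply _ hA, withDensity_apply _ hA, Measure.restrict_restrict hA,
    inter_eq_left.2 hAΩ]
  gcongr with x
  rw [← ofReal_norm]
  refine ENNReal.ofReal_le_ofReal (Real.le_sqrt_of_sq_le ?_)
  linarith

theorem variation_compl_eq_zero {Ω : Set Plane} (hΩ : MeasurableSet Ω) {ψ : Plane → ℝ}
    {μ : VectorMeasure Plane Plane} (h : IsDistribGradient Ω ψ μ) : μ.variation Ωᶜ = 0 := by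
  rw [← h.1, VectorMeasure.variation_restrict hΩ, Measure.restrict_apply hΩ.compl]
  simp

theorem gradient_eq (η : Plane → ℝ) (x : Plane) :
    gradient η x = (InnerProductSpace.toDual ℝ Plane).symm (fderiv ℝ η x) := rfl

theorem continuous_gradient {η : Plane → ℝ} (hη : ContDiff ℝ ∞ η) : Continuous (gradient η) :=
  (InnerProductSpace.toDual ℝ Plane).symm.continuous.comp (hη.continuous_fderiv (by simp))

theorem exists_gradient_bound {η : Plane → ℝ} (hη : ContDiff ℝ ∞ η) (hc : HasCompactSupport η) :
    ∃ B, ∀ x, ‖gradient η x‖ ≤ B := by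
  obtain ⟨B, hB⟩ := (hη.continuous_fderiv (by simp)).bounded_above_of_compact_support
    (hc.fderiv ℝ)
  exact ⟨B, fun x => by rw [gradient_eq, LinearIsometryEquiv.norm_map]; exact hB x⟩

theorem inner_gradient (η : Plane → ℝ) (x w : Plane) : inner ℝ (gradient η x) w = fderiv ℝ η x w :=
  InnerProductSpace.toDual_symm_apply

theorem integrable_smul_gradient {m : Measure Plane} {ψ : Plane → ℝ} (hψ : Integrable ψ m)
    {η : Plane → ℝ} (hη : ContDiff ℝ ∞ η) (hc : HasCompactSupport η) :
    Integrable (fun x => ψ x • gradient η x) m := by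
  obtain ⟨B, hB⟩ := exists_gradient_bound hη hc
  exact hψ.smul_bdd B (continuous_gradient hη).aestronglyMeasurable (ae_of_all _ hB)

theorem tendsto_integral_smul_gradient {m : Measure Plane} {ψ : Plane → ℝ} {u : ℕ → Plane → ℝ}
    (hψ : Integrable ψ m) (hu : ∀ k, Integrable (u k) m)
    (hlim : Tendsto (fun k => ∫ x, |u k x - ψ x| ∂m) atTop (𝓝 0))
    {η : Plane → ℝ} (hη : ContDiff ℝ ∞ η) (hc : HasCompactSupport η) :
    Tendsto (fun k => ∫ x, u k x • gradient η x ∂m) atTop (𝓝 (∫ x, ψ x • gradient η x ∂m)) := by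
  obtain ⟨B, hB⟩ := exists_gradient_bound hη hc
  rw [tendsto_iff_norm_sub_tendsto_zero]
  refine squeeze_zero (fun _ => norm_nonneg _) (fun k => ?_) (by simpa using hlim.mul_const B)
  rw [← integral_sub (integrable_smul_gradient (hu k) hη hc) (integrable_smul_gradient hψ hη hc),
    ← integral_mul_const]
  refine (norm_integral_le_integral_norm _).trans (integral_mono_of_nonneg
    (ae_of_all _ fun x => norm_nonneg _) (((hu k).sub hψ).abs.mul_const B)
    (ae_of_all _ fun x => ?_))
  beta_reduce
  rw [← sub_smul, norm_smul, Real.norm_eq_abs]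
  exact mul_le_mul_of_nonneg_left (hB x) (abs_nonneg _)

theorem tendsto_pairing {Ω : Set Plane} {ψ : Plane → ℝ} {u : ℕ → Plane → ℝ}
    (hψ : IntegrableOn ψ Ω) (hu : ∀ k, IntegrableOn (u k) Ω)
    (hlim : Tendsto (fun k => ∫ x in Ω, |u k x - ψ x|) atTop (𝓝 0))
    {U : Set Plane} {g : Plane → Space} (hg : IsTestField U g) :
    Tendsto (fun k => pairing Ω (u k) g) atTop (𝓝 (pairing Ω ψ g)) := by
  have h (i : Fin 3) := tendsto_integral_smul_gradient hψ hu hlim (hg.contDiff_apply i)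
    (hg.hasCompactSupport_apply i)
  have hj (i : Fin 3) (j : Fin 2) :=
    ((EuclideanSpace.proj j : Plane →L[ℝ] ℝ).continuous.tendsto _).comp (h i)
  exact (tendsto_const_nhds.add (hj 1 0)).add (hj 2 1)

/-- One field that is nearly optimal for `ψ` suffices, since its pairing with `u k` converges. The
estimate is needed on arbitrary open subsets, because boundary strips will be treated separately. -/
theorem eventually_areaMeasure_ge {Ω : Set Plane} (hΩ : IsOpen Ω) (hb : Bornology.IsBounded Ω)
    {ψ : Plane → ℝ} {u : ℕ → Plane → ℝ} (hψ : MemBV Ω ψ) (hu : ∀ k, MemBV Ω (u k))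
    (hlim : Tendsto (fun k => ∫ x in Ω, |u k x - ψ x|) atTop (𝓝 0))
    {U : Set Plane} (hUo : IsOpen U) (hU : U ⊆ Ω) {ε : ℝ} (hε : 0 < ε) :
    ∀ᶠ k in atTop, (areaMeasure Ω ψ U).toReal - ε ≤ (areaMeasure Ω (u k) U).toReal := by
  obtain ⟨g, hg, hge⟩ := exists_pairing_ge hΩ hb hψ hUo hU (half_pos hε)
  have := tendsto_pairing hψ.1 (fun k => (hu k).1) hlim hg
  filter_upwards [this.eventually (lt_mem_nhds (sub_lt_self _ (half_pos hε)))] with k hk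
  have := pairing_le hΩ hb (hu k) hUo hU hg
  linarith

theorem memBV_of_tendsto_L1 {Ω : Set Plane} (hΩ : IsOpen Ω) (hb : Bornology.IsBounded Ω)
    {ψ : Plane → ℝ} {u : ℕ → Plane → ℝ} (hψ : IntegrableOn ψ Ω) (hu : ∀ k, MemBV Ω (u k))
    (hlim : Tendsto (fun k => ∫ x in Ω, |u k x - ψ x|) atTop (𝓝 0)) (C : ℝ≥0)
    (hC : ∀ k, areaMeasure Ω (u k) Ω ≤ C) : MemBV Ω ψ := by
  have hg k := isDistribGradient_distribGrad (hu k)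
  refine memBV_of_tendsto hΩ hb hψ (fun k => distribGrad Ω (u k)) C (fun k => ?_)
    (fun k => variation_compl_eq_zero hΩ.measurableSet (hg k)) fun η h1 h2 h3 => ?_
  · rw [← measure_add_measure_compl hΩ.measurableSet,
      variation_compl_eq_zero hΩ.measurableSet (hg k), add_zero]
    exact (variation_distribGrad_le hΩ.measurableSet _ hΩ.measurableSet subset_rfl).trans (hC k)
  · refine (tendsto_integral_smul_gradient hψ (fun k => (hu k).1) hlim h1 h2).congr fun k => ?_
    rw [(hg k).2 η h1 h2 h3]

/-! ### Linearity of the gradient and convexity of the area -/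

theorem integral_linear_smul_gradient {m : Measure Plane} {u v : Plane → ℝ} (hu : Integrable u m)
    (hv : Integrable v m) {η : Plane → ℝ} (h1 : ContDiff ℝ ∞ η) (h2 : HasCompactSupport η)
    (a b : ℝ) :
    ∫ x, (a * u x + b * v x) • gradient η x ∂m
      = a • (∫ x, u x • gradient η x ∂m) + b • ∫ x, v x • gradient η x ∂m := by
  rw [← integral_smul, ← integral_smul,
    ← integral_add (show Integrable (fun x => a • (u x • gradient η x)) m from
      (integrable_smul_gradient hu h1 h2).smul a)
    (show Integrable (fun x => b • (v x • gradient η x)) m from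
      (integrable_smul_gradient hv h1 h2).smul b)]
  refine integral_congr_ae (ae_of_all _ fun x => ?_)
  beta_reduce
  rw [add_smul, mul_smul, mul_smul]

theorem IsDistribGradient.linear {Ω : Set Plane} {u v : Plane → ℝ} {μ ν : VectorMeasure Plane Plane}
    (hu : IntegrableOn u Ω) (hv : IntegrableOn v Ω) (hμ : IsDistribGradient Ω u μ)
    (hν : IsDistribGradient Ω v ν) (a b : ℝ) :
    IsDistribGradient Ω (fun x => a * u x + b * v x) (a • μ + b • ν) := by
  refine ⟨?_, fun η h1 h2 h3 => ?_⟩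
  · rw [VectorMeasure.restrict_add, VectorMeasure.restrict_smul, VectorMeasure.restrict_smul,
      hμ.1, hν.1]
  · obtain ⟨B, hB⟩ := h1.continuous.bounded_above_of_compact_support h2
    have hi (m : VectorMeasure Plane Plane) : m.Integrable η :=
      Integrable.of_bound h1.continuous.aestronglyMeasurable B (ae_of_all _ hB)
    rw [VectorMeasure.integral_add_vectorMeasure (hi _) (hi _),
      VectorMeasure.integral_smul_vectorMeasure, VectorMeasure.integral_smul_vectorMeasure]
    rw [integral_linear_smul_gradient hu hv h1 h2, hμ.2 η h1 h2 h3, hν.2 η h1 h2 h3]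
    simp only [smul_neg, neg_add]

theorem MemBV.linear {Ω : Set Plane} {u v : Plane → ℝ} (hu : MemBV Ω u) (hv : MemBV Ω v)
    (a b : ℝ) : MemBV Ω (fun x => a * u x + b * v x) :=
  ⟨(hu.1.const_mul a).add (hv.1.const_mul b), _,
    (isDistribGradient_distribGrad hu).linear hu.1 hv.1 (isDistribGradient_distribGrad hv) a b⟩

theorem pairing_convex {Ω : Set Plane} {u v : Plane → ℝ} (hu : IntegrableOn u Ω)
    (hv : IntegrableOn v Ω) {U : Set Plane} {g : Plane → Space} (hg : IsTestField U g)
    {a b : ℝ} (hab : a + b = 1) :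
    pairing Ω (fun x => a * u x + b * v x) g = a * pairing Ω u g + b * pairing Ω v g := by
  have key (i : Fin 3) : ∫ x in Ω, (a * u x + b * v x) • gradient (fun y => g y i) x
      = a • (∫ x in Ω, u x • gradient (fun y => g y i) x)
        + b • ∫ x in Ω, v x • gradient (fun y => g y i) x :=
    integral_linear_smul_gradient hu hv (hg.contDiff_apply i) (hg.hasCompactSupport_apply i) a b
  have e0 : ∫ x in Ω, g x 0 = a * (∫ x in Ω, g x 0) + b * ∫ x in Ω, g x 0 := by
    rw [← add_mul, hab, one_mul]
  rw [pairing, pairing, pairing, key, key]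
  simp only [PiLp.add_apply, PiLp.smul_apply, smul_eq_mul]
  linear_combination e0

/-- A field which is nearly optimal for the combination is tested on `u` and `v`; the pairing
respects convex combinations, the condition `a + b = 1` accounting for its constant term. -/
theorem areaMeasure_convex {Ω : Set Plane} (hΩ : IsOpen Ω) (hb : Bornology.IsBounded Ω)
    {u v : Plane → ℝ} (hu : MemBV Ω u) (hv : MemBV Ω v) {a b : ℝ} (ha : 0 ≤ a) (hb' : 0 ≤ b)
    (hab : a + b = 1) :
    (areaMeasure Ω (fun x => a * u x + b * v x) Ω).toReal
      ≤ a * (areaMeasure Ω u Ω).toReal + b * (areaMeasure Ω v Ω).toReal := by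
  refine le_of_forall_pos_le_add fun ε hε => ?_
  obtain ⟨g, hg, hge⟩ := exists_pairing_ge hΩ hb (hu.linear hv a b) hΩ subset_rfl hε
  rw [pairing_convex hu.1 hv.1 hg hab] at hge
  have h1 := pairing_le hΩ hb hu hΩ subset_rfl hg
  have h2 := pairing_le hΩ hb hv hΩ subset_rfl hg
  nlinarith

/-! ### Independence of the representative -/

theorem isDistribGradient_congr {Ω : Set Plane} {u v : Plane → ℝ}
    (h : u =ᵐ[volume.restrict Ω] v) : IsDistribGradient Ω u = IsDistribGradient Ω v := by
  ext μ
  refine and_congr_right fun _ => forall_congr' fun η => ?_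
  rw [integral_congr_ae (g := fun x => v x • gradient η x) (h.mono fun x hx => by simp [hx])]

theorem memBV_congr {Ω : Set Plane} {u v : Plane → ℝ}
    (h : u =ᵐ[volume.restrict Ω] v) : MemBV Ω u ↔ MemBV Ω v := by
  rw [MemBV, MemBV, isDistribGradient_congr h, IntegrableOn, IntegrableOn, integrable_congr h]

theorem distribGrad_congr {Ω : Set Plane} {u v : Plane → ℝ}
    (h : u =ᵐ[volume.restrict Ω] v) : distribGrad Ω u = distribGrad Ω v := by
  unfold distribGrad
  rw [isDistribGradient_congr h]

theorem area_congr {Ω : Set Plane} {u v : Plane → ℝ}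
    (h : u =ᵐ[volume.restrict Ω] v) : area Ω u = area Ω v := by
  unfold area singGrad acGrad
  rw [distribGrad_congr h]

theorem isTraceAt_congr {Ω : Set Plane} {u v : Plane → ℝ}
    (h : u =ᵐ[volume.restrict Ω] v) : IsTraceAt Ω u = IsTraceAt Ω v := by
  ext x z
  unfold IsTraceAt
  have : ∀ r : ℝ, (⨍ y in Metric.ball x r ∩ Ω, |u y - z|) = ⨍ y in Metric.ball x r ∩ Ω, |v y - z| :=
    fun r => average_congr ((ae_restrict_of_ae_restrict_of_subset inter_subset_right h).mono
      fun y hy => by beta_reduce; rw [hy])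
  simp_rw [this]

theorem trace_congr {Ω : Set Plane} {u v : Plane → ℝ}
    (h : u =ᵐ[volume.restrict Ω] v) : trace Ω u = trace Ω v := by
  unfold trace
  rw [isTraceAt_congr h]

/-- Every integrable function on `Ω` has a measurable representative which vanishes off `Ω`. -/
theorem exists_measurable_rep {Ω : Set Plane} (hΩ : MeasurableSet Ω) {u : Plane → ℝ}
    (hu : IntegrableOn u Ω) :
    ∃ v : Plane → ℝ, Measurable v ∧ Integrable v ∧ u =ᵐ[volume.restrict Ω] v := by
  refine ⟨Ω.indicator (hu.aestronglyMeasurable.mk u),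
    hu.aestronglyMeasurable.stronglyMeasurable_mk.measurable.indicator hΩ, ?_, ?_⟩
  · rw [integrable_indicator_iff hΩ, IntegrableOn, ← integrable_congr hu.aestronglyMeasurable.ae_eq_mk]
    exact hu
  · filter_upwards [hu.aestronglyMeasurable.ae_eq_mk, ae_restrict_mem hΩ] with x hx hxΩ
    rw [indicator_of_mem hxΩ, ← hx]

/-! ### Translations of functions of bounded variation -/

theorem integrable_bdd_continuous_mul {v : Plane → ℝ} (hv : Integrable v) {h : Plane → ℝ}
    (hh : Continuous h) {B : ℝ} (hB : ∀ x, ‖h x‖ ≤ B) : Integrable fun x => v x * h x :=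
  hv.mul_bdd (c := B) hh.aestronglyMeasurable (ae_of_all _ hB)

/-- The pairing of a translation difference with a test function. -/
theorem integral_translate_sub_mul_le {Ω : Set Plane} (hΩ : MeasurableSet Ω) {v : Plane → ℝ}
    (hvi : Integrable v) {μ : VectorMeasure Plane Plane} (hμ : IsDistribGradient Ω v μ)
    {ζ ρ : Plane → ℝ} (hζ : ContDiff ℝ ∞ ζ) (hζc : HasCompactSupport ζ)
    (hρ : Continuous ρ) (hρc : HasCompactSupport ρ) (hζρ : ∀ x, |ζ x| ≤ ρ x) (w : Plane)
    (hsupp : ∀ x ∈ tsupport ζ, ∀ s ∈ Icc (0 : ℝ) 1, x + s • w ∈ Ω) :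
    ∫ z, (v (z + w) - v z) * ζ z
      ≤ ‖w‖ * ∫ s in (0 : ℝ)..1, ∫ x, ρ (x - s • w) ∂μ.variation := by
  obtain ⟨B, hB⟩ := exists_gradient_bound hζ hζc
  obtain ⟨B', hB'⟩ := hζ.continuous.bounded_above_of_compact_support hζc
  obtain ⟨B'', hB''⟩ := hρ.bounded_above_of_compact_support hρc
  have hB0 : 0 ≤ B := (norm_nonneg _).trans (hB 0)
  have hcζ := hζ.continuous
  have hder (s : ℝ) (x : Plane) : HasDerivAt (fun s : ℝ => v x * ζ (x - s • w))
      (v x * -inner ℝ (gradient ζ (x - s • w)) w) s := by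
    refine HasDerivAt.const_mul _ ?_
    have h1 : HasDerivAt (fun s : ℝ => x - s • w) (-w) s := by
      simpa using ((hasDerivAt_id s).smul_const w).const_sub x
    have h2 : HasFDerivAt ζ (fderiv ℝ ζ (x - s • w)) (x - s • w) :=
      (hζ.differentiable (by simp) _).hasFDerivAt
    have := h2.comp_hasDerivAt s h1
    rw [inner_gradient, ← map_neg]
    exact this
  have hbound (s : ℝ) (x : Plane) :
      ‖v x * -inner ℝ (gradient ζ (x - s • w)) w‖ ≤ |v x| * (B * ‖w‖) := by
    rw [norm_mul, norm_neg, Real.norm_eq_abs]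
    exact mul_le_mul_of_nonneg_left ((norm_inner_le_norm _ _).trans
      (mul_le_mul_of_nonneg_right (hB _) (norm_nonneg _))) (abs_nonneg _)
  have hcg (s : ℝ) : Continuous fun x => -inner ℝ (gradient ζ (x - s • w)) w :=
    (((continuous_gradient hζ).comp (continuous_id.sub continuous_const)).inner
      continuous_const).neg
  -- The left side equals `f 1 - f 0` after a change of variable. The derivative of `f` pairs `v`
  -- with the gradient of a translate of `ζ`, hence is an integral of that translate against the
  -- distributional gradient.
  set f : ℝ → ℝ := fun s => ∫ x, v x * ζ (x - s • w) with hf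
  set f' : ℝ → ℝ := fun s => ∫ x, v x * -inner ℝ (gradient ζ (x - s • w)) w with hf'
  have hfd (s : ℝ) : HasDerivAt f (f' s) s := by
    refine (hasDerivAt_integral_of_dominated_loc_of_deriv_le (s := univ) (𝕜 := ℝ)
      (F' := fun s x => v x * -inner ℝ (gradient ζ (x - s • w)) w)
      (bound := fun x => |v x| * (B * ‖w‖)) univ_mem
      (Eventually.of_forall fun s => ?_) ?_ ?_ ?_ ?_ ?_).2
    · exact hvi.aestronglyMeasurable.mul
        (hcζ.comp (continuous_id.sub continuous_const)).aestronglyMeasurable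
    · exact integrable_bdd_continuous_mul hvi (hcζ.comp (continuous_id.sub continuous_const))
        fun x => hB' _
    · exact hvi.aestronglyMeasurable.mul (hcg s).aestronglyMeasurable
    · exact ae_of_all _ fun x s _ => hbound s x
    · exact hvi.abs.mul_const _
    · exact ae_of_all _ fun x s _ => hder s x
  have hf'c : Continuous f' := by
    refine continuous_of_dominated (bound := fun x => |v x| * (B * ‖w‖)) (fun s => ?_)
      (fun s => ae_of_all _ (hbound s)) (hvi.abs.mul_const _) (ae_of_all _ fun x => ?_)
    · exact hvi.aestronglyMeasurable.mul (hcg s).aestronglyMeasurable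
    · refine continuous_const.mul ?_
      exact (((continuous_gradient hζ).comp (continuous_const.sub
        (continuous_id.smul continuous_const))).inner continuous_const).neg
  have hf'le (s : ℝ) (hs : s ∈ Icc (0 : ℝ) 1) :
      f' s ≤ ‖w‖ * ∫ x, ρ (x - s • w) ∂μ.variation := by
    set ζs : Plane → ℝ := fun x => ζ (x - s • w)
    have h1 : ContDiff ℝ ∞ ζs := hζ.comp (contDiff_id.sub contDiff_const)
    have h2 : HasCompactSupport ζs := by
      have := hζc.comp_homeomorph (Homeomorph.addRight (-(s • w)))
      simpa [ζs, Function.comp_def, sub_eq_add_neg] using this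
    have h3 : tsupport ζs ⊆ Ω := by
      intro x hx
      have hx' : x - s • w ∈ tsupport ζ := by
        have hpre : IsClosed ((fun x => x - s • w) ⁻¹' tsupport ζ) :=
          (isClosed_tsupport ζ).preimage (continuous_id.sub continuous_const)
        have hsub : Function.support ζs ⊆ (fun x => x - s • w) ⁻¹' tsupport ζ :=
          fun y hy => subset_tsupport ζ hy
        exact closure_minimal hsub hpre hx
      simpa using hsupp _ hx' s hs
    have hgr (x : Plane) : gradient ζs x = gradient ζ (x - s • w) := by
      rw [gradient_eq, gradient_eq]
      congr 1
      exact fderiv_comp_sub _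
    have e : f' s = inner ℝ w (∫ᵛ x, ζs x ∂•μ) := by
      have : ∫ᵛ x, ζs x ∂•μ = -∫ x in Ω, v x • gradient ζs x := by
        rw [hμ.2 ζs h1 h2 h3, neg_neg]
      rw [this, inner_neg_right, ← integral_inner ((integrable_smul_gradient hvi h1 h2).integrableOn),
        setIntegral_eq_integral_of_forall_compl_eq_zero, hf', ← integral_neg]
      · refine integral_congr_ae (ae_of_all _ fun x => ?_)
        beta_reduce
        rw [hgr, inner_smul_right, real_inner_comm, mul_neg]
      · intro x hx
        have : gradient ζs x = 0 := by
          have hn : x ∉ tsupport ζs := fun h => hx (h3 h)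
          rw [gradient_eq, image_eq_zero_of_notMem_tsupport
            (fun h => hn (tsupport_fderiv_subset ℝ h)), map_zero]
        simp [this]
    rw [e]
    refine (real_inner_le_norm _ _).trans (mul_le_mul_of_nonneg_left ?_ (norm_nonneg _))
    refine (norm_integral_vectorMeasure_le μ ζs).trans ?_
    refine integral_mono_of_nonneg (ae_of_all _ fun x => norm_nonneg _)
      (Integrable.of_bound (hρ.comp (continuous_id.sub continuous_const)).aestronglyMeasurable B''
        (ae_of_all _ fun x => hB'' _)) (ae_of_all _ fun x => hζρ _)
  have hρs : Continuous fun s : ℝ => ∫ x, ρ (x - s • w) ∂μ.variation := by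
    refine continuous_of_dominated (bound := fun _ => B'') (fun s => ?_)
      (fun s => ae_of_all _ fun x => hB'' _) (integrable_const _) (ae_of_all _ fun x => ?_)
    · exact (hρ.comp (continuous_id.sub continuous_const)).aestronglyMeasurable
    · exact hρ.comp (continuous_const.sub (continuous_id.smul continuous_const))
  have hftc := intervalIntegral.integral_eq_sub_of_hasDerivAt (a := 0) (b := 1)
    (fun s _ => hfd s) (hf'c.intervalIntegrable _ _)
  have e1 : ∫ z, (v (z + w) - v z) * ζ z = f 1 - f 0 := by
    have a1 : f 1 = ∫ z, v (z + w) * ζ z := by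
      rw [hf]
      simp only [one_smul]
      rw [← integral_add_right_eq_self _ w]
      simp
    have a0 : f 0 = ∫ z, v z * ζ z := by simp [hf]
    rw [a1, a0, ← integral_sub (integrable_bdd_continuous_mul (hvi.comp_add_right w) hcζ hB')
      (integrable_bdd_continuous_mul hvi hcζ hB')]
    simp_rw [sub_mul]
  rw [e1, ← hftc, ← intervalIntegral.integral_const_mul]
  exact intervalIntegral.integral_mono_on zero_le_one (hf'c.intervalIntegrable _ _)
    ((hρs.const_mul _).intervalIntegrable _ _) hf'le

/-- Weighted `L¹` estimate for translations of a function of bounded variation. -/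
theorem integral_translate_sub_le {Ω : Set Plane} (hΩ : MeasurableSet Ω) {v : Plane → ℝ}
    (hvi : Integrable v) {μ : VectorMeasure Plane Plane} (hμ : IsDistribGradient Ω v μ)
    {ρ : Plane → ℝ} (hρ : ContDiff ℝ ∞ ρ) (hρc : HasCompactSupport ρ) (hρ0 : ∀ x, 0 ≤ ρ x)
    (w : Plane) (hsupp : ∀ x ∈ tsupport ρ, ∀ s ∈ Icc (0 : ℝ) 1, x + s • w ∈ Ω) :
    ∫ z, |v (z + w) - v z| * ρ z
      ≤ ‖w‖ * ∫ s in (0 : ℝ)..1, ∫ x, ρ (x - s • w) ∂μ.variation := by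
  obtain ⟨B, hB⟩ := hρ.continuous.bounded_above_of_compact_support hρc
  refine le_of_forall_pos_le_add fun ε hε => ?_
  have hH : Integrable fun z => (v (z + w) - v z) * ρ z :=
    integrable_bdd_continuous_mul ((hvi.comp_add_right w).sub hvi) hρ.continuous hB
  -- `g` is a smooth substitute for the sign of the difference. The product `g ρ` is then bounded by
  -- `ρ`, as the pairing estimate requires.
  obtain ⟨g, h1, h2, -, h4, h5⟩ := exists_smooth_pairing (U := univ) isOpen_univ
    (H := fun z => (v (z + w) - v z) * ρ z) hH.integrableOn hε
  simp only [Measure.restrict_univ] at h5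
  have hle := integral_translate_sub_mul_le hΩ hvi hμ (ζ := fun x => g x * ρ x) (h1.mul hρ)
    hρc.mul_left hρ.continuous hρc (fun x => by
      rw [abs_mul, abs_of_nonneg (hρ0 x)]
      exact mul_le_of_le_one_left (hρ0 x) (h4 x)) w
    (fun x hx => hsupp x (closure_mono (Function.support_mul_subset_right _ _) hx))
  have e1 : ∫ z, ‖(v (z + w) - v z) * ρ z‖ = ∫ z, |v (z + w) - v z| * ρ z := by
    refine integral_congr_ae (ae_of_all _ fun z => ?_)
    beta_reduce
    rw [norm_mul, Real.norm_eq_abs, Real.norm_of_nonneg (hρ0 z)]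
  have e2 : ∫ z, inner ℝ (g z) ((v (z + w) - v z) * ρ z)
      = ∫ z, (v (z + w) - v z) * (g z * ρ z) := by
    refine integral_congr_ae (ae_of_all _ fun z => ?_)
    simp only [RCLike.inner_apply, conj_trivial]
    ring
  rw [e1, e2] at h5
  linarith

/-- `L¹` estimate for translations on an open set. -/
theorem lintegral_translate_sub_le {Ω : Set Plane} (hΩ : MeasurableSet Ω) {v : Plane → ℝ}
    (hvm : Measurable v) (hvi : Integrable v) {μ : VectorMeasure Plane Plane}
    (hμ : IsDistribGradient Ω v μ) {Q D : Set Plane} (hQ : IsOpen Q) (hD : MeasurableSet D)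
    (hDΩ : D ⊆ Ω) (w : Plane) (hQD : ∀ x ∈ Q, ∀ s ∈ Icc (0 : ℝ) 1, x + s • w ∈ D) :
    ∫⁻ z in Q, ‖v (z + w) - v z‖ₑ ≤ ‖w‖ₑ * μ.variation D := by
  have hi : Integrable fun z => v (z + w) - v z := (hvi.comp_add_right w).sub hvi
  set m : Measure Plane := volume.withDensity fun z => ‖v (z + w) - v z‖ₑ with hm
  have hfin : IsFiniteMeasure m := ⟨by simpa [hm] using! hi.2⟩
  have e : ∫⁻ z in Q, ‖v (z + w) - v z‖ₑ = m Q := by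
    rw [hm, withDensity_apply _ hQ.measurableSet]
  -- By inner regularity it is enough to bound the integral over compact subsets of `Q`, where a
  -- cutoff supported in `Q` serves as the weight.
  rw [e, hQ.measure_eq_iSup_isCompact]
  refine iSup₂_le fun K hKQ => iSup_le fun hK => ?_
  obtain ⟨χ, hχ, hχc, hχs, hχ01, hχ1⟩ := exists_smooth_cutoff hK hQ hKQ
  have hle := integral_translate_sub_le hΩ hvi hμ hχ hχc (fun x => (hχ01 x).1) w
    (fun x hx s hs => hDΩ (hQD x (hχs hx) s hs))
  have h1 (s : ℝ) (hs : s ∈ Icc (0 : ℝ) 1) :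
      ∫ x, χ (x - s • w) ∂μ.variation ≤ μ.variation.real D := by
    rw [← integral_indicator_one hD]
    refine integral_mono_of_nonneg (ae_of_all _ fun x => (hχ01 _).1)
      ((integrable_const (1 : ℝ)).indicator hD) (ae_of_all _ fun x => ?_)
    by_cases hx : x ∈ D
    · simpa [hx] using (hχ01 _).2
    · have : x - s • w ∉ tsupport χ := fun h => hx (by simpa using hQD _ (hχs h) s hs)
      simp [hx, image_eq_zero_of_notMem_tsupport this]
  have hcs : Continuous fun s : ℝ => ∫ x, χ (x - s • w) ∂μ.variation := by
    refine continuous_of_dominated (bound := fun _ => 1) (fun s => ?_)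
      (fun s => ae_of_all _ fun x => ?_) (integrable_const _) (ae_of_all _ fun x => ?_)
    · exact (hχ.continuous.comp (continuous_id.sub continuous_const)).aestronglyMeasurable
    · rw [Real.norm_of_nonneg (hχ01 _).1]; exact (hχ01 _).2
    · exact hχ.continuous.comp (continuous_const.sub (continuous_id.smul continuous_const))
  have h2 : ∫ s in (0 : ℝ)..1, ∫ x, χ (x - s • w) ∂μ.variation ≤ μ.variation.real D := by
    have := intervalIntegral.integral_mono_on (μ := volume) zero_le_one
      (hcs.intervalIntegrable 0 1) (continuous_const.intervalIntegrable 0 1) h1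
    simpa using this
  have h3 : m.real K ≤ ‖w‖ * μ.variation.real D := by
    refine le_trans ?_ (hle.trans (mul_le_mul_of_nonneg_left h2 (norm_nonneg _)))
    have : m.real K = ∫ z in K, |v (z + w) - v z| := by
      rw [measureReal_def, hm, withDensity_apply _ hK.measurableSet,
        ← integral_norm_eq_lintegral_enorm hi.aestronglyMeasurable.restrict]
      rfl
    rw [this, ← integral_indicator hK.measurableSet]
    obtain ⟨B, hB⟩ := hχ.continuous.bounded_above_of_compact_support hχc
    refine integral_mono_of_nonneg (ae_of_all _ fun x => indicator_nonneg
      (fun _ _ => abs_nonneg _) _) (integrable_bdd_continuous_mul hi.abs hχ.continuous hB)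
      (ae_of_all _ fun x => ?_)
    by_cases hx : x ∈ K
    · simp [hx, hχ1 x hx]
    · simpa [hx] using mul_nonneg (abs_nonneg _) (hχ01 x).1
  rw [← ofReal_measureReal (measure_ne_top m K), ← ofReal_measureReal (measure_ne_top _ D),
    ← ofReal_norm, ← ENNReal.ofReal_mul (norm_nonneg _)]
  exact ENNReal.ofReal_le_ofReal h3

/-- A Poincaré inequality on convex sets, in double integral form. -/
theorem lintegral_lintegral_sub_le {Ω : Set Plane} (hΩ : MeasurableSet Ω) {v : Plane → ℝ}
    (hvm : Measurable v) (hvi : Integrable v) {μ : VectorMeasure Plane Plane}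
    (hμ : IsDistribGradient Ω v μ) {D : Set Plane} (hD : IsOpen D) (hDc : Convex ℝ D)
    (hDΩ : D ⊆ Ω) {d : ℝ} (hd : ∀ x ∈ D, ∀ y ∈ D, ‖x - y‖ ≤ d) :
    ∫⁻ x in D, ∫⁻ y in D, ‖v x - v y‖ₑ
      ≤ ENNReal.ofReal d * volume (Metric.closedBall (0 : Plane) d) * μ.variation D := by
  have hm1 : Measurable fun p : Plane × Plane => ‖v p.1 - v p.2‖ₑ :=
    ((hvm.comp measurable_fst).sub (hvm.comp measurable_snd)).enorm
  -- Substitute `y = x + w`. For fixed `w` the integral in `x` is a translation difference over `D ∩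
  -- (D - w)`; by convexity the connecting segments remain in `D`, and only `‖w‖ ≤ d` contributes.
  set F : Plane → Plane → ℝ≥0∞ := fun x w =>
    D.indicator 1 x * D.indicator 1 (x + w) * ‖v (x + w) - v x‖ₑ with hF
  have hFm : Measurable (Function.uncurry F) := by
    have a1 : Measurable fun p : Plane × Plane => D.indicator (1 : Plane → ℝ≥0∞) p.1 :=
      (measurable_one.indicator hD.measurableSet).comp measurable_fst
    have a2 : Measurable fun p : Plane × Plane => D.indicator (1 : Plane → ℝ≥0∞) (p.1 + p.2) :=
      (measurable_one.indicator hD.measurableSet).comp (measurable_fst.add measurable_snd)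
    exact (a1.mul a2).mul
      ((hvm.comp (measurable_fst.add measurable_snd)).sub (hvm.comp measurable_fst)).enorm
  have e1 : ∫⁻ x in D, ∫⁻ y in D, ‖v x - v y‖ₑ = ∫⁻ x, ∫⁻ w, F x w := by
    rw [← lintegral_indicator hD.measurableSet]
    refine lintegral_congr fun x => ?_
    by_cases hx : x ∈ D
    · rw [indicator_of_mem hx, ← lintegral_indicator hD.measurableSet,
        ← lintegral_add_left_eq_self _ x]
      refine lintegral_congr fun w => ?_
      by_cases hw : x + w ∈ D
      · simp [hF, hx, hw, enorm_sub_rev]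
      · simp [hF, hw]
    · simp [hF, hx]
  rw [e1, lintegral_lintegral_swap hFm.aemeasurable]
  have h1 (w : Plane) : ∫⁻ x, F x w
      ≤ (Metric.closedBall (0 : Plane) d).indicator (fun _ => ENNReal.ofReal d * μ.variation D) w := by
    set Q : Set Plane := D ∩ (fun x => x + w) ⁻¹' D with hQ
    have hQo : IsOpen Q := hD.inter (hD.preimage (continuous_id.add continuous_const))
    have e2 : ∫⁻ x, F x w = ∫⁻ x in Q, ‖v (x + w) - v x‖ₑ := by
      rw [← lintegral_indicator hQo.measurableSet]
      refine lintegral_congr fun x => ?_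
      by_cases hx : x ∈ D
      · by_cases hw : x + w ∈ D
        · have : x ∈ Q := ⟨hx, hw⟩
          simp [hF, hx, hw, this]
        · have : x ∉ Q := fun h => hw h.2
          simp [hF, hw, this]
      · have : x ∉ Q := fun h => hx h.1
        simp [hF, hx, this]
    rw [e2]
    by_cases hne : Q.Nonempty
    · obtain ⟨x, hx, hxw⟩ := hne
      have hwd : ‖w‖ ≤ d := by simpa using hd _ hxw _ hx
      rw [indicator_of_mem (by simpa using hwd)]
      refine (lintegral_translate_sub_le hΩ hvm hvi hμ hQo hD.measurableSet hDΩ w ?_).trans ?_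
      · intro y hy s hs
        exact hDc.add_smul_mem hy.1 hy.2 hs
      · gcongr
        rw [← ofReal_norm]
        exact ENNReal.ofReal_le_ofReal hwd
    · rw [not_nonempty_iff_eq_empty.1 hne]
      simp
  refine (lintegral_mono h1).trans ?_
  rw [lintegral_indicator Metric.isClosed_closedBall.measurableSet, setLIntegral_const]
  exact le_of_eq (by ring)

/-! ### Flat parts of the boundary of a convex domain -/

/-- The quarter turn of a vector. -/
def turn (u : Plane) : Plane := !₂[-u 1, u 0]

theorem inner_plane (x y : Plane) : inner ℝ x y = x 0 * y 0 + x 1 * y 1 := by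
  simp [PiLp.inner_apply, Fin.sum_univ_two, mul_comm]

theorem inner_turn (u x : Plane) : inner ℝ (turn u) x = -u 1 * x 0 + u 0 * x 1 := by
  simp [inner_plane, turn]

theorem norm_sq_eq_inner_turn {u : Plane} (hu : ‖u‖ = 1) (x : Plane) :
    ‖x‖ ^ 2 = inner ℝ u x ^ 2 + inner ℝ (turn u) x ^ 2 := by
  have h : u 0 ^ 2 + u 1 ^ 2 = 1 := by rw [← norm_sq_plane, hu, one_pow]
  rw [norm_sq_plane, inner_plane, inner_turn]
  linear_combination (-(x 0 ^ 2) - x 1 ^ 2) * h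

theorem norm_turn (u : Plane) : ‖turn u‖ = ‖u‖ := by
  rw [← sq_eq_sq₀ (norm_nonneg _) (norm_nonneg _), norm_sq_plane, norm_sq_plane]
  simp [turn]
  ring

theorem decompose_turn {u : Plane} (hu : ‖u‖ = 1) (x : Plane) :
    x = inner ℝ u x • u + inner ℝ (turn u) x • turn u := by
  have h : u 0 ^ 2 + u 1 ^ 2 = 1 := by rw [← norm_sq_plane, hu, one_pow]
  ext j
  fin_cases j
  · simp only [inner_plane, PiLp.add_apply, PiLp.smul_apply, turn, smul_eq_mul,
      Fin.zero_eta, Matrix.cons_val_zero]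
    simp
    linear_combination (-(x 0)) * h
  · simp only [inner_plane, PiLp.add_apply, PiLp.smul_apply, turn, smul_eq_mul]
    simp
    linear_combination (-(x 1)) * h

/-- `ν` is an outer unit normal of the convex set `Ω` at `b`. -/
def IsNormalAt (Ω : Set Plane) (b ν : Plane) : Prop :=
  ‖ν‖ = 1 ∧ ∀ x ∈ Ω, inner ℝ ν (x - b) ≤ 0

/-- The boundary points with an outer normal close to `u`. -/
def flatPart (Ω : Set Plane) (u : Plane) (ε : ℝ) : Set Plane :=
  {b ∈ frontier Ω | ∃ ν, IsNormalAt Ω b ν ∧ ‖ν - u‖ ≤ ε}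

theorem exists_isNormalAt {Ω : Set Plane} (hΩ : IsOpen Ω) (hc : Convex ℝ Ω) (hne : Ω.Nonempty)
    {b : Plane} (hb : b ∉ Ω) : ∃ ν, IsNormalAt Ω b ν := by
  obtain ⟨f, hf⟩ := geometric_hahn_banach_open_point hc hΩ hb
  set ν := (InnerProductSpace.toDual ℝ Plane).symm f
  have hν x : inner ℝ ν x = f x := InnerProductSpace.toDual_symm_apply
  have hν0 : ν ≠ 0 := by
    obtain ⟨x, hx⟩ := hne
    intro h
    have := hf x hx
    rw [← hν, ← hν, h] at this
    simp at this
  refine ⟨‖ν‖⁻¹ • ν, ?_, fun x hx => ?_⟩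
  · rw [norm_smul, norm_inv, norm_norm, inv_mul_cancel₀ (norm_ne_zero_iff.2 hν0)]
  · rw [real_inner_smul_left, inner_sub_right, hν, hν]
    exact mul_nonpos_of_nonneg_of_nonpos (by positivity) (by linarith [hf x hx])

theorem IsNormalAt.closure {Ω : Set Plane} {b ν : Plane} (h : IsNormalAt Ω b ν) {x : Plane}
    (hx : x ∈ closure Ω) : inner ℝ ν (x - b) ≤ 0 := by
  have hcl : IsClosed {x : Plane | inner ℝ ν (x - b) ≤ 0} :=
    isClosed_le (continuous_const.inner (continuous_id.sub continuous_const)) continuous_const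
  exact closure_minimal h.2 hcl hx

/-- Each point lies in the supporting half-plane at the other, and replacing either normal by `u`
costs at most `ε ‖b - b'‖`. One point gives the upper bound and the other the lower one. -/
theorem abs_inner_sub_le_of_mem_flatPart {Ω : Set Plane} {u : Plane} {ε : ℝ} {b b' : Plane}
    (hb : b ∈ flatPart Ω u ε) (hb' : b' ∈ flatPart Ω u ε) :
    |inner ℝ u (b - b')| ≤ ε * ‖b - b'‖ := by
  obtain ⟨h1, ν, hν, hνu⟩ := hb
  obtain ⟨h1', ν', hν', hνu'⟩ := hb'
  have a1 := hν.closure (frontier_subset_closure h1')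
  have a2 := hν'.closure (frontier_subset_closure h1)
  have b1 : |inner ℝ (ν - u) (b - b')| ≤ ε * ‖b - b'‖ := (abs_real_inner_le_norm _ _).trans
    (mul_le_mul_of_nonneg_right hνu (norm_nonneg _))
  have b2 : |inner ℝ (ν' - u) (b - b')| ≤ ε * ‖b - b'‖ := (abs_real_inner_le_norm _ _).trans
    (mul_le_mul_of_nonneg_right hνu' (norm_nonneg _))
  rw [inner_sub_left] at b1 b2
  rw [← neg_sub, inner_neg_right] at a1
  rw [abs_le] at b1 b2 ⊢
  constructor <;> linarith

/-- The set is the projection, along the compact unit circle of normals, of a set defined by closed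
conditions. -/
theorem isClosed_flatPart {Ω : Set Plane} (u : Plane) (ε : ℝ) : IsClosed (flatPart Ω u ε) := by
  have hK : CompactSpace (Metric.sphere (0 : Plane) 1) :=
    isCompact_iff_compactSpace.1 (isCompact_sphere _ _)
  set S : Set (Metric.sphere (0 : Plane) 1 × Plane) :=
    {p | p.2 ∈ frontier Ω ∧ ‖(p.1 : Plane) - u‖ ≤ ε ∧ ∀ x ∈ Ω, inner ℝ (p.1 : Plane) (x - p.2) ≤ 0}
  have hS : IsClosed S := by
    refine (isClosed_frontier.preimage continuous_snd).inter (IsClosed.inter ?_ ?_)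
    · exact isClosed_le ((continuous_subtype_val.comp continuous_fst).sub continuous_const).norm
        continuous_const
    · have : {p : Metric.sphere (0 : Plane) 1 × Plane | ∀ x ∈ Ω, inner ℝ (p.1 : Plane) (x - p.2) ≤ 0}
          = ⋂ x ∈ Ω, {p | inner ℝ (p.1 : Plane) (x - p.2) ≤ 0} := by ext; simp
      change IsClosed {p : Metric.sphere (0 : Plane) 1 × Plane |
        ∀ x ∈ Ω, inner ℝ (p.1 : Plane) (x - p.2) ≤ 0}
      rw [this]
      exact isClosed_biInter fun x _ => isClosed_le
        ((continuous_subtype_val.comp continuous_fst).inner (continuous_const.sub continuous_snd))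
        continuous_const
  have := isClosedMap_snd_of_compactSpace S hS
  convert this using 1
  ext b
  constructor
  · rintro ⟨h1, ν, hν, hνu⟩
    exact ⟨(⟨ν, by simpa using hν.1⟩, b), ⟨h1, hνu, hν.2⟩, rfl⟩
  · rintro ⟨⟨⟨ν, hν⟩, b'⟩, ⟨h1, h2, h3⟩, rfl⟩
    exact ⟨h1, ν, ⟨by simpa using hν, h3⟩, h2⟩

/-- A set which is almost orthogonal to `u` is a Lipschitz graph over the orthogonal line, and its
length is controlled by that of its projection. -/
theorem hausdorffMeasure_flat_le {u : Plane} (hu : ‖u‖ = 1) {ε : ℝ} (hε1 : ε < 1)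
    (hε0 : 0 ≤ ε) {A : Set Plane}
    (hA : ∀ b ∈ A, ∀ b' ∈ A, |inner ℝ u (b - b')| ≤ ε * ‖b - b'‖) (T : Set ℝ) :
    μH[1] (A ∩ (fun x => inner ℝ (turn u) x) ⁻¹' T)
      ≤ ENNReal.ofReal (Real.sqrt (1 - ε ^ 2))⁻¹ * volume T := by
  have hε : 0 < 1 - ε ^ 2 := by nlinarith
  set P : Plane → ℝ := fun x => inner ℝ (turn u) x with hP
  set c : ℝ := (Real.sqrt (1 - ε ^ 2))⁻¹ with hc
  have hc0 : 0 < c := by positivity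
  -- Pythagoras in the frame `u`, `turn u`: the component along `u` is at most `ε` times the length,
  -- so the tangential one controls the rest. Hence the projection has a Lipschitz inverse on `A`.
  have hdist : ∀ b ∈ A, ∀ b' ∈ A, ‖b - b'‖ ≤ c * |P b - P b'| := by
    intro b hb b' hb'
    have h1 := norm_sq_eq_inner_turn hu (b - b')
    have h2 := hA b hb b' hb'
    have h3 : inner ℝ u (b - b') ^ 2 ≤ ε ^ 2 * ‖b - b'‖ ^ 2 := by
      rw [← sq_abs, ← mul_pow]
      exact pow_le_pow_left₀ (abs_nonneg _) h2 2
    rw [inner_sub_right (turn u)] at h1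
    have h4 : (1 - ε ^ 2) * ‖b - b'‖ ^ 2 ≤ |P b - P b'| ^ 2 := by
      rw [sq_abs]
      simp only [hP]
      linarith
    have h5 : Real.sqrt (1 - ε ^ 2) * ‖b - b'‖ ≤ |P b - P b'| := by
      refine le_of_sq_le_sq ?_ (abs_nonneg _)
      rw [mul_pow, Real.sq_sqrt hε.le]
      exact h4
    rw [hc, inv_mul_eq_div, le_div_iff₀ (by positivity), mul_comm]
    exact h5
  set A' := A ∩ P ⁻¹' T
  have hinj : InjOn P A := fun b hb b' hb' h => by
    have := hdist b hb b' hb'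
    rw [h, sub_self, abs_zero, mul_zero] at this
    exact sub_eq_zero.1 (norm_le_zero_iff.1 this)
  set g := Function.invFunOn P A
  have hg : ∀ b ∈ A, g (P b) = b := fun b hb => hinj.leftInvOn_invFunOn hb
  have hLip : LipschitzOnWith (Real.toNNReal c) g (P '' A') := by
    refine LipschitzOnWith.of_dist_le_mul ?_
    rintro _ ⟨b, hb, rfl⟩ _ ⟨b', hb', rfl⟩
    rw [hg b hb.1, hg b' hb'.1, Real.coe_toNNReal _ hc0.le, dist_eq_norm, Real.dist_eq]
    exact hdist b hb.1 b' hb'.1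
  have himg : g '' (P '' A') = A' := by
    ext b
    constructor
    · rintro ⟨_, ⟨b', hb', rfl⟩, rfl⟩
      rwa [hg b' hb'.1]
    · intro hb
      exact ⟨P b, ⟨b, hb, rfl⟩, hg b hb.1⟩
  have h1 := hLip.hausdorffMeasure_image_le (d := 1) zero_le_one
  rw [himg, hausdorffMeasure_real, ENNReal.rpow_one] at h1
  refine h1.trans ?_
  change ENNReal.ofReal c * _ ≤ _
  gcongr
  rintro _ ⟨b, hb, rfl⟩
  exact hb.2

theorem exists_finite_directions {ε : ℝ} (hε : 0 < ε) :
    ∃ F : Finset Plane, (∀ u ∈ F, ‖u‖ = 1) ∧ ∀ ν : Plane, ‖ν‖ = 1 → ∃ u ∈ F, ‖ν - u‖ ≤ ε := by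
  obtain ⟨t, ht, htf, hcov⟩ := (isCompact_sphere (0 : Plane) 1).finite_cover_balls hε
  refine ⟨htf.toFinset, fun u hu => by simpa using ht (htf.mem_toFinset.1 hu), fun ν hν => ?_⟩
  have := hcov (show ν ∈ Metric.sphere (0 : Plane) 1 by simpa using hν)
  simp only [mem_iUnion, Metric.mem_ball, dist_eq_norm] at this
  obtain ⟨u, hu, h⟩ := this
  exact ⟨u, htf.mem_toFinset.2 hu, h.le⟩

theorem frontier_subset_flatPart {Ω : Set Plane} (hΩ : IsOpen Ω) (hc : Convex ℝ Ω)
    (hne : Ω.Nonempty) {ε : ℝ} {F : Finset Plane}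
    (hF : ∀ ν : Plane, ‖ν‖ = 1 → ∃ u ∈ F, ‖ν - u‖ ≤ ε) :
    frontier Ω ⊆ ⋃ u ∈ F, flatPart Ω u ε := by
  intro b hb
  have hbΩ : b ∉ Ω := fun h => by
    rw [frontier, hΩ.interior_eq] at hb
    exact hb.2 h
  obtain ⟨ν, hν⟩ := exists_isNormalAt hΩ hc hne hbΩ
  obtain ⟨u, hu, h⟩ := hF ν hν.1
  exact mem_biUnion hu ⟨hb, ν, hν, h⟩

/-- Upper Ahlfors regularity of the boundary of a convex set. -/
theorem exists_hausdorffMeasure_frontier_le {Ω : Set Plane} (hΩ : IsOpen Ω) (hc : Convex ℝ Ω)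
    (hne : Ω.Nonempty) :
    ∃ C : ℝ≥0, ∀ (z : Plane) (r : ℝ),
      μH[1] (frontier Ω ∩ Metric.closedBall z r) ≤ C * ENNReal.ofReal r := by
  -- Any fixed `ε < 1` would serve. Each of the finitely many flat parts projects into an interval
  -- of length `2 r`.
  obtain ⟨F, hF1, hF⟩ := exists_finite_directions (ε := 1 / 2) (by norm_num)
  set c : ℝ := (Real.sqrt (1 - (1 / 2) ^ 2))⁻¹ with hc'
  refine ⟨F.card * (c * 2).toNNReal, fun z r => ?_⟩
  have h1 (u : Plane) (hu : u ∈ F) :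
      μH[1] (flatPart Ω u (1 / 2) ∩ Metric.closedBall z r)
        ≤ ENNReal.ofReal (c * 2) * ENNReal.ofReal r := by
    have := hausdorffMeasure_flat_le (hF1 u hu) (ε := 1 / 2) (by norm_num) (by norm_num)
      (A := flatPart Ω u (1 / 2)) (fun b hb b' hb' => abs_inner_sub_le_of_mem_flatPart hb hb')
      (Metric.closedBall (inner ℝ (turn u) z) r)
    rw [Real.volume_closedBall] at this
    refine (measure_mono (inter_subset_inter_right _ fun x hx => ?_)).trans (this.trans ?_)
    · rw [mem_preimage, Metric.mem_closedBall, Real.dist_eq, ← inner_sub_right]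
      refine (abs_real_inner_le_norm _ _).trans ?_
      rw [norm_turn, hF1 u hu, one_mul, ← dist_eq_norm]
      exact hx
    · rw [← ENNReal.ofReal_mul (by positivity), ← ENNReal.ofReal_mul (by positivity), mul_assoc]
  calc μH[1] (frontier Ω ∩ Metric.closedBall z r)
      ≤ μH[1] (⋃ u ∈ F, flatPart Ω u (1 / 2) ∩ Metric.closedBall z r) := by
        refine measure_mono ?_
        rw [← iUnion₂_inter]
        exact inter_subset_inter_left _ (frontier_subset_flatPart hΩ hc hne hF)
    _ ≤ ∑ u ∈ F, μH[1] (flatPart Ω u (1 / 2) ∩ Metric.closedBall z r) :=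
        measure_biUnion_finset_le _ _
    _ ≤ ∑ _u ∈ F, ENNReal.ofReal (c * 2) * ENNReal.ofReal r := Finset.sum_le_sum h1
    _ = _ := by
        rw [Finset.sum_const, nsmul_eq_mul, ENNReal.coe_mul, ENNReal.coe_natCast, mul_assoc]
        rfl

theorem hausdorffMeasure_frontier_lt_top {Ω : Set Plane} (hΩ : IsOpen Ω) (hc : Convex ℝ Ω)
    (hne : Ω.Nonempty) (hb : Bornology.IsBounded Ω) :
    μH[1] (frontier Ω) < (⊤ : ℝ≥0∞) := by
  obtain ⟨C, hC⟩ := exists_hausdorffMeasure_frontier_le hΩ hc hne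
  obtain ⟨r, hr⟩ := hb.closure.subset_closedBall (0 : Plane)
  have := hC 0 r
  rw [inter_eq_left.2 (frontier_subset_closure.trans hr)] at this
  exact this.trans_lt (ENNReal.mul_lt_top ENNReal.coe_lt_top ENNReal.ofReal_lt_top)

/-! ### Averages -/

theorem lintegral_sub_average_le {v : Plane → ℝ} (hvi : Integrable v)
    {A B D : Set Plane} (hAD : A ⊆ D) (hBD : B ⊆ D) (hB : volume B ≠ (⊤ : ℝ≥0∞)) :
    (∫⁻ x in A, ‖v x - ⨍ y in B, v y‖ₑ) * volume B ≤ ∫⁻ x in D, ∫⁻ y in D, ‖v x - v y‖ₑ := by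
  have hpt (x : Plane) : ‖v x - ⨍ y in B, v y‖ₑ * volume B ≤ ∫⁻ y in B, ‖v x - v y‖ₑ := by
    have e : ∫ y in B, (v x - v y) = volume.real B * (v x - ⨍ y in B, v y) := by
      rw [integral_sub (integrableOn_const (C := v x) hB) hvi.integrableOn, setIntegral_const, mul_sub,
        ← smul_eq_mul (b := ⨍ y in B, v y), measure_smul_setAverage _ hB, smul_eq_mul]
    have h := enorm_integral_le_lintegral_enorm (μ := volume.restrict B) fun y => v x - v y
    rw [e, enorm_mul, Real.enorm_of_nonneg measureReal_nonneg, ofReal_measureReal hB] at h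
    rwa [mul_comm]
  calc (∫⁻ x in A, ‖v x - ⨍ y in B, v y‖ₑ) * volume B
      = ∫⁻ x in A, ‖v x - ⨍ y in B, v y‖ₑ * volume B := (lintegral_mul_const' _ _ hB).symm
    _ ≤ ∫⁻ x in A, ∫⁻ y in B, ‖v x - v y‖ₑ := lintegral_mono hpt
    _ ≤ ∫⁻ x in D, ∫⁻ y in B, ‖v x - v y‖ₑ := lintegral_mono_set hAD
    _ ≤ _ := lintegral_mono fun x => lintegral_mono_set hBD

theorem enorm_average_sub_mul_le {v : Plane → ℝ} (hvi : Integrable v)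
    {A : Set Plane} (hA : volume A ≠ (⊤ : ℝ≥0∞)) (c : ℝ) :
    ‖(⨍ y in A, v y) - c‖ₑ * volume A ≤ ∫⁻ x in A, ‖v x - c‖ₑ := by
  have e : ∫ y in A, (v y - c) = volume.real A * ((⨍ y in A, v y) - c) := by
    rw [integral_sub hvi.integrableOn (integrableOn_const (C := c) hA), setIntegral_const, mul_sub,
      ← smul_eq_mul (b := ⨍ y in A, v y), measure_smul_setAverage _ hA, smul_eq_mul]
  have h := enorm_integral_le_lintegral_enorm (μ := volume.restrict A) fun y => v y - c
  rw [e, enorm_mul, Real.enorm_of_nonneg measureReal_nonneg, ofReal_measureReal hA] at h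
  rwa [mul_comm]

/-! ### Density of a measure on a disjoint set of finite length -/

/-- `ν` lives on the open set `Ω` and the length measure on its frontier, so the two are mutually
singular and the Besicovitch derivative of `ν` vanishes almost everywhere. The linear bound for the
length in a ball replaces the length by the radius. -/
theorem ae_tendsto_density_zero {Ω : Set Plane} (hΩ : IsOpen Ω) (hc : Convex ℝ Ω)
    (hne : Ω.Nonempty) (hb : Bornology.IsBounded Ω) {ν : Measure Plane} [IsFiniteMeasure ν]
    (hν : ν Ωᶜ = 0) :
    ∀ᵐ b ∂((μH[1] : Measure Plane).restrict (frontier Ω)),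
      Tendsto (fun r : ℝ => ν (Metric.closedBall b r) / ENNReal.ofReal r) (𝓝[>] 0) (𝓝 0) := by
  set ρ := (μH[1] : Measure Plane).restrict (frontier Ω) with hρ
  have hfin : IsFiniteMeasure ρ :=
    ⟨by simpa [hρ] using hausdorffMeasure_frontier_lt_top hΩ hc hne hb⟩
  obtain ⟨C, hC⟩ := exists_hausdorffMeasure_frontier_le hΩ hc hne
  have hsing : ν ⟂ₘ ρ := by
    refine ⟨Ωᶜ, hΩ.measurableSet.compl, hν, ?_⟩
    rw [compl_compl, hρ, Measure.restrict_apply hΩ.measurableSet, hΩ.inter_frontier_eq]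
    simp
  filter_upwards [Besicovitch.ae_tendsto_rnDeriv ν ρ, hsing.rnDeriv_ae_eq_zero] with b h1 h2
  rw [h2, Pi.zero_apply] at h1
  rw [ENNReal.tendsto_nhds_zero] at h1 ⊢
  intro ε hε
  obtain ⟨δ, hδ0, hδt, hδ⟩ : ∃ δ : ℝ≥0∞, 0 < δ ∧ δ ≠ ⊤ ∧ δ * C ≤ ε := by
    rcases eq_or_ne ε ⊤ with rfl | hεt
    · exact ⟨1, one_pos, ENNReal.one_ne_top, le_top⟩
    refine ⟨ε / (C + 1), ENNReal.div_pos hε.ne' (by simp), ENNReal.div_ne_top hεt (by simp), ?_⟩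
    calc ε / (C + 1) * C ≤ ε / (C + 1) * (C + 1) := by gcongr; exact le_self_add
      _ = ε := ENNReal.div_mul_cancel (by simp) (by simp)
  filter_upwards [h1 δ hδ0, self_mem_nhdsWithin] with r hr hr0
  have hr0' : (0 : ℝ) < r := hr0
  have hle : ν (Metric.closedBall b r) ≤ δ * ρ (Metric.closedBall b r) := by
    rcases eq_or_ne (ρ (Metric.closedBall b r)) 0 with h0 | h0
    · rw [h0] at hr
      by_cases hn : ν (Metric.closedBall b r) = 0
      · simp [hn]
      · rw [ENNReal.div_zero hn] at hr
        exact absurd (top_le_iff.1 hr) hδt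
    · exact (ENNReal.div_le_iff h0 (measure_ne_top _ _)).1 hr
  rw [ENNReal.div_le_iff (by simpa using hr0') ENNReal.ofReal_ne_top]
  refine hle.trans ?_
  have h3 : ρ (Metric.closedBall b r) ≤ C * ENNReal.ofReal r := by
    rw [hρ, Measure.restrict_apply Metric.isClosed_closedBall.measurableSet, inter_comm]
    exact hC b r
  calc δ * ρ (Metric.closedBall b r) ≤ δ * (C * ENNReal.ofReal r) := by gcongr
    _ = δ * C * ENNReal.ofReal r := by ring
    _ ≤ ε * ENNReal.ofReal r := by gcongr

/-! ### Existence of the trace -/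

theorem le_ofReal_div_mul_of_mul_ofReal_le {X m : ℝ≥0∞} {p q : ℝ} (hp : 0 < p)
    (h : X * ENNReal.ofReal p ≤ ENNReal.ofReal q * m) : X ≤ ENNReal.ofReal (q / p) * m := by
  have hp' : ENNReal.ofReal p ≠ 0 := by simpa using hp
  rw [ENNReal.ofReal_div_of_pos hp, ENNReal.div_eq_inv_mul, mul_assoc, ← ENNReal.div_eq_inv_mul,
    ENNReal.le_div_iff_mul_le (Or.inl hp') (Or.inl ENNReal.ofReal_ne_top)]
  exact h

theorem volume_ball_plane (x : Plane) {r : ℝ} (hr : 0 ≤ r) :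
    volume (Metric.ball x r) = ENNReal.ofReal (Real.pi * r ^ 2) := by
  rw [EuclideanSpace.volume_ball_fin_two, ← ENNReal.ofReal_pow hr,
    ENNReal.ofReal_mul Real.pi_pos.le, mul_comm]

theorem volume_closedBall_plane (x : Plane) {r : ℝ} (hr : 0 ≤ r) :
    volume (Metric.closedBall x r) = ENNReal.ofReal (Real.pi * r ^ 2) := by
  rw [Measure.addHaar_closedBall_eq_addHaar_ball, volume_ball_plane x hr]

/-- Points of the segment from a point of the closure to the centre of a ball in a convex set are
the centres of proportionally smaller balls. -/
theorem ball_combo_subset {Ω : Set Plane} (hΩ : IsOpen Ω) (hc : Convex ℝ Ω) {x₀ : Plane} {δ : ℝ}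
    (hδ : Metric.ball x₀ δ ⊆ Ω) {b : Plane} (hb : b ∈ closure Ω) {r : ℝ} (hr0 : 0 < r)
    (hr1 : r ≤ 1) : Metric.ball (b + r • (x₀ - b)) (δ * r) ⊆ Ω := by
  intro y hy
  have hw : x₀ + r⁻¹ • (y - (b + r • (x₀ - b))) ∈ Ω := by
    apply hδ
    rw [Metric.mem_ball, dist_eq_norm, add_sub_cancel_left, norm_smul, norm_inv,
      Real.norm_of_nonneg hr0.le, inv_mul_lt_iff₀ hr0, mul_comm, ← dist_eq_norm]
    exact hy
  have := hc.combo_closure_interior_mem_interior hb (hΩ.interior_eq.symm ▸ hw)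
    (a := 1 - r) (b := r) (by linarith) hr0 (by ring)
  rw [hΩ.interior_eq] at this
  convert this using 1
  rw [smul_add, smul_smul, mul_inv_cancel₀ hr0.ne', one_smul]
  module

theorem convex_setOf_closedBall_subset {Ω : Set Plane} (hc : Convex ℝ Ω) (δ : ℝ) :
    Convex ℝ {z | Metric.closedBall z δ ⊆ Ω} := by
  intro z hz z' hz' a b ha hb hab y hy
  have h (w : Plane) (hw : w ∈ {z | Metric.closedBall z δ ⊆ Ω}) :
      w + (y - (a • z + b • z')) ∈ Ω := by
    apply hw
    rw [Metric.mem_closedBall, dist_eq_norm, add_sub_cancel_left, ← dist_eq_norm]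
    exact hy
  have := hc (h z hz) (h z' hz') ha hb hab
  convert this using 1
  have e : y = (a + b) • y := by rw [hab, one_smul]
  have e2 : (a • z + b • z') = (a + b) • (a • z + b • z') := by rw [hab, one_smul]
  calc y = a • z + b • z' + ((a + b) • y - (a + b) • (a • z + b • z')) := by rw [← e, ← e2]; abel
    _ = _ := by module

/-- Oscillation of averages. -/
theorem lintegral_sub_average_mul_le {Ω : Set Plane} (hΩ : MeasurableSet Ω) {v : Plane → ℝ}
    (hvm : Measurable v) (hvi : Integrable v) {μ : VectorMeasure Plane Plane}
    (hμ : IsDistribGradient Ω v μ) {A B D : Set Plane} (hAD : A ⊆ D) (hBD : B ⊆ D)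
    (hD : IsOpen D) (hDc : Convex ℝ D) (hDΩ : D ⊆ Ω) {d : ℝ} (hd0 : 0 ≤ d)
    (hd : ∀ x ∈ D, ∀ y ∈ D, ‖x - y‖ ≤ d) {β : ℝ} (hB : volume B ≠ (⊤ : ℝ≥0∞)) (hβ : 0 < β)
    (hBβ : ENNReal.ofReal β ≤ volume B) :
    ∫⁻ x in A, ‖v x - ⨍ y in B, v y‖ₑ
      ≤ ENNReal.ofReal (Real.pi * d ^ 3 / β) * μ.variation D := by
  refine le_ofReal_div_mul_of_mul_ofReal_le hβ ?_
  calc _ ≤ (∫⁻ x in A, ‖v x - ⨍ y in B, v y‖ₑ) * volume B := by gcongr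
    _ ≤ _ := (lintegral_sub_average_le hvi hAD hBD hB).trans
      (lintegral_lintegral_sub_le hΩ hvm hvi hμ hD hDc hDΩ hd)
    _ = _ := by
      rw [volume_closedBall_plane _ hd0, ← ENNReal.ofReal_mul hd0]
      ring_nf

theorem lintegral_measure_ball_inter {G : Set Plane} (hG : MeasurableSet G)
    {ν ρ : Measure Plane} [IsFiniteMeasure ν] [IsFiniteMeasure ρ] (s : ℝ) :
    ∫⁻ b, ν (Metric.ball b s ∩ G) ∂ρ = ∫⁻ z in G, ρ (Metric.ball z s) ∂ν := by
  have hm : MeasurableSet {p : Plane × Plane | dist p.2 p.1 < s} :=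
    (isOpen_lt (continuous_snd.dist continuous_fst) continuous_const).measurableSet
  have h1 (b : Plane) : ν (Metric.ball b s ∩ G)
      = ∫⁻ z in G, {p : Plane × Plane | dist p.2 p.1 < s}.indicator 1 (b, z) ∂ν := by
    rw [← Measure.restrict_apply Metric.isOpen_ball.measurableSet,
      ← lintegral_indicator_one Metric.isOpen_ball.measurableSet]
    rfl
  have h2 (z : Plane) : ρ (Metric.ball z s)
      = ∫⁻ b, {p : Plane × Plane | dist p.2 p.1 < s}.indicator 1 (b, z) ∂ρ := by
    rw [← lintegral_indicator_one Metric.isOpen_ball.measurableSet]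
    refine lintegral_congr fun b => ?_
    simp [indicator, dist_comm]
  simp_rw [h1, h2]
  rw [lintegral_lintegral_swap]
  exact (measurable_one.indicator hm).aemeasurable

/-- Bounded overlap: all indices satisfying `S` lie in a window of length `M` that starts at the
first of them. -/
theorem tsum_indicator_le {S : ℕ → Prop} [DecidablePred S] {M : ℕ}
    (h : ∀ j k, S j → S k → k < j + M) : ∑' k, (if S k then (1 : ℝ≥0∞) else 0) ≤ M := by
  by_cases hS : ∃ k, S k
  · set j := Nat.find hS
    have hj : S j := Nat.find_spec hS
    rw [tsum_eq_sum (s := Finset.Ico j (j + M))]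
    · calc _ ≤ ∑ _k ∈ Finset.Ico j (j + M), (1 : ℝ≥0∞) :=
          Finset.sum_le_sum fun k _ => by split_ifs <;> simp
        _ = M := by simp
    · intro k hk
      rw [if_neg]
      intro hSk
      exact hk (Finset.mem_Ico.2 ⟨Nat.find_min' hS hSk, h j k hj hSk⟩)
  · push Not at hS
    simp [hS]

/-- The inner parallel pieces of `Ω` used to approach the boundary. -/
theorem ae_tsum_variation_ne_top {Ω : Set Plane} (hΩ : IsOpen Ω) (hc : Convex ℝ Ω)
    (hne : Ω.Nonempty) (hb : Bornology.IsBounded Ω) {ν : Measure Plane} [IsFiniteMeasure ν]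
    {ρ L : ℝ} (hρ : 0 < ρ) (hL : 0 < L) :
    ∀ᵐ b ∂((μH[1] : Measure Plane).restrict (frontier Ω)),
      ∑' k : ℕ, ENNReal.ofReal (((1 / 2) ^ k)⁻¹) * ν (Metric.ball b (L * (1 / 2) ^ k)
        ∩ interior {z | Metric.closedBall z (ρ * (1 / 2) ^ k) ⊆ Ω}) ≠ ⊤ := by
  set m := (μH[1] : Measure Plane).restrict (frontier Ω) with hm
  have hfin : IsFiniteMeasure m :=
    ⟨by simpa [hm] using hausdorffMeasure_frontier_lt_top hΩ hc hne hb⟩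
  obtain ⟨C, hC⟩ := exists_hausdorffMeasure_frontier_le hΩ hc hne
  set G : ℕ → Set Plane := fun k => interior {z | Metric.closedBall z (ρ * (1 / 2) ^ k) ⊆ Ω}
  have hG k : MeasurableSet (G k) := isOpen_interior.measurableSet
  set f : ℕ → Plane → ℝ≥0∞ := fun k b =>
    ENNReal.ofReal (((1 / 2) ^ k)⁻¹) * ν (Metric.ball b (L * (1 / 2) ^ k) ∩ G k) with hf
  have hfm k : Measurable (f k) := by
    have e : (fun b => ν (Metric.ball b (L * (1 / 2) ^ k) ∩ G k))
        = fun b => ∫⁻ z in G k,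
          {p : Plane × Plane | dist p.2 p.1 < L * (1 / 2) ^ k}.indicator 1 (b, z) ∂ν := by
      ext b
      rw [← Measure.restrict_apply Metric.isOpen_ball.measurableSet,
        ← lintegral_indicator_one Metric.isOpen_ball.measurableSet]
      rfl
    have : Measurable fun b => ν (Metric.ball b (L * (1 / 2) ^ k) ∩ G k) := by
      rw [e]
      refine Measurable.lintegral_prod_right' (f := fun p : Plane × Plane =>
        {p : Plane × Plane | dist p.2 p.1 < L * (1 / 2) ^ k}.indicator 1 p) ?_
      exact measurable_one.indicator
        (isOpen_lt (continuous_snd.dist continuous_fst) continuous_const).measurableSet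
    exact this.const_mul _
  -- With this `M`, no point has depth more than `ρ 2⁻ʲ` and also distance less than `L 2⁻ᵏ` to the
  -- boundary if `k ≥ j + M`. So each point is counted at no more than `M` scales.
  obtain ⟨M, hM⟩ := pow_unbounded_of_one_lt (L / ρ) (one_lt_two : (1 : ℝ) < 2)
  classical
  set S : ℕ → Plane → Prop := fun k z =>
    z ∈ G k ∩ Metric.thickening (L * (1 / 2) ^ k) (frontier Ω) with hS
  have hSm k : MeasurableSet {z | S k z} := (hG k).inter Metric.isOpen_thickening.measurableSet
  -- After Fubini, the length of the boundary within `L 2⁻ᵏ` of `z` is at most `C L 2⁻ᵏ`, which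
  -- cancels the weight `2ᵏ`.
  have h1 k : ∫⁻ b, f k b ∂m ≤ ∫⁻ z, C * ENNReal.ofReal L * (if S k z then 1 else 0) ∂ν := by
    rw [hf, lintegral_const_mul' _ _ ENNReal.ofReal_ne_top,
      lintegral_measure_ball_inter (hG k), ← lintegral_const_mul' _ _ ENNReal.ofReal_ne_top,
      ← lintegral_indicator (hG k)]
    refine lintegral_mono fun z => ?_
    by_cases hz : z ∈ G k
    · rw [indicator_of_mem hz]
      by_cases hz' : z ∈ Metric.thickening (L * (1 / 2) ^ k) (frontier Ω)
      · rw [if_pos (show S k z from ⟨hz, hz'⟩), mul_one]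
        have : m (Metric.ball z (L * (1 / 2) ^ k)) ≤ C * ENNReal.ofReal (L * (1 / 2) ^ k) := by
          rw [hm, Measure.restrict_apply Metric.isOpen_ball.measurableSet, inter_comm]
          exact (measure_mono (inter_subset_inter_right _ Metric.ball_subset_closedBall)).trans
            (hC z _)
        calc _ ≤ ENNReal.ofReal (((1 / 2) ^ k)⁻¹) * (C * ENNReal.ofReal (L * (1 / 2) ^ k)) := by
              gcongr
          _ = C * (ENNReal.ofReal (((1 / 2) ^ k)⁻¹) * ENNReal.ofReal (L * (1 / 2) ^ k)) := by ring
          _ = _ := by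
            rw [← ENNReal.ofReal_mul (by positivity)]
            congr 2
            field_simp
      · have : Metric.ball z (L * (1 / 2) ^ k) ∩ frontier Ω = ∅ := by
          rw [eq_empty_iff_forall_notMem]
          rintro y ⟨hy, hy'⟩
          exact hz' (Metric.mem_thickening_iff.2 ⟨y, hy', by rw [dist_comm]; exact hy⟩)
        rw [hm, Measure.restrict_apply Metric.isOpen_ball.measurableSet, this]
        simp
    · rw [indicator_of_notMem hz]
      exact zero_le
  have h2 : ∫⁻ b, ∑' k, f k b ∂m ≠ ⊤ := by
    rw [lintegral_tsum fun k => (hfm k).aemeasurable]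
    refine ne_top_of_le_ne_top ?_ (ENNReal.tsum_le_tsum h1)
    rw [← lintegral_tsum fun k => by
      refine (Measurable.const_mul ?_ _).aemeasurable
      exact Measurable.ite (hSm k) measurable_const measurable_const]
    refine ne_top_of_le_ne_top ?_ (lintegral_mono (g := fun _ => C * ENNReal.ofReal L * M)
      fun z => ?_)
    · rw [lintegral_const]
      exact ENNReal.mul_ne_top (ENNReal.mul_ne_top (ENNReal.mul_ne_top ENNReal.coe_ne_top
        ENNReal.ofReal_ne_top) (ENNReal.natCast_ne_top M)) (measure_ne_top _ _)
    · beta_reduce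
      rw [ENNReal.tsum_mul_left]
      gcongr
      refine tsum_indicator_le (S := fun k => S k z) fun j k hj hk => ?_
      by_contra! hjk
      obtain ⟨i, rfl⟩ := Nat.exists_eq_add_of_le hjk
      obtain ⟨b, hbF, hzb⟩ := Metric.mem_thickening_iff.1 hk.2
      have hbΩ : b ∉ Ω := fun h => by
        rw [frontier, hΩ.interior_eq] at hbF
        exact hbF.2 h
      have hj' : ¬ dist b z ≤ ρ * (1 / 2) ^ j := fun h => hbΩ (interior_subset hj.1 h)
      rw [dist_comm, not_le] at hj'
      have h3 : ρ * (1 / 2) ^ j < L * (1 / 2) ^ (j + M + i) := hj'.trans hzb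
      have h4 : L * (1 / 2 : ℝ) ^ (j + M + i) ≤ L * (1 / 2) ^ (j + M) := by
        gcongr ?_ * ?_
        exact pow_le_pow_of_le_one (by norm_num) (by norm_num) (by omega)
      have h5 : L * (1 / 2 : ℝ) ^ (j + M) < ρ * (1 / 2) ^ j := by
        rw [div_lt_iff₀ hρ] at hM
        rw [pow_add, mul_left_comm, mul_comm ρ]
        have : (0 : ℝ) < (1 / 2) ^ j := by positivity
        gcongr
        rw [one_div, inv_pow, ← div_eq_mul_inv, div_lt_iff₀ (by positivity)]
        linarith
      linarith
  exact (ae_lt_top' (Measurable.tsum hfm).aemeasurable h2).mono fun b h => h.ne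

/-! ### Characterization and uniqueness of the trace -/

theorem lintegral_enorm_sub_eq_average {Ω : Set Plane} {v : Plane → ℝ}
    (hv : IntegrableOn v Ω) (b : Plane) (r z : ℝ) :
    ∫⁻ y in Metric.ball b r ∩ Ω, ‖v y - z‖ₑ
      = ENNReal.ofReal (⨍ y in Metric.ball b r ∩ Ω, |v y - z|)
        * volume (Metric.ball b r ∩ Ω) := by
  have hfin : volume (Metric.ball b r ∩ Ω) ≠ (⊤ : ℝ≥0∞) :=
    ne_top_of_le_ne_top measure_ball_lt_top.ne (measure_mono inter_subset_left)
  have hi : IntegrableOn (fun y => v y - z) (Metric.ball b r ∩ Ω) :=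
    (hv.mono_set inter_subset_right).sub (integrableOn_const (C := z) hfin)
  rw [← ofReal_integral_norm_eq_lintegral_enorm hi, setAverage_eq, smul_eq_mul]
  by_cases h0 : volume (Metric.ball b r ∩ Ω) = 0
  · rw [h0, mul_zero, Measure.restrict_eq_zero.2 h0]
    simp
  · rw [← ofReal_measureReal hfin, ← ENNReal.ofReal_mul
      (mul_nonneg (by positivity) (integral_nonneg fun _ => abs_nonneg _))]
    congr 1
    have : volume.real (Metric.ball b r ∩ Ω) ≠ 0 := (measureReal_ne_zero_iff hfin).2 h0
    simp_rw [Real.norm_eq_abs]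
    field_simp

theorem measure_ball_inter_pos {Ω : Set Plane} (hΩ : IsOpen Ω) {b : Plane} (hb : b ∈ closure Ω)
    {r : ℝ} (hr : 0 < r) : 0 < volume (Metric.ball b r ∩ Ω) := by
  refine (Metric.isOpen_ball.inter hΩ).measure_pos _ ?_
  obtain ⟨y, hy, hyb⟩ := Metric.mem_closure_iff.1 hb r hr
  exact ⟨y, by rw [Metric.mem_ball, dist_comm]; exact hyb, hy⟩

/-- Frees the definition of the trace from division: at points of the closure the measure of `B_r ∩
Ω` is positive, so the averages may be handled as integrals in `[0, ∞]`. -/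
theorem isTraceAt_iff {Ω : Set Plane} (hΩ : IsOpen Ω) {v : Plane → ℝ}
    (hv : IntegrableOn v Ω) {b : Plane} (hb : b ∈ closure Ω) {z : ℝ} :
    IsTraceAt Ω v b z ↔ ∀ ε > 0, ∀ᶠ r in 𝓝[>] (0 : ℝ),
      ∫⁻ y in Metric.ball b r ∩ Ω, ‖v y - z‖ₑ
        ≤ ENNReal.ofReal ε * volume (Metric.ball b r ∩ Ω) := by
  have hnn (r : ℝ) : 0 ≤ ⨍ y in Metric.ball b r ∩ Ω, |v y - z| := by
    rw [setAverage_eq]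
    exact smul_nonneg (by positivity) (integral_nonneg fun _ => abs_nonneg _)
  have key (ε : ℝ) (hε : 0 < ε) (r : ℝ) (hr : 0 < r) :
      (∫⁻ y in Metric.ball b r ∩ Ω, ‖v y - z‖ₑ
        ≤ ENNReal.ofReal ε * volume (Metric.ball b r ∩ Ω))
        ↔ (⨍ y in Metric.ball b r ∩ Ω, |v y - z|) ≤ ε := by
    rw [lintegral_enorm_sub_eq_average hv, ENNReal.mul_le_mul_iff_left
      (measure_ball_inter_pos hΩ hb hr).ne'
      (ne_top_of_le_ne_top measure_ball_lt_top.ne (measure_mono inter_subset_left)),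
      ENNReal.ofReal_le_ofReal_iff hε.le]
  constructor
  · intro h ε hε
    filter_upwards [h.eventually (ge_mem_nhds hε), self_mem_nhdsWithin] with r hr hr0
    exact (key ε hε r hr0).2 hr
  · intro h
    refine (tendsto_order.2 ⟨fun a ha => Eventually.of_forall fun r => ha.trans_le (hnn r),
      fun a ha => ?_⟩)
    filter_upwards [h (a / 2) (by positivity), self_mem_nhdsWithin] with r hr hr0
    linarith [(key (a / 2) (by positivity) r hr0).1 hr]

theorem IsTraceAt.unique {Ω : Set Plane} (hΩ : IsOpen Ω) {v : Plane → ℝ}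
    (hv : IntegrableOn v Ω) {b : Plane} (hb : b ∈ closure Ω) {z z' : ℝ}
    (h : IsTraceAt Ω v b z) (h' : IsTraceAt Ω v b z') : z = z' := by
  by_contra hne
  have hd : 0 < |z - z'| := abs_pos.2 (sub_ne_zero.2 hne)
  have h1 := (isTraceAt_iff hΩ hv hb).1 h (|z - z'| / 4) (by positivity)
  have h2 := (isTraceAt_iff hΩ hv hb).1 h' (|z - z'| / 4) (by positivity)
  obtain ⟨r, ⟨h1, h2⟩, hr⟩ := ((h1.and h2).and self_mem_nhdsWithin).exists
  have hpos := measure_ball_inter_pos hΩ hb hr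
  have hfin : volume (Metric.ball b r ∩ Ω) ≠ (⊤ : ℝ≥0∞) :=
    ne_top_of_le_ne_top measure_ball_lt_top.ne (measure_mono inter_subset_left)
  have h3 : ‖z - z'‖ₑ * volume (Metric.ball b r ∩ Ω)
      ≤ (∫⁻ y in Metric.ball b r ∩ Ω, ‖v y - z‖ₑ)
        + ∫⁻ y in Metric.ball b r ∩ Ω, ‖v y - z'‖ₑ := by
    rw [← setLIntegral_const, ← lintegral_add_left']
    · refine lintegral_mono fun y => ?_
      have : z - z' = (v y - z') - (v y - z) := by ring
      rw [this, add_comm]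
      exact enorm_sub_le
    · exact ((hv.mono_set inter_subset_right).aestronglyMeasurable.aemeasurable.sub_const z).enorm
  have h4 := h3.trans (add_le_add h1 h2)
  rw [← add_mul, ENNReal.mul_le_mul_iff_left hpos.ne' hfin, ← ENNReal.ofReal_add (by positivity)
    (by positivity), Real.enorm_eq_ofReal_abs, ENNReal.ofReal_le_ofReal_iff (by positivity)] at h4
  linarith

theorem IsTraceAt.trace_eq {Ω : Set Plane} (hΩ : IsOpen Ω) {v : Plane → ℝ}
    (hv : IntegrableOn v Ω) {b : Plane} (hb : b ∈ closure Ω) {z : ℝ}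
    (h : IsTraceAt Ω v b z) : trace Ω v b = z := by
  have hex : ∃ z, IsTraceAt Ω v b z := ⟨z, h⟩
  rw [trace, dif_pos hex]
  exact hex.choose_spec.unique hΩ hv hb h

/-- The averages over balls `N k`, which approach `b` inside a cone at dyadic scales, form a Cauchy
sequence. By Poincaré, consecutive ones differ by a multiple of `2ᵏ |Dv|(D k)`, and these numbers
are summable for almost every `b`. The limit is the trace, because at almost every `b` the variation
in `B_s(b) ∩ Ω` is `o(s)`, and Poincaré then bounds the mean deviation from the average over `N k`.
-/
theorem ae_exists_isTraceAt_of_measurable {Ω : Set Plane} (hΩ : IsOpen Ω) (hc : Convex ℝ Ω)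
    (hne : Ω.Nonempty) (hbd : Bornology.IsBounded Ω) {v : Plane → ℝ} (hvm : Measurable v)
    (hvi : Integrable v) {μ : VectorMeasure Plane Plane} (hμ : IsDistribGradient Ω v μ) :
    ∀ᵐ b ∂((μH[1] : Measure Plane).restrict (frontier Ω)), ∃ z, IsTraceAt Ω v b z := by
  obtain ⟨x₀, hx₀⟩ := hne
  obtain ⟨ρ, hρ, hball⟩ : ∃ ρ > 0, Metric.ball x₀ (2 * ρ) ⊆ Ω := by
    obtain ⟨δ, hδ, h⟩ := Metric.isOpen_iff.1 hΩ x₀ hx₀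
    exact ⟨δ / 2, by positivity, by rwa [mul_div_cancel₀ _ two_ne_zero]⟩
  obtain ⟨R, hR0, hR⟩ : ∃ R : ℝ, 0 < R ∧ closure Ω ⊆ Metric.closedBall x₀ R := by
    obtain ⟨R, hR⟩ := hbd.closure.subset_closedBall x₀
    exact ⟨max R 1, by positivity, hR.trans (Metric.closedBall_subset_closedBall (le_max_left _ _))⟩
  set L : ℝ := R + ρ with hLdef
  have hL : 0 < L := by positivity
  set ν := μ.variation with hν
  have hΩm := hΩ.measurableSet
  filter_upwards [ae_tsum_variation_ne_top hΩ hc ⟨x₀, hx₀⟩ hbd (ν := ν)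
      (ρ := ρ / 2) (L := L) (by positivity) hL,
    ae_tendsto_density_zero hΩ hc ⟨x₀, hx₀⟩ hbd (ν := ν) (variation_compl_eq_zero hΩm hμ),
    ae_restrict_mem isClosed_frontier.measurableSet] with b hsum hdens hbF
  have hbc : b ∈ closure Ω := frontier_subset_closure hbF
  set r : ℕ → ℝ := fun k => (1 / 2) ^ k with hr
  have hr0 k : 0 < r k := by positivity
  have hr1 k : r k ≤ 1 := pow_le_one₀ (by norm_num) (by norm_num)
  have hrs k : r (k + 1) = r k / 2 := by rw [hr]; simp only [pow_succ]; ring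
  -- The centres lie on the segment from `b` to `x₀`. The set `D k` contains both `N k` and `N (k +
  -- 1)`, is convex, and consists of points whose depth in `Ω` is comparable to the scale, as the
  -- summability statement demands.
  set N : ℕ → Set Plane := fun k => Metric.ball (b + r k • (x₀ - b)) (ρ * r k) with hN
  set D : ℕ → Set Plane := fun k => Metric.ball b (L * r k)
    ∩ interior {z | Metric.closedBall z (ρ / 2 * r k) ⊆ Ω} with hD
  have hNΩ k : Metric.ball (b + r k • (x₀ - b)) (2 * ρ * r k) ⊆ Ω :=
    ball_combo_subset hΩ hc hball hbc (hr0 k) (hr1 k)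
  have hNb k : N k ⊆ Metric.ball b (L * r k) := by
    refine Metric.ball_subset_ball' ?_
    rw [dist_eq_norm, add_sub_cancel_left, norm_smul, Real.norm_of_nonneg (hr0 k).le]
    have : ‖x₀ - b‖ ≤ R := by
      have := hR hbc
      rwa [Metric.mem_closedBall, dist_comm, dist_eq_norm] at this
    nlinarith [mul_le_mul_of_nonneg_left this (hr0 k).le]
  have hNN k : N k ⊆ Ω := (Metric.ball_subset_ball (by nlinarith [mul_pos hρ (hr0 k)])).trans (hNΩ k)
  have hNi k (δ : ℝ) (hδ : δ ≤ ρ * r k) : N k ⊆ interior {z | Metric.closedBall z δ ⊆ Ω} := by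
    refine interior_maximal (fun y hy => ?_) Metric.isOpen_ball
    refine Subset.trans (fun w hw => ?_) (hNΩ k)
    rw [Metric.mem_ball] at hy ⊢
    rw [Metric.mem_closedBall] at hw
    linarith [dist_triangle w y (b + r k • (x₀ - b))]
  have hND k : N k ⊆ D k := subset_inter (hNb k) (hNi k _ (by nlinarith [mul_pos hρ (hr0 k)]))
  have hND' k : N (k + 1) ⊆ D k := by
    refine subset_inter ((hNb _).trans (Metric.ball_subset_ball ?_)) (hNi _ _ ?_)
    · rw [hrs]; nlinarith [mul_pos hL (hr0 k)]
    · rw [hrs]; linarith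
  have hDo k : IsOpen (D k) := Metric.isOpen_ball.inter isOpen_interior
  have hDc k : Convex ℝ (D k) :=
    (convex_ball _ _).inter (convex_setOf_closedBall_subset hc _).interior
  have hDΩ k : D k ⊆ Ω := fun y hy =>
    interior_subset hy.2 (Metric.mem_closedBall_self (by positivity))
  have hdiam {s : ℝ} : ∀ x ∈ Metric.ball b s, ∀ y ∈ Metric.ball b s, ‖x - y‖ ≤ 2 * s := by
    intro x hx y hy
    rw [Metric.mem_ball] at hx hy
    rw [← dist_eq_norm]
    linarith [dist_triangle_right x y b]
  have hNv k : volume (N k) = ENNReal.ofReal (Real.pi * (ρ * r k) ^ 2) :=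
    volume_ball_plane _ (by positivity)
  have hNt k : volume (N k) ≠ (⊤ : ℝ≥0∞) := by rw [hNv]; exact ENNReal.ofReal_ne_top
  have hNp k : 0 < Real.pi * (ρ * r k) ^ 2 := by positivity
  set a : ℕ → ℝ := fun k => ⨍ y in N k, v y with ha
  have hstep k : edist (a k) (a (k + 1))
      ≤ ENNReal.ofReal (32 * L ^ 3 / (Real.pi * ρ ^ 4)) * (ENNReal.ofReal (r k)⁻¹ * ν (D k)) := by
    have h1 := lintegral_sub_average_mul_le hΩm hvm hvi hμ (hND k) (hND' k) (hDo k) (hDc k)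
      (hDΩ k) (d := 2 * (L * r k)) (by positivity) (fun x hx y hy => hdiam x hx.1 y hy.1)
      (hNt (k + 1)) (hNp (k + 1)) (hNv _).ge
    have h2 := enorm_average_sub_mul_le hvi (hNt k) (a (k + 1))
    rw [hNv] at h2
    have h3 := le_ofReal_div_mul_of_mul_ofReal_le (hNp k) (h2.trans h1)
    rw [edist_eq_enorm_sub, ← mul_assoc, ← ENNReal.ofReal_mul (by positivity)]
    refine h3.trans (le_of_eq ?_)
    congr 2
    rw [hrs]
    have := hr0 k
    field_simp
    ring
  have hcauchy : CauchySeq a := by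
    refine cauchySeq_of_edist_le_of_tsum_ne_top _ hstep ?_
    rw [show (tsum fun k => _) = _ from ENNReal.tsum_mul_left]
    exact ENNReal.mul_ne_top ENNReal.ofReal_ne_top hsum
  obtain ⟨z, hz⟩ := cauchySeq_tendsto_of_complete hcauchy
  refine ⟨z, (isTraceAt_iff hΩ hvi.integrableOn hbc).2 fun ε hε => ?_⟩
  -- `K` is chosen so that the density threshold `ε / (2 K)` turns the Poincaré bound at scale `r k`
  -- into `ε / 2` times the area of `N (k + 1)`.
  set K : ℝ := 32 * L ^ 4 / (Real.pi * ρ ^ 4) with hK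
  have hK0 : 0 < K := by positivity
  have hrt : Tendsto (fun k => L * r k) atTop (𝓝[>] 0) := by
    refine tendsto_nhdsWithin_iff.2 ⟨?_, Eventually.of_forall fun k => ?_⟩
    · have := (tendsto_pow_atTop_nhds_zero_of_lt_one (r := (1 / 2 : ℝ)) (by norm_num)
        (by norm_num)).const_mul L
      rwa [mul_zero] at this
    · exact mul_pos hL (hr0 k)
  have hd' := ENNReal.tendsto_nhds_zero.1 (hdens.comp hrt) (ENNReal.ofReal (ε / (2 * K)))
    (by simpa using by positivity)
  have hz' := Metric.tendsto_atTop.1 hz (ε / 2) (by positivity)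
  obtain ⟨k₁, hk₁⟩ := eventually_atTop.1 hd'
  obtain ⟨k₂, hk₂⟩ := hz'
  set k₀ := max k₁ k₂
  have hev : Ioo (0 : ℝ) (L * r k₀) ∈ 𝓝[>] (0 : ℝ) := Ioo_mem_nhdsGT (mul_pos hL (hr0 _))
  filter_upwards [hev] with s hs
  -- The radius `s` is placed between consecutive dyadic scales, so `B_s ∩ Ω` lies in the Poincaré
  -- domain of scale `k` and contains `N (k + 1)`.
  obtain ⟨k, hk1, hk2⟩ := exists_nat_pow_near_of_lt_one (x := s / L) (y := (1 / 2 : ℝ))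
    (div_pos hs.1 hL) ((div_le_one hL).2 (hs.2.le.trans (by nlinarith [hr1 k₀]))) (by norm_num)
    (by norm_num)
  change r (k + 1) < s / L at hk1
  change s / L ≤ r k at hk2
  rw [lt_div_iff₀ hL] at hk1
  rw [div_le_iff₀ hL] at hk2
  have hkk : k₀ ≤ k := by
    by_contra! h
    have : r k₀ ≤ r (k + 1) := pow_le_pow_of_le_one (by norm_num) (by norm_num) h
    nlinarith [hs.2]
  set A := Metric.ball b s ∩ Ω with hA
  have hAt : volume A ≠ (⊤ : ℝ≥0∞) :=
    ne_top_of_le_ne_top measure_ball_lt_top.ne (measure_mono inter_subset_left)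
  set D' := Metric.ball b (L * r k) ∩ Ω with hD'
  have h1 := lintegral_sub_average_mul_le hΩm hvm hvi hμ (A := A) (B := N k) (D := D')
    (inter_subset_inter_left _ (Metric.ball_subset_ball (by linarith)))
    (subset_inter (hNb k) (hNN k)) (Metric.isOpen_ball.inter hΩ) ((convex_ball _ _).inter hc)
    inter_subset_right (d := 2 * (L * r k)) (by positivity) (fun x hx y hy => hdiam x hx.1 y hy.1)
    (hNt k) (hNp k) (hNv k).ge
  have h2 : ν D' ≤ ENNReal.ofReal (ε / (2 * K)) * ENNReal.ofReal (L * r k) := by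
    have := hk₁ k ((le_max_left _ _).trans hkk)
    rw [Function.comp_apply, ENNReal.div_le_iff (by simpa using mul_pos hL (hr0 k))
      ENNReal.ofReal_ne_top] at this
    exact (measure_mono (inter_subset_left.trans Metric.ball_subset_closedBall)).trans this
  have h3 : ENNReal.ofReal (Real.pi * (ρ * r (k + 1)) ^ 2) ≤ volume A := by
    rw [← hNv]
    exact measure_mono (subset_inter ((hNb _).trans (Metric.ball_subset_ball (by linarith))) (hNN _))
  have h4 : ∫⁻ y in A, ‖v y - a k‖ₑ ≤ ENNReal.ofReal (ε / 2) * volume A := by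
    calc _ ≤ _ := h1
      _ ≤ ENNReal.ofReal (Real.pi * (2 * (L * r k)) ^ 3 / (Real.pi * (ρ * r k) ^ 2))
          * (ENNReal.ofReal (ε / (2 * K)) * ENNReal.ofReal (L * r k)) := by gcongr
      _ = ENNReal.ofReal (ε / 2) * ENNReal.ofReal (Real.pi * (ρ * r (k + 1)) ^ 2) := by
        have := hr0 k
        rw [← ENNReal.ofReal_mul (by positivity), ← ENNReal.ofReal_mul (by positivity),
          ← ENNReal.ofReal_mul (by positivity), hrs, hK]
        congr 1
        field_simp
        ring
      _ ≤ _ := by gcongr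
  calc ∫⁻ y in A, ‖v y - z‖ₑ ≤ ∫⁻ y in A, (‖v y - a k‖ₑ + ‖a k - z‖ₑ) := by
        refine lintegral_mono fun y => ?_
        have : v y - z = (v y - a k) + (a k - z) := by ring
        rw [this]
        exact enorm_add_le _ _
    _ = (∫⁻ y in A, ‖v y - a k‖ₑ) + ‖a k - z‖ₑ * volume A := by
        rw [lintegral_add_right _ measurable_const, setLIntegral_const]
    _ ≤ ENNReal.ofReal (ε / 2) * volume A + ENNReal.ofReal (ε / 2) * volume A := by
        gcongr
        rw [Real.enorm_eq_ofReal_abs]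
        refine ENNReal.ofReal_le_ofReal ?_
        have := hk₂ k ((le_max_right _ _).trans hkk)
        rw [Real.dist_eq] at this
        exact this.le
    _ = _ := by
        rw [← add_mul, ← ENNReal.ofReal_add (by positivity) (by positivity), add_halves]

/-- A function of bounded variation has a trace at almost every boundary point. -/
theorem MemBV.ae_isTraceAt {Ω : Set Plane} (hΩ : IsOpen Ω) (hc : Convex ℝ Ω)
    (hbd : Bornology.IsBounded Ω) {ψ : Plane → ℝ} (hψ : MemBV Ω ψ) :
    ∀ᵐ b ∂((μH[1] : Measure Plane).restrict (frontier Ω)), IsTraceAt Ω ψ b (trace Ω ψ b) := by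
  rcases Ω.eq_empty_or_nonempty with rfl | hne
  · simp
  obtain ⟨v, hvm, hvi, hv⟩ := exists_measurable_rep hΩ.measurableSet hψ.1
  obtain ⟨μ, hμ⟩ := hψ.2
  rw [isDistribGradient_congr hv] at hμ
  filter_upwards [ae_exists_isTraceAt_of_measurable hΩ hc hne hbd hvm hvi hμ] with b hb
  rw [← isTraceAt_congr hv] at hb
  rw [trace, dif_pos hb]
  exact hb.choose_spec

/-! ### The boundary trace inequality near a flat piece of the boundary -/

theorem measurePreserving_turn {u : Plane} (hu : ‖u‖ = 1) :
    MeasurePreserving (fun p : ℝ × ℝ => p.1 • turn u - p.2 • u) := by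
  let f : Plane →ₗ[ℝ] Plane :=
    { toFun := fun x => x 0 • turn u - x 1 • u
      map_add' := fun x y => by simp only [PiLp.add_apply]; module
      map_smul' := fun a x => by
        simp only [PiLp.smul_apply, smul_eq_mul, RingHom.id_apply]; module }
  have hf (x : Plane) : ‖f x‖ = ‖x‖ := by
    have h1 : u 0 ^ 2 + u 1 ^ 2 = 1 := by rw [← norm_sq_plane, hu]; norm_num
    have h2 : ‖f x‖ ^ 2 = ‖x‖ ^ 2 := by
      rw [norm_sq_plane, norm_sq_plane]
      change (x 0 * (-u 1) - x 1 * u 0) ^ 2 + (x 0 * u 0 - x 1 * u 1) ^ 2 = _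
      linear_combination (x 0 ^ 2 + x 1 ^ 2) * h1
    exact (pow_left_inj₀ (norm_nonneg _) (norm_nonneg _) two_ne_zero).1 h2
  let F : Plane →ₗᵢ[ℝ] Plane := ⟨f, hf⟩
  exact ((F.toLinearIsometryEquiv rfl).measurePreserving.comp
    (PiLp.volume_preserving_toLp (Fin 2))).comp
    ((volume_preserving_finTwoArrow ℝ).symm MeasurableEquiv.finTwoArrow)

/-- Fubini inequality in the directions along and across a flat piece of the boundary. -/
theorem lintegral_lintegral_sub_smul_le {u : Plane} (hu : ‖u‖ = 1) {m : Measure Plane} {c : ℝ≥0∞}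
    (hm : m.map (fun x => inner ℝ (turn u) x) ≤ c • volume) {g : Plane → ℝ≥0∞}
    (hg : Measurable g) :
    ∫⁻ b, (∫⁻ s : ℝ, g (b - s • u)) ∂m ≤ c * ∫⁻ x, g x := by
  set G : ℝ → ℝ≥0∞ := fun p => ∫⁻ s : ℝ, g (p • turn u - s • u) with hG
  have hg2 : Measurable fun p : ℝ × ℝ => g (p.1 • turn u - p.2 • u) :=
    hg.comp (measurePreserving_turn hu).measurable
  have hGm : Measurable G := hg2.lintegral_prod_right'
  -- An integral over the whole line in direction `u` depends only on the tangential coordinate of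
  -- `b`, and the image of `m` under this coordinate is controlled by `hm`.
  have h1 (b : Plane) : ∫⁻ s : ℝ, g (b - s • u) = G (inner ℝ (turn u) b) := by
    rw [hG]
    beta_reduce
    rw [← lintegral_add_right_eq_self _ (inner ℝ u b : ℝ)]
    refine lintegral_congr fun s => ?_
    congr 1
    have hb := decompose_turn hu b
    generalize (inner ℝ u b : ℝ) = α at hb ⊢
    generalize (inner ℝ (turn u) b : ℝ) = β at hb ⊢
    rw [hb]
    module
  simp_rw [h1]
  have hP : Measurable fun x : Plane => (inner ℝ (turn u) x : ℝ) :=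
    (continuous_const.inner continuous_id).measurable
  rw [← lintegral_map hGm hP]
  calc _ ≤ ∫⁻ p, G p ∂(c • volume) := lintegral_mono' hm le_rfl
    _ = c * ∫⁻ p, G p := lintegral_smul_measure _ _
    _ = c * ∫⁻ x, g x := by
      rw [hG, ← (measurePreserving_turn hu).lintegral_comp hg, Measure.volume_eq_prod,
        lintegral_prod _ hg2.aemeasurable]

theorem map_hausdorffMeasure_flat_le {u : Plane} (hu : ‖u‖ = 1) {ε : ℝ} (hε1 : ε < 1)
    (hε0 : 0 ≤ ε) {Ω K : Set Plane} (hK : K ⊆ flatPart Ω u ε) :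
    ((μH[1] : Measure Plane).restrict K).map (fun x => inner ℝ (turn u) x)
      ≤ ENNReal.ofReal (Real.sqrt (1 - ε ^ 2))⁻¹ • volume := by
  have hP : Measurable fun x : Plane => (inner ℝ (turn u) x : ℝ) :=
    (continuous_const.inner continuous_id).measurable
  refine Measure.le_iff.2 fun T hT => ?_
  rw [Measure.map_apply hP hT, Measure.restrict_apply (hP hT), inter_comm]
  exact hausdorffMeasure_flat_le hu hε1 hε0
    (fun b hb b' hb' => abs_inner_sub_le_of_mem_flatPart (hK hb) (hK hb')) T

/-- Moving the weight inward by `σ` costs at most the variation that it sweeps. The sweep is taken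
over the full interval up to `h`, so that the bound is uniform in `σ` and can be averaged. -/
theorem lintegral_weighted_le_translate {Ω : Set Plane} (hΩ : MeasurableSet Ω) {v : Plane → ℝ}
    (hvm : Measurable v) (hvi : Integrable v) {μ : VectorMeasure Plane Plane}
    (hμ : IsDistribGradient Ω v μ) {ρ : Plane → ℝ} (hρ : ContDiff ℝ ∞ ρ)
    (hρc : HasCompactSupport ρ) (hρ0 : ∀ x, 0 ≤ ρ x) {e : Plane} (he : ‖e‖ = 1) {h : ℝ}
    (hsupp : ∀ x ∈ tsupport ρ, ∀ t ∈ Icc (0 : ℝ) h, x + t • e ∈ Ω) {σ : ℝ} (hσ : σ ∈ Icc 0 h) :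
    ∫⁻ x, ‖v x‖ₑ * ENNReal.ofReal (ρ x)
      ≤ (∫⁻ x, ‖v x‖ₑ * ENNReal.ofReal (ρ (x - σ • e)))
        + ∫⁻ t in Ioc 0 h, ∫⁻ x, ENNReal.ofReal (ρ (x - t • e)) ∂μ.variation := by
  obtain ⟨B, hB⟩ := hρ.continuous.bounded_above_of_compact_support hρc
  set f : ℝ → ℝ := fun t => ∫ x, ρ (x - t • e) ∂μ.variation with hf
  have hfi (t : ℝ) : Integrable (fun x => ρ (x - t • e)) μ.variation :=
    Integrable.of_bound (hρ.continuous.comp (by fun_prop)).aestronglyMeasurable B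
      (Eventually.of_forall fun x => hB _)
  have hf0 (t : ℝ) : 0 ≤ f t := integral_nonneg fun x => hρ0 _
  have hfc : Continuous f := by
    refine continuous_of_dominated (bound := fun _ => B) (fun t => (hfi t).aestronglyMeasurable)
      (fun t => Eventually.of_forall fun x => hB _) (integrable_const _)
      (Eventually.of_forall fun x => ?_)
    exact hρ.continuous.comp (by fun_prop)
  have key := integral_translate_sub_le hΩ hvi hμ hρ hρc hρ0 (σ • e) fun x hx s hs => by
    rw [smul_smul]
    exact hsupp x hx _ ⟨mul_nonneg hs.1 hσ.1, by nlinarith [hs.1, hs.2, hσ.1, hσ.2]⟩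
  have hkey : ∫ z, |v (z + σ • e) - v z| * ρ z ≤ ∫ t in (0 : ℝ)..h, f t := by
    refine key.trans ?_
    have e1 := intervalIntegral.smul_integral_comp_mul_left (a := 0) (b := 1) f σ
    rw [mul_zero, mul_one] at e1
    rw [norm_smul, he, mul_one, Real.norm_of_nonneg hσ.1]
    have e2 : ∀ s : ℝ, s • σ • e = (σ * s) • e := fun s => by rw [smul_smul, mul_comm]
    simp_rw [e2]
    rw [smul_eq_mul] at e1
    change σ * ∫ s in (0 : ℝ)..1, f (σ * s) ≤ _
    rw [e1]
    refine intervalIntegral.integral_mono_interval le_rfl hσ.1 hσ.2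
      (Eventually.of_forall hf0) (hfc.intervalIntegrable _ _)
  have h1 : ∫⁻ z, ‖v (z + σ • e) - v z‖ₑ * ENNReal.ofReal (ρ z)
      ≤ ∫⁻ t in Ioc 0 h, ∫⁻ x, ENNReal.ofReal (ρ (x - t • e)) ∂μ.variation := by
    have hi : Integrable fun z => |v (z + σ • e) - v z| * ρ z :=
      (((hvi.comp_add_right _).sub hvi).abs.mul_bdd (c := B) hρ.continuous.aestronglyMeasurable
        (Eventually.of_forall hB))
    calc _ = ∫⁻ z, ENNReal.ofReal (|v (z + σ • e) - v z| * ρ z) := by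
          refine lintegral_congr fun z => ?_
          rw [ENNReal.ofReal_mul (abs_nonneg _), Real.enorm_eq_ofReal_abs]
      _ = ENNReal.ofReal (∫ z, |v (z + σ • e) - v z| * ρ z) :=
          (ofReal_integral_eq_lintegral_ofReal hi
            (Eventually.of_forall fun z => mul_nonneg (abs_nonneg _) (hρ0 z))).symm
      _ ≤ ENNReal.ofReal (∫ t in (0 : ℝ)..h, f t) := ENNReal.ofReal_le_ofReal hkey
      _ = ∫⁻ t in Ioc 0 h, ENNReal.ofReal (f t) := by
          rw [intervalIntegral.integral_of_le (hσ.1.trans hσ.2),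
            ofReal_integral_eq_lintegral_ofReal
              (hfc.integrableOn_Icc.mono_set Ioc_subset_Icc_self) (Eventually.of_forall hf0)]
      _ = _ := by
          refine lintegral_congr fun t => ?_
          exact ofReal_integral_eq_lintegral_ofReal (hfi t) (Eventually.of_forall fun x => hρ0 _)
  have h2 : ∫⁻ x, ‖v (x + σ • e)‖ₑ * ENNReal.ofReal (ρ x)
      = ∫⁻ x, ‖v x‖ₑ * ENNReal.ofReal (ρ (x - σ • e)) := by
    rw [← lintegral_add_right_eq_self (fun x => ‖v x‖ₑ * ENNReal.ofReal (ρ (x - σ • e))) (σ • e)]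
    simp
  have hρm : Measurable fun x => ENNReal.ofReal (ρ x) := hρ.continuous.measurable.ennreal_ofReal
  calc ∫⁻ x, ‖v x‖ₑ * ENNReal.ofReal (ρ x)
      ≤ ∫⁻ x, (‖v (x + σ • e)‖ₑ * ENNReal.ofReal (ρ x)
        + ‖v (x + σ • e) - v x‖ₑ * ENNReal.ofReal (ρ x)) := by
        refine lintegral_mono fun x => ?_
        rw [← add_mul]
        gcongr
        have : v x = v (x + σ • e) - (v (x + σ • e) - v x) := by ring
        conv_lhs => rw [this]
        exact enorm_sub_le
    _ = (∫⁻ x, ‖v (x + σ • e)‖ₑ * ENNReal.ofReal (ρ x))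
        + ∫⁻ x, ‖v (x + σ • e) - v x‖ₑ * ENNReal.ofReal (ρ x) := by
        refine lintegral_add_left ?_ _
        exact (hvm.comp (measurable_id.add_const _)).enorm.mul hρm
    _ ≤ _ := by rw [h2]; gcongr

/-- The average of the previous estimate over `σ ∈ (0, h]`. Both terms become integrals of the same
translated weights, against the single measure `|v| dx + h |Dv|`. -/
theorem lintegral_weighted_mul_le {Ω : Set Plane} (hΩ : MeasurableSet Ω) {v : Plane → ℝ}
    (hvm : Measurable v) (hvi : Integrable v) {μ : VectorMeasure Plane Plane}
    (hμ : IsDistribGradient Ω v μ) {ρ : Plane → ℝ} (hρ : ContDiff ℝ ∞ ρ)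
    (hρc : HasCompactSupport ρ) (hρ0 : ∀ x, 0 ≤ ρ x) {e : Plane} (he : ‖e‖ = 1) {h : ℝ}
    (hsupp : ∀ x ∈ tsupport ρ, ∀ t ∈ Icc (0 : ℝ) h, x + t • e ∈ Ω) :
    (∫⁻ x, ‖v x‖ₑ * ENNReal.ofReal (ρ x)) * ENNReal.ofReal h
      ≤ ∫⁻ t in Ioc 0 h, ∫⁻ x, ENNReal.ofReal (ρ (x - t • e))
        ∂(volume.withDensity (fun x => ‖v x‖ₑ) + ENNReal.ofReal h • μ.variation) := by
  have hm : Measurable fun p : ℝ × Plane => ENNReal.ofReal (ρ (p.2 - p.1 • e)) :=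
    (hρ.continuous.comp (by fun_prop)).measurable.ennreal_ofReal
  set J := ∫⁻ t in Ioc 0 h, ∫⁻ x, ENNReal.ofReal (ρ (x - t • e)) ∂μ.variation with hJ
  have h1 : (∫⁻ x, ‖v x‖ₑ * ENNReal.ofReal (ρ x)) * ENNReal.ofReal h
      ≤ ∫⁻ t in Ioc 0 h, ((∫⁻ x, ‖v x‖ₑ * ENNReal.ofReal (ρ (x - t • e))) + J) := by
    have : volume (Ioc 0 h) = ENNReal.ofReal h := by simp
    rw [← this, ← setLIntegral_const]
    exact setLIntegral_mono' measurableSet_Ioc fun t ht =>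
      lintegral_weighted_le_translate hΩ hvm hvi hμ hρ hρc hρ0 he hsupp (Ioc_subset_Icc_self ht)
  refine h1.trans (le_of_eq ?_)
  have e1 (t : ℝ) : ∫⁻ x, ENNReal.ofReal (ρ (x - t • e))
        ∂(volume.withDensity (fun x => ‖v x‖ₑ) + ENNReal.ofReal h • μ.variation)
      = (∫⁻ x, ‖v x‖ₑ * ENNReal.ofReal (ρ (x - t • e)))
        + ENNReal.ofReal h * ∫⁻ x, ENNReal.ofReal (ρ (x - t • e)) ∂μ.variation := by
    rw [lintegral_add_measure, lintegral_smul_measure, smul_eq_mul,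
      lintegral_withDensity_eq_lintegral_mul _ hvm.enorm
        (g := fun x => ENNReal.ofReal (ρ (x - t • e))) (hm.comp (measurable_prodMk_left (x := t)))]
    rfl
  simp_rw [e1]
  rw [lintegral_add_right _ measurable_const, lintegral_add_right, setLIntegral_const,
    lintegral_const_mul' _ _ ENNReal.ofReal_ne_top]
  · simp [mul_comm, hJ]
  · exact Measurable.const_mul (hm.lintegral_prod_right') _

/-- After exchanging integrals, for fixed `x` one integrates a bump over the base point `b` and the
depth `t`. Fubini along and across the flat piece bounds this by `c` times the mass of the bump, and
points outside `V` are never reached. -/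
theorem setLIntegral_lintegral_bump_le {u : Plane} (hu : ‖u‖ = 1) {m : Measure Plane} [SFinite m]
    {c : ℝ≥0∞} (hm : m.map (fun x => inner ℝ (turn u) x) ≤ c • volume) {g : Plane → ℝ≥0∞}
    (hg : Measurable g) {ν : Measure Plane} [SFinite ν] {V : Set Plane} (hV : MeasurableSet V)
    (a : Plane) {K : Set Plane} (hmK : m Kᶜ = 0) {h : ℝ}
    (hsupp : ∀ b ∈ K, ∀ t ∈ Ioc 0 h, ∀ x ∉ V, g (x - (b + a) + t • u) = 0) :
    ∫⁻ b, (∫⁻ t in Ioc 0 h, (∫⁻ x, g (x - (b + a) + t • u) ∂ν)) ∂m ≤ c * (∫⁻ x, g x) * ν V := by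
  have hgm : Measurable fun p : (Plane × ℝ) × Plane => g (p.2 - (p.1.1 + a) + p.1.2 • u) := by
    refine hg.comp ?_
    fun_prop
  have hgm2 : Measurable fun p : (Plane × Plane) × ℝ => g (p.1.2 - (p.1.1 + a) + p.2 • u) := by
    refine hg.comp ?_
    fun_prop
  have s1 : ∀ b, ∫⁻ t in Ioc 0 h, (∫⁻ x, g (x - (b + a) + t • u) ∂ν)
      = ∫⁻ x, (∫⁻ t in Ioc 0 h, g (x - (b + a) + t • u)) ∂ν := fun b =>
    lintegral_lintegral_swap
      (hgm.comp (f := fun p : ℝ × Plane => ((b, p.1), p.2)) (by fun_prop)).aemeasurable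
  simp_rw [s1]
  rw [lintegral_lintegral_swap (f := fun b x => ∫⁻ t in Ioc 0 h, g (x - (b + a) + t • u))
    (hgm2.lintegral_prod_right' (ν := volume.restrict (Ioc 0 h))).aemeasurable,
    ← setLIntegral_const, ← lintegral_indicator hV]
  refine lintegral_mono fun x => ?_
  by_cases hx : x ∈ V
  · rw [indicator_of_mem hx]
    have hneg : Measurable fun y => g (x - a - y) := hg.comp (by fun_prop)
    calc _ ≤ ∫⁻ b, (∫⁻ t : ℝ, g (x - a - (b - t • u))) ∂m := by
          refine lintegral_mono fun b => (setLIntegral_le_lintegral _ _).trans (le_of_eq ?_)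
          refine lintegral_congr fun t => ?_
          congr 1
          module
      _ ≤ c * ∫⁻ y, g (x - a - y) := lintegral_lintegral_sub_smul_le hu hm hneg
      _ = _ := by rw [lintegral_sub_left_eq_self]
  · rw [indicator_of_notMem hx, nonpos_iff_eq_zero]
    rw [lintegral_eq_zero_iff' (Measurable.aemeasurable ?_)]
    · filter_upwards [measure_eq_zero_iff_ae_notMem.1 hmK] with b hb
      rw [notMem_compl_iff] at hb
      exact (setLIntegral_congr_fun measurableSet_Ioc fun t ht => hsupp b hb t ht x hx).trans
        (by simp)
    · exact (hgm2.comp (f := fun p : Plane × ℝ => ((p.1, x), p.2)) (by fun_prop)).lintegral_prod_right'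
        (ν := volume.restrict (Ioc 0 h))

theorem frontier_finite_restrict {Ω : Set Plane} (hΩ : IsOpen Ω) (hc : Convex ℝ Ω)
    (hbd : Bornology.IsBounded Ω) {K : Set Plane} (hK : K ⊆ frontier Ω) :
    IsFiniteMeasure ((μH[1] : Measure Plane).restrict K) := by
  rcases Ω.eq_empty_or_nonempty with rfl | hne
  · rw [frontier_empty, subset_empty_iff] at hK
    rw [hK, Measure.restrict_empty]
    infer_instance
  · exact ⟨by
      rw [Measure.restrict_apply_univ]
      exact (measure_mono hK).trans_lt (hausdorffMeasure_frontier_lt_top hΩ hc hne hbd)⟩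

/-- The weights have mass one, support in `B_{2r} ∩ Ω` and height of order `r⁻²`. The weighted mean
of `|v - z|` is thus at most a multiple of its ordinary mean over that set, which tends to zero. -/
theorem IsTraceAt.eventually_le_weighted {Ω : Set Plane} (hΩ : IsOpen Ω) {v : Plane → ℝ}
    (hvm : Measurable v) (hvi : Integrable v) {b : Plane} (hb : b ∈ closure Ω) {z : ℝ}
    (hz : IsTraceAt Ω v b z) {κ : ℝ} (hκ : 0 < κ) {ι : Type*} {l : Filter ι} {r : ι → ℝ}
    (hr : Tendsto r l (𝓝[>] 0)) {ρ : ι → Plane → ℝ} (hρm : ∀ k, Measurable (ρ k))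
    (hρ1 : ∀ k, ∫⁻ x, ENNReal.ofReal (ρ k x) = 1)
    (hρb : ∀ k x, ρ k x ≤ 1 / (Real.pi * (κ * r k) ^ 2))
    (hρs : ∀ k x, ρ k x ≠ 0 → x ∈ Metric.ball b (2 * r k) ∩ Ω) {ε : ℝ} (hε : 0 < ε) :
    ∀ᶠ k in l, ‖z‖ₑ ≤ (∫⁻ x, ‖v x‖ₑ * ENNReal.ofReal (ρ k x)) + ENNReal.ofReal ε := by
  have h2 : Tendsto (fun k => 2 * r k) l (𝓝[>] 0) := by
    rw [tendsto_nhdsWithin_iff] at hr ⊢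
    refine ⟨by simpa using hr.1.const_mul 2, hr.2.mono fun k hk => ?_⟩
    have : 0 < r k := hk
    exact mem_Ioi.2 (by positivity)
  -- `4 / κ²` is the product of the area `π (2r)²` and the maximal height `1 / (π (κ r)²)`.
  filter_upwards [h2.eventually ((isTraceAt_iff hΩ hvi.integrableOn hb).1 hz (ε * κ ^ 2 / 4)
    (by positivity)), hr.eventually self_mem_nhdsWithin] with k hk hk0
  have hk0' : 0 < r k := hk0
  set A := Metric.ball b (2 * r k) ∩ Ω with hA
  have hAm : MeasurableSet A := Metric.isOpen_ball.measurableSet.inter hΩ.measurableSet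
  have hρe : Measurable fun x => ENNReal.ofReal (ρ k x) := (hρm k).ennreal_ofReal
  have h3 : ∫⁻ x, ‖v x - z‖ₑ * ENNReal.ofReal (ρ k x) ≤ ENNReal.ofReal ε := by
    calc ∫⁻ x, ‖v x - z‖ₑ * ENNReal.ofReal (ρ k x)
        ≤ ∫⁻ x in A, ‖v x - z‖ₑ * ENNReal.ofReal (1 / (Real.pi * (κ * r k) ^ 2)) := by
          rw [← lintegral_indicator hAm]
          refine lintegral_mono fun x => ?_
          by_cases hx : ρ k x = 0
          · simp [hx]
          · rw [indicator_of_mem (hρs k x hx)]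
            gcongr
            exact hρb k x
      _ = (∫⁻ x in A, ‖v x - z‖ₑ) * ENNReal.ofReal (1 / (Real.pi * (κ * r k) ^ 2)) :=
          lintegral_mul_const' _ _ ENNReal.ofReal_ne_top
      _ ≤ ENNReal.ofReal (ε * κ ^ 2 / 4) * ENNReal.ofReal (Real.pi * (2 * r k) ^ 2)
          * ENNReal.ofReal (1 / (Real.pi * (κ * r k) ^ 2)) := by
          gcongr
          refine hk.trans ?_
          gcongr
          rw [← volume_ball_plane b (by positivity)]
          exact measure_mono inter_subset_left
      _ = ENNReal.ofReal ε := by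
          rw [← ENNReal.ofReal_mul (by positivity), ← ENNReal.ofReal_mul (by positivity)]
          congr 1
          field_simp
          ring
  calc ‖z‖ₑ = ∫⁻ x, ‖z‖ₑ * ENNReal.ofReal (ρ k x) := by
        rw [lintegral_const_mul _ hρe, hρ1, mul_one]
    _ ≤ ∫⁻ x, (‖v x‖ₑ * ENNReal.ofReal (ρ k x) + ‖v x - z‖ₑ * ENNReal.ofReal (ρ k x)) := by
        refine lintegral_mono fun x => ?_
        rw [← add_mul]
        gcongr
        have : z = v x - (v x - z) := by ring
        conv_lhs => rw [this]
        exact enorm_sub_le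
    _ = (∫⁻ x, ‖v x‖ₑ * ENNReal.ofReal (ρ k x)) + ∫⁻ x, ‖v x - z‖ₑ * ENNReal.ofReal (ρ k x) :=
        lintegral_add_left (hvm.enorm.mul hρe) _
    _ ≤ _ := by gcongr

/-- Bumps placed at distance `r k` inside the boundary recover the trace as `k` grows, by Fatou. For
each `k` they are moved inward over all depths up to `h`, and the averaged estimate is integrated
over `K`. The only loss in the coefficient of the variation is the slope factor between length on
`K` and length of its projection. -/
theorem lintegral_trace_flat_le_of_measurable {Ω : Set Plane} (hΩ : IsOpen Ω) (hc : Convex ℝ Ω)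
    (hbd : Bornology.IsBounded Ω) {v : Plane → ℝ} (hvm : Measurable v) (hvi : Integrable v)
    {μ : VectorMeasure Plane Plane} (hμ : IsDistribGradient Ω v μ) {u : Plane} (hu : ‖u‖ = 1)
    {ε : ℝ} (hε0 : 0 ≤ ε) (hε1 : ε < 1) {K : Set Plane} (hK : IsCompact K)
    (hKu : K ⊆ flatPart Ω u ε) {h : ℝ} (hh : 0 < h) (hKh : ∀ b ∈ K, b - (2 * h) • u ∈ Ω) :
    ∫⁻ b in K, ‖trace Ω v b‖ₑ ∂μH[1] ≤ ENNReal.ofReal (Real.sqrt (1 - ε ^ 2))⁻¹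
      * (μ.variation (Ω ∩ Metric.thickening (2 * h) K)
        + ENNReal.ofReal h⁻¹ * ∫⁻ x in Ω, ‖v x‖ₑ) := by
  have hKF : K ⊆ frontier Ω := fun b hb => (hKu hb).1
  have hfin := frontier_finite_restrict hΩ hc hbd hKF
  set m := (μH[1] : Measure Plane).restrict K with hm
  have hKm : MeasurableSet K := hK.measurableSet
  -- a uniform cone condition
  obtain ⟨κ, hκ0, hκ1, hcone⟩ : ∃ κ : ℝ, 0 < κ ∧ κ ≤ 1 ∧ ∀ b ∈ K, ∀ τ ∈ Ioc 0 (2 * h),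
      Metric.ball (b - τ • u) (κ * τ) ⊆ Ω := by
    have hK' : IsCompact ((fun b => b - (2 * h) • u) '' K) := hK.image (by fun_prop)
    obtain ⟨δ, hδ, hsub⟩ := hK'.exists_thickening_subset_open hΩ
      (by rintro _ ⟨b, hb, rfl⟩; exact hKh b hb)
    refine ⟨min (δ / (2 * h)) 1, by positivity, min_le_right _ _, fun b hb τ hτ => ?_⟩
    have hball : Metric.ball (b - (2 * h) • u) δ ⊆ Ω := fun y hy =>
      hsub (Metric.mem_thickening_iff.2 ⟨_, ⟨b, hb, rfl⟩, hy⟩)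
    have := ball_combo_subset hΩ hc hball (frontier_subset_closure (hKF hb))
      (r := τ / (2 * h)) (div_pos hτ.1 (by positivity)) ((div_le_one (by positivity)).2 hτ.2)
    refine Subset.trans ?_ this
    have e1 : b + (τ / (2 * h)) • (b - (2 * h) • u - b) = b - τ • u := by
      rw [sub_sub_cancel_left, smul_neg, smul_smul, div_mul_cancel₀ _ (by positivity), sub_eq_add_neg]
    rw [e1]
    refine Metric.ball_subset_ball ?_
    calc min (δ / (2 * h)) 1 * τ ≤ δ / (2 * h) * τ := by
          gcongr
          · exact hτ.1.le
          · exact min_le_left _ _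
      _ = _ := by ring
  -- The shift by three gives `3 r k ≤ h`, so that the moved bumps, including their radius, stay
  -- within distance `2 h` of `K`.
  set r : ℕ → ℝ := fun k => h / (k + 3) with hr
  have hr0 k : 0 < r k := by positivity
  have hr3 k : 3 * r k ≤ h := by
    rw [hr]
    beta_reduce
    rw [mul_div_assoc', div_le_iff₀ (by positivity)]
    nlinarith [(Nat.cast_nonneg k : (0 : ℝ) ≤ k)]
  have hrt : Tendsto r atTop (𝓝[>] 0) := by
    refine tendsto_nhdsWithin_iff.2 ⟨?_, Eventually.of_forall hr0⟩
    exact tendsto_const_nhds.div_atTop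
      (tendsto_atTop_add_const_right _ _ tendsto_natCast_atTop_atTop)
  let β : ∀ k, ContDiffBump (0 : Plane) := fun k =>
    ⟨κ / 4 * r k, κ / 2 * r k, by have := hr0 k; positivity, by
      have := mul_pos hκ0 (hr0 k); linarith⟩
  have hβ0 k x : 0 ≤ (β k).normed volume x := (β k).nonneg_normed _
  have hβs k x (hx : (β k).normed volume x ≠ 0) : ‖x‖ < κ / 2 * r k := by
    have : x ∈ Function.support ((β k).normed volume) := hx
    rw [(β k).support_normed_eq] at this
    simpa using this
  set ρ : ℕ → Plane → Plane → ℝ := fun k b x => (β k).normed volume (x - (b + -(r k • u))) with hρ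
  have hρs k b x (hx : ρ k b x ≠ 0) : x ∈ Metric.ball (b - r k • u) (κ / 2 * r k) := by
    rw [Metric.mem_ball, dist_eq_norm, sub_eq_add_neg b]
    exact hβs k _ hx
  have hβi k : ∫⁻ x, ENNReal.ofReal ((β k).normed volume x) = 1 := by
    rw [← ofReal_integral_eq_lintegral_ofReal (β k).integrable_normed
      (Eventually.of_forall (hβ0 k)), (β k).integral_normed, ENNReal.ofReal_one]
  have hβc k : Continuous ((β k).normed volume) := (β k).continuous_normed
  set g : ℕ → Plane → ℝ≥0∞ := fun k x => ENNReal.ofReal ((β k).normed volume x) with hg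
  have hgm k : Measurable (g k) := (hβc k).measurable.ennreal_ofReal
  set V := Ω ∩ Metric.thickening (2 * h) K with hV
  have hVm : MeasurableSet V := hΩ.measurableSet.inter Metric.isOpen_thickening.measurableSet
  -- Dividing the mass of `N` by `h` gives precisely the two terms of the claim.
  set N : Measure Plane := volume.withDensity (fun x => ‖v x‖ₑ) + ENNReal.ofReal h • μ.variation
    with hN
  set T : ℕ → Plane → ℝ≥0∞ := fun k b => ∫⁻ x, ‖v x‖ₑ * ENNReal.ofReal (ρ k b x) with hT
  have hTm k : Measurable (T k) := by
    refine Measurable.lintegral_prod_right' (f := fun p : Plane × Plane =>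
      ‖v p.2‖ₑ * ENNReal.ofReal (ρ k p.1 p.2)) ?_
    exact (hvm.comp measurable_snd).enorm.mul
      ((hβc k).comp (by fun_prop)).measurable.ennreal_ofReal
  have hsfin : SFinite N := by
    have : IsFiniteMeasure (ENNReal.ofReal h • μ.variation) :=
      Measure.smul_finite _ ENNReal.ofReal_ne_top
    infer_instance
  have hpt k : ∀ b ∈ K, T k b * ENNReal.ofReal h
      ≤ ∫⁻ t in Ioc 0 h, ∫⁻ x, g k (x - (b + -(r k • u)) + t • u) ∂N := by
    intro b hb
    have hts : tsupport (ρ k b) ⊆ Metric.closedBall (b - r k • u) (κ / 2 * r k) :=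
      closure_minimal (fun x hx => Metric.ball_subset_closedBall (hρs k b x hx))
        Metric.isClosed_closedBall
    have := lintegral_weighted_mul_le hΩ.measurableSet hvm hvi hμ (ρ := ρ k b) (e := -u) (h := h)
      ((β k).contDiff_normed.comp (by fun_prop))
      (HasCompactSupport.intro (isCompact_closedBall (b - r k • u) (κ / 2 * r k))
        fun x hx => by
          by_contra hne
          exact hx (Metric.ball_subset_closedBall (hρs k b x hne)))
      (fun x => hβ0 k _) (by rwa [norm_neg]) (fun x hx t ht => ?_)
    · refine this.trans (le_of_eq (lintegral_congr fun t => lintegral_congr fun x => ?_))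
      simp only [hρ, hg]
      congr 2
      module
    · have h1 := hts hx
      refine hcone b hb (r k + t) ⟨by linarith [hr0 k, ht.1], by linarith [hr3 k, hr0 k, ht.2]⟩ ?_
      rw [Metric.mem_closedBall, dist_eq_norm] at h1
      rw [Metric.mem_ball, dist_eq_norm]
      have e : x + t • -u - (b - (r k + t) • u) = x - (b - r k • u) := by module
      rw [e]
      nlinarith [mul_pos hκ0 (hr0 k), mul_nonneg hκ0.le ht.1]
  set c : ℝ≥0∞ := ENNReal.ofReal (Real.sqrt (1 - ε ^ 2))⁻¹ with hcdef
  have hint k : (∫⁻ b, T k b ∂m) * ENNReal.ofReal h ≤ c * N V := by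
    rw [← lintegral_mul_const _ (hTm k)]
    calc _ ≤ ∫⁻ b, (∫⁻ t in Ioc 0 h, (∫⁻ x, g k (x - (b + -(r k • u)) + t • u) ∂N)) ∂m :=
          setLIntegral_mono' hKm (hpt k)
      _ ≤ c * (∫⁻ x, g k x) * N V := by
          refine setLIntegral_lintegral_bump_le hu (map_hausdorffMeasure_flat_le hu hε1 hε0 hKu)
            (hgm k) hVm _ (K := K) (by rw [Measure.restrict_apply hKm.compl]; simp) ?_
          intro b hb t ht x hx
          by_contra hne
          have hn : (β k).normed volume (x - (b + -(r k • u)) + t • u) ≠ 0 := fun h0 => by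
            simp [hg, h0] at hne
          have h1 := hβs k _ hn
          have e : x - (b + -(r k • u)) + t • u = x - (b - (r k + t) • u) := by module
          rw [e] at h1
          have hrt0 : 0 ≤ r k + t := by linarith [hr0 k, ht.1]
          refine hx ⟨hcone b hb (r k + t) ⟨by linarith [hr0 k, ht.1],
            by linarith [hr3 k, hr0 k, ht.2]⟩ ?_, Metric.mem_thickening_iff.2 ⟨b, hb, ?_⟩⟩
          · rw [Metric.mem_ball, dist_eq_norm]
            nlinarith [mul_pos hκ0 (hr0 k), mul_nonneg hκ0.le ht.1.le]
          · rw [dist_eq_norm]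
            have e2 : x - b = (x - (b - (r k + t) • u)) - (r k + t) • u := by module
            rw [e2]
            refine (norm_sub_le _ _).trans_lt ?_
            rw [norm_smul, hu, mul_one, Real.norm_of_nonneg hrt0]
            nlinarith [hr0 k, hr3 k, ht.2]
      _ = c * N V := by rw [hβi, mul_one]
  have hpos : ENNReal.ofReal h ≠ 0 := by simpa using hh
  have hlim : ∫⁻ b, ‖trace Ω v b‖ₑ ∂m ≤ c * N V / ENNReal.ofReal h := by
    have hψ : MemBV Ω v := ⟨hvi.integrableOn, μ, hμ⟩
    have htr : ∀ᵐ b ∂m, IsTraceAt Ω v b (trace Ω v b) :=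
      ae_mono (Measure.restrict_mono hKF le_rfl) (hψ.ae_isTraceAt hΩ hc hbd)
    calc ∫⁻ b, ‖trace Ω v b‖ₑ ∂m ≤ ∫⁻ b, liminf (fun k => T k b) atTop ∂m := by
          refine lintegral_mono_ae ?_
          filter_upwards [htr, ae_restrict_mem hKm] with b hb hbK
          refine ENNReal.le_of_forall_pos_le_add fun η hη _ => ?_
          have hev := hb.eventually_le_weighted hΩ hvm hvi (frontier_subset_closure (hKF hbK))
            (κ := κ / 4) (by positivity) hrt (ρ := fun k => ρ k b)
            (fun k => ((hβc k).comp (by fun_prop)).measurable)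
            (fun k => by
              rw [← hβi k]
              exact lintegral_sub_right_eq_self (fun x => ENNReal.ofReal ((β k).normed volume x)) _)
            (fun k x => ?_) (fun k x hx => ?_) (ε := η) (by simpa using hη)
          · rw [← tsub_le_iff_right]
            refine le_liminf_of_le (by isBoundedDefault) ?_
            filter_upwards [hev] with k hk
            rw [tsub_le_iff_right]
            simpa using hk
          · refine ((β k).normed_le_div_measure_closedBall_rIn volume _).trans (le_of_eq ?_)
            rw [measureReal_def, volume_closedBall_plane _ (β k).rIn_pos.le, ENNReal.toReal_ofReal
              (by positivity)]
          · have h1 := hρs k b x hx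
            refine ⟨Metric.ball_subset_ball' ?_ h1, hcone b hbK (r k) ⟨hr0 k, by
              linarith [hr3 k, hr0 k]⟩ (Metric.ball_subset_ball ?_ h1)⟩
            · rw [dist_eq_norm, sub_sub_cancel_left, norm_neg, norm_smul, hu, mul_one,
                Real.norm_of_nonneg (hr0 k).le]
              nlinarith [hr0 k]
            · nlinarith [mul_pos hκ0 (hr0 k)]
      _ ≤ liminf (fun k => ∫⁻ b, T k b ∂m) atTop := lintegral_liminf_le hTm
      _ ≤ c * N V / ENNReal.ofReal h := by
          refine (liminf_le_liminf (v := fun _ => c * N V / ENNReal.ofReal h)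
            (Eventually.of_forall fun k => ?_)).trans (by simp)
          rw [ENNReal.le_div_iff_mul_le (Or.inl hpos) (Or.inl ENNReal.ofReal_ne_top)]
          exact hint k
  refine hlim.trans ?_
  rw [mul_div_assoc]
  gcongr
  rw [hN, Measure.add_apply, Measure.smul_apply, smul_eq_mul, withDensity_apply _ hVm,
    ENNReal.add_div, mul_comm (ENNReal.ofReal h), ENNReal.mul_div_cancel_right hpos
      ENNReal.ofReal_ne_top, add_comm, ENNReal.ofReal_inv_of_pos hh, ENNReal.div_eq_inv_mul]
  gcongr
  exact inter_subset_left

/-- The boundary trace inequality with the sharp constant near a flat piece of the boundary. -/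
theorem lintegral_trace_flat_le {Ω : Set Plane} (hΩ : IsOpen Ω) (hc : Convex ℝ Ω)
    (hbd : Bornology.IsBounded Ω) {v : Plane → ℝ} (hvi : IntegrableOn v Ω)
    {μ : VectorMeasure Plane Plane} (hμ : IsDistribGradient Ω v μ) {u : Plane} (hu : ‖u‖ = 1)
    {ε : ℝ} (hε0 : 0 ≤ ε) (hε1 : ε < 1) {K : Set Plane} (hK : IsCompact K)
    (hKu : K ⊆ flatPart Ω u ε) {h : ℝ} (hh : 0 < h) (hKh : ∀ b ∈ K, b - (2 * h) • u ∈ Ω) :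
    ∫⁻ b in K, ‖trace Ω v b‖ₑ ∂μH[1] ≤ ENNReal.ofReal (Real.sqrt (1 - ε ^ 2))⁻¹
      * (μ.variation (Ω ∩ Metric.thickening (2 * h) K)
        + ENNReal.ofReal h⁻¹ * ∫⁻ x in Ω, ‖v x‖ₑ) := by
  obtain ⟨w, hwm, hwi, hw⟩ := exists_measurable_rep hΩ.measurableSet hvi
  rw [isDistribGradient_congr hw] at hμ
  rw [trace_congr hw, lintegral_congr_ae (hw.mono fun x hx => by beta_reduce; rw [hx] :
    (fun x => ‖v x‖ₑ) =ᵐ[volume.restrict Ω] fun x => ‖w x‖ₑ)]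
  exact lintegral_trace_flat_le_of_measurable hΩ hc hbd hwm hwi hμ hu hε0 hε1 hK hKu hh hKh

/-! ### Decomposition of the boundary into flat pieces -/

/-- If the line through `b` in direction `u` met `Ω`, it would do so on the inner side, since the
normal at `b` is close to `u`. So a bad point projects to the frontier of the projection of `Ω`.
That projection is convex in the line, its frontier is null, and on the flat part length is
controlled by the length of the projection. -/
theorem hausdorffMeasure_flatPart_bad {Ω : Set Plane} (hΩ : IsOpen Ω) (hc : Convex ℝ Ω)
    {u : Plane} (hu : ‖u‖ = 1) {ε : ℝ} (hε0 : 0 ≤ ε) (hε1 : ε < 1) :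
    μH[1] {b ∈ flatPart Ω u ε | ∀ t > (0 : ℝ), b - t • u ∉ Ω} = 0 := by
  set P : Plane →L[ℝ] ℝ := innerSL ℝ (turn u) with hP
  have hPapp x : P x = inner ℝ (turn u) x := rfl
  have hI : Convex ℝ (P '' Ω) := hc.linear_image P.toLinearMap
  have h0 : volume (frontier (P '' Ω)) = 0 := hI.addHaar_frontier volume
  have h1 := hausdorffMeasure_flat_le hu hε1 hε0 (A := flatPart Ω u ε)
    (fun b hb b' hb' => abs_inner_sub_le_of_mem_flatPart hb hb') (frontier (P '' Ω))
  rw [h0, mul_zero, nonpos_iff_eq_zero] at h1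
  refine measure_mono_null ?_ h1
  rintro b ⟨hb, hbad⟩
  refine ⟨hb, ?_⟩
  rw [mem_preimage]
  refine ⟨map_mem_closure P.continuous (frontier_subset_closure hb.1) (mapsTo_image P Ω), ?_⟩
  intro hint
  obtain ⟨x, hx, hxb⟩ := interior_subset hint
  change P x = P b at hxb
  have e : x - b = (inner ℝ u (x - b) : ℝ) • u := by
    have := decompose_turn hu (x - b)
    rwa [inner_sub_right (turn u), ← hPapp, ← hPapp, hxb, sub_self, zero_smul, add_zero] at this
  set s : ℝ := inner ℝ u (x - b)
  rcases lt_or_ge s 0 with hs | hs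
  · refine hbad (-s) (by linarith) ?_
    have : b - -s • u = x := by rw [neg_smul, sub_neg_eq_add, ← e]; abel
    rwa [this]
  · obtain ⟨hbF, ν, hν, hνu⟩ := hb
    have h2 := hν.2 x hx
    rw [e, inner_smul_right] at h2
    have h3 : (1 : ℝ) - ε ≤ inner ℝ ν u := by
      have h4 : inner ℝ ν u = 1 + inner ℝ (ν - u) u := by
        rw [inner_sub_left, real_inner_self_eq_norm_sq, hu]; ring
      have h5 := abs_real_inner_le_norm (ν - u) u
      rw [hu, mul_one] at h5
      linarith [neg_abs_le (inner ℝ (ν - u) u : ℝ)]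
    have hs0 : s = 0 := by nlinarith
    rw [hs0, zero_smul, sub_eq_zero] at e
    rw [e] at hx
    rw [frontier, hΩ.interior_eq] at hbF
    exact hbF.2 hx

/-- A depth that works at `b` works at nearby points, since `Ω` is open, and then by convexity every
smaller positive depth does. Compactness makes the depth uniform. -/
theorem eventually_sub_smul_mem {Ω : Set Plane} (hΩ : IsOpen Ω) (hc : Convex ℝ Ω) {u : Plane}
    {K : Set Plane} (hK : IsCompact K) (hKc : K ⊆ closure Ω)
    (hg : ∀ b ∈ K, ∃ t > (0 : ℝ), b - t • u ∈ Ω) :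
    ∀ᶠ h in 𝓝[>] (0 : ℝ), ∀ b ∈ K, b - (2 * h) • u ∈ Ω := by
  have key : ∃ t₀ > (0 : ℝ), ∀ b ∈ K, ∀ t ∈ Ioc 0 t₀, b - t • u ∈ Ω := by
    refine hK.induction_on (p := fun S => ∃ t₀ > (0 : ℝ), ∀ b ∈ S, ∀ t ∈ Ioc 0 t₀, b - t • u ∈ Ω)
      ⟨1, one_pos, by simp⟩ (fun s t hst ⟨t₀, h0, h⟩ => ⟨t₀, h0, fun b hb => h b (hst hb)⟩)
      (fun s t ⟨t₀, h0, h⟩ ⟨t₁, h1, h'⟩ => ⟨min t₀ t₁, lt_min h0 h1, ?_⟩) fun b hb => ?_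
    · rintro b (hb | hb) τ hτ
      · exact h b hb τ ⟨hτ.1, hτ.2.trans (min_le_left _ _)⟩
      · exact h' b hb τ ⟨hτ.1, hτ.2.trans (min_le_right _ _)⟩
    · obtain ⟨t, ht, hbt⟩ := hg b hb
      refine ⟨K ∩ (fun y => y - t • u) ⁻¹' Ω, inter_mem_nhdsWithin _
        ((hΩ.preimage (by fun_prop)).mem_nhds hbt), t, ht, fun y hy τ hτ => ?_⟩
      have := hc.combo_closure_interior_mem_interior (hKc hy.1) (hΩ.interior_eq.symm ▸ hy.2)
        (a := 1 - τ / t) (b := τ / t) (by rw [sub_nonneg, div_le_one ht]; exact hτ.2)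
        (div_pos hτ.1 ht) (by ring)
      rw [hΩ.interior_eq] at this
      convert this using 1
      have h1 : τ = τ / t * t := by field_simp
      beta_reduce
      rw [smul_sub, smul_smul, ← h1]
      module
  obtain ⟨t₀, ht₀, h⟩ := key
  filter_upwards [Ioo_mem_nhdsGT (half_pos ht₀)] with s hs b hb
  exact h b hb _ ⟨by linarith [hs.1], by linarith [hs.2]⟩

/-- The flat parts for a finite `ε`-net of directions cover the frontier. They are made disjoint,
the null sets of points from which `-u i` does not lead into `Ω` are dropped, and inner regularity
gives compact sets. Disjoint compact sets have disjoint neighbourhoods at small scales. -/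
theorem exists_flat_decomposition {Ω : Set Plane} (hΩ : IsOpen Ω) (hc : Convex ℝ Ω)
    (hne : Ω.Nonempty) (hbd : Bornology.IsBounded Ω) {ε : ℝ} (hε0 : 0 < ε) (hε1 : ε < 1)
    {δ : ℝ≥0∞} (hδ : δ ≠ 0) :
    ∃ (N : ℕ) (u : Fin N → Plane) (K : Fin N → Set Plane), (∀ i, ‖u i‖ = 1) ∧
      (∀ i, IsCompact (K i)) ∧ (∀ i, K i ⊆ flatPart Ω (u i) ε) ∧
      Pairwise (Function.onFun Disjoint K) ∧ μH[1] (frontier Ω \ ⋃ i, K i) ≤ δ ∧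
      ∀ᶠ h in 𝓝[>] (0 : ℝ), (∀ i, ∀ b ∈ K i, b - (2 * h) • u i ∈ Ω) ∧
        Pairwise (Function.onFun Disjoint fun i => Metric.thickening (2 * h) (K i)) := by
  obtain ⟨F, hF1, hF⟩ := exists_finite_directions hε0
  set N := F.card
  let e := F.equivFin.symm
  set u : Fin N → Plane := fun i => e i with hu
  have hu1 i : ‖u i‖ = 1 := hF1 _ (e i).2
  set A : Fin N → Set Plane := fun i => flatPart Ω (u i) ε with hA
  have hAm i : MeasurableSet (A i) := (isClosed_flatPart _ _).measurableSet
  set good : Fin N → Set Plane := fun i => {b | ∃ t > (0 : ℝ), b - t • u i ∈ Ω} with hgood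
  have hgm i : MeasurableSet (good i) := by
    have : IsOpen (good i) := by
      have e : good i = ⋃ t > (0 : ℝ), (fun b => b - t • u i) ⁻¹' Ω := by
        ext b; simp [hgood]
      rw [e]
      exact isOpen_biUnion fun t _ => hΩ.preimage (by fun_prop)
    exact this.measurableSet
  set B : Fin N → Set Plane := fun i => A i \ ⋃ j < i, A j with hB
  have hBm i : MeasurableSet (B i) :=
    (hAm i).diff (MeasurableSet.iUnion fun j => MeasurableSet.iUnion fun _ => hAm j)
  have hBd : ∀ i j, i ≠ j → Disjoint (B i) (B j) := by
    have : ∀ i j, i < j → Disjoint (B i) (B j) := fun i j hij =>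
      Set.disjoint_left.2 fun x hx hx' => hx'.2 (mem_biUnion (show i < j from hij) hx.1)
    intro i j hij
    rcases lt_or_gt_of_ne hij with h | h
    · exact this i j h
    · exact (this j i h).symm
  have hcov : frontier Ω ⊆ ⋃ i, B i := by
    intro b hb
    have hex : ∃ i, b ∈ A i := by
      obtain ⟨v, hv, hbv⟩ := mem_iUnion₂.1 (frontier_subset_flatPart hΩ hc hne hF hb)
      refine ⟨e.symm ⟨v, hv⟩, ?_⟩
      simpa [hA, hu] using hbv
    obtain ⟨i, hi, hmin⟩ := WellFounded.has_min (wellFounded_lt (α := Fin N)) {i | b ∈ A i} hex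
    refine mem_iUnion.2 ⟨i, hi, fun h => ?_⟩
    obtain ⟨j, hj, hbj⟩ := mem_iUnion₂.1 h
    exact hmin j hbj hj
  have hfin := frontier_finite_restrict hΩ hc hbd (K := frontier Ω) le_rfl
  set m := (μH[1] : Measure Plane).restrict (frontier Ω)
  have hK i : ∃ K ⊆ B i ∩ good i, IsCompact K ∧ m ((B i ∩ good i) \ K) < δ / (N + 1) :=
    ((hBm i).inter (hgm i)).exists_isCompact_sdiff_lt (measure_ne_top _ _)
      (ENNReal.div_pos hδ (by finiteness)).ne'
  choose K hKs hKc hKδ using hK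
  have hKA i : K i ⊆ A i := (hKs i).trans (inter_subset_left.trans sdiff_subset)
  have hKF i : K i ⊆ frontier Ω := (hKA i).trans fun b hb => hb.1
  have hKd : ∀ i j, i ≠ j → Disjoint (K i) (K j) := fun i j hij =>
    (hBd i j hij).mono ((hKs i).trans inter_subset_left) ((hKs j).trans inter_subset_left)
  refine ⟨N, u, K, hu1, hKc, hKA, fun i j hij => hKd i j hij, ?_, ?_⟩
  · have hbad i : m (A i \ good i) = 0 := by
      refine measure_mono_null (fun b hb => ?_)
        (nonpos_iff_eq_zero.1 ((Measure.restrict_apply_le _ _).trans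
          (hausdorffMeasure_flatPart_bad hΩ hc (hu1 i) hε0.le hε1).le))
      refine ⟨hb.1, fun t ht h => hb.2 ⟨t, ht, h⟩⟩
    have hm0 : μH[1] (frontier Ω \ ⋃ i, K i) = m (frontier Ω \ ⋃ i, K i) := by
      rw [Measure.restrict_apply (isClosed_frontier.measurableSet.diff
        (MeasurableSet.iUnion fun i => (hKc i).measurableSet)), inter_eq_left.2 sdiff_subset]
    rw [hm0]
    calc m (frontier Ω \ ⋃ i, K i)
        ≤ m (⋃ i, ((B i ∩ good i) \ K i ∪ A i \ good i)) := by
          refine measure_mono fun b hb => ?_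
          obtain ⟨i, hi⟩ := mem_iUnion.1 (hcov hb.1)
          refine mem_iUnion.2 ⟨i, ?_⟩
          by_cases hg : b ∈ good i
          · exact Or.inl ⟨⟨hi, hg⟩, fun h => hb.2 (mem_iUnion.2 ⟨i, h⟩)⟩
          · exact Or.inr ⟨hi.1, hg⟩
      _ ≤ ∑ i, m ((B i ∩ good i) \ K i ∪ A i \ good i) := measure_iUnion_fintype_le _ _
      _ ≤ ∑ _i : Fin N, δ / (N + 1) := by
          refine Finset.sum_le_sum fun i _ => (measure_union_le _ _).trans ?_
          rw [hbad, add_zero]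
          exact (hKδ i).le
      _ ≤ (N + 1) * (δ / (N + 1)) := by
          rw [Finset.sum_const, nsmul_eq_mul, Finset.card_univ, Fintype.card_fin]
          gcongr
          exact le_self_add
      _ = δ := ENNReal.mul_div_cancel (by simp) (by finiteness)
  · refine Filter.Eventually.and (eventually_all.2 fun i => eventually_sub_smul_mem hΩ hc (hKc i)
      ((hKF i).trans frontier_subset_closure) fun b hb => (hKs i hb).2) ?_
    refine eventually_all.2 fun i => eventually_all.2 fun j => ?_
    by_cases hij : i = j
    · exact Eventually.of_forall fun h h' => absurd hij h'
    obtain ⟨d, hd, hdis⟩ := (hKd i j hij).exists_thickenings (hKc i) (hKc j).isClosed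
    filter_upwards [Ioo_mem_nhdsGT (half_pos hd)] with s hs _
    exact hdis.mono (Metric.thickening_mono (by linarith [hs.2]) _)
      (Metric.thickening_mono (by linarith [hs.2]) _)

/-! ### Linearity and measurability of the trace -/

theorem IsTraceAt.linear {Ω : Set Plane} (hΩ : IsOpen Ω) {v w : Plane → ℝ}
    (hv : IntegrableOn v Ω) (hw : IntegrableOn w Ω) {x : Plane} (hx : x ∈ closure Ω) {y z : ℝ}
    (hy : IsTraceAt Ω v x y) (hz : IsTraceAt Ω w x z) (a b : ℝ) :
    IsTraceAt Ω (fun p => a * v p + b * w p) x (a * y + b * z) := by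
  have hvw : IntegrableOn (fun p => a * v p + b * w p) Ω := (hv.const_mul a).add (hw.const_mul b)
  rw [isTraceAt_iff hΩ hvw hx]
  intro ε hε
  have h1 := (isTraceAt_iff hΩ hv hx).1 hy (ε / (2 * (|a| + 1))) (by positivity)
  have h2 := (isTraceAt_iff hΩ hw hx).1 hz (ε / (2 * (|b| + 1))) (by positivity)
  filter_upwards [h1, h2] with r h1 h2
  set A := Metric.ball x r ∩ Ω
  have hc1 : ‖a‖ₑ * ENNReal.ofReal (ε / (2 * (|a| + 1))) ≤ ENNReal.ofReal (ε / 2) := by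
    rw [Real.enorm_eq_ofReal_abs, ← ENNReal.ofReal_mul (abs_nonneg _)]
    refine ENNReal.ofReal_le_ofReal ?_
    rw [mul_div_assoc', div_le_div_iff₀ (by positivity) (by positivity)]
    nlinarith [abs_nonneg a]
  have hc2 : ‖b‖ₑ * ENNReal.ofReal (ε / (2 * (|b| + 1))) ≤ ENNReal.ofReal (ε / 2) := by
    rw [Real.enorm_eq_ofReal_abs, ← ENNReal.ofReal_mul (abs_nonneg _)]
    refine ENNReal.ofReal_le_ofReal ?_
    rw [mul_div_assoc', div_le_div_iff₀ (by positivity) (by positivity)]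
    nlinarith [abs_nonneg b]
  have hvm : AEMeasurable (fun p => ‖a‖ₑ * ‖v p - y‖ₑ) (volume.restrict A) :=
    ((hv.mono_set inter_subset_right).aestronglyMeasurable.aemeasurable.sub_const y).enorm.const_mul _
  calc ∫⁻ p in A, ‖a * v p + b * w p - (a * y + b * z)‖ₑ
      ≤ ∫⁻ p in A, (‖a‖ₑ * ‖v p - y‖ₑ + ‖b‖ₑ * ‖w p - z‖ₑ) := by
        refine lintegral_mono fun p => ?_
        have : a * v p + b * w p - (a * y + b * z) = a * (v p - y) + b * (w p - z) := by ring
        rw [this, ← enorm_mul, ← enorm_mul]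
        exact enorm_add_le _ _
    _ = ‖a‖ₑ * (∫⁻ p in A, ‖v p - y‖ₑ) + ‖b‖ₑ * ∫⁻ p in A, ‖w p - z‖ₑ := by
        rw [lintegral_add_left' hvm, lintegral_const_mul' _ _ enorm_ne_top,
          lintegral_const_mul' _ _ enorm_ne_top]
    _ ≤ ‖a‖ₑ * (ENNReal.ofReal (ε / (2 * (|a| + 1))) * volume A)
        + ‖b‖ₑ * (ENNReal.ofReal (ε / (2 * (|b| + 1))) * volume A) := by gcongr
    _ ≤ ENNReal.ofReal (ε / 2) * volume A + ENNReal.ofReal (ε / 2) * volume A := by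
        rw [← mul_assoc, ← mul_assoc]
        gcongr
    _ = ENNReal.ofReal ε * volume A := by
        rw [← add_mul, ← ENNReal.ofReal_add (by positivity) (by positivity), add_halves]

theorem ae_trace_linear {Ω : Set Plane} (hΩ : IsOpen Ω) (hc : Convex ℝ Ω)
    (hbd : Bornology.IsBounded Ω) {v w : Plane → ℝ} (hv : MemBV Ω v) (hw : MemBV Ω w) (a b : ℝ) :
    ∀ᵐ x ∂((μH[1] : Measure Plane).restrict (frontier Ω)),
      trace Ω (fun p => a * v p + b * w p) x = a * trace Ω v x + b * trace Ω w x := by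
  filter_upwards [hv.ae_isTraceAt hΩ hc hbd, hw.ae_isTraceAt hΩ hc hbd,
    ae_restrict_mem isClosed_frontier.measurableSet] with x h1 h2 hx
  have hx' := frontier_subset_closure hx
  exact (h1.linear hΩ hv.1 hw.1 hx' h2 a b).trace_eq hΩ (hv.linear hw a b).1 hx'

theorem IsTraceAt.tendsto_average {Ω : Set Plane} (hΩ : IsOpen Ω) {v : Plane → ℝ}
    (hv : IntegrableOn v Ω) {b : Plane} (hb : b ∈ closure Ω) {z : ℝ} (h : IsTraceAt Ω v b z) :
    Tendsto (fun r : ℝ => ⨍ y in Metric.ball b r ∩ Ω, v y) (𝓝[>] 0) (𝓝 z) := by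
  rw [tendsto_iff_dist_tendsto_zero]
  refine squeeze_zero' (Eventually.of_forall fun _ => dist_nonneg) ?_ h
  filter_upwards [self_mem_nhdsWithin] with r hr
  set A := Metric.ball b r ∩ Ω
  have hfin : volume A ≠ (⊤ : ℝ≥0∞) :=
    ne_top_of_le_ne_top measure_ball_lt_top.ne (measure_mono inter_subset_left)
  have hpos : volume.real A ≠ 0 :=
    (measureReal_ne_zero_iff hfin).2 (measure_ball_inter_pos hΩ hb hr).ne'
  have e : (⨍ y in A, v y) - z = ⨍ y in A, (v y - z) := by
    rw [setAverage_eq, setAverage_eq, integral_sub (hv.mono_set inter_subset_right)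
      (integrableOn_const (C := z) hfin), setIntegral_const, smul_sub, smul_smul,
      inv_mul_cancel₀ hpos, one_smul]
  rw [Real.dist_eq, e, setAverage_eq, setAverage_eq, smul_eq_mul, smul_eq_mul, abs_mul,
    abs_of_nonneg (by positivity : 0 ≤ (volume.real A)⁻¹)]
  gcongr
  exact abs_integral_le_integral_abs

/-- The trace is the almost everywhere limit of averages over `B_r(b) ∩ Ω` along a sequence of
radii, and each average is measurable in `b` as a parameter integral. -/
theorem aemeasurable_trace {Ω : Set Plane} (hΩ : IsOpen Ω) (hc : Convex ℝ Ω)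
    (hbd : Bornology.IsBounded Ω) {ψ : Plane → ℝ} (hψ : MemBV Ω ψ) :
    AEMeasurable (trace Ω ψ) ((μH[1] : Measure Plane).restrict (frontier Ω)) := by
  obtain ⟨v, hvm, hvi, hv⟩ := exists_measurable_rep hΩ.measurableSet hψ.1
  have hψv : MemBV Ω v := (memBV_congr hv).1 hψ
  rw [trace_congr hv]
  have hr : Tendsto (fun k : ℕ => ((k : ℝ) + 1)⁻¹) atTop (𝓝[>] 0) :=
    tendsto_nhdsWithin_iff.2 ⟨tendsto_inv_atTop_zero.comp
      (tendsto_atTop_add_const_right _ _ tendsto_natCast_atTop_atTop),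
      Eventually.of_forall fun k => mem_Ioi.2 (by positivity)⟩
  have hmeas (r : ℝ) {w : Plane → ℝ} (hw : Measurable w) :
      Measurable fun b => ∫ y in Metric.ball b r ∩ Ω, w y := by
    have e (b : Plane) : ∫ y in Metric.ball b r ∩ Ω, w y
        = ∫ y in Ω, {p : Plane × Plane | dist p.2 p.1 < r}.indicator (fun p => w p.2) (b, y) := by
      rw [inter_comm, ← setIntegral_indicator Metric.isOpen_ball.measurableSet]
      rfl
    simp_rw [e]
    refine (StronglyMeasurable.integral_prod_right' (f := {p : Plane × Plane |
      dist p.2 p.1 < r}.indicator (fun p => w p.2)) ?_).measurable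
    exact ((hw.comp measurable_snd).indicator
      (isOpen_lt (continuous_snd.dist continuous_fst) continuous_const).measurableSet).stronglyMeasurable
  refine aemeasurable_of_tendsto_metrizable_ae atTop
    (f := fun k b => ⨍ y in Metric.ball b (((k : ℕ) : ℝ) + 1)⁻¹ ∩ Ω, v y) (fun k => ?_) ?_
  · have e : (fun b => ⨍ y in Metric.ball b ((k : ℝ) + 1)⁻¹ ∩ Ω, v y)
        = fun b => (∫ y in Metric.ball b ((k : ℝ) + 1)⁻¹ ∩ Ω, (1 : ℝ))⁻¹
          * ∫ y in Metric.ball b ((k : ℝ) + 1)⁻¹ ∩ Ω, v y := by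
      ext b
      rw [setAverage_eq, setIntegral_const, smul_eq_mul, smul_eq_mul, mul_one]
    rw [e]
    exact ((hmeas _ measurable_const).inv.mul (hmeas _ hvm)).aemeasurable
  · filter_upwards [hψv.ae_isTraceAt hΩ hc hbd, ae_restrict_mem isClosed_frontier.measurableSet]
      with b h hb
    exact (h.tendsto_average hΩ hvi.integrableOn (frontier_subset_closure hb)).comp hr

/-! ### Lower semicontinuity -/

/-- The area plus the boundary term: the part of the functional which depends on `ψ`. -/
def boundaryArea (Ω : Set Plane) (φ ψ : Plane → ℝ) : ℝ≥0∞ :=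
  area Ω ψ + ∫⁻ x in frontier Ω, ENNReal.ofReal |trace Ω ψ x - φ x| ∂μH[1]

/-- The trace inequality for `v - w`. The variation is replaced by the sum of the two areas, which
is the quantity that can be compared with the functional. -/
theorem lintegral_trace_sub_flat_le {Ω : Set Plane} (hΩ : IsOpen Ω) (hc : Convex ℝ Ω)
    (hbd : Bornology.IsBounded Ω) {v w : Plane → ℝ} (hv : MemBV Ω v) (hw : MemBV Ω w)
    {u : Plane} (hu : ‖u‖ = 1) {ε : ℝ} (hε0 : 0 ≤ ε) (hε1 : ε < 1) {K : Set Plane}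
    (hK : IsCompact K) (hKu : K ⊆ flatPart Ω u ε) {h : ℝ} (hh : 0 < h)
    (hKh : ∀ b ∈ K, b - (2 * h) • u ∈ Ω) :
    ∫⁻ b in K, ‖trace Ω v b - trace Ω w b‖ₑ ∂μH[1] ≤ ENNReal.ofReal (Real.sqrt (1 - ε ^ 2))⁻¹
      * (areaMeasure Ω v (Ω ∩ Metric.thickening (2 * h) K)
        + areaMeasure Ω w (Ω ∩ Metric.thickening (2 * h) K)
        + ENNReal.ofReal h⁻¹ * ∫⁻ x in Ω, ‖v x - w x‖ₑ) := by
  have hKF : K ⊆ frontier Ω := fun b hb => (hKu hb).1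
  have hΩm := hΩ.measurableSet
  have hVm : MeasurableSet (Ω ∩ Metric.thickening (2 * h) K) :=
    hΩm.inter Metric.isOpen_thickening.measurableSet
  have hg := (isDistribGradient_distribGrad hv).linear hv.1 hw.1
    (isDistribGradient_distribGrad hw) 1 (-1)
  have h1 := lintegral_trace_flat_le hΩ hc hbd (hv.linear hw 1 (-1)).1 hg hu hε0 hε1 hK hKu hh hKh
  have htr : ∀ᵐ b ∂((μH[1] : Measure Plane).restrict K),
      trace Ω (fun x => 1 * v x + -1 * w x) b = trace Ω v b - trace Ω w b := by
    filter_upwards [ae_mono (Measure.restrict_mono hKF le_rfl)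
      (ae_trace_linear hΩ hc hbd hv hw 1 (-1))] with b hb
    rw [hb]; ring
  rw [lintegral_congr_ae (htr.mono fun b hb => by beta_reduce; rw [hb] :
    (fun b => ‖trace Ω (fun x => 1 * v x + -1 * w x) b‖ₑ) =ᵐ[_]
      fun b => ‖trace Ω v b - trace Ω w b‖ₑ)] at h1
  refine h1.trans ?_
  have hvar : ((1 : ℝ) • distribGrad Ω v + (-1 : ℝ) • distribGrad Ω w).variation
      ≤ (distribGrad Ω v).variation + (distribGrad Ω w).variation := by
    have e : (-1 : ℝ) • distribGrad Ω w = -distribGrad Ω w := by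
      ext A hA i
      simp
    rw [one_smul, e, ← sub_eq_add_neg]
    exact VectorMeasure.variation_sub_le
  gcongr
  · rw [one_smul] at hvar ⊢
    exact (hvar _).trans (add_le_add (variation_distribGrad_le hΩm v hVm inter_subset_left)
      (variation_distribGrad_le hΩm w hVm inter_subset_left))
  · exact le_of_eq (by congr 1; ring)

theorem aemeasurable_boundary_integrand {Ω : Set Plane} (hΩ : IsOpen Ω) (hc : Convex ℝ Ω)
    (hbd : Bornology.IsBounded Ω) {φ : Plane → ℝ} (hφ : ContinuousOn φ (frontier Ω))
    {ψ : Plane → ℝ} (hψ : MemBV Ω ψ) :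
    AEMeasurable (fun x => ENNReal.ofReal |trace Ω ψ x - φ x|)
      ((μH[1] : Measure Plane).restrict (frontier Ω)) := by
  have h1 := (aemeasurable_trace hΩ hc hbd hψ).sub
    (hφ.aemeasurable isClosed_frontier.measurableSet (μ := μH[1]))
  exact (h1.norm.ennreal_ofReal)

/-- In the strip `W h` along the pieces, passing from the trace of `v k` to that of `ψ` costs the
areas of both functions there. On the inner set `U h` the area is lower semicontinuous. These sets
are disjoint, so both contributions of `v k` fit into its total area. What remains is the area of
`ψ` in the strip, which vanishes with `h`. -/
theorem lintegral_flat_add_area_le {Ω : Set Plane} (hΩ : IsOpen Ω) (hc : Convex ℝ Ω)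
    (hne : Ω.Nonempty) (hbd : Bornology.IsBounded Ω) {φ : Plane → ℝ}
    (hφ : ContinuousOn φ (frontier Ω)) {ψ : Plane → ℝ} {v : ℕ → Plane → ℝ} (hψ : MemBV Ω ψ)
    (hv : ∀ k, MemBV Ω (v k)) (hlim : Tendsto (fun k => ∫ x in Ω, |v k x - ψ x|) atTop (𝓝 0))
    {C : ℝ≥0} (hC : ∀ k, boundaryArea Ω φ (v k) ≤ C) {ε : ℝ} (hε0 : 0 < ε) (hε1 : ε < 1)
    {N : ℕ} {u : Fin N → Plane} {K : Fin N → Set Plane} (hu : ∀ i, ‖u i‖ = 1)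
    (hK : ∀ i, IsCompact (K i)) (hKu : ∀ i, K i ⊆ flatPart Ω (u i) ε)
    (hKd : Pairwise (Function.onFun Disjoint K))
    (hKh : ∀ᶠ h in 𝓝[>] (0 : ℝ), (∀ i, ∀ b ∈ K i, b - (2 * h) • u i ∈ Ω) ∧
        Pairwise (Function.onFun Disjoint fun i => Metric.thickening (2 * h) (K i))) :
    (∫⁻ x in ⋃ i, K i, ENNReal.ofReal |trace Ω ψ x - φ x| ∂μH[1]) + area Ω ψ
      ≤ ENNReal.ofReal (Real.sqrt (1 - ε ^ 2))⁻¹ * C := by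
  set c : ℝ≥0∞ := ENNReal.ofReal (Real.sqrt (1 - ε ^ 2))⁻¹ with hcdef
  have hc1 : 1 ≤ c := by
    rw [hcdef, ← ENNReal.ofReal_one]
    refine ENNReal.ofReal_le_ofReal ((one_le_inv₀ (Real.sqrt_pos.2 (by nlinarith))).2 ?_)
    rw [Real.sqrt_le_one]
    nlinarith
  have hct : c ≠ ⊤ := ENNReal.ofReal_ne_top
  have hKF i : K i ⊆ frontier Ω := fun b hb => (hKu i hb).1
  have hKm i : MeasurableSet (K i) := (hK i).measurableSet
  have hFc : frontier Ω ⊆ Ωᶜ := fun b hb h => by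
    rw [frontier, hΩ.interior_eq] at hb
    exact hb.2 h
  have hΩm := hΩ.measurableSet
  have hfin := frontier_finite_restrict hΩ hc hbd (K := frontier Ω) le_rfl
  have hcne : (Ωᶜ : Set Plane).Nonempty := by
    by_contra h
    rw [not_nonempty_iff_eq_empty, compl_empty_iff] at h
    rw [h] at hbd
    exact NormedSpace.unbounded_univ ℝ Plane hbd
  set U : ℝ → Set Plane := fun h => {x | 2 * h < Metric.infDist x Ωᶜ} with hU
  have hUo h : IsOpen (U h) := isOpen_lt continuous_const (Metric.continuous_infDist_pt _)
  have hUΩ {h : ℝ} (hh : 0 < h) : U h ⊆ Ω := fun x hx => by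
    by_contra hxΩ
    have h1 : 2 * h < Metric.infDist x Ωᶜ := hx
    rw [Metric.infDist_zero_of_mem (show x ∈ Ωᶜ from hxΩ)] at h1
    linarith
  set W : ℝ → Set Plane := fun h => ⋃ i, Ω ∩ Metric.thickening (2 * h) (K i) with hW
  have hWo h : IsOpen (W h) := isOpen_iUnion fun i => hΩ.inter Metric.isOpen_thickening
  have hUW h : Disjoint (W h) (U h) := by
    refine Set.disjoint_left.2 fun x hx hx' => ?_
    obtain ⟨i, hi⟩ := mem_iUnion.1 hx
    obtain ⟨b, hb, hxb⟩ := Metric.mem_thickening_iff.1 hi.2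
    have h1 : 2 * h < Metric.infDist x Ωᶜ := hx'
    linarith [Metric.infDist_le_dist_of_mem (x := x) (hFc (hKF i hb))]
  set f : (Plane → ℝ) → Plane → ℝ≥0∞ := fun w x => ENNReal.ofReal |trace Ω w x - φ x| with hf
  have hfm {w : Plane → ℝ} (hw : MemBV Ω w) {A : Set Plane} (hA : A ⊆ frontier Ω) :
      AEMeasurable (f w) ((μH[1] : Measure Plane).restrict A) :=
    (aemeasurable_boundary_integrand hΩ hc hbd hφ hw).mono_measure (Measure.restrict_mono hA le_rfl)
  set d : ℕ → ℝ≥0∞ := fun k => ∫⁻ x in Ω, ‖ψ x - v k x‖ₑ with hd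
  have hd0 : Tendsto d atTop (𝓝 0) := by
    have h1 : d = fun k => ENNReal.ofReal (∫ x in Ω, |v k x - ψ x|) := by
      ext k
      have := ofReal_integral_norm_eq_lintegral_enorm ((hv k).1.sub hψ.1)
      simp only [Pi.sub_apply, Real.norm_eq_abs] at this
      rw [this, hd]
      exact lintegral_congr fun x => enorm_sub_rev _ _
    rw [h1, ← ENNReal.ofReal_zero]
    exact ENNReal.tendsto_ofReal hlim
  have hAtop w (hw : MemBV Ω w) {A : Set Plane} (hA : A ⊆ Ω) : areaMeasure Ω w A < ⊤ :=
    areaMeasure_lt_top hΩ hbd hw hA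
  -- the estimate at a fixed scale
  have hscale : ∀ h > (0 : ℝ), (∀ i, ∀ b ∈ K i, b - (2 * h) • u i ∈ Ω) →
      Pairwise (Function.onFun Disjoint fun i => Metric.thickening (2 * h) (K i)) →
      (∫⁻ x in ⋃ i, K i, f ψ x ∂μH[1]) + areaMeasure Ω ψ (U h)
        ≤ c * C + c * areaMeasure Ω ψ (W h) := by
    intro h hh hin hdis
    have hWsum w : areaMeasure Ω w (W h)
        = ∑ i, areaMeasure Ω w (Ω ∩ Metric.thickening (2 * h) (K i)) := by
      rw [hW]
      beta_reduce
      rw [measure_iUnion (fun i j hij => (hdis hij).mono inter_subset_right inter_subset_right)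
        (fun i => hΩm.inter Metric.isOpen_thickening.measurableSet), tsum_fintype]
    have hKsum (g : Plane → ℝ≥0∞) : ∫⁻ x in ⋃ i, K i, g x ∂μH[1] = ∑ i, ∫⁻ x in K i, g x ∂μH[1] := by
      rw [lintegral_iUnion hKm hKd, tsum_fintype]
    have hk k : ∫⁻ x in ⋃ i, K i, f ψ x ∂μH[1] ≤ (∫⁻ x in frontier Ω, f (v k) x ∂μH[1])
        + c * areaMeasure Ω ψ (W h) + c * areaMeasure Ω (v k) (W h)
        + N * (c * ENNReal.ofReal h⁻¹) * d k := by
      have hi i : ∫⁻ x in K i, f ψ x ∂μH[1] ≤ (∫⁻ x in K i, f (v k) x ∂μH[1])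
          + c * (areaMeasure Ω ψ (Ω ∩ Metric.thickening (2 * h) (K i))
            + areaMeasure Ω (v k) (Ω ∩ Metric.thickening (2 * h) (K i))
            + ENNReal.ofReal h⁻¹ * d k) := by
        refine le_trans ?_ (add_le_add_right (lintegral_trace_sub_flat_le hΩ hc hbd hψ (hv k) (hu i)
          hε0.le hε1 (hK i) (hKu i) hh (hin i)) _)
        rw [← lintegral_add_left' (hfm (hv k) (hKF i))]
        refine lintegral_mono fun x => ?_
        simp only [hf]
        rw [← Real.enorm_eq_ofReal_abs, ← Real.enorm_eq_ofReal_abs]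
        have : trace Ω ψ x - φ x = (trace Ω (v k) x - φ x) + (trace Ω ψ x - trace Ω (v k) x) := by
          ring
        rw [this]
        exact enorm_add_le _ _
      calc _ = ∑ i, ∫⁻ x in K i, f ψ x ∂μH[1] := hKsum _
        _ ≤ ∑ i, _ := Finset.sum_le_sum fun i _ => hi i
        _ = (∫⁻ x in ⋃ i, K i, f (v k) x ∂μH[1]) + c * (areaMeasure Ω ψ (W h)
            + areaMeasure Ω (v k) (W h) + N * (ENNReal.ofReal h⁻¹ * d k)) := by
            rw [Finset.sum_add_distrib, ← hKsum, ← Finset.mul_sum, Finset.sum_add_distrib,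
              Finset.sum_add_distrib, ← hWsum, ← hWsum]
            simp
        _ ≤ (∫⁻ x in frontier Ω, f (v k) x ∂μH[1]) + c * (areaMeasure Ω ψ (W h)
            + areaMeasure Ω (v k) (W h) + N * (ENNReal.ofReal h⁻¹ * d k)) := by
            gcongr
            exact iUnion_subset hKF
        _ = _ := by ring
    have hWU k : areaMeasure Ω (v k) (W h) + areaMeasure Ω (v k) (U h) ≤ area Ω (v k) := by
      rw [area_eq_areaMeasure hΩm, ← measure_union (hUW h) (hUo h).measurableSet]
      exact measure_mono (union_subset (iUnion_subset fun i => inter_subset_left) (hUΩ hh))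
    refine ENNReal.le_of_forall_pos_le_add fun η hη _ => ?_
    have hη2 : (0 : ℝ) < η / 2 := by positivity
    have hev1 := eventually_areaMeasure_ge hΩ hbd hψ hv hlim (hUo h) (hUΩ hh) hη2
    have hev2 : ∀ᶠ k in atTop, N * (c * ENNReal.ofReal h⁻¹) * d k ≤ ENNReal.ofReal (η / 2) := by
      have : Tendsto (fun k => N * (c * ENNReal.ofReal h⁻¹) * d k) atTop (𝓝 0) := by
        have := ENNReal.Tendsto.const_mul (a := N * (c * ENNReal.ofReal h⁻¹)) hd0
          (Or.inr (by finiteness))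
        rwa [mul_zero] at this
      exact this.eventually (ge_mem_nhds (by simpa using hη))
    obtain ⟨k, hk1, hk2⟩ := (hev1.and hev2).exists
    have hk1' : areaMeasure Ω ψ (U h) ≤ areaMeasure Ω (v k) (U h) + ENNReal.ofReal (η / 2) := by
      have a1 := (hAtop ψ hψ (hUΩ hh)).ne
      have a2 := (hAtop (v k) (hv k) (hUΩ hh)).ne
      rw [← ENNReal.ofReal_toReal a1, ← ENNReal.ofReal_toReal a2,
        ← ENNReal.ofReal_add ENNReal.toReal_nonneg hη2.le]
      exact ENNReal.ofReal_le_ofReal (by linarith)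
    set B := ∫⁻ x in frontier Ω, f (v k) x ∂μH[1] with hB
    calc (∫⁻ x in ⋃ i, K i, f ψ x ∂μH[1]) + areaMeasure Ω ψ (U h)
        ≤ (B + c * areaMeasure Ω ψ (W h) + c * areaMeasure Ω (v k) (W h) + ENNReal.ofReal (η / 2))
          + (areaMeasure Ω (v k) (U h) + ENNReal.ofReal (η / 2)) :=
          add_le_add ((hk k).trans (add_le_add_right hk2 _)) hk1'
      _ ≤ (c * B + c * areaMeasure Ω ψ (W h) + c * areaMeasure Ω (v k) (W h)
          + ENNReal.ofReal (η / 2)) + (c * areaMeasure Ω (v k) (U h) + ENNReal.ofReal (η / 2)) := by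
          gcongr
          · exact le_mul_of_one_le_left' hc1
          · exact le_mul_of_one_le_left' hc1
      _ = c * (areaMeasure Ω (v k) (W h) + areaMeasure Ω (v k) (U h) + B)
          + c * areaMeasure Ω ψ (W h) + (ENNReal.ofReal (η / 2) + ENNReal.ofReal (η / 2)) := by ring
      _ ≤ c * C + c * areaMeasure Ω ψ (W h) + η := by
          rw [← ENNReal.ofReal_add hη2.le hη2.le, add_halves, ENNReal.ofReal_coe_nnreal]
          gcongr
          exact (add_le_add_left (hWU k) _).trans (hC k)
  -- the scale tends to zero
  set hs : ℕ → ℝ := fun j => ((j : ℝ) + 1)⁻¹ with hhs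
  have hs0 j : 0 < hs j := by positivity
  have hsa : Antitone hs := fun i j hij => by
    simp only [hhs]
    gcongr
  have hst0 : Tendsto hs atTop (𝓝 0) := tendsto_inv_atTop_zero.comp
      (tendsto_atTop_add_const_right _ _ tendsto_natCast_atTop_atTop)
  have hst : Tendsto hs atTop (𝓝[>] 0) :=
    tendsto_nhdsWithin_iff.2 ⟨hst0, Eventually.of_forall hs0⟩
  -- The sets `Ω \ U (hs j)` decrease to the empty set, and the area measure of `ψ` is finite.
  have hvan : Tendsto (fun j => areaMeasure Ω ψ (Ω \ U (hs j))) atTop (𝓝 0) := by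
    have h1 := tendsto_measure_iInter_atTop (μ := areaMeasure Ω ψ) (s := fun j => Ω \ U (hs j))
      (fun j => (hΩm.diff (hUo _).measurableSet).nullMeasurableSet)
      (fun i j hij => sdiff_subset_sdiff_right fun x (hx : 2 * hs i < _) =>
        show 2 * hs j < _ by linarith [hsa hij])
      ⟨0, (hAtop ψ hψ sdiff_subset).ne⟩
    have h2 : ⋂ j, Ω \ U (hs j) = ∅ := by
      rw [eq_empty_iff_forall_notMem]
      intro x hx
      have hxΩ : x ∈ Ω := (mem_iInter.1 hx 0).1
      have hpos : 0 < Metric.infDist x Ωᶜ :=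
        (hΩ.isClosed_compl.notMem_iff_infDist_pos hcne).1 (by simpa using hxΩ)
      have h3 := (hst0.const_mul 2).eventually (gt_mem_nhds (by simpa using hpos))
      obtain ⟨j, hj⟩ := h3.exists
      exact (mem_iInter.1 hx j).2 hj
    rwa [h2, measure_empty] at h1
  rw [area_eq_areaMeasure hΩm]
  have hlim2 : Tendsto (fun j => c * C + (c + 1) * areaMeasure Ω ψ (Ω \ U (hs j))) atTop
      (𝓝 (c * C + (c + 1) * 0)) :=
    Tendsto.const_add _ (ENNReal.Tendsto.const_mul hvan (Or.inr (by finiteness)))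
  rw [mul_zero, add_zero] at hlim2
  refine ge_of_tendsto hlim2 ?_
  filter_upwards [hst.eventually hKh] with j hj
  have h1 := hscale (hs j) (hs0 j) hj.1 hj.2
  have h2 : areaMeasure Ω ψ Ω ≤ areaMeasure Ω ψ (U (hs j)) + areaMeasure Ω ψ (Ω \ U (hs j)) := by
    refine (measure_mono fun x hx => ?_).trans (measure_union_le _ _)
    by_cases h : x ∈ U (hs j)
    · exact Or.inl h
    · exact Or.inr ⟨hx, h⟩
  have h3 : areaMeasure Ω ψ (W (hs j)) ≤ areaMeasure Ω ψ (Ω \ U (hs j)) :=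
    measure_mono fun x hx => ⟨(iUnion_subset fun i => inter_subset_left : W (hs j) ⊆ Ω) hx,
      Set.disjoint_left.1 (hUW _) hx⟩
  calc (∫⁻ x in ⋃ i, K i, f ψ x ∂μH[1]) + areaMeasure Ω ψ Ω
      ≤ ((∫⁻ x in ⋃ i, K i, f ψ x ∂μH[1]) + areaMeasure Ω ψ (U (hs j)))
        + areaMeasure Ω ψ (Ω \ U (hs j)) := by rw [add_assoc]; gcongr
    _ ≤ (c * C + c * areaMeasure Ω ψ (Ω \ U (hs j))) + areaMeasure Ω ψ (Ω \ U (hs j)) := by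
        exact add_le_add_left (h1.trans (by gcongr)) _
    _ = _ := by ring

/-- Lower semicontinuity of the functional with respect to convergence in `L¹`. -/
theorem boundaryArea_le_of_tendsto {Ω : Set Plane} (hΩ : IsOpen Ω) (hc : Convex ℝ Ω)
    (hne : Ω.Nonempty) (hbd : Bornology.IsBounded Ω) {φ : Plane → ℝ}
    (hφ : ContinuousOn φ (frontier Ω)) {ψ : Plane → ℝ} {v : ℕ → Plane → ℝ} (hψ : MemBV Ω ψ)
    (hv : ∀ k, MemBV Ω (v k)) (hlim : Tendsto (fun k => ∫ x in Ω, |v k x - ψ x|) atTop (𝓝 0))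
    {C : ℝ≥0} (hC : ∀ k, boundaryArea Ω φ (v k) ≤ C) : boundaryArea Ω φ ψ ≤ C := by
  have hfin := frontier_finite_restrict hΩ hc hbd (K := frontier Ω) le_rfl
  have hAt : area Ω ψ ≠ ⊤ := by
    rw [area_eq_areaMeasure hΩ.measurableSet]
    exact (areaMeasure_lt_top hΩ hbd hψ le_rfl).ne
  set f : Plane → ℝ≥0∞ := fun x => ENNReal.ofReal |trace Ω ψ x - φ x| with hf
  have hε : ∀ ε ∈ Ioo (0 : ℝ) 1, boundaryArea Ω φ ψ
      ≤ ENNReal.ofReal (Real.sqrt (1 - ε ^ 2))⁻¹ * C := by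
    intro ε hε
    set c : ℝ≥0∞ := ENNReal.ofReal (Real.sqrt (1 - ε ^ 2))⁻¹
    -- The boundary integrand is not known to be integrable, so it is first replaced by a simple
    -- function below it. This one is bounded, and the part of the frontier missed by the flat
    -- pieces then costs at most `η`.
    have hsimple (g : SimpleFunc Plane ℝ≥0) (hg : ∀ x, (g x : ℝ≥0∞) ≤ f x) :
        (∫⁻ x in frontier Ω, g x ∂μH[1]) + area Ω ψ ≤ c * C := by
      obtain ⟨B, hB⟩ : ∃ B : ℝ≥0, ∀ x, g x ≤ B := by
        obtain ⟨B, hB⟩ := g.range.exists_le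
        exact ⟨B, fun x => hB _ (g.mem_range_self x)⟩
      refine ENNReal.le_of_forall_pos_le_add fun η hη _ => ?_
      have hδ : (η : ℝ≥0∞) / (B + 1) ≠ 0 := (ENNReal.div_pos (by simpa using hη.ne')
        (by finiteness)).ne'
      obtain ⟨N, u, K, hu, hK, hKu, hKd, hKδ, hKh⟩ :=
        exists_flat_decomposition hΩ hc hne hbd hε.1 hε.2 hδ
      have h1 := lintegral_flat_add_area_le hΩ hc hne hbd hφ hψ hv hlim hC hε.1 hε.2 hu hK hKu
        hKd hKh
      have h2 : ∫⁻ x in frontier Ω, g x ∂μH[1] ≤ (∫⁻ x in ⋃ i, K i, f x ∂μH[1]) + η := by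
        calc ∫⁻ x in frontier Ω, g x ∂μH[1]
            ≤ ∫⁻ x in (⋃ i, K i) ∪ (frontier Ω \ ⋃ i, K i), g x ∂μH[1] :=
              lintegral_mono_set fun x hx => by
                by_cases h : x ∈ ⋃ i, K i
                · exact Or.inl h
                · exact Or.inr ⟨hx, h⟩
          _ ≤ (∫⁻ x in ⋃ i, K i, g x ∂μH[1]) + ∫⁻ x in frontier Ω \ ⋃ i, K i, g x ∂μH[1] :=
              lintegral_union_le _ _ _
          _ ≤ (∫⁻ x in ⋃ i, K i, f x ∂μH[1]) + ∫⁻ _x in frontier Ω \ ⋃ i, K i, B ∂μH[1] := by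
              gcongr with x x
              · exact hg x
              · exact hB x
          _ ≤ (∫⁻ x in ⋃ i, K i, f x ∂μH[1]) + (B + 1) * (η / (B + 1)) := by
              rw [setLIntegral_const]
              gcongr
              exact le_self_add
          _ = _ := by rw [ENNReal.mul_div_cancel (by simp) (by finiteness)]
      calc _ ≤ ((∫⁻ x in ⋃ i, K i, f x ∂μH[1]) + η) + area Ω ψ := by gcongr
        _ = ((∫⁻ x in ⋃ i, K i, f x ∂μH[1]) + area Ω ψ) + η := by ring
        _ ≤ _ := by gcongr
    have hle : area Ω ψ ≤ c * C := by
      have := hsimple 0 (by simp)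
      simpa using this
    -- The finite area is moved to the right side, so that the supremum over simple functions
    -- applies to the boundary integral alone.
    have hint : ∫⁻ x in frontier Ω, f x ∂μH[1] ≤ c * C - area Ω ψ := by
      rw [lintegral_eq_nnreal]
      refine iSup₂_le fun g hg => ENNReal.le_sub_of_add_le_right hAt ?_
      rw [← SimpleFunc.lintegral_eq_lintegral]
      exact hsimple g hg
    calc boundaryArea Ω φ ψ ≤ area Ω ψ + (c * C - area Ω ψ) := by
          rw [boundaryArea]
          gcongr
      _ = c * C := add_tsub_cancel_of_le hle
  have hlim2 : Tendsto (fun ε : ℝ => ENNReal.ofReal (Real.sqrt (1 - ε ^ 2))⁻¹ * C) (𝓝[>] 0)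
      (𝓝 (ENNReal.ofReal (Real.sqrt (1 - 0 ^ 2))⁻¹ * C)) := by
    refine ENNReal.Tendsto.mul_const (ENNReal.tendsto_ofReal ?_) (Or.inr ENNReal.coe_ne_top)
    have : ContinuousAt (fun ε : ℝ => (Real.sqrt (1 - ε ^ 2))⁻¹) 0 :=
      ContinuousAt.inv₀ (by fun_prop) (by simp)
    exact this.tendsto.mono_left nhdsWithin_le_nhds
  have h0 : ENNReal.ofReal (Real.sqrt (1 - 0 ^ 2))⁻¹ * C = C := by simp
  rw [h0] at hlim2
  refine ge_of_tendsto hlim2 ?_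
  filter_upwards [Ioo_mem_nhdsGT (one_pos : (0 : ℝ) < 1)] with ε h using hε ε h

/-! ### Convexity -/

theorem boundaryArea_convex {Ω : Set Plane} (hΩ : IsOpen Ω) (hc : Convex ℝ Ω)
    (hbd : Bornology.IsBounded Ω) {φ : Plane → ℝ}
    (hφ : ContinuousOn φ (frontier Ω)) {u v : Plane → ℝ} (hu : MemBV Ω u)
    (hv : MemBV Ω v) {a b : ℝ} (ha : 0 ≤ a) (hb : 0 ≤ b) (hab : a + b = 1) :
    boundaryArea Ω φ (fun x => a * u x + b * v x)
      ≤ ENNReal.ofReal a * boundaryArea Ω φ u + ENNReal.ofReal b * boundaryArea Ω φ v := by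
  have hA {w : Plane → ℝ} (hw : MemBV Ω w) :
      area Ω w = ENNReal.ofReal (areaMeasure Ω w Ω).toReal := by
    rw [ENNReal.ofReal_toReal (areaMeasure_lt_top hΩ hbd hw le_rfl).ne,
      area_eq_areaMeasure hΩ.measurableSet]
  have h1 : area Ω (fun x => a * u x + b * v x)
      ≤ ENNReal.ofReal a * area Ω u + ENNReal.ofReal b * area Ω v := by
    rw [hA (hu.linear hv a b), hA hu, hA hv, ← ENNReal.ofReal_mul ha, ← ENNReal.ofReal_mul hb,
      ← ENNReal.ofReal_add (by positivity) (by positivity)]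
    exact ENNReal.ofReal_le_ofReal (areaMeasure_convex hΩ hbd hu hv ha hb hab)
  have h2 : ∫⁻ x in frontier Ω,
        ENNReal.ofReal |trace Ω (fun x => a * u x + b * v x) x - φ x| ∂μH[1]
      ≤ ENNReal.ofReal a * (∫⁻ x in frontier Ω, ENNReal.ofReal |trace Ω u x - φ x| ∂μH[1])
        + ENNReal.ofReal b * ∫⁻ x in frontier Ω, ENNReal.ofReal |trace Ω v x - φ x| ∂μH[1] := by
    rw [← lintegral_const_mul' _ _ ENNReal.ofReal_ne_top,
      ← lintegral_const_mul' _ _ ENNReal.ofReal_ne_top,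
      ← lintegral_add_left' ((aemeasurable_boundary_integrand hΩ hc hbd hφ hu).const_mul _)]
    refine lintegral_mono_ae ?_
    filter_upwards [ae_trace_linear hΩ hc hbd hu hv a b] with x hx
    rw [hx, ← ENNReal.ofReal_mul ha, ← ENNReal.ofReal_mul hb,
      ← ENNReal.ofReal_add (by positivity) (by positivity)]
    refine ENNReal.ofReal_le_ofReal ?_
    have e : a * trace Ω u x + b * trace Ω v x - φ x
        = a * (trace Ω u x - φ x) + b * (trace Ω v x - φ x) := by
      linear_combination (φ x) * hab
    rw [e]
    refine (abs_add_le _ _).trans ?_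
    rw [abs_mul, abs_mul, abs_of_nonneg ha, abs_of_nonneg hb]
  calc _ ≤ _ := add_le_add h1 h2
    _ = _ := by simp only [boundaryArea]; ring

/-! ### Truncation -/

/-- `T` is a primitive of a bump function equal to one on `[-M, M]`. Smoothness allows an elementary
chain rule for mollified functions, which a sharp truncation would not. -/
theorem exists_smooth_truncation (M : ℝ) (hM : 0 < M) :
    ∃ T : ℝ → ℝ, ContDiff ℝ ∞ T ∧ (∀ x, |deriv T x| ≤ 1) ∧ (∀ x ∈ Icc 0 M, T x = x) ∧
      ∃ B, ∀ x, |T x| ≤ B := by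
  let χ : ContDiffBump (0 : ℝ) := ⟨M, M + 1, hM, by linarith⟩
  have hχc : Continuous χ := χ.continuous
  have hχi : Integrable χ := χ.integrable
  set T : ℝ → ℝ := fun x => ∫ t in (0 : ℝ)..x, χ t with hT
  have hd x : HasDerivAt T (χ x) x :=
    intervalIntegral.integral_hasDerivAt_right (hχc.intervalIntegrable _ _)
      (hχc.stronglyMeasurableAtFilter _ _) hχc.continuousAt
  have hdT : deriv T = χ := funext fun x => (hd x).deriv
  refine ⟨T, contDiff_infty_iff_deriv.2 ⟨fun x => (hd x).differentiableAt, ?_⟩, fun x => ?_,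
    fun x hx => ?_, ∫ t, ‖χ t‖, fun x => ?_⟩
  · rw [hdT]; exact χ.contDiff
  · rw [hdT, abs_of_nonneg χ.nonneg]; exact χ.le_one
  · rw [hT]
    beta_reduce
    rw [intervalIntegral.integral_congr (g := fun _ => (1 : ℝ))]
    · simp
    · intro t ht
      rw [uIcc_of_le hx.1] at ht
      refine χ.one_of_mem_closedBall ?_
      rw [Metric.mem_closedBall, Real.dist_eq, sub_zero, abs_of_nonneg ht.1]
      exact ht.2.trans hx.2
  · rw [hT, ← Real.norm_eq_abs]
    exact (intervalIntegral.norm_integral_le_integral_norm_uIoc).trans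
      (setIntegral_le_integral hχi.norm (ae_of_all _ fun _ => norm_nonneg _))

/-- The divergence of the last two components of a field. -/
def fieldDiv (G : Plane → Space) (x : Plane) : ℝ :=
  fderiv ℝ (fun y => G y 1) x (EuclideanSpace.single 0 1)
    + fderiv ℝ (fun y => G y 2) x (EuclideanSpace.single 1 1)

theorem gradient_apply (η : Plane → ℝ) (x : Plane) (j : Fin 2) :
    gradient η x j = fderiv ℝ η x (EuclideanSpace.single j 1) := by
  rw [← inner_gradient, EuclideanSpace.inner_single_right]
  simp

theorem IsTestField.continuous_fieldDiv {U : Set Plane} {G : Plane → Space}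
    (hG : IsTestField U G) : Continuous (fieldDiv G) :=
  (((hG.contDiff_apply 1).continuous_fderiv (by simp)).clm_apply continuous_const).add
    (((hG.contDiff_apply 2).continuous_fderiv (by simp)).clm_apply continuous_const)

theorem IsTestField.fieldDiv_eq_zero {U : Set Plane} {G : Plane → Space}
    (hG : IsTestField U G) {x : Plane} (hx : x ∉ tsupport G) : fieldDiv G x = 0 := by
  have h (i : Fin 3) : fderiv ℝ (fun y => G y i) x = 0 := by
    have : x ∉ tsupport (fun y => G y i) := fun h => hx (closure_mono (fun y hy => by
      simp only [Function.mem_support] at hy ⊢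
      exact fun h0 => hy (by rw [h0]; rfl)) h)
    exact image_eq_zero_of_notMem_tsupport (fun h' => this (tsupport_fderiv_subset ℝ h'))
  simp [fieldDiv, h]

theorem IsTestField.hasCompactSupport_fieldDiv {U : Set Plane} {G : Plane → Space}
    (hG : IsTestField U G) : HasCompactSupport (fieldDiv G) :=
  HasCompactSupport.intro hG.hasCompactSupport fun _ hx => hG.fieldDiv_eq_zero hx

theorem pairing_eq_integral {Ω : Set Plane} {v : Plane → ℝ}
    (hv : IntegrableOn v Ω) {G : Plane → Space} (hG : IsTestField Ω G) :
    pairing Ω v G = (∫ x, G x 0) + ∫ x, v x * fieldDiv G x := by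
  have h (i : Fin 3) (j : Fin 2) : (∫ x in Ω, v x • gradient (fun y => G y i) x) j
      = ∫ x in Ω, v x * fderiv ℝ (fun y => G y i) x (EuclideanSpace.single j 1) := by
    rw [integral_plane_apply (integrable_smul_gradient hv (hG.contDiff_apply i)
      (hG.hasCompactSupport_apply i))]
    refine integral_congr_ae (ae_of_all _ fun x => ?_)
    beta_reduce
    rw [PiLp.smul_apply, gradient_apply, smul_eq_mul]
  have hint (i : Fin 3) (j : Fin 2) : IntegrableOn (fun x =>
      v x * fderiv ℝ (fun y => G y i) x (EuclideanSpace.single j 1)) Ω := by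
    have hcont : Continuous fun x => fderiv ℝ (fun y => G y i) x (EuclideanSpace.single j 1) :=
      ((hG.contDiff_apply i).continuous_fderiv (by simp)).clm_apply continuous_const
    obtain ⟨B, hB⟩ := exists_gradient_bound (hG.contDiff_apply i) (hG.hasCompactSupport_apply i)
    refine hv.mul_bdd (c := B) hcont.aestronglyMeasurable (ae_of_all _ fun x => ?_)
    rw [← gradient_apply]
    exact (PiLp.norm_apply_le _ _).trans (hB x)
  rw [pairing, h, h, add_assoc, ← integral_add (hint 1 0) (hint 2 1),
    setIntegral_eq_integral_of_forall_compl_eq_zero, ← setIntegral_eq_integral_of_forall_compl_eq_zero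
      (s := Ω) (f := fun x => v x * fieldDiv G x)]
  · congr 1
    refine integral_congr_ae (ae_of_all _ fun x => ?_)
    simp only [fieldDiv]
    ring
  · intro x hx
    rw [hG.fieldDiv_eq_zero fun h => hx (hG.tsupport_subset h), mul_zero]
  · intro x hx
    rw [hG.apply_eq_zero hx]; rfl

/-! ### Mollification and the chain rule -/

theorem IsTestField.translate {U Ω : Set Plane} {G : Plane → Space} (hG : IsTestField U G)
    {z : Plane} (hz : ∀ x ∈ tsupport G, x - z ∈ Ω) : IsTestField Ω fun x => G (x + z) where
  contDiff := hG.contDiff.comp (by fun_prop)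
  hasCompactSupport := hG.hasCompactSupport.comp_homeomorph (Homeomorph.addRight z)
  tsupport_subset := by
    have : tsupport (fun x => G (x + z)) = (Homeomorph.addRight z) ⁻¹' tsupport G :=
      tsupport_comp_eq_preimage G (Homeomorph.addRight z)
    rw [this]
    intro x hx
    have := hz _ hx
    simpa using this
  norm_le x := hG.norm_le _

theorem fieldDiv_translate (G : Plane → Space) (z x : Plane) :
    fieldDiv (fun x => G (x + z)) x = fieldDiv G (x + z) := by
  unfold fieldDiv
  rw [fderiv_comp_add_right (f := fun y => G y 1), fderiv_comp_add_right (f := fun y => G y 2)]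

/-- A mollification is an average of translates, and the translation can be moved to the field. Each
translated field is still admissible in `Ω`, so every pairing in the average is at most the area of
`v`. -/
theorem pairing_mollify_le {Ω : Set Plane} (hΩ : IsOpen Ω) (hb : Bornology.IsBounded Ω)
    {v : Plane → ℝ} (hvi : Integrable v) (hv : MemBV Ω v) (β : ContDiffBump (0 : Plane))
    {w : Plane → ℝ} (hw : ∀ x, w x = ∫ z, β.normed volume z * v (x - z)) (hwi : IntegrableOn w Ω)
    {G : Plane → Space} (hG : IsTestField Ω G)
    (hGz : ∀ x ∈ tsupport G, ∀ z ∈ Metric.ball (0 : Plane) β.rOut, x - z ∈ Ω) :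
    pairing Ω w G ≤ (areaMeasure Ω v Ω).toReal := by
  set A := (areaMeasure Ω v Ω).toReal
  set b : Plane → ℝ := β.normed volume with hbdef
  have hbi : Integrable b := β.integrable_normed
  have hb1 : ∫ z, b z = 1 := β.integral_normed
  obtain ⟨B, hB⟩ := hG.continuous_fieldDiv.bounded_above_of_compact_support
    hG.hasCompactSupport_fieldDiv
  have hprod : Integrable (fun p : Plane × Plane => b p.2 * v (p.1 - p.2) * fieldDiv G p.1)
      (volume.prod volume) := by
    have h1 := Integrable.convolution_integrand (ContinuousLinearMap.lsmul ℝ ℝ)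
      (μ := (volume : Measure Plane)) (ν := volume) hbi hvi
    refine Integrable.mul_bdd (c := B) h1 ?_ (ae_of_all _ fun p => hB p.1)
    exact (hG.continuous_fieldDiv.comp continuous_fst).aestronglyMeasurable
  have e1 : ∫ x, w x * fieldDiv G x = ∫ z, b z * ∫ x, v (x - z) * fieldDiv G x := by
    calc ∫ x, w x * fieldDiv G x = ∫ x, ∫ z, b z * v (x - z) * fieldDiv G x := by
          refine integral_congr_ae (ae_of_all _ fun x => ?_)
          beta_reduce
          rw [hw, integral_mul_const]
      _ = ∫ z, ∫ x, b z * v (x - z) * fieldDiv G x := integral_integral_swap hprod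
      _ = _ := by
          refine integral_congr_ae (ae_of_all _ fun z => ?_)
          beta_reduce
          rw [← integral_const_mul]
          simp_rw [mul_assoc]
  have hi2 : Integrable fun z => b z * ∫ x, v (x - z) * fieldDiv G x := by
    have := hprod.integral_prod_right
    refine this.congr (ae_of_all _ fun z => ?_)
    beta_reduce
    rw [← integral_const_mul]
    simp_rw [mul_assoc]
  have e2 : ∫ x, G x 0 = ∫ z, b z * ∫ x, G x 0 := by rw [integral_mul_const, hb1, one_mul]
  rw [pairing_eq_integral hwi hG, e1, e2, ← integral_add (hbi.mul_const _) hi2]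
  calc _ ≤ ∫ z, b z * A := by
        refine integral_mono ((hbi.mul_const _).add hi2) (hbi.mul_const _) fun z => ?_
        beta_reduce
        rw [← mul_add]
        by_cases hz : b z = 0
        · simp [hz]
        have hz' : z ∈ Metric.ball (0 : Plane) β.rOut := by
          rw [← β.support_normed_eq (μ := volume)]; exact hz
        have hGt : IsTestField Ω fun x => G (x + z) := hG.translate fun x hx => hGz x hx z hz'
        refine mul_le_mul_of_nonneg_left ?_ (β.nonneg_normed z)
        have h3 := pairing_le hΩ hb hv hΩ subset_rfl hGt
        rw [pairing_eq_integral hvi.integrableOn hGt] at h3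
        simp_rw [fieldDiv_translate] at h3
        rw [integral_add_right_eq_self (fun x => G x 0) z,
          ← integral_add_right_eq_self (fun x => v (x - z) * fieldDiv G x) z] at *
        simpa using h3
    _ = A := by rw [integral_mul_const, hb1, one_mul]

theorem contDiff_deriv_of_contDiff {T : ℝ → ℝ} (hT : ContDiff ℝ ∞ T) : ContDiff ℝ ∞ (deriv T) :=
  (contDiff_infty_iff_deriv.1 hT).2

theorem integral_fderiv_eq_zero {F : Plane → ℝ} (hF : ContDiff ℝ ∞ F) (hFc : HasCompactSupport F)
    (e : Plane) : ∫ x, fderiv ℝ F x e = 0 := by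
  have hc : Continuous fun x => fderiv ℝ F x e :=
    (hF.continuous_fderiv (by simp)).clm_apply continuous_const
  have hcs : HasCompactSupport fun x => fderiv ℝ F x e :=
    (hFc.fderiv ℝ).comp_left (g := fun L : Plane →L[ℝ] ℝ => L e) rfl
  have := integral_mul_fderiv_eq_neg_fderiv_mul_of_integrable (μ := (volume : Measure Plane))
    (f := fun _ => (1 : ℝ)) (g := F) (v := e) (by simp)
    (by simpa using hc.integrable_of_hasCompactSupport hcs)
    (by simpa using hF.continuous.integrable_of_hasCompactSupport hFc)
    (fun x _ => by fun_prop) (fun x _ => hF.differentiable (by simp) x)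
  simpa using this

/-- The difference of the integrands is the derivative of the compactly supported function `T(w) η -
w T'(w) η`. -/
theorem integral_comp_mul_fderiv {T : ℝ → ℝ} (hT : ContDiff ℝ ∞ T) {w η : Plane → ℝ}
    (hw : ContDiff ℝ ∞ w) (hη : ContDiff ℝ ∞ η) (hηc : HasCompactSupport η) (e : Plane) :
    ∫ x, T (w x) * fderiv ℝ η x e
      = ∫ x, w x * fderiv ℝ (fun y => deriv T (w y) * η y) x e := by
  have hT' := contDiff_deriv_of_contDiff hT
  have hTw : ContDiff ℝ ∞ fun x => T (w x) := hT.comp hw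
  have hT'w : ContDiff ℝ ∞ fun x => deriv T (w x) := hT'.comp hw
  have hG : ContDiff ℝ ∞ fun y => deriv T (w y) * η y := hT'w.mul hη
  set F : Plane → ℝ := fun x => T (w x) * η x - w x * (deriv T (w x) * η x) with hF
  have hFs : ContDiff ℝ ∞ F := (hTw.mul hη).sub (hw.mul hG)
  have hFc : HasCompactSupport F := HasCompactSupport.intro hηc fun x hx => by
    simp [hF, image_eq_zero_of_notMem_tsupport hx]
  have hne : (∞ : WithTop ℕ∞) ≠ 0 := by simp
  have hpt x : fderiv ℝ F x e
      = T (w x) * fderiv ℝ η x e - w x * fderiv ℝ (fun y => deriv T (w y) * η y) x e := by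
    have d1 : DifferentiableAt ℝ η x := hη.differentiable hne x
    have d2 : DifferentiableAt ℝ w x := hw.differentiable hne x
    have d3 : DifferentiableAt ℝ (fun y => deriv T (w y) * η y) x := hG.differentiable hne x
    have d5 : HasFDerivAt (fun x => T (w x)) (deriv T (w x) • fderiv ℝ w x) x :=
      ((hT.differentiable hne (w x)).hasDerivAt).comp_hasFDerivAt x d2.hasFDerivAt
    have d6 : HasFDerivAt F _ x :=
      (d5.mul d1.hasFDerivAt).sub (d2.hasFDerivAt.mul d3.hasFDerivAt)
    rw [d6.fderiv]
    simp only [sub_apply, add_apply, smul_apply, smul_eq_mul]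
    ring
  have hint {f g : Plane → ℝ} (hf : ContDiff ℝ ∞ f) (hg : ContDiff ℝ ∞ g)
      (hgc : HasCompactSupport g) : Integrable fun x => f x * fderiv ℝ g x e := by
    refine (hf.continuous.mul ((hg.continuous_fderiv (by simp)).clm_apply
      continuous_const)).integrable_of_hasCompactSupport ?_
    exact HasCompactSupport.mul_left ((hgc.fderiv ℝ).comp_left
      (g := fun L : Plane →L[ℝ] ℝ => L e) rfl)
  have h0 := integral_fderiv_eq_zero hFs hFc e
  simp_rw [hpt] at h0
  rw [integral_sub (hint hTw hη hηc) (hint hw hG hηc.mul_left)] at h0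
  linarith

/-- The test field obtained from `g` by the chain rule. -/
def chainField (T : ℝ → ℝ) (w : Plane → ℝ) (g : Plane → Space) (x : Plane) : Space :=
  WithLp.toLp 2 ![g x 0, deriv T (w x) * g x 1, deriv T (w x) * g x 2]

theorem IsTestField.chainField {U : Set Plane} {g : Plane → Space} (hg : IsTestField U g)
    {T : ℝ → ℝ} (hT : ContDiff ℝ ∞ T) (hT1 : ∀ x, |deriv T x| ≤ 1) {w : Plane → ℝ}
    (hw : ContDiff ℝ ∞ w) : IsTestField U (chainField T w g) := by
  have hsupp : Function.support (RelaxedArea.chainField T w g) ⊆ Function.support g := by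
    intro x hx h
    refine hx ?_
    ext i
    fin_cases i <;> simp [RelaxedArea.chainField, h]
  have hd : ContDiff ℝ ∞ fun x => deriv T (w x) := (contDiff_deriv_of_contDiff hT).comp hw
  refine ⟨contDiff_euclidean.2 fun i => ?_, hg.hasCompactSupport.mono hsupp,
    (closure_mono hsupp).trans hg.tsupport_subset, fun x => ?_⟩
  · fin_cases i
    · exact hg.contDiff_apply 0
    · exact hd.mul (hg.contDiff_apply 1)
    · exact hd.mul (hg.contDiff_apply 2)
  · refine le_trans ?_ (hg.norm_le x)
    rw [norm_space, norm_space]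
    refine Real.sqrt_le_sqrt ?_
    have h1 : deriv T (w x) ^ 2 ≤ 1 := by
      rw [← sq_abs]; exact pow_le_one₀ (abs_nonneg _) (hT1 _)
    change g x 0 ^ 2 + (deriv T (w x) * g x 1) ^ 2 + (deriv T (w x) * g x 2) ^ 2 ≤ _
    nlinarith [sq_nonneg (g x 1), sq_nonneg (g x 2)]

/-- The composition is moved from the function to the field. Since `|T'| ≤ 1` the new field still
takes values in the unit ball, so truncation cannot raise the supremum of pairings. -/
theorem pairing_comp_eq {Ω : Set Plane} {T : ℝ → ℝ} (hT : ContDiff ℝ ∞ T)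
    (hT1 : ∀ x, |deriv T x| ≤ 1) {w : Plane → ℝ} (hw : ContDiff ℝ ∞ w)
    (hwi : IntegrableOn w Ω) (hTwi : IntegrableOn (fun x => T (w x)) Ω) {g : Plane → Space}
    (hg : IsTestField Ω g) :
    pairing Ω (fun x => T (w x)) g = pairing Ω w (chainField T w g) := by
  have hG := hg.chainField hT hT1 hw
  have hd : ContDiff ℝ ∞ fun x => deriv T (w x) := (contDiff_deriv_of_contDiff hT).comp hw
  rw [pairing_eq_integral hTwi hg, pairing_eq_integral hwi hG]
  have hint {f η : Plane → ℝ} (hf : ContDiff ℝ ∞ f) (hg : ContDiff ℝ ∞ η)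
      (hgc : HasCompactSupport η) (e : Plane) : Integrable fun x => f x * fderiv ℝ η x e := by
    refine (hf.continuous.mul ((hg.continuous_fderiv (by simp)).clm_apply
      continuous_const)).integrable_of_hasCompactSupport ?_
    exact HasCompactSupport.mul_left ((hgc.fderiv ℝ).comp_left
      (g := fun L : Plane →L[ℝ] ℝ => L e) rfl)
  have hTw : ContDiff ℝ ∞ fun x => T (w x) := hT.comp hw
  congr 1
  simp only [fieldDiv, mul_add]
  rw [integral_add (hint hTw (hg.contDiff_apply 1) (hg.hasCompactSupport_apply 1) _)
      (hint hTw (hg.contDiff_apply 2) (hg.hasCompactSupport_apply 2) _),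
    integral_add (hint hw (hG.contDiff_apply 1) (hG.hasCompactSupport_apply 1) _)
      (hint hw (hG.contDiff_apply 2) (hG.hasCompactSupport_apply 2) _),
    integral_comp_mul_fderiv hT hw (hg.contDiff_apply 1) (hg.hasCompactSupport_apply 1),
    integral_comp_mul_fderiv hT hw (hg.contDiff_apply 2) (hg.hasCompactSupport_apply 2)]
  rfl

/-- The gradient of a smooth function is controlled by pairings. -/
theorem lintegral_gradient_le_of_pairing_le {Ω U : Set Plane} (hU : IsOpen U) (hUΩ : U ⊆ Ω)
    (hΩb : Bornology.IsBounded Ω) {w : Plane → ℝ} (hw : ContDiff ℝ ∞ w)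
    {A : ℝ} (hA : ∀ g, IsTestField U g → pairing Ω w g ≤ A) :
    ∫⁻ x in U, ‖gradient w x‖ₑ ≤ ENNReal.ofReal A := by
  have hcl : IsCompact (closure Ω) := hΩb.isCompact_closure
  have hgc := continuous_gradient hw
  have hwi : IntegrableOn w Ω :=
    (hw.continuous.continuousOn.integrableOn_compact hcl).mono_set subset_closure
  -- For smooth `w` the pairing is the integral of `⟨g, (1, -∇w)⟩` by parts, and the norm of this
  -- vector dominates the gradient.
  set H : Plane → Space := fun x => WithLp.toLp 2 ![1, -gradient w x 0, -gradient w x 1] with hH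
  have hHc : Continuous H := by
    refine (PiLp.continuous_toLp 2 _).comp (continuous_pi fun i => ?_)
    fin_cases i
    · exact continuous_const
    · exact ((EuclideanSpace.proj 0 : Plane →L[ℝ] ℝ).continuous.comp hgc).neg
    · exact ((EuclideanSpace.proj 1 : Plane →L[ℝ] ℝ).continuous.comp hgc).neg
  have hHi : IntegrableOn H U :=
    (hHc.continuousOn.integrableOn_compact hcl).mono_set (hUΩ.trans subset_closure)
  have hnorm x : ‖gradient w x‖ ≤ ‖H x‖ := by
    rw [norm_space, ← Real.sqrt_sq (norm_nonneg (gradient w x)), norm_sq_plane]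
    refine Real.sqrt_le_sqrt ?_
    change _ ≤ (1 : ℝ) ^ 2 + (-gradient w x 0) ^ 2 + (-gradient w x 1) ^ 2
    nlinarith
  have hint : ∫ x in U, ‖H x‖ ≤ A := by
    refine le_of_forall_pos_le_add fun ε hε => ?_
    obtain ⟨g, g1, g2, g3, g4, g5⟩ := exists_smooth_pairing hU hHi hε
    have hg : IsTestField U g := ⟨g1, g2, g3, g4⟩
    have h1 := hA g hg
    have hib (i : Fin 3) (j : Fin 2) : ∫ x, w x * fderiv ℝ (fun y => g y i) x (EuclideanSpace.single j 1)
        = -∫ x, gradient w x j * g x i := by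
      have hc1 : Continuous fun x => fderiv ℝ w x (EuclideanSpace.single j 1) :=
        (hw.continuous_fderiv (by simp)).clm_apply continuous_const
      have := integral_mul_fderiv_eq_neg_fderiv_mul_of_integrable (μ := (volume : Measure Plane))
        (f := w) (g := fun x => g x i) (v := EuclideanSpace.single j 1)
        ((hc1.mul (hg.contDiff_apply i).continuous).integrable_of_hasCompactSupport
          (hg.hasCompactSupport_apply i).mul_left)
        ((hw.continuous.mul (((hg.contDiff_apply i).continuous_fderiv (by simp)).clm_apply
          continuous_const)).integrable_of_hasCompactSupport
          (HasCompactSupport.mul_left (((hg.hasCompactSupport_apply i).fderiv ℝ).comp_left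
            (g := fun L : Plane →L[ℝ] ℝ => L (EuclideanSpace.single j 1)) rfl)))
        ((hw.continuous.mul (hg.contDiff_apply i).continuous).integrable_of_hasCompactSupport
          (hg.hasCompactSupport_apply i).mul_left)
        (fun x _ => hw.differentiable (by simp) x)
        (fun x _ => (hg.contDiff_apply i).differentiable (by simp) x)
      rw [this]
      simp_rw [gradient_apply]
    have hci (f : Plane → ℝ) (hf : Continuous f) (i : Fin 3) : Integrable fun x => f x * g x i :=
      (hf.mul (hg.contDiff_apply i).continuous).integrable_of_hasCompactSupport
          (hg.hasCompactSupport_apply i).mul_left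
    have hgcj (j : Fin 2) : Continuous fun x => gradient w x j :=
      (EuclideanSpace.proj j : Plane →L[ℝ] ℝ).continuous.comp hgc
    have hif (i : Fin 3) (j : Fin 2) : Integrable fun x =>
        w x * fderiv ℝ (fun y => g y i) x (EuclideanSpace.single j 1) :=
      (hw.continuous.mul (((hg.contDiff_apply i).continuous_fderiv (by simp)).clm_apply
          continuous_const)).integrable_of_hasCompactSupport
          (HasCompactSupport.mul_left (((hg.hasCompactSupport_apply i).fderiv ℝ).comp_left
            (g := fun L : Plane →L[ℝ] ℝ => L (EuclideanSpace.single j 1)) rfl))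
    have e : pairing Ω w g = ∫ x in U, inner ℝ (g x) (H x) := by
      rw [pairing_eq_integral hwi (hg.mono hUΩ), setIntegral_eq_integral_of_forall_compl_eq_zero]
      · simp only [fieldDiv, mul_add]
        rw [integral_add (hif 1 0) (hif 2 1), hib, hib, ← add_assoc, ← sub_eq_add_neg,
          ← sub_eq_add_neg]
        have i0 : Integrable fun x => g x 0 := by
          simpa using hci (fun _ => 1) continuous_const 0
        have i1 : Integrable fun x => g x 0 - gradient w x 0 * g x 1 := i0.sub (hci _ (hgcj 0) 1)
        have i2 : Integrable fun x => gradient w x 1 * g x 2 := hci _ (hgcj 1) 2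
        rw [← integral_sub i0 (hci _ (hgcj 0) 1), ← integral_sub i1 i2]
        refine integral_congr_ae (ae_of_all _ fun x => ?_)
        beta_reduce
        rw [inner_space]
        simp [hH]
        ring
      · intro x hx
        rw [hg.apply_eq_zero hx]
        simp
    linarith
  calc ∫⁻ x in U, ‖gradient w x‖ₑ ≤ ∫⁻ x in U, ‖H x‖ₑ := lintegral_mono fun x => by
        rw [← ofReal_norm, ← ofReal_norm]
        exact ENNReal.ofReal_le_ofReal (hnorm x)
    _ = ENNReal.ofReal (∫ x in U, ‖H x‖) := (ofReal_integral_norm_eq_lintegral_enorm hHi).symm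
    _ ≤ _ := ENNReal.ofReal_le_ofReal hint

/-- For mollifications `w k`, pairings with `T(w k)` are pairings of `w k` with chain-rule fields,
hence at most the area of the original function. As `T` is bounded, `T(w k)` converges in `L¹`, and
the bound passes to the limit. -/
theorem MemBV.comp_smooth {Ω : Set Plane} (hΩ : IsOpen Ω) (hb : Bornology.IsBounded Ω)
    {ψ : Plane → ℝ} (hψ : MemBV Ω ψ) {T : ℝ → ℝ} (hT : ContDiff ℝ ∞ T)
    (hT1 : ∀ x, |deriv T x| ≤ 1) {B : ℝ} (hB : ∀ x, |T x| ≤ B) :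
    MemBV Ω (fun x => T (ψ x)) ∧ area Ω (fun x => T (ψ x)) ≤ area Ω ψ := by
  have hΩm := hΩ.measurableSet
  obtain ⟨v, hvm, hvi, hv⟩ := exists_measurable_rep hΩm hψ.1
  have hcongr : (fun x => T (ψ x)) =ᵐ[volume.restrict Ω] fun x => T (v x) :=
    hv.mono fun x hx => by beta_reduce; rw [hx]
  rw [memBV_congr hcongr, area_congr hcongr, area_congr hv]
  rw [memBV_congr hv] at hψ
  have hfinΩ : volume Ω < (⊤ : ℝ≥0∞) := hb.measure_lt_top
  have hfin : IsFiniteMeasure ((volume : Measure Plane).restrict Ω) := ⟨by simpa using hfinΩ⟩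
  set A : ℝ≥0∞ := areaMeasure Ω v Ω with hA
  have hAt : A ≠ ⊤ := (areaMeasure_lt_top hΩ hb hψ subset_rfl).ne
  -- mollification
  set r : ℕ → ℝ := fun k => ((k : ℝ) + 1)⁻¹ with hr
  have hr0 k : 0 < r k := by positivity
  have hrt : Tendsto r atTop (𝓝 0) := tendsto_inv_atTop_zero.comp
      (tendsto_atTop_add_const_right _ _ tendsto_natCast_atTop_atTop)
  let β : ∀ k, ContDiffBump (0 : Plane) := fun k => ⟨r k / 2, r k, half_pos (hr0 k),
    half_lt_self (hr0 k)⟩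
  set w : ℕ → Plane → ℝ := fun k =>
    convolution ((β k).normed volume) v (ContinuousLinearMap.lsmul ℝ ℝ) volume with hw
  have hws k : ContDiff ℝ ∞ (w k) :=
    (β k).hasCompactSupport_normed.contDiff_convolution_left _ (β k).contDiff_normed
      hvi.locallyIntegrable
  have hwt : ∀ᵐ x, Tendsto (fun k => w k x) atTop (𝓝 (v x)) :=
    ContDiffBump.ae_convolution_tendsto_right_of_locallyIntegrable (φ := β) (K := 2) hrt
      (Eventually.of_forall fun k => by change r k ≤ 2 * (r k / 2); linarith) hvi.locallyIntegrable
  have hwi k : IntegrableOn (w k) Ω :=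
    ((hws k).continuous.continuousOn.integrableOn_compact hb.isCompact_closure).mono_set
      subset_closure
  have hTc : Continuous T := hT.continuous
  have hTwi k : IntegrableOn (fun x => T (w k x)) Ω :=
    ((hTc.comp (hws k).continuous).continuousOn.integrableOn_compact hb.isCompact_closure).mono_set
      subset_closure
  have hTvi : IntegrableOn (fun x => T (v x)) Ω :=
    Integrable.of_bound (hTc.measurable.comp hvm).aestronglyMeasurable B (ae_of_all _ fun x => hB _)
  have hlim : Tendsto (fun k => ∫ x in Ω, |T (w k x) - T (v x)|) atTop (𝓝 0) := by
    have := tendsto_integral_of_dominated_convergence (μ := volume.restrict Ω)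
      (F := fun k x => |T (w k x) - T (v x)|) (f := fun _ => 0) (fun _ => B + B)
      (fun k => ((hTwi k).sub hTvi).abs.aestronglyMeasurable) (integrable_const _)
      (fun k => ae_of_all _ fun x => by
        rw [Real.norm_eq_abs, abs_abs]
        exact (abs_sub _ _).trans (add_le_add (hB _) (hB _)))
      (by
        filter_upwards [ae_restrict_of_ae hwt] with x hx
        have h1 := (((hTc.tendsto _).comp hx).sub_const (T (v x))).abs
        simpa using h1)
    simpa using this
  -- Fields supported in `U k` may be translated by up to `r k` without leaving `Ω`, as the
  -- mollification estimate needs.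
  set U : ℕ → Set Plane := fun k => interior {x | Metric.closedBall x (r k) ⊆ Ω} with hU
  have hUo k : IsOpen (U k) := isOpen_interior
  have hUΩ k : U k ⊆ Ω := fun x hx => interior_subset hx (Metric.mem_closedBall_self (hr0 k).le)
  have key k g (hg : IsTestField (U k) g) : pairing Ω (fun x => T (w k x)) g ≤ A.toReal := by
    rw [pairing_comp_eq hT hT1 (hws k) (hwi k) (hTwi k) (hg.mono (hUΩ k))]
    have hG := hg.chainField hT hT1 (hws k)
    refine pairing_mollify_le hΩ hb hvi hψ (β k) (fun x => rfl) (hwi k) (hG.mono (hUΩ k))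
      fun x hx z hz => ?_
    refine interior_subset (hG.tsupport_subset hx) ?_
    rw [Metric.mem_closedBall, dist_eq_norm, sub_sub_cancel_left, norm_neg, ← dist_zero_right]
    exact (Metric.mem_ball.1 hz).le
  have hTws k : ContDiff ℝ ∞ fun x => T (w k x) := hT.comp (hws k)
  have hgrad k := lintegral_gradient_le_of_pairing_le (hUo k) (hUΩ k) hb (hTws k) (key k)
  rw [ENNReal.ofReal_toReal hAt] at hgrad
  have hUev {S : Set Plane} (hS : IsCompact S) (hSΩ : S ⊆ Ω) : ∀ᶠ k in atTop, S ⊆ U k := by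
    obtain ⟨δ, hδ, hsub⟩ := hS.exists_thickening_subset_open hΩ hSΩ
    filter_upwards [hrt.eventually (gt_mem_nhds (half_pos hδ))] with k hk
    refine (Metric.self_subset_thickening (half_pos hδ) S).trans
      (interior_maximal (fun x hx y hy => hsub ?_) Metric.isOpen_thickening)
    obtain ⟨p, hp, hxp⟩ := Metric.mem_thickening_iff.1 hx
    rw [Metric.mem_closedBall] at hy
    exact Metric.mem_thickening_iff.2 ⟨p, hp, by linarith [dist_triangle y x p]⟩
  -- Outside `BV` the area is computed from the default gradient zero, so membership must be settled
  -- first. It follows from the gradients of `T(w k)` cut off to `U k`, whose variations are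
  -- uniformly bounded.
  have hBV : MemBV Ω fun x => T (v x) := by
    set F : ℕ → Plane → Plane := fun k => (U k).indicator (gradient fun x => T (w k x)) with hF
    have hFi k : Integrable (F k) := by
      rw [hF, integrable_indicator_iff (hUo k).measurableSet]
      exact ((continuous_gradient (hTws k)).continuousOn.integrableOn_compact
        hb.isCompact_closure).mono_set ((hUΩ k).trans subset_closure)
    have hvar k : (volume.withDensityᵥ (F k)).variation = volume.withDensity fun x => ‖F k x‖ₑ :=
      Measure.variation_withDensityᵥ (hFi k)
    have hFe k x : ‖F k x‖ₑ = (U k).indicator (fun x => ‖gradient (fun x => T (w k x)) x‖ₑ) x := by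
      simp only [hF, indicator]
      split_ifs <;> simp
    refine memBV_of_tendsto hΩ hb hTvi (fun k => volume.withDensityᵥ (F k)) A.toNNReal
      (fun k => ?_) (fun k => ?_) fun η h1 h2 h3 => ?_
    · rw [hvar, withDensity_apply _ MeasurableSet.univ, Measure.restrict_univ,
        ENNReal.coe_toNNReal hAt]
      simp_rw [hFe]
      rw [lintegral_indicator (hUo k).measurableSet]
      exact hgrad k
    · rw [hvar, withDensity_apply _ hΩm.compl, setLIntegral_congr_fun (g := fun _ => 0) hΩm.compl]
      · simp
      · intro x hx
        beta_reduce
        rw [hFe, indicator_of_notMem fun h => hx (hUΩ k h)]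
    · have ht := tendsto_integral_smul_gradient hTvi hTwi hlim h1 h2
      refine ht.congr' ?_
      filter_upwards [hUev h2 h3] with k hk
      obtain ⟨Bη, hBη⟩ := h1.continuous.bounded_above_of_compact_support h2
      rw [integral_withDensityᵥ (hFi k) h1.continuous.stronglyMeasurable hBη]
      have e1 : ∫ x, η x • F k x = ∫ x, η x • gradient (fun x => T (w k x)) x := by
        refine integral_congr_ae (ae_of_all _ fun x => ?_)
        beta_reduce
        by_cases hx : x ∈ tsupport η
        · rw [hF]; beta_reduce; rw [indicator_of_mem (hk hx)]
        · rw [image_eq_zero_of_notMem_tsupport hx, zero_smul, zero_smul]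
      have e2 : ∫ x in Ω, T (w k x) • gradient η x = ∫ x, T (w k x) • gradient η x := by
        refine setIntegral_eq_integral_of_forall_compl_eq_zero fun x hx => ?_
        rw [gradient_eq, image_eq_zero_of_notMem_tsupport
          (fun h => hx (h3 (tsupport_fderiv_subset ℝ h))), map_zero, smul_zero]
      rw [e1, e2]
      have i1 : Integrable fun x => T (w k x) • gradient η x :=
        ((hTws k).continuous.smul (continuous_gradient h1)).integrable_of_hasCompactSupport
          (HasCompactSupport.smul_left (HasCompactSupport.intro h2 fun x hx => by
            rw [gradient_eq, image_eq_zero_of_notMem_tsupport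
              (fun h => hx (tsupport_fderiv_subset ℝ h)), map_zero]))
      have i2 : Integrable fun x => η x • gradient (fun x => T (w k x)) x :=
        (h1.continuous.smul (continuous_gradient (hTws k))).integrable_of_hasCompactSupport
          h2.smul_right
      ext j
      rw [PiLp.neg_apply, integral_plane_apply i1, integral_plane_apply i2]
      simp only [PiLp.smul_apply, smul_eq_mul, gradient_apply]
      have := integral_mul_fderiv_eq_neg_fderiv_mul_of_integrable (μ := (volume : Measure Plane))
        (f := fun x => T (w k x)) (g := η) (v := EuclideanSpace.single j 1)
        ((((hTws k).continuous_fderiv (by simp)).clm_apply continuous_const |>.mul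
          h1.continuous).integrable_of_hasCompactSupport h2.mul_left)
        (((hTws k).continuous.mul ((h1.continuous_fderiv (by simp)).clm_apply
          continuous_const)).integrable_of_hasCompactSupport
          (HasCompactSupport.mul_left ((h2.fderiv ℝ).comp_left
            (g := fun L : Plane →L[ℝ] ℝ => L (EuclideanSpace.single j 1)) rfl)))
        (((hTws k).continuous.mul h1.continuous).integrable_of_hasCompactSupport h2.mul_left)
        (fun x _ => (hTws k).differentiable (by simp) x)
        (fun x _ => h1.differentiable (by simp) x)
      rw [this]
      simp_rw [mul_comm (η _)]
  refine ⟨hBV, ?_⟩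
  rw [area_eq_areaMeasure hΩm, area_eq_areaMeasure hΩm,
    ← ENNReal.toReal_le_toReal (areaMeasure_lt_top hΩ hb hBV subset_rfl).ne hAt]
  refine le_of_forall_pos_le_add fun ε hε => ?_
  obtain ⟨g, hg, hge⟩ := exists_pairing_ge hΩ hb hBV hΩ subset_rfl hε
  have ht := tendsto_pairing hTvi hTwi hlim hg
  have hle : pairing Ω (fun x => T (v x)) g ≤ A.toReal := by
    refine le_of_tendsto ht ?_
    filter_upwards [hUev hg.hasCompactSupport hg.tsupport_subset] with k hk
    exact key k g ⟨hg.1, hg.2, hk, hg.4⟩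
  linarith

theorem IsTraceAt.comp_lipschitz {Ω : Set Plane} (hΩ : IsOpen Ω) {v : Plane → ℝ}
    (hv : IntegrableOn v Ω) {T : ℝ → ℝ} (hT : LipschitzWith 1 T)
    (hTv : IntegrableOn (fun x => T (v x)) Ω) {b : Plane} (hb : b ∈ closure Ω) {z : ℝ}
    (h : IsTraceAt Ω v b z) : IsTraceAt Ω (fun x => T (v x)) b (T z) := by
  rw [isTraceAt_iff hΩ hTv hb]
  intro ε hε
  filter_upwards [(isTraceAt_iff hΩ hv hb).1 h ε hε] with r hr
  refine (lintegral_mono fun y => ?_).trans hr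
  rw [← edist_eq_enorm_sub, ← edist_eq_enorm_sub]
  simpa using hT (v y) z

/-- Smooth truncation does not increase the functional. -/
theorem boundaryArea_comp_le {Ω : Set Plane} (hΩ : IsOpen Ω) (hc : Convex ℝ Ω)
    (hb : Bornology.IsBounded Ω) {φ : Plane → ℝ} {M : ℝ} (hφ : ∀ x ∈ frontier Ω, φ x ∈ Icc 0 M)
    {ψ : Plane → ℝ} (hψ : MemBV Ω ψ) {T : ℝ → ℝ} (hT : ContDiff ℝ ∞ T)
    (hT1 : ∀ x, |deriv T x| ≤ 1) (hTM : ∀ x ∈ Icc 0 M, T x = x) {B : ℝ} (hB : ∀ x, |T x| ≤ B) :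
    boundaryArea Ω φ (fun x => T (ψ x)) ≤ boundaryArea Ω φ ψ := by
  obtain ⟨hBV, harea⟩ := hψ.comp_smooth hΩ hb hT hT1 hB
  have hLip : LipschitzWith 1 T :=
    lipschitzWith_of_nnnorm_deriv_le (hT.differentiable (by simp)) fun x => by
      rw [← NNReal.coe_le_coe]; simpa using hT1 x
  refine add_le_add harea (lintegral_mono_ae ?_)
  filter_upwards [hψ.ae_isTraceAt hΩ hc hb, ae_restrict_mem isClosed_frontier.measurableSet]
    with x hx hxF
  have hxc := frontier_subset_closure hxF
  rw [(hx.comp_lipschitz hΩ hψ.1 hLip hBV.1 hxc).trace_eq hΩ hBV.1 hxc]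
  refine ENNReal.ofReal_le_ofReal ?_
  -- The boundary values lie in `[0, M]`, where `T` is the identity, so `T` is a contraction towards
  -- them.
  conv_lhs => rw [← hTM _ (hφ x hxF)]
  simpa [Real.dist_eq] using hLip.dist_le_mul (trace Ω ψ x) (φ x)

/-! ### Existence of limits of minimizing sequences -/

/-- A decreasing sequence of nonempty bounded closed convex sets in a Hilbert space has nonempty
intersection. -/
theorem nonempty_iInter_of_convex {H : Type*} [NormedAddCommGroup H] [InnerProductSpace ℝ H]
    [CompleteSpace H] {X : ℕ → Set H} (hX : Antitone X) (hne : ∀ k, (X k).Nonempty)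
    (hcl : ∀ k, IsClosed (X k)) (hcv : ∀ k, Convex ℝ (X k)) {R : ℝ}
    (hR : ∀ x ∈ X 0, ‖x‖ ≤ R) : (⋂ k, X k).Nonempty := by
  -- The points of least norm have increasing bounded norms. Midpoints remain in the larger set, and
  -- the parallelogram law makes the sequence Cauchy.
  have hmin k := exists_norm_eq_iInf_of_complete_convex (hne k) (hcl k).isComplete (hcv k) 0
  choose x hx hxm using hmin
  have hle k y (hy : y ∈ X k) : ‖x k‖ ≤ ‖y‖ := by
    have h1 := hxm k
    simp only [zero_sub, norm_neg] at h1
    rw [h1]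
    exact ciInf_le ⟨0, by rintro _ ⟨z, rfl⟩; exact norm_nonneg _⟩ (⟨y, hy⟩ : X k)
  have hmono : Monotone fun k => ‖x k‖ ^ 2 := fun j k hjk => by
    have := hle j (x k) (hX hjk (hx k))
    beta_reduce
    gcongr
  have hbdd : BddAbove (range fun k => ‖x k‖ ^ 2) := by
    refine ⟨R ^ 2, ?_⟩
    rintro _ ⟨k, rfl⟩
    have := hR _ (hX (Nat.zero_le k) (hx k))
    beta_reduce
    gcongr
  have hcau : CauchySeq fun k => ‖x k‖ ^ 2 := (tendsto_atTop_ciSup hmono hbdd).cauchySeq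
  have hdist {j k : ℕ} (hjk : j ≤ k) : ‖x j - x k‖ ^ 2 ≤ 2 * (‖x k‖ ^ 2 - ‖x j‖ ^ 2) := by
    have h1 := parallelogram_law_with_norm ℝ (x j) (x k)
    have h2 := hle j _ ((hcv j) (hx j) (hX hjk (hx k)) (a := 1 / 2) (b := 1 / 2) (by norm_num)
      (by norm_num) (by norm_num))
    rw [← smul_add, norm_smul] at h2
    norm_num at h2
    nlinarith [norm_nonneg (x j), norm_nonneg (x j + x k)]
  have hxc : CauchySeq x := by
    rw [Metric.cauchySeq_iff'] at hcau ⊢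
    intro ε hε
    obtain ⟨N, hN⟩ := hcau (ε ^ 2 / 2) (by positivity)
    refine ⟨N, fun k hk => ?_⟩
    have h1 := hN k hk
    rw [Real.dist_eq] at h1
    have h2 := hdist hk
    rw [dist_comm, dist_eq_norm]
    have h3 := le_abs_self (‖x k‖ ^ 2 - ‖x N‖ ^ 2)
    exact lt_of_pow_lt_pow_left₀ 2 hε.le (by linarith)
  obtain ⟨y, hy⟩ := cauchySeq_tendsto_of_complete hxc
  refine ⟨y, mem_iInter.2 fun k => (hcl k).mem_of_tendsto hy ?_⟩
  filter_upwards [eventually_ge_atTop k] with j hj using hX hj (hx j)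

/-! ### Convex sublevel sets in `L²` -/

theorem boundaryArea_congr {Ω : Set Plane} {φ u v : Plane → ℝ}
    (h : u =ᵐ[volume.restrict Ω] v) : boundaryArea Ω φ u = boundaryArea Ω φ v := by
  rw [boundaryArea, boundaryArea, area_congr h, trace_congr h]

/-- Bounded functions of bounded variation with controlled functional vanishing on `Z`, as a
subset of `L²(Ω)`. -/
def sublevel (Ω : Set Plane) (φ : Plane → ℝ) (B : ℝ) (C : ℝ≥0) (Z : Set Plane) :
    Set (Lp ℝ 2 ((volume : Measure Plane).restrict Ω)) :=
  {f | MemBV Ω f ∧ boundaryArea Ω φ f ≤ C ∧ (∀ᵐ x ∂volume.restrict Ω, |f x| ≤ B) ∧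
    ∀ᵐ x ∂volume.restrict Ω, x ∈ Z → f x = 0}

theorem convex_sublevel {Ω : Set Plane} (hΩ : IsOpen Ω) (hc : Convex ℝ Ω)
    (hb : Bornology.IsBounded Ω) {φ : Plane → ℝ} (hφ : ContinuousOn φ (frontier Ω)) (B : ℝ)
    (C : ℝ≥0) (Z : Set Plane) : Convex ℝ (sublevel Ω φ B C Z) := by
  rintro f ⟨f1, f2, f3, f4⟩ g ⟨g1, g2, g3, g4⟩ a b ha hb' hab
  have hcoe : ⇑(a • f + b • g) =ᵐ[volume.restrict Ω] fun x => a * f x + b * g x := by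
    filter_upwards [Lp.coeFn_add (a • f) (b • g), Lp.coeFn_smul a f, Lp.coeFn_smul b g]
      with x h1 h2 h3
    rw [h1, Pi.add_apply, h2, h3, Pi.smul_apply, Pi.smul_apply, smul_eq_mul, smul_eq_mul]
  refine ⟨(memBV_congr hcoe).2 (f1.linear g1 a b), ?_, ?_, ?_⟩
  · rw [boundaryArea_congr hcoe]
    calc _ ≤ _ := boundaryArea_convex hΩ hc hb hφ f1 g1 ha hb' hab
      _ ≤ ENNReal.ofReal a * C + ENNReal.ofReal b * C := by gcongr
      _ = C := by rw [← add_mul, ← ENNReal.ofReal_add ha hb', hab, ENNReal.ofReal_one, one_mul]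
  · filter_upwards [hcoe, f3, g3] with x h1 h2 h3
    rw [h1]
    calc |a * f x + b * g x| ≤ a * |f x| + b * |g x| := by
          refine (abs_add_le _ _).trans ?_
          rw [abs_mul, abs_mul, abs_of_nonneg ha, abs_of_nonneg hb']
      _ ≤ a * B + b * B := by gcongr
      _ = B := by rw [← add_mul, hab, one_mul]
  · filter_upwards [hcoe, f4, g4] with x h1 h2 h3 hx
    rw [h1, h2 hx, h3 hx]
    simp

theorem tendsto_integral_abs_sub_of_Lp {m : Measure Plane} [IsFiniteMeasure m] {f : Lp ℝ 2 m}
    {u : ℕ → Lp ℝ 2 m} (h : Tendsto u atTop (𝓝 f)) :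
    Tendsto (fun k => ∫ x, |u k x - f x| ∂m) atTop (𝓝 0) := by
  have h1 : Tendsto (fun k => ‖u k - f‖ₑ) atTop (𝓝 0) := by
    have := tendsto_iff_edist_tendsto_0.1 h
    simpa [edist_eq_enorm_sub] using this
  set c : ℝ≥0∞ := m univ ^ (1 / (1 : ℝ≥0∞).toReal - 1 / (2 : ℝ≥0∞).toReal)
  have hct : c ≠ ⊤ := ENNReal.rpow_ne_top_of_nonneg (by norm_num) (measure_ne_top _ _)
  have h2 k : ENNReal.ofReal (∫ x, |u k x - f x| ∂m) ≤ ‖u k - f‖ₑ * c := by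
    have e1 : ENNReal.ofReal (∫ x, |u k x - f x| ∂m) = eLpNorm (u k - f) 1 m := by
      have hi : Integrable (fun x => u k x - f x) m :=
        ((Lp.memLp (u k)).sub (Lp.memLp f)).integrable (by norm_num)
      have := ofReal_integral_norm_eq_lintegral_enorm hi
      simp only [Real.norm_eq_abs] at this
      rw [this, eLpNorm_one_eq_lintegral_enorm]
      refine lintegral_congr_ae ?_
      filter_upwards [Lp.coeFn_sub (u k) f] with x hx
      rw [hx, Pi.sub_apply]
    have e2 : ‖u k - f‖ₑ = eLpNorm (u k - f) 2 m := Lp.enorm_def _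
    rw [e1, e2]
    exact eLpNorm_le_eLpNorm_mul_rpow_measure_univ (by norm_num)
      (Lp.aestronglyMeasurable _)
  have h3 : Tendsto (fun k => ENNReal.ofReal (∫ x, |u k x - f x| ∂m)) atTop (𝓝 0) := by
    refine tendsto_of_tendsto_of_tendsto_of_le_of_le tendsto_const_nhds ?_ (fun _ => zero_le) h2
    have := ENNReal.Tendsto.mul_const (b := c) h1 (Or.inr hct)
    rwa [zero_mul] at this
  have h4 := (ENNReal.tendsto_toReal ENNReal.zero_ne_top).comp h3
  refine (h4.congr fun k => ?_)
  exact ENNReal.toReal_ofReal (integral_nonneg fun _ => abs_nonneg _)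

/-- On a bounded domain `L²` convergence implies `L¹` convergence, which gives membership in `BV`
and the bound on the functional. The pointwise conditions pass to the limit along an almost
everywhere convergent subsequence. -/
theorem isClosed_sublevel {Ω : Set Plane} (hΩ : IsOpen Ω) (hc : Convex ℝ Ω) (hne : Ω.Nonempty)
    (hb : Bornology.IsBounded Ω) {φ : Plane → ℝ} (hφ : ContinuousOn φ (frontier Ω)) (B : ℝ)
    (C : ℝ≥0) (Z : Set Plane) : IsClosed (sublevel Ω φ B C Z) := by
  have hfin : IsFiniteMeasure ((volume : Measure Plane).restrict Ω) :=
    ⟨by simpa using hb.measure_lt_top⟩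
  refine IsSeqClosed.isClosed fun u f hu hlim => ?_
  have hL1 := tendsto_integral_abs_sub_of_Lp hlim
  have hfi : IntegrableOn f Ω := (Lp.memLp f).integrable (by norm_num)
  obtain ⟨ns, -, hns⟩ : ∃ ns : ℕ → ℕ, StrictMono ns ∧
      ∀ᵐ x ∂volume.restrict Ω, Tendsto (fun i => u (ns i) x) atTop (𝓝 (f x)) :=
    (tendstoInMeasure_of_tendsto_Lp hlim).exists_seq_tendsto_ae
  have hBV : MemBV Ω f := by
    refine memBV_of_tendsto_L1 hΩ hb hfi (fun k => (hu k).1) hL1 C fun k => ?_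
    rw [← area_eq_areaMeasure hΩ.measurableSet]
    exact le_self_add.trans (hu k).2.1
  refine ⟨hBV, boundaryArea_le_of_tendsto hΩ hc hne hb hφ hBV (fun k => (hu k).1) hL1
    fun k => (hu k).2.1, ?_, ?_⟩
  · filter_upwards [hns, ae_all_iff.2 fun k => (hu k).2.2.1] with x hx hB
    exact le_of_tendsto hx.abs (Eventually.of_forall fun i => hB _)
  · filter_upwards [hns, ae_all_iff.2 fun k => (hu k).2.2.2] with x hx h0 hxZ
    refine tendsto_nhds_unique hx ?_
    simp_rw [h0 _ hxZ]
    exact tendsto_const_nhds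

/-- Compactness and lower semicontinuity: a sequence of functions of bounded variation vanishing
on sets `E k` with bounded functional has a limit function, which vanishes on all the sets
`⋂ j ≥ k, E j`. -/
theorem exists_limit_function {Ω : Set Plane} (hΩ : IsOpen Ω) (hc : Convex ℝ Ω)
    (hne : Ω.Nonempty) (hb : Bornology.IsBounded Ω) {φ : Plane → ℝ}
    (hφ : ContinuousOn φ (frontier Ω)) (hφ0 : ∀ x ∈ frontier Ω, 0 ≤ φ x) {f : ℕ → Plane → ℝ}
    (hf : ∀ k, MemBV Ω (f k)) {E : ℕ → Set Plane}
    (hE : ∀ k, ∀ᵐ x ∂volume.restrict Ω, x ∈ E k → f k x = 0) {L : ℝ≥0}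
    (hL : ∀ δ : ℝ≥0, 0 < δ → ∀ᶠ k in atTop, boundaryArea Ω φ (f k) ≤ (L + δ : ℝ≥0)) :
    ∃ ψ, MemBV Ω ψ ∧ boundaryArea Ω φ ψ ≤ L ∧
      ∀ k, ∀ᵐ x ∂volume.restrict Ω, (∀ j ≥ k, x ∈ E j) → ψ x = 0 := by
  have hfin : IsFiniteMeasure ((volume : Measure Plane).restrict Ω) :=
    ⟨by simpa using hb.measure_lt_top⟩
  obtain ⟨M, hM0, hM⟩ : ∃ M : ℝ, 0 < M ∧ ∀ x ∈ frontier Ω, φ x ∈ Icc 0 M := by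
    have hcomp : IsCompact (frontier Ω) :=
      hb.isCompact_closure.of_isClosed_subset isClosed_frontier frontier_subset_closure
    obtain ⟨M, hM⟩ := hcomp.exists_bound_of_continuousOn hφ
    exact ⟨max M 1, by positivity, fun x hx =>
      ⟨hφ0 x hx, (le_abs_self _).trans ((hM x hx).trans (le_max_left _ _))⟩⟩
  obtain ⟨T, hT, hT1, hTM, B, hB⟩ := exists_smooth_truncation M hM0
  have hTf k := (hf k).comp_smooth hΩ hb hT hT1 hB
  have hT0 : T 0 = 0 := hTM 0 ⟨le_rfl, hM0.le⟩
  set δ : ℕ → ℝ≥0 := fun k => ((k : ℝ≥0) + 1)⁻¹ with hδ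
  have hδ0 k : 0 < δ k := by positivity
  have hδa : Antitone δ := fun i j hij => by
    simp only [hδ]
    gcongr
  -- Requiring zero only on the intersection of the later sets makes the sequence decreasing, and
  -- lets any sufficiently late truncated `f j` be an element of `X k`.
  set X : ℕ → Set (Lp ℝ 2 ((volume : Measure Plane).restrict Ω)) := fun k =>
    sublevel Ω φ B (L + δ k) {x | ∀ j ≥ k, x ∈ E j} with hX
  have hXa : Antitone X := by
    rintro j k hjk g ⟨g1, g2, g3, g4⟩
    refine ⟨g1, g2.trans ?_, g3, g4.mono fun x hx hxj => hx fun i hi => hxj i (hjk.trans hi)⟩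
    exact ENNReal.coe_le_coe.2 (add_le_add_right (hδa hjk) L)
  have hXne k : (X k).Nonempty := by
    obtain ⟨j, hj, hjk⟩ := ((hL (δ k) (hδ0 k)).and (eventually_ge_atTop k)).exists
    have hmem : MemLp (fun x => T (f j x)) 2 (volume.restrict Ω) :=
      MemLp.of_bound (hTf j).1.1.aestronglyMeasurable B (ae_of_all _ fun x => hB _)
    have hcoe := hmem.coeFn_toLp
    refine ⟨hmem.toLp, (memBV_congr hcoe).2 (hTf j).1, ?_, ?_, ?_⟩
    · rw [boundaryArea_congr hcoe]
      exact (boundaryArea_comp_le hΩ hc hb hM (hf j) hT hT1 hTM hB).trans hj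
    · filter_upwards [hcoe] with x hx
      rw [hx]; exact hB _
    · filter_upwards [hcoe, hE j] with x hx h0 hxZ
      rw [hx, h0 (hxZ j hjk), hT0]
  obtain ⟨g, hg⟩ := nonempty_iInter_of_convex hXa hXne
    (fun k => isClosed_sublevel hΩ hc hne hb hφ _ _ _)
    (fun k => convex_sublevel hΩ hc hb hφ _ _ _)
    (R := (measureUnivNNReal (volume.restrict Ω : Measure Plane) : ℝ) ^ (ENNReal.toReal 2)⁻¹ * B) (by
      rintro g ⟨-, -, g3, -⟩
      have hB0 : 0 ≤ B := (abs_nonneg _).trans (hB 0)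
      exact Lp.norm_le_of_ae_bound (f := g) hB0 (by simpa using g3))
  rw [mem_iInter] at hg
  refine ⟨g, (hg 0).1, ?_, fun k => (hg k).2.2.2⟩
  have hlim : Tendsto (fun k => ((L + δ k : ℝ≥0) : ℝ≥0∞)) atTop (𝓝 ((L + 0 : ℝ≥0) : ℝ≥0∞)) := by
    refine ENNReal.tendsto_coe.2 (tendsto_const_nhds.add ?_)
    have : Tendsto (fun k : ℕ => ((k : ℝ) + 1)⁻¹) atTop (𝓝 0) := tendsto_inv_atTop_zero.comp
      (tendsto_atTop_add_const_right _ _ tendsto_natCast_atTop_atTop)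
    rw [← NNReal.tendsto_coe]
    simpa [hδ] using this
  rw [add_zero] at hlim
  exact ge_of_tendsto hlim (Eventually.of_forall fun k => (hg k).2.1)

/-! ### Enclosed regions -/

/-- A point outside `C` is separated from it by a line, and on its side a ray runs to infinity
without meeting `Γ`. Its component is therefore unbounded. -/
theorem enclosed_subset {Γ C : Set Plane} (hC : IsClosed C) (hCc : Convex ℝ C)
    (hne : C.Nonempty) (hΓ : Γ ⊆ C) : enclosed Γ ⊆ C := by
  intro x hx
  by_contra hxC
  have hxΓ : x ∈ Γᶜ := fun h => hxC (hΓ h)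
  have hbd : Bornology.IsBounded (connectedComponentIn Γᶜ x) := hx.resolve_left hxΓ
  obtain ⟨f, u, hfC, hfx⟩ := geometric_hahn_banach_closed_point hCc hC hxC
  obtain ⟨c, hc⟩ := hne
  set v := x - c with hv
  have hfv : 0 < f v := by rw [hv, map_sub]; linarith [hfC c hc]
  have hv0 : 0 < ‖v‖ := norm_pos_iff.2 fun h => by rw [h, map_zero] at hfv; exact hfv.false
  set S : Set Plane := (fun r : ℝ => x + r • v) '' Ici 0 with hS
  have hSc : IsPreconnected S := isPreconnected_Ici.image _ (by fun_prop)
  have hSΓ : S ⊆ Γᶜ := by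
    rintro _ ⟨r, hr, rfl⟩ h
    have h1 := hfC _ (hΓ h)
    rw [map_add, map_smul, smul_eq_mul] at h1
    have : 0 ≤ r * f v := mul_nonneg hr hfv.le
    linarith
  have hxS : x ∈ S := ⟨0, self_mem_Ici, by simp⟩
  obtain ⟨R, hR⟩ := (hbd.subset (hSc.subset_connectedComponentIn hxS hSΓ)).exists_norm_le
  have hR0 : 0 ≤ R := (norm_nonneg _).trans (hR x hxS)
  have h2 := hR _ ⟨(R + ‖x‖ + 1) / ‖v‖, mem_Ici.2 (by positivity), rfl⟩
  have h3 : ‖((R + ‖x‖ + 1) / ‖v‖) • v‖ = R + ‖x‖ + 1 := by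
    rw [norm_smul, Real.norm_of_nonneg (by positivity), div_mul_cancel₀ _ hv0.ne']
  have h4 := norm_sub_le (x + ((R + ‖x‖ + 1) / ‖v‖) • v) x
  rw [add_sub_cancel_left, h3] at h4
  beta_reduce at h2
  linarith

/-- A point in an unbounded component of the complement has that open component as a neighbourhood
outside the enclosed set. -/
theorem isClosed_enclosed {Γ : Set Plane} (hΓ : IsClosed Γ) : IsClosed (enclosed Γ) := by
  rw [← isOpen_compl_iff, isOpen_iff_mem_nhds]
  intro x hx
  have hxΓ : x ∈ Γᶜ := fun h => hx (Or.inl h)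
  have hopen : IsOpen (connectedComponentIn Γᶜ x) := hΓ.isOpen_compl.connectedComponentIn
  filter_upwards [hopen.mem_nhds (mem_connectedComponentIn hxΓ)] with y hy
  rintro (h | h)
  · exact connectedComponentIn_subset _ _ hy h
  · refine hx (Or.inr ?_)
    rw [mem_ofPred_eq, connectedComponentIn_eq hy]
    exact h

theorem subset_enclosed (Γ : Set Plane) : Γ ⊆ enclosed Γ := subset_union_left

/-- One inclusion is convexity. For the other, a connected set starting in the interior cannot leave
it without crossing the frontier, so the component is bounded. -/
theorem enclosed_frontier {K : Set Plane} (hK : IsCompact K) (hKc : Convex ℝ K)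
    (hne : K.Nonempty) : enclosed (frontier K) = K := by
  refine (enclosed_subset hK.isClosed hKc hne hK.isClosed.frontier_subset).antisymm fun x hx => ?_
  by_cases hxi : x ∈ interior K
  · refine Or.inr (hK.isBounded.subset ((?_ : _ ⊆ interior K).trans interior_subset))
    have hpre : IsPreconnected (connectedComponentIn (frontier K)ᶜ x) :=
      isPreconnected_connectedComponentIn
    have hxF : x ∈ (frontier K)ᶜ := fun h => h.2 hxi
    refine hpre.subset_left_of_subset_union isOpen_interior hK.isClosed.isOpen_compl
      (Set.disjoint_left.2 fun y hy hy' => hy' (interior_subset hy)) ?_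
      ⟨x, mem_connectedComponentIn hxF, hxi⟩
    intro y hy
    have hyF := connectedComponentIn_subset _ _ hy
    by_cases hyK : y ∈ K
    · refine Or.inl ?_
      by_contra hyi
      exact hyF ⟨subset_closure hyK, hyi⟩
    · exact Or.inr hyK
  · exact Or.inl ⟨subset_closure hx, hxi⟩

/-! ### Arcs of the boundary -/

theorem notMem_of_mem_frontier {Ω : Set Plane} (hΩ : IsOpen Ω) {x : Plane}
    (hx : x ∈ frontier Ω) : x ∉ Ω := fun h => by
  rw [frontier, hΩ.interior_eq] at hx
  exact hx.2 h

/-- A half-line from a point of a bounded open set meets the frontier. -/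
theorem exists_frontier_on_ray {Ω : Set Plane} (hΩ : IsOpen Ω) (hb : Bornology.IsBounded Ω)
    {c v : Plane} (hc : c ∈ Ω) (hv : v ≠ 0) : ∃ r > (0 : ℝ), c + r • v ∈ frontier Ω := by
  have hv0 : 0 < ‖v‖ := norm_pos_iff.2 hv
  set S : Set Plane := (fun r : ℝ => c + r • v) '' Ici 0 with hS
  have hSc : IsPreconnected S := isPreconnected_Ici.image _ (by fun_prop)
  have hcS : c ∈ S := ⟨0, self_mem_Ici, by simp⟩
  obtain ⟨R, hR⟩ := hb.exists_norm_le
  have hR0 : 0 ≤ R := (norm_nonneg _).trans (hR c hc)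
  obtain ⟨x, hx, hxF⟩ : (S ∩ frontier Ω).Nonempty := by
    by_contra hempty
    have hsub : S ⊆ Ω := by
      refine hSc.subset_left_of_subset_union hΩ isClosed_closure.isOpen_compl
        (Set.disjoint_left.2 fun y hy hy' => hy' (subset_closure hy)) (fun y hy => ?_) ⟨c, hcS, hc⟩
      by_cases hyc : y ∈ closure Ω
      · by_cases hyΩ : y ∈ Ω
        · exact Or.inl hyΩ
        · exact absurd ⟨y, hy, hyc, by rwa [hΩ.interior_eq]⟩ hempty
      · exact Or.inr hyc
    have h2 := hR _ (hsub ⟨(R + ‖c‖ + 1) / ‖v‖, mem_Ici.2 (by positivity), rfl⟩)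
    have h3 : ‖((R + ‖c‖ + 1) / ‖v‖) • v‖ = R + ‖c‖ + 1 := by
      rw [norm_smul, Real.norm_of_nonneg (by positivity), div_mul_cancel₀ _ hv0.ne']
    have h4 := norm_sub_le (c + ((R + ‖c‖ + 1) / ‖v‖) • v) c
    rw [add_sub_cancel_left, h3] at h4
    beta_reduce at h2
    linarith
  obtain ⟨r, hr, rfl⟩ := hx
  refine ⟨r, lt_of_le_of_ne hr fun h => ?_, hxF⟩
  subst h
  exact notMem_of_mem_frontier hΩ hxF (by simpa using hc)

/-- A half-line from a point of a convex open set meets the frontier only once. -/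
theorem frontier_ray_unique {Ω : Set Plane} (hΩ : IsOpen Ω) (hc : Convex ℝ Ω)
    {c v : Plane} (hcΩ : c ∈ Ω) {r r' : ℝ} (hr : 0 < r) (hr' : 0 < r')
    (h : c + r • v ∈ frontier Ω) (h' : c + r' • v ∈ frontier Ω) : r = r' := by
  have key {r r' : ℝ} (hr : 0 < r) (hr' : 0 < r') (h : c + r • v ∈ frontier Ω)
      (h' : c + r' • v ∈ frontier Ω) : ¬ r < r' := fun hlt => by
    refine notMem_of_mem_frontier hΩ h ?_
    have := hc.combo_closure_interior_mem_interior (frontier_subset_closure h')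
      (hΩ.interior_eq.symm ▸ hcΩ) (a := r / r') (b := 1 - r / r') (by positivity)
      (by rw [sub_pos, div_lt_one hr']; exact hlt) (by ring)
    rw [hΩ.interior_eq] at this
    convert this using 1
    rw [smul_add, smul_smul, div_mul_cancel₀ _ hr'.ne']
    module
  exact le_antisymm (not_lt.1 (key hr' hr h' h)) (not_lt.1 (key hr hr' h h'))

theorem IsBoundaryParam.eq_of_eq {Ω : Set Plane} {γ : ℝ → Plane} (hγ : IsBoundaryParam Ω γ)
    {a x y : ℝ} (hx : x ∈ Ico a (a + 1)) (hy : y ∈ Ico a (a + 1)) (h : γ x = γ y) : x = y := by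
  have hfr z : γ (Int.fract z) = γ z := by
    have := hγ.2.1.sub_int_mul_eq ⌊z⌋ (x := z)
    rwa [mul_one] at this
  have h1 : Int.fract x = Int.fract y := hγ.2.2.1 ⟨Int.fract_nonneg _, Int.fract_lt_one _⟩
    ⟨Int.fract_nonneg _, Int.fract_lt_one _⟩ (by rw [hfr, hfr, h])
  obtain ⟨z, hz⟩ := Int.fract_eq_fract.1 h1
  have hz1 : (-1 : ℝ) < z := by rw [← hz]; linarith [hx.1, hy.2]
  have hz2 : (z : ℝ) < 1 := by rw [← hz]; linarith [hx.2, hy.1]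
  have hz0 : z = 0 := by
    have a1 : -1 < z := by exact_mod_cast hz1
    have a2 : z < 1 := by exact_mod_cast hz2
    omega
  rw [hz0] at hz
  simp at hz
  linarith

theorem IsBoundaryParam.exists_mem_Ico {Ω : Set Plane} {γ : ℝ → Plane} (hγ : IsBoundaryParam Ω γ)
    (a : ℝ) {x : Plane} (hx : x ∈ frontier Ω) : ∃ r ∈ Ico a (a + 1), γ r = x := by
  rw [← hγ.2.2.2] at hx
  obtain ⟨y, rfl⟩ := hx
  obtain ⟨r, hr, h⟩ := hγ.2.1.exists_mem_Ico one_pos y a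
  exact ⟨r, hr, h.symm⟩

theorem IsBoundaryParam.mem_frontier {Ω : Set Plane} {γ : ℝ → Plane} (hγ : IsBoundaryParam Ω γ)
    (x : ℝ) : γ x ∈ frontier Ω := hγ.2.2.2 ▸ mem_range_self x

/-- A continuous function without zeros on an open interval has a constant sign. -/
theorem sign_of_ne_zero_Ioo {f : ℝ → ℝ} (hf : Continuous f) {a b : ℝ}
    (h : ∀ x ∈ Ioo a b, f x ≠ 0) : (∀ x ∈ Ioo a b, 0 < f x) ∨ ∀ x ∈ Ioo a b, f x < 0 := by
  by_contra! hcon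
  obtain ⟨⟨x, hx, hx0⟩, y, hy, hy0⟩ := hcon
  obtain ⟨z, hz, hz0⟩ := isPreconnected_Ioo.intermediate_value hx hy hf.continuousOn
    (show (0 : ℝ) ∈ Icc (f x) (f y) from ⟨hx0, hy0⟩)
  exact h z hz hz0

/-- A chord of the boundary separates the two boundary arcs between its endpoints. -/
theorem IsBoundaryParam.exists_separating {Ω : Set Plane} (hΩ : IsOpen Ω) (hc : Convex ℝ Ω)
    (hb : Bornology.IsBounded Ω) {γ : ℝ → Plane} (hγ : IsBoundaryParam Ω γ) {t s : ℝ}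
    (hts : t < s) (hst : s < t + 1) :
    ∃ u : Plane, ∃ κ : ℝ, ‖u‖ = 1 ∧ (∀ x ∈ Icc t s, κ ≤ inner ℝ u (γ x)) ∧
      ∀ x ∈ Icc s (t + 1), inner ℝ u (γ x) ≤ κ := by
  set q := γ t with hq
  set p := γ s with hp
  have hqp : q ≠ p := fun h => hts.ne (hγ.eq_of_eq (a := t) ⟨le_rfl, by linarith⟩ ⟨hts.le, hst⟩ h)
  have hper : γ (t + 1) = q := hγ.2.1 t
  -- a unit normal to the chord
  obtain ⟨u, hu, huq⟩ : ∃ u : Plane, ‖u‖ = 1 ∧ inner ℝ u (q - p) = 0 := by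
    have h0 : 0 < ‖q - p‖ := norm_pos_iff.2 (sub_ne_zero.2 hqp)
    refine ⟨turn (‖q - p‖⁻¹ • (q - p)), ?_, ?_⟩
    · rw [norm_turn, norm_smul, norm_inv, norm_norm, inv_mul_cancel₀ h0.ne']
    · rw [inner_turn]
      simp only [PiLp.smul_apply, smul_eq_mul]
      ring
  set ℓ : Plane → ℝ := fun x => inner ℝ u (x - p) with hℓ
  have hℓc : Continuous ℓ := by fun_prop
  have hℓe x : inner ℝ u x = inner ℝ u p + ℓ x := by simp only [hℓ, inner_sub_right]; ring
  have hℓp : ℓ p = 0 := by simp [hℓ]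
  have hℓq : ℓ q = 0 := huq
  have hℓγ : Continuous fun τ => ℓ (γ τ) := hℓc.comp hγ.1
  -- it suffices to find the signs
  suffices hsign : ((∀ x ∈ Icc t s, 0 ≤ ℓ (γ x)) ∧ ∀ x ∈ Icc s (t + 1), ℓ (γ x) ≤ 0) ∨
      ((∀ x ∈ Icc t s, ℓ (γ x) ≤ 0) ∧ ∀ x ∈ Icc s (t + 1), 0 ≤ ℓ (γ x)) by
    rcases hsign with ⟨h1, h2⟩ | ⟨h1, h2⟩
    · refine ⟨u, inner ℝ u p, hu, fun x hx => ?_, fun x hx => ?_⟩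
      · rw [hℓe (γ x)]; linarith [h1 x hx]
      · rw [hℓe (γ x)]; linarith [h2 x hx]
    · refine ⟨-u, -inner ℝ u p, by rwa [norm_neg], fun x hx => ?_, fun x hx => ?_⟩
      · rw [inner_neg_left, hℓe (γ x)]; linarith [h1 x hx]
      · rw [inner_neg_left, hℓe (γ x)]; linarith [h2 x hx]
  have hends {P : ℝ → Prop} (h0 : P 0) {a b : ℝ} (ha : ℓ (γ a) = 0) (hb : ℓ (γ b) = 0)
      (h : ∀ x ∈ Ioo a b, P (ℓ (γ x))) : ∀ x ∈ Icc a b, P (ℓ (γ x)) := by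
    intro x hx
    rcases eq_or_lt_of_le hx.1 with rfl | h1
    · rwa [ha]
    rcases eq_or_lt_of_le hx.2 with rfl | h2
    · rwa [hb]
    exact h x ⟨h1, h2⟩
  have e1 : ℓ (γ t) = 0 := hℓq
  have e2 : ℓ (γ s) = 0 := hℓp
  have e3 : ℓ (γ (t + 1)) = 0 := by rw [hper]; exact hℓq
  -- If the line of the chord meets `Ω`, it meets the frontier only at `p` and `q`, so `ℓ` has a
  -- constant sign on each open arc. Equal signs are impossible because `Ω` extends to both sides of
  -- the line.
  by_cases hmeet : ∃ c ∈ Ω, ℓ c = 0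
  · obtain ⟨c, hcΩ, hcℓ⟩ := hmeet
    -- points of the line are determined by one coordinate
    have hline {x : Plane} (hx : ℓ x = 0) : x = c + (inner ℝ (turn u) (x - c) : ℝ) • turn u := by
      have h1 : inner ℝ u (x - c) = 0 := by
        have : x - c = (x - p) - (c - p) := by abel
        rw [this, inner_sub_right]
        change ℓ x - ℓ c = 0
        rw [hx, hcℓ, sub_zero]
      have h2 := decompose_turn hu (x - c)
      rw [h1, zero_smul, zero_add] at h2
      rw [← h2]; abel
    have hz {x : Plane} (hx : x ∈ frontier Ω) : (inner ℝ (turn u) (x - c) : ℝ) ≠ 0 ∨ ℓ x ≠ 0 := by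
      by_contra! h
      have := hline h.2
      rw [h.1, zero_smul, add_zero] at this
      rw [this] at hx
      exact notMem_of_mem_frontier hΩ hx hcΩ
    have hsame {x y : Plane} (hx : x ∈ frontier Ω) (hy : y ∈ frontier Ω) (hxℓ : ℓ x = 0)
        (hyℓ : ℓ y = 0) (hxy : 0 < (inner ℝ (turn u) (x - c) : ℝ) * inner ℝ (turn u) (y - c)) :
        x = y := by
      have h1 := hline hxℓ
      have h2 := hline hyℓ
      generalize (inner ℝ (turn u) (x - c) : ℝ) = α at *
      generalize (inner ℝ (turn u) (y - c) : ℝ) = β at *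
      rcases pos_and_pos_or_neg_and_neg_of_mul_pos hxy with ⟨ha, hb'⟩ | ⟨ha, hb'⟩
      · rw [h1] at hx
        rw [h2] at hy
        rw [h1, h2, frontier_ray_unique hΩ hc hcΩ ha hb' hx hy]
      · have hx' : c + (-α) • (-turn u) ∈ frontier Ω := by rw [smul_neg, neg_smul, neg_neg, ← h1]; exact hx
        have hy' : c + (-β) • (-turn u) ∈ frontier Ω := by rw [smul_neg, neg_smul, neg_neg, ← h2]; exact hy
        have := frontier_ray_unique hΩ hc hcΩ (neg_pos.2 ha) (neg_pos.2 hb') hx' hy'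
        rw [h1, h2, neg_injective this]
    -- Seen from `c`, the line has two rays, each meeting the frontier once. A third frontier point
    -- would share its ray with `p` or `q`, or force `p` and `q` onto the same ray.
    have honly {x : Plane} (hx : x ∈ frontier Ω) (hxℓ : ℓ x = 0) : x = p ∨ x = q := by
      have hpF := hγ.mem_frontier s
      have hqF := hγ.mem_frontier t
      have h1 := (hz hx).resolve_right (by simpa using hxℓ)
      have h2 := (hz hpF).resolve_right (by simpa using hℓp)
      have h3 := (hz hqF).resolve_right (by simpa using hℓq)
      by_contra! hne
      have a1 : (inner ℝ (turn u) (x - c) : ℝ) * inner ℝ (turn u) (p - c) < 0 :=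
        lt_of_le_of_ne (not_lt.1 fun h => hne.1 (hsame hx hpF hxℓ hℓp h)) (mul_ne_zero h1 h2)
      have a2 : (inner ℝ (turn u) (x - c) : ℝ) * inner ℝ (turn u) (q - c) < 0 :=
        lt_of_le_of_ne (not_lt.1 fun h => hne.2 (hsame hx hqF hxℓ hℓq h)) (mul_ne_zero h1 h3)
      refine hqp (hsame hqF hpF hℓq hℓp ?_)
      have := mul_pos_of_neg_of_neg a1 a2
      have hsq : 0 < (inner ℝ (turn u) (x - c) : ℝ) ^ 2 := by positivity
      by_contra! hcon
      nlinarith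
    have hne1 : ∀ x ∈ Ioo t s, ℓ (γ x) ≠ 0 := fun x hx h0 => by
      rcases honly (hγ.mem_frontier x) h0 with h | h
      · exact hx.2.ne (hγ.eq_of_eq (a := t) ⟨hx.1.le, by linarith [hx.2]⟩ ⟨hts.le, hst⟩ h)
      · exact hx.1.ne' (hγ.eq_of_eq (a := t) ⟨hx.1.le, by linarith [hx.2]⟩ ⟨le_rfl, by linarith⟩ h)
    have hne2 : ∀ x ∈ Ioo s (t + 1), ℓ (γ x) ≠ 0 := fun x hx h0 => by
      rcases honly (hγ.mem_frontier x) h0 with h | h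
      · exact hx.1.ne' (hγ.eq_of_eq (a := t) ⟨by linarith [hx.1], hx.2⟩ ⟨hts.le, hst⟩ h)
      · exact (hts.trans hx.1).ne' (hγ.eq_of_eq (a := t) ⟨by linarith [hx.1], hx.2⟩
          ⟨le_rfl, by linarith⟩ h)
    have hboth (w : Plane) (hw : ∀ x ∈ frontier Ω, 0 ≤ inner ℝ w (x - p)) (hw0 : w ≠ 0)
        (hwc : inner ℝ w (c - p) = 0) : False := by
      obtain ⟨r, hr, hrF⟩ := exists_frontier_on_ray hΩ hb hcΩ (neg_ne_zero.2 hw0)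
      have h1 := hw _ hrF
      have e : c + r • -w - p = (c - p) - r • w := by module
      rw [e, inner_sub_right, hwc, inner_smul_right, real_inner_self_eq_norm_sq] at h1
      have : 0 < r * ‖w‖ ^ 2 := by positivity
      linarith
    have hu0 : u ≠ 0 := norm_pos_iff.1 (by rw [hu]; exact one_pos)
    have hcover {x : Plane} (hx : x ∈ frontier Ω) {P : ℝ → Prop} (h1 : ∀ x ∈ Icc t s, P (ℓ (γ x)))
        (h2 : ∀ x ∈ Icc s (t + 1), P (ℓ (γ x))) : P (ℓ x) := by
      obtain ⟨τ, hτ, rfl⟩ := hγ.exists_mem_Ico t hx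
      rcases le_total τ s with h | h
      · exact h1 τ ⟨hτ.1, h⟩
      · exact h2 τ ⟨h, hτ.2.le⟩
    rcases sign_of_ne_zero_Ioo hℓγ hne1 with h1 | h1 <;>
      rcases sign_of_ne_zero_Ioo hℓγ hne2 with h2 | h2
    · exfalso
      refine hboth u (fun x hx => ?_) hu0 hcℓ
      exact hcover hx (P := fun y => 0 ≤ y) (hends (P := fun y => 0 ≤ y) le_rfl e1 e2
        fun x hx => (h1 x hx).le) (hends (P := fun y => 0 ≤ y) le_rfl e2 e3 fun x hx => (h2 x hx).le)
    · exact Or.inl ⟨hends (P := fun y => 0 ≤ y) le_rfl e1 e2 fun x hx => (h1 x hx).le,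
        hends (P := fun y => y ≤ 0) le_rfl e2 e3 fun x hx => (h2 x hx).le⟩
    · exact Or.inr ⟨hends (P := fun y => y ≤ 0) le_rfl e1 e2 fun x hx => (h1 x hx).le,
        hends (P := fun y => 0 ≤ y) le_rfl e2 e3 fun x hx => (h2 x hx).le⟩
    · exfalso
      refine hboth (-u) (fun x hx => ?_) (neg_ne_zero.2 hu0) (by rw [inner_neg_left]; simpa using hcℓ)
      rw [inner_neg_left, Left.nonneg_neg_iff]
      exact hcover hx (P := fun y => y ≤ 0) (hends (P := fun y => y ≤ 0) le_rfl e1 e2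
        fun x hx => (h1 x hx).le) (hends (P := fun y => y ≤ 0) le_rfl e2 e3 fun x hx => (h2 x hx).le)
  · push Not at hmeet
    -- the line supports the domain
    have hseg : segment ℝ q p ⊆ {x | ℓ x = 0} ∩ frontier Ω := by
      intro x hx
      have hxℓ : ℓ x = 0 := by
        obtain ⟨a, b, ha, hb', hab, rfl⟩ := hx
        have : a • q + b • p - p = a • (q - p) := by
          have : p = (a + b) • p := by rw [hab, one_smul]
          nth_rewrite 2 [this]
          module
        simp only [hℓ]
        rw [this, inner_smul_right, huq, mul_zero]
      refine ⟨hxℓ, hc.closure.segment_subset (frontier_subset_closure (hγ.mem_frontier t))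
        (frontier_subset_closure (hγ.mem_frontier s)) hx, ?_⟩
      rw [hΩ.interior_eq]
      exact fun h => hmeet x h hxℓ
    -- Suppose both open arcs had points `γ a`, `γ b` off the line. These cut the frontier into two
    -- closed arcs, one containing `p` and the other `q`. The chord is a connected subset of the
    -- frontier, so it would meet both arcs in a common point, which can only be `γ a` or `γ b`.
    have hflat : (∀ x ∈ Ioo t s, ℓ (γ x) = 0) ∨ ∀ x ∈ Ioo s (t + 1), ℓ (γ x) = 0 := by
      by_contra! hcon
      obtain ⟨⟨a, ha, ha0⟩, b, hb', hb0⟩ := hcon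
      have hpre : IsPreconnected (segment ℝ q p) := (convex_segment q p).isPreconnected
      obtain ⟨x, hxs, hx1, hx2⟩ := isPreconnected_closed_iff.1 hpre (γ '' Icc a b) (γ '' Icc b (a + 1))
        (isCompact_Icc.image hγ.1).isClosed (isCompact_Icc.image hγ.1).isClosed
        (fun x hx => by
          obtain ⟨τ, hτ, rfl⟩ := hγ.exists_mem_Ico a (hseg hx).2
          rcases le_total τ b with h | h
          · exact Or.inl ⟨τ, ⟨hτ.1, h⟩, rfl⟩
          · exact Or.inr ⟨τ, ⟨h, hτ.2.le⟩, rfl⟩)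
        ⟨p, right_mem_segment ℝ q p, s, ⟨ha.2.le, hb'.1.le⟩, rfl⟩
        ⟨q, left_mem_segment ℝ q p, t + 1, ⟨hb'.2.le, by linarith [ha.1]⟩, hper⟩
      obtain ⟨τ, hτ, hτx⟩ := hx1
      obtain ⟨τ', hτ', rfl⟩ := hx2
      have hxℓ : ℓ (γ τ') = 0 := (hseg hxs).1
      have hba : b < a + 1 := by linarith [ha.1, hb'.2]
      rcases eq_or_lt_of_le hτ'.2 with h | h
      · rw [h, hγ.2.1 a] at hxℓ
        exact ha0 hxℓ
      · have := hγ.eq_of_eq (a := a) ⟨hτ.1, by linarith [hτ.2]⟩ ⟨by linarith [hτ'.1, ha.2, hb'.1], h⟩ hτx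
        have hb2 : τ' = b := le_antisymm (this ▸ hτ.2) hτ'.1
        rw [hb2] at hxℓ
        exact hb0 hxℓ
    have hconst : (∀ x ∈ frontier Ω, 0 ≤ ℓ x) ∨ ∀ x ∈ frontier Ω, ℓ x ≤ 0 := by
      have h1 : (∀ x ∈ Ω, 0 ≤ ℓ x) ∨ ∀ x ∈ Ω, ℓ x ≤ 0 := by
        by_contra! hcon
        obtain ⟨⟨x, hx, hx0⟩, y, hy, hy0⟩ := hcon
        obtain ⟨z, hz, hz0⟩ := hc.isPreconnected.intermediate_value hx hy hℓc.continuousOn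
          (show (0 : ℝ) ∈ Icc (ℓ x) (ℓ y) from ⟨hx0.le, hy0.le⟩)
        exact hmeet z hz hz0
      refine h1.imp (fun h x hx => ?_) fun h x hx => ?_
      · exact closure_minimal (t := {x | 0 ≤ ℓ x}) h (isClosed_le continuous_const hℓc)
          (frontier_subset_closure hx)
      · exact closure_minimal (t := {x | ℓ x ≤ 0}) h (isClosed_le hℓc continuous_const)
          (frontier_subset_closure hx)
    rcases hflat with h1 | h1 <;> rcases hconst with h2 | h2
    · exact Or.inr ⟨hends (P := fun y => y ≤ 0) le_rfl e1 e2 fun x hx => (h1 x hx).le,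
        fun x _ => h2 _ (hγ.mem_frontier x)⟩
    · exact Or.inl ⟨hends (P := fun y => 0 ≤ y) le_rfl e1 e2 fun x hx => (h1 x hx).ge,
        fun x _ => h2 _ (hγ.mem_frontier x)⟩
    · exact Or.inl ⟨fun x _ => h2 _ (hγ.mem_frontier x),
        hends (P := fun y => y ≤ 0) le_rfl e2 e3 fun x hx => (h1 x hx).le⟩
    · exact Or.inr ⟨fun x _ => h2 _ (hγ.mem_frontier x),
        hends (P := fun y => 0 ≤ y) le_rfl e2 e3 fun x hx => (h1 x hx).ge⟩

variable {n : ℕ}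

/-! ### Convex hulls of the arcs -/

theorem strictMono_of_interlaced {s : Fin (n + 1) → ℝ} {t : Fin n → ℝ}
    (hst : ∀ i : Fin n, s i.castSucc < t i ∧ t i < s i.succ) : StrictMono s :=
  Fin.strictMono_iff_lt_succ.2 fun i => (hst i).1.trans (hst i).2

theorem arc_length_lt_one {s : Fin (n + 1) → ℝ} {t : Fin n → ℝ}
    (hst : ∀ i : Fin n, s i.castSucc < t i ∧ t i < s i.succ)
    (hs : s (Fin.last n) = s 0 + 1) (i : Fin n) : s i.succ < t i + 1 := by
  have h := (strictMono_of_interlaced hst).monotone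
  linarith [h (Fin.le_last i.succ), h (Fin.zero_le i.castSucc), (hst i).1]

theorem interior_subset_of_inner_le {u : Plane} (hu : ‖u‖ = 1) {κ : ℝ} {A : Set Plane}
    (hA : ∀ x ∈ A, inner ℝ u x ≤ κ) : ∀ x ∈ interior A, (inner ℝ u x : ℝ) < κ := by
  intro x hx
  obtain ⟨ε, hε, hball⟩ := Metric.isOpen_iff.1 isOpen_interior x hx
  have hy : x + (ε / 2) • u ∈ A := interior_subset <| hball <| by
    rw [Metric.mem_ball, dist_self_add_left, norm_smul, hu, mul_one, Real.norm_of_nonneg (by positivity)]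
    linarith
  have := hA _ hy
  rw [inner_add_right, inner_smul_right, real_inner_self_eq_norm_sq, hu] at this
  linarith

theorem closure_convexHull_inner_le {u : Plane} {κ : ℝ} {A : Set Plane}
    (hA : ∀ x ∈ A, inner ℝ u x ≤ κ) : ∀ x ∈ closure (convexHull ℝ A), inner ℝ u x ≤ κ := by
  have hclosed : IsClosed {x : Plane | inner ℝ u x ≤ κ} :=
    isClosed_le (by fun_prop) continuous_const
  have hconv : Convex ℝ {x : Plane | inner ℝ u x ≤ κ} :=
    convex_halfSpace_le (innerSL ℝ u).isLinear κ
  exact closure_minimal (convexHull_min hA hconv) hclosed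

/-- The chord of one arc separates it from the other arc. Hence the closed hulls lie in opposite
closed half-planes, and their interiors in the disjoint open ones. -/
theorem hull_interior_disjoint {Ω : Set Plane} (hΩ : IsOpen Ω) (hc : Convex ℝ Ω)
    (hb : Bornology.IsBounded Ω) {γ : ℝ → Plane} (hγ : IsBoundaryParam Ω γ)
    {s : Fin (n + 1) → ℝ} {t : Fin n → ℝ}
    (hst : ∀ i : Fin n, s i.castSucc < t i ∧ t i < s i.succ)
    (hs : s (Fin.last n) = s 0 + 1) {i j : Fin n} (hij : i ≠ j) :
    interior (closure (convexHull ℝ (γ '' Icc (t i) (s i.succ)))) ∩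
      interior (closure (convexHull ℝ (γ '' Icc (t j) (s j.succ)))) = ∅ := by
  wlog hlt : i < j generalizing i j
  · rw [inter_comm]
    exact this hij.symm (lt_of_le_of_ne (not_lt.1 hlt) hij.symm)
  obtain ⟨u, κ, hu, h1, h2⟩ := hγ.exists_separating hΩ hc hb (hst i).2 (arc_length_lt_one hst hs i)
  have hmono := (strictMono_of_interlaced hst).monotone
  rw [eq_empty_iff_forall_notMem]
  rintro x ⟨hxi, hxj⟩
  have a1 := interior_subset_of_inner_le (u := -u) (κ := -κ) (by rwa [norm_neg])
    (closure_convexHull_inner_le (by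
      rintro _ ⟨τ, hτ, rfl⟩
      rw [inner_neg_left]
      linarith [h1 τ hτ])) x hxi
  have a2 := interior_subset_of_inner_le hu (closure_convexHull_inner_le (by
      rintro _ ⟨τ, hτ, rfl⟩
      refine h2 τ ⟨?_, ?_⟩
      · have : s i.succ ≤ s j.castSucc := hmono (Fin.succ_le_castSucc_iff.2 hlt)
        linarith [hτ.1, (hst j).1]
      · linarith [hτ.2, hmono (Fin.le_last j.succ), hmono (Fin.zero_le i.castSucc), (hst i).1])) x hxj
  rw [inner_neg_left] at a1
  linarith

/-! ### Compactness of convex sets -/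

/-- Blaschke selection for finite families of compact sets. -/
theorem exists_subseq_hausdorff {C : Set Plane} (hC : IsCompact C) (K : ℕ → Fin n → Set Plane)
    (hK : ∀ k i, IsClosed (K k i)) (hKC : ∀ k i, K k i ⊆ C) (hKn : ∀ k i, (K k i).Nonempty) :
    ∃ (K' : Fin n → Set Plane) (g : ℕ → ℕ), StrictMono g ∧ (∀ i, IsCompact (K' i)) ∧
      (∀ i, K' i ⊆ C) ∧ ∀ δ > (0 : ℝ), ∀ᶠ k in atTop, ∀ i,
        (∀ x ∈ K (g k) i, ∃ y ∈ K' i, dist x y < δ) ∧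
        ∀ y ∈ K' i, ∃ x ∈ K (g k) i, dist y x < δ := by
  have : CompactSpace C := isCompact_iff_compactSpace.1 hC
  have hKc k i : IsCompact ((↑) ⁻¹' K k i : Set C) :=
    ((hK k i).preimage continuous_subtype_val).isCompact
  -- Nonempty compact subsets of a compact space form a compact space for the Hausdorff distance,
  -- and so do finite families of them.
  let F : ℕ → Fin n → TopologicalSpace.NonemptyCompacts C := fun k i =>
    ⟨⟨(↑) ⁻¹' K k i, hKc k i⟩, by
      obtain ⟨x, hx⟩ := hKn k i
      exact ⟨⟨x, hKC k i hx⟩, hx⟩⟩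
  obtain ⟨a, g, hg, hlim⟩ := CompactSpace.tendsto_subseq F
  refine ⟨fun i => (↑) '' (a i : Set C), g, hg, fun i => (a i).isCompact.image continuous_subtype_val,
    fun i => ?_, fun δ hδ => ?_⟩
  · rintro _ ⟨x, -, rfl⟩
    exact x.2
  have hev := (Metric.tendsto_nhds.1 hlim) δ hδ
  filter_upwards [hev] with k hk i
  have hki : Metric.hausdorffDist (F (g k) i : Set C) (a i : Set C) < δ :=
    (dist_le_pi_dist _ _ i).trans_lt hk
  have hfin : Metric.hausdorffEDist (F (g k) i : Set C) (a i : Set C) ≠ ⊤ :=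
    Metric.hausdorffEDist_ne_top_of_nonempty_of_bounded (F (g k) i).nonempty (a i).nonempty
      (F (g k) i).isCompact.isBounded (a i).isCompact.isBounded
  constructor
  · intro x hx
    obtain ⟨y, hy, hd⟩ := Metric.exists_dist_lt_of_hausdorffDist_lt
      (show (⟨x, hKC _ _ hx⟩ : C) ∈ (F (g k) i : Set C) from hx) hki hfin
    exact ⟨y, mem_image_of_mem _ hy, hd⟩
  · rintro _ ⟨y, hy, rfl⟩
    obtain ⟨x, hx, hd⟩ := Metric.exists_dist_lt_of_hausdorffDist_lt' hy hki hfin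
    exact ⟨x, hx, by rw [dist_comm]; exact hd⟩

/-- A closed convex set that comes close to every point of a ball contains a smaller ball. -/
theorem ball_subset_of_dist_lt {K : Set Plane} (hK : IsClosed K) (hKc : Convex ℝ K)
    {x : Plane} {ε δ : ℝ} (hδ : 0 < δ)
    (h : ∀ y ∈ Metric.ball x ε, ∃ z ∈ K, dist y z < δ) :
    Metric.ball x (ε - δ) ⊆ K := by
  intro z hz
  by_contra hzK
  obtain ⟨f, a, hfK, hfz⟩ := geometric_hahn_banach_closed_point hKc hK hzK
  set w := (InnerProductSpace.toDual ℝ Plane).symm f with hw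
  have hfw y : f y = inner ℝ w y := by simp [hw]
  rw [hfw] at hfz
  rw [Metric.mem_ball] at hz
  have hw0 : 0 < ‖w‖ := by
    rw [norm_pos_iff]
    intro h0
    obtain ⟨y, hyK, -⟩ := h x (Metric.mem_ball_self (by linarith [dist_nonneg (x := z) (y := x)]))
    have := hfK y hyK
    rw [hfw, h0, inner_zero_left] at this
    rw [h0, inner_zero_left] at hfz
    linarith
  -- Pushing `z` by `δ` along the normal of a separating line stays in the ball of radius `ε`, but
  -- lands at distance at least `δ` from `K`.
  obtain ⟨y, hyK, hy⟩ := h (z + (δ / ‖w‖) • w) (by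
    rw [Metric.mem_ball]
    have h1 := dist_triangle (z + (δ / ‖w‖) • w) z x
    rw [dist_self_add_left, norm_smul, Real.norm_of_nonneg (by positivity),
      div_mul_cancel₀ _ hw0.ne'] at h1
    linarith)
  have h1 := hfK y hyK
  rw [hfw] at h1
  have h2 : inner ℝ w (z + (δ / ‖w‖) • w - y) ≤ ‖w‖ * δ :=
    (real_inner_le_norm _ _).trans (by rw [dist_eq_norm] at hy; gcongr)
  rw [inner_sub_right, inner_add_right, inner_smul_right, real_inner_self_eq_norm_sq] at h2
  have h3 : δ / ‖w‖ * ‖w‖ ^ 2 = ‖w‖ * δ := by field_simp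
  linarith

variable {n : ℕ}

/-- Blaschke selection for families of convex sets with disjoint interiors, with the
semicontinuity of the interior and of the area. -/
theorem exists_limit_regions {C : Set Plane} (hC : IsCompact C) (K : ℕ → Fin n → Set Plane)
    (hK : ∀ k i, IsClosed (K k i)) (hKC : ∀ k i, K k i ⊆ C) (hKc : ∀ k i, Convex ℝ (K k i))
    {A : Fin n → Set Plane} (hAn : ∀ i, (A i).Nonempty) (hA : ∀ k i, A i ⊆ K k i)
    (hdisj : ∀ k i j, i ≠ j → interior (K k i) ∩ interior (K k j) = ∅) :
    ∃ (K' : Fin n → Set Plane) (g : ℕ → ℕ), StrictMono g ∧ (∀ i, IsCompact (K' i)) ∧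
      (∀ i, K' i ⊆ C) ∧ (∀ i, Convex ℝ (K' i)) ∧ (∀ i, A i ⊆ K' i) ∧
      (∀ i j, i ≠ j → interior (K' i) ∩ interior (K' j) = ∅) ∧
      (∀ i, ∀ x ∈ interior (K' i), ∀ᶠ k in atTop, x ∈ K (g k) i) ∧
      ∀ η : ℝ≥0∞, η ≠ 0 → ∀ᶠ k in atTop,
        volume (⋃ i, K (g k) i) ≤ volume (⋃ i, K' i) + η := by
  obtain ⟨K', g, hg, hK', hK'C, hlim⟩ :=
    exists_subseq_hausdorff hC K hK hKC fun k i => (hAn i).mono (hA k i)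
  -- A ball inside the limit is approximated by the convex sets, which therefore contain a ball of
  -- half the radius. Convexity is essential: arbitrary compact sets could converge while having no
  -- interior.
  have hint i : ∀ x ∈ interior (K' i), ∀ᶠ k in atTop, x ∈ interior (K (g k) i) := by
    intro x hx
    obtain ⟨ε, hε, hball⟩ := Metric.isOpen_iff.1 isOpen_interior x hx
    filter_upwards [hlim (ε / 2) (by positivity)] with k hk
    have := ball_subset_of_dist_lt (hK (g k) i) (hKc (g k) i) (x := x) (ε := ε) (half_pos hε)
      fun y hy => (hk i).2 y (interior_subset (hball hy))
    exact interior_maximal this Metric.isOpen_ball (Metric.mem_ball_self (by linarith))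
  refine ⟨K', g, hg, hK', hK'C, fun i => ?_, fun i x hx => ?_, fun i j hij => ?_, fun i x hx => ?_,
    fun η hη => ?_⟩
  · intro x hx y hy a b ha hb hab
    rw [← (hK' i).isClosed.closure_eq, Metric.mem_closure_iff]
    intro ε hε
    obtain ⟨k, hk⟩ := (hlim (ε / 2) (by positivity)).exists
    obtain ⟨x', hx', hdx⟩ := (hk i).2 x hx
    obtain ⟨y', hy', hdy⟩ := (hk i).2 y hy
    obtain ⟨z, hz, hdz⟩ := (hk i).1 _ (hKc (g k) i hx' hy' ha hb hab)
    refine ⟨z, hz, ?_⟩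
    have h1 : dist (a • x + b • y) (a • x' + b • y') ≤ ε / 2 := by
      refine (dist_add_add_le _ _ _ _).trans ?_
      rw [dist_smul₀, dist_smul₀, Real.norm_of_nonneg ha, Real.norm_of_nonneg hb]
      calc a * dist x x' + b * dist y y' ≤ a * (ε / 2) + b * (ε / 2) := by gcongr
        _ = ε / 2 := by rw [← add_mul, hab, one_mul]
    linarith [dist_triangle (a • x + b • y) (a • x' + b • y') z]
  · rw [← (hK' i).isClosed.closure_eq, Metric.mem_closure_iff]
    intro ε hε
    obtain ⟨k, hk⟩ := (hlim ε hε).exists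
    exact (hk i).1 x (hA _ _ hx)
  · rw [eq_empty_iff_forall_notMem]
    rintro x ⟨hxi, hxj⟩
    obtain ⟨k, hki, hkj⟩ := ((hint i x hxi).and (hint j x hxj)).exists
    exact eq_empty_iff_forall_notMem.1 (hdisj (g k) i j hij) x ⟨hki, hkj⟩
  · exact (hint i x hx).mono fun k hk => interior_subset hk
  · have hU : IsCompact (⋃ i, K' i) := isCompact_iUnion hK'
    have hlt : volume (⋃ i, K' i) < volume (⋃ i, K' i) + η :=
      ENNReal.lt_add_right hU.measure_lt_top.ne hη
    -- The approximating sets lie in a small thickening of the compact limit, and the area of such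
    -- thickenings decreases to that of the limit.
    have hth := (tendsto_measure_cthickening_of_isCompact (μ := volume) hU).eventually_lt_const hlt
    obtain ⟨δ, hδ, hball⟩ := Metric.eventually_nhds_iff.1 hth
    filter_upwards [hlim (δ / 2) (by positivity)] with k hk
    refine (measure_mono ?_).trans (hball (y := δ / 2) ?_).le
    · refine iUnion_subset fun i x hx => ?_
      obtain ⟨y, hy, hd⟩ := (hk i).1 x hx
      exact Metric.mem_cthickening_of_dist_le x y _ _ (mem_iUnion.2 ⟨i, hy⟩) hd.le
    · rw [Real.dist_eq, sub_zero, abs_of_pos (by positivity)]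
      linarith

/-! ### Directions in the plane -/

/-- The tangent of half of the angle from `v` to `w`. -/
def halfAngleTan (v w : Plane) : ℝ := inner ℝ (turn v) w / (‖w‖ + inner ℝ v w)

/-- A vector for which the tangent of half of the angle from `v` is `x`. -/
def dirOfTan (v : Plane) (x : ℝ) : Plane := (1 - x ^ 2) • v + (2 * x) • turn v

theorem inner_turn_self (v : Plane) : (inner ℝ v (turn v) : ℝ) = 0 := by
  rw [real_inner_comm, inner_turn]; ring

theorem norm_sq_eq_of_unit {v : Plane} (hv : ‖v‖ = 1) (w : Plane) :
    ‖w‖ ^ 2 = (inner ℝ v w : ℝ) ^ 2 + (inner ℝ (turn v) w : ℝ) ^ 2 := by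
  have h : v.ofLp 0 * v.ofLp 0 + v.ofLp 1 * v.ofLp 1 = 1 := by
    rw [← inner_plane, real_inner_self_eq_norm_sq, hv, one_pow]
  rw [← real_inner_self_eq_norm_sq, inner_turn, inner_plane, inner_plane]
  linear_combination (-(w.ofLp 0 ^ 2) - w.ofLp 1 ^ 2) * h

theorem inner_dirOfTan {v : Plane} (hv : ‖v‖ = 1) (x : ℝ) :
    (inner ℝ v (dirOfTan v x) : ℝ) = 1 - x ^ 2 := by
  rw [dirOfTan, inner_add_right, inner_smul_right, inner_smul_right, inner_turn_self,
    real_inner_self_eq_norm_sq, hv]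
  ring

theorem inner_turn_dirOfTan {v : Plane} (hv : ‖v‖ = 1) (x : ℝ) :
    (inner ℝ (turn v) (dirOfTan v x) : ℝ) = 2 * x := by
  rw [dirOfTan, inner_add_right, inner_smul_right, inner_smul_right, real_inner_comm,
    inner_turn_self, real_inner_self_eq_norm_sq, norm_turn, hv]
  ring

theorem norm_dirOfTan {v : Plane} (hv : ‖v‖ = 1) (x : ℝ) : ‖dirOfTan v x‖ = 1 + x ^ 2 := by
  rw [← sq_eq_sq₀ (norm_nonneg _) (by positivity), norm_sq_eq_of_unit hv, inner_dirOfTan hv,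
    inner_turn_dirOfTan hv]
  ring

theorem halfAngleTan_smul (v : Plane) {c : ℝ} (hc : 0 < c) (w : Plane) :
    halfAngleTan v (c • w) = halfAngleTan v w := by
  rw [halfAngleTan, halfAngleTan, inner_smul_right, inner_smul_right, norm_smul,
    Real.norm_of_nonneg hc.le, ← mul_add, mul_div_mul_left _ _ hc.ne']

theorem halfAngleTan_dirOfTan {v : Plane} (hv : ‖v‖ = 1) (x : ℝ) :
    halfAngleTan v (dirOfTan v x) = x := by
  rw [halfAngleTan, inner_dirOfTan hv, inner_turn_dirOfTan hv, norm_dirOfTan hv]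
  ring

/-- With `halfAngleTan_dirOfTan`, directions other than `-v` correspond to real numbers by
stereographic projection. This rational parameter replaces the angle and has no branch to choose. -/
theorem dirOfTan_halfAngleTan {v : Plane} (hv : ‖v‖ = 1) {w : Plane}
    (hw : 0 < ‖w‖ + inner ℝ v w) :
    dirOfTan v (halfAngleTan v w) = (2 / (‖w‖ + inner ℝ v w)) • w := by
  have h := norm_sq_eq_of_unit hv w
  have hd := decompose_turn hv w
  rw [dirOfTan, halfAngleTan]
  generalize (inner ℝ v w : ℝ) = a at *
  generalize (inner ℝ (turn v) w : ℝ) = b at *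
  generalize ‖w‖ = r at *
  have e1 : 1 - (b / (r + a)) ^ 2 = 2 / (r + a) * a := by
    field_simp
    linear_combination h
  have e2 : 2 * (b / (r + a)) = 2 / (r + a) * b := by ring
  rw [hd, e1, e2, smul_add, smul_smul, smul_smul]

/-- The denominator of the half-angle tangent is zero only for nonnegative multiples of `-v`. -/
theorem norm_add_inner_pos {v : Plane} (hv : ‖v‖ = 1) {w : Plane} (hw : w ≠ ‖w‖ • (-v)) :
    0 < ‖w‖ + inner ℝ v w := by
  have h1 := norm_sq_eq_of_unit hv w
  have h2 : -‖w‖ ≤ (inner ℝ v w : ℝ) := by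
    nlinarith [norm_nonneg w, sq_nonneg (inner ℝ (turn v) w : ℝ)]
  refine lt_of_le_of_ne (by linarith) fun h => hw ?_
  have h3 : (inner ℝ v w : ℝ) = -‖w‖ := by linarith
  have h4 : (inner ℝ (turn v) w : ℝ) = 0 := by
    rw [h3] at h1
    nlinarith
  conv_lhs => rw [decompose_turn hv w, h3, h4]
  module

theorem norm_dirOfTan_sub_le {v : Plane} (hv : ‖v‖ = 1) {x y M : ℝ} (hx : |x| ≤ M)
    (hy : |y| ≤ M) : ‖dirOfTan v x - dirOfTan v y‖ ≤ (2 * M + 2) * |x - y| := by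
  have h : dirOfTan v x - dirOfTan v y
      = (-((x + y) * (x - y))) • v + (2 * (x - y)) • turn v := by
    simp only [dirOfTan]; module
  rw [h]
  refine (norm_add_le _ _).trans ?_
  rw [norm_smul, norm_smul, norm_turn, hv, norm_neg, norm_mul, norm_mul, Real.norm_eq_abs,
    Real.norm_eq_abs, Real.norm_eq_abs, abs_two]
  nlinarith [abs_add_le x y, abs_nonneg (x - y)]

/-! ### Radial projection onto the frontier of a convex body -/

/-- On vectors of norm at least one, `1 / g` and `‖b‖ / g b` are at most `R`. The difference splits
into the change of the vector and the change of the factor. -/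
theorem norm_radial_sub_le {g : Plane → ℝ} {R L : ℝ} (hR : 0 < R)
    (hgR : ∀ a, ‖a‖ ≤ R * g a) (hL : ∀ a b, |g a - g b| ≤ L * ‖a - b‖) {a b : Plane}
    (ha : 1 ≤ ‖a‖) (hb : 1 ≤ ‖b‖) :
    ‖(g a)⁻¹ • a - (g b)⁻¹ • b‖ ≤ (R + R * L * R) * ‖a - b‖ := by
  have h1 := hgR a
  have h2 := hgR b
  have ga : 0 < g a := by by_contra! h; nlinarith
  have gb : 0 < g b := by by_contra! h; nlinarith
  have e : (g a)⁻¹ • a - (g b)⁻¹ • b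
      = (g a)⁻¹ • (a - b) + ((g a)⁻¹ * (g b - g a) * (g b)⁻¹) • b := by
    have : (g a)⁻¹ * (g b - g a) * (g b)⁻¹ = (g a)⁻¹ - (g b)⁻¹ := by field_simp
    rw [this]; module
  have hia : (g a)⁻¹ ≤ R := by
    rw [inv_le_iff_one_le_mul₀ ga]; linarith
  have hib : (g b)⁻¹ * ‖b‖ ≤ R := by
    rw [inv_mul_le_iff₀ gb]; linarith
  rw [e]
  refine (norm_add_le _ _).trans ?_
  rw [norm_smul, norm_smul, norm_mul, norm_mul, norm_inv, norm_inv, Real.norm_of_nonneg ga.le,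
    Real.norm_of_nonneg gb.le, Real.norm_eq_abs, abs_sub_comm, add_mul, mul_assoc _ _ ‖b‖]
  have hLab := hL a b
  have : (g a)⁻¹ * |g a - g b| * ((g b)⁻¹ * ‖b‖) ≤ R * (L * ‖a - b‖) * R := by
    gcongr
    exact mul_nonneg hR.le ((abs_nonneg _).trans hLab)
  nlinarith [mul_le_mul_of_nonneg_right hia (norm_nonneg (a - b))]

/-! ### Curves which bound a given convex set -/

/-- The conclusion of the construction: `σ` is an admissible curve between the endpoints of the
boundary arc `A`, and `A` and `σ` enclose a convex set which differs from `K` by a null set. -/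
def IsBoundingCurve (Ω A K : Set Plane) (q p : Plane) (σ : unitInterval → Plane) : Prop :=
  (∃ L : ℝ≥0, LipschitzWith L σ) ∧ (∀ τ, σ τ ∈ closure Ω) ∧ Function.Injective σ ∧
    σ 0 = q ∧ σ 1 = p ∧ Convex ℝ (enclosed (A ∪ range σ)) ∧ enclosed (A ∪ range σ) ⊆ K ∧
    interior K ⊆ enclosed (A ∪ range σ)

/-- The curve is a segment if the convex set has empty interior. -/
theorem exists_boundingCurve_of_interior_eq_empty {Ω : Set Plane} {γ : ℝ → Plane}
    (hγ : IsBoundaryParam Ω γ) {t s : ℝ} (hts : t < s) (hst : s < t + 1) {K : Set Plane}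
    (hKc : Convex ℝ K) (hAK : γ '' Icc t s ⊆ K) (hKΩ : K ⊆ closure Ω) (hint : interior K = ∅) :
    ∃ σ, IsBoundingCurve Ω (γ '' Icc t s) K (γ t) (γ s) σ := by
  have hinj : InjOn γ (Icc t s) := fun x hx y hy h =>
    hγ.eq_of_eq (a := t) ⟨hx.1, hx.2.trans_lt hst⟩ ⟨hy.1, hy.2.trans_lt hst⟩ h
  have htm : t ∈ Icc t s := left_mem_Icc.2 hts.le
  have hsm : s ∈ Icc t s := right_mem_Icc.2 hts.le
  have hq : γ t ∈ K := hAK (mem_image_of_mem _ htm)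
  have hp : γ s ∈ K := hAK (mem_image_of_mem _ hsm)
  have hqp : γ t ≠ γ s := fun h => hts.ne (hinj htm hsm h)
  -- A convex set without interior has a proper affine span, hence lies on a line with some normal
  -- `u`.
  obtain ⟨u, hu, hperp⟩ : ∃ u : Plane, ‖u‖ = 1 ∧ ∀ x ∈ K, inner ℝ u (x - γ t) = 0 := by
    have h1 : affineSpan ℝ K ≠ ⊤ := fun h => by
      rw [← hKc.interior_nonempty_iff_affineSpan_eq_top, hint] at h
      exact not_nonempty_empty h
    have h2 : (affineSpan ℝ K).direction ≠ ⊤ := fun h => h1 <|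
      (AffineSubspace.direction_eq_top_iff_of_nonempty ⟨γ t, subset_affineSpan ℝ K hq⟩).1 h
    have h3 : (affineSpan ℝ K).directionᗮ ≠ ⊥ := fun h => h2 (Submodule.orthogonal_eq_bot_iff.1 h)
    obtain ⟨w, hw, hw0⟩ := Submodule.exists_mem_ne_zero_of_ne_bot h3
    refine ⟨‖w‖⁻¹ • w, by rw [norm_smul, norm_inv, norm_norm, inv_mul_cancel₀ (norm_ne_zero_iff.2 hw0)],
      fun x hx => ?_⟩
    have h4 : x - γ t ∈ (affineSpan ℝ K).direction :=
      AffineSubspace.vsub_mem_direction (subset_affineSpan ℝ K hx) (subset_affineSpan ℝ K hq)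
    rw [inner_smul_left, (Submodule.mem_orthogonal' _ _).1 hw _ h4, mul_zero]
  set c : ℝ → ℝ := fun τ => inner ℝ (turn u) (γ τ - γ t) with hc
  have hcc : Continuous c := by have := hγ.1; fun_prop
  have hγc : ∀ τ ∈ Icc t s, γ τ = γ t + c τ • turn u := fun τ hτ => by
    have := decompose_turn hu (γ τ - γ t)
    rw [hperp _ (hAK (mem_image_of_mem _ hτ)), zero_smul, zero_add] at this
    rw [hc, ← this]; abel
  have hcinj : InjOn c (Icc t s) := fun x hx y hy h =>
    hinj hx hy (by rw [hγc x hx, hγc y hy, h])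
  have hct : c t = 0 := by simp [hc]
  -- On the line the arc has an injective continuous coordinate, which is monotone, so the arc stays
  -- between its endpoints. The curve may therefore run along the same segment, and the enclosed set
  -- is that segment.
  have hseg : γ '' Icc t s ⊆ segment ℝ (γ t) (γ s) := by
    rintro _ ⟨τ, hτ, rfl⟩
    have hcs : c s ≠ 0 := fun h => hts.ne' (hcinj hsm htm (h.trans hct.symm))
    have hθ : c τ / c s ∈ Icc (0 : ℝ) 1 := by
      rcases hcc.continuousOn.strictMonoOn_of_injOn_Icc' hts.le hcinj with hm | hm
      · have h1 := hm.monotoneOn htm hτ hτ.1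
        have h2 := hm.monotoneOn hτ hsm hτ.2
        rw [hct] at h1
        exact ⟨div_nonneg h1 (h1.trans h2), div_le_one_of_le₀ h2 (h1.trans h2)⟩
      · have h1 := hm.antitoneOn htm hτ hτ.1
        have h2 := hm.antitoneOn hτ hsm hτ.2
        rw [hct] at h1
        refine ⟨div_nonneg_of_nonpos h1 (h2.trans h1), ?_⟩
        rw [← neg_div_neg_eq]
        exact div_le_one_of_le₀ (by linarith) (by linarith)
    rw [segment_eq_image_lineMap]
    refine ⟨c τ / c s, hθ, ?_⟩
    rw [AffineMap.lineMap_apply_module', hγc τ hτ, hγc s hsm, add_sub_cancel_left, smul_smul,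
      div_mul_cancel₀ _ hcs, add_comm]
  set σ : unitInterval → Plane := fun τ => AffineMap.lineMap (γ t) (γ s) (τ : ℝ) with hσ
  have hrange : range σ = segment ℝ (γ t) (γ s) := by
    rw [segment_eq_image_lineMap, hσ]
    ext x; simp
  have hsegK : segment ℝ (γ t) (γ s) ⊆ K := hKc.segment_subset hq hp
  have hcl : IsClosed (segment ℝ (γ t) (γ s)) := by
    rw [segment_eq_image_lineMap]
    exact (isCompact_Icc.image AffineMap.lineMap_continuous).isClosed
  have hE : enclosed (γ '' Icc t s ∪ range σ) = segment ℝ (γ t) (γ s) := by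
    rw [hrange, union_eq_right.2 hseg]
    exact (enclosed_subset hcl (convex_segment _ _) ⟨_, left_mem_segment _ _ _⟩ Subset.rfl).antisymm
      (subset_enclosed _)
  refine ⟨σ, ⟨nndist (γ t) (γ s), ?_⟩, fun τ => hKΩ (hsegK (hrange ▸ mem_range_self τ)), ?_, ?_, ?_,
    ?_, ?_, ?_⟩
  · refine LipschitzWith.of_dist_le_mul fun x y => ?_
    rw [hσ, dist_lineMap_lineMap, mul_comm, coe_nndist]
    exact le_rfl
  · intro x y h
    exact Subtype.ext (AffineMap.lineMap_injective ℝ hqp h)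
  · simp [hσ]
  · simp [hσ]
  · rw [hE]; exact convex_segment _ _
  · rw [hE]; exact hsegK
  · rw [hint]; exact empty_subset _

/-- The gauge of a convex body with respect to an interior point `o`. -/
theorem exists_gauge {K : Set Plane} (hK : IsCompact K) (hKc : Convex ℝ K) {o : Plane}
    (ho : o ∈ interior K) :
    ∃ (g : Plane → ℝ) (R L : ℝ), 0 < R ∧ 0 ≤ L ∧ (∀ a, ‖a‖ ≤ R * g a) ∧
      (∀ a b, |g a - g b| ≤ L * ‖a - b‖) ∧ (∀ c : ℝ, 0 ≤ c → ∀ a, g (c • a) = c * g a) ∧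
      ∀ a, g a = 1 ↔ o + a ∈ frontier K := by
  set K₀ : Set Plane := (Homeomorph.addLeft o) ⁻¹' K with hK₀
  have hconv : Convex ℝ K₀ := hKc.translate_preimage_right o
  have hnhds : K₀ ∈ 𝓝 (0 : Plane) := by
    refine (Homeomorph.addLeft o).continuous.continuousAt.preimage_mem_nhds ?_
    simpa using mem_interior_iff_mem_nhds.1 ho
  obtain ⟨R, hR⟩ := hK.isBounded.exists_norm_le
  obtain ⟨L, hL⟩ := hconv.lipschitz_gauge hnhds
  have hR0 : 0 ≤ R := (norm_nonneg _).trans (hR o (interior_subset ho))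
  have hball : K₀ ⊆ Metric.closedBall 0 (R + ‖o‖ + 1) := fun x hx => by
    rw [mem_closedBall_zero_iff]
    have h1 := hR _ hx
    have h2 := norm_sub_le (o + x) o
    rw [add_sub_cancel_left] at h2
    simp only [Homeomorph.coe_addLeft] at h1
    linarith
  refine ⟨gauge K₀, R + ‖o‖ + 1, L, by positivity, L.2, fun a => ?_, fun a b => ?_, fun c hc a => ?_,
    fun a => ?_⟩
  · have := le_gauge_of_subset_closedBall (absorbent_nhds_zero hnhds) (by positivity) hball (x := a)
    rwa [div_le_iff₀' (by positivity)] at this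
  · have := hL.dist_le_mul a b
    rwa [Real.dist_eq, dist_eq_norm] at this
  · rw [gauge_smul_of_nonneg hc, smul_eq_mul]
  · rw [gauge_eq_one_iff_mem_frontier hconv hnhds, hK₀, ← Homeomorph.preimage_frontier]
    rfl

/-- The curve is the other arc of the frontier if the convex set has interior points. -/
theorem exists_boundingCurve_of_interior_nonempty {Ω : Set Plane} (hΩ : IsOpen Ω)
    (hc : Convex ℝ Ω) (hb : Bornology.IsBounded Ω) {γ : ℝ → Plane}
    (hγ : IsBoundaryParam Ω γ) {t s : ℝ} (hts : t < s) (hst : s < t + 1) {K : Set Plane}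
    (hK : IsCompact K) (hKc : Convex ℝ K) (hAK : γ '' Icc t s ⊆ K) (hKΩ : K ⊆ closure Ω)
    (hint : (interior K).Nonempty) :
    ∃ σ, IsBoundingCurve Ω (γ '' Icc t s) K (γ t) (γ s) σ := by
  obtain ⟨o, ho⟩ := hint
  -- An open convex set is the interior of its closure. Consequently the boundary arc cannot meet
  -- the interior of `K` and must lie on its frontier.
  have hiΩ : interior K ⊆ Ω := by
    have hne : (interior (closure Ω)).Nonempty := ⟨o, interior_mono hKΩ ho⟩
    have hneΩ : (interior Ω).Nonempty := by
      rw [hΩ.interior_eq]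
      by_contra h
      rw [not_nonempty_iff_eq_empty.1 h, closure_empty, interior_empty] at hne
      exact not_nonempty_empty hne
    have := interior_mono hKΩ
    rwa [hc.interior_closure_eq_interior_of_nonempty_interior hneΩ, hΩ.interior_eq] at this
  have hoΩ : o ∈ Ω := hiΩ ho
  have hAF : γ '' Icc t s ⊆ frontier K := by
    rintro _ ⟨τ, hτ, rfl⟩
    exact ⟨subset_closure (hAK (mem_image_of_mem _ hτ)), fun h =>
      notMem_of_mem_frontier hΩ (hγ.mem_frontier τ) (hiΩ h)⟩
  obtain ⟨g, R, L, hR, hL0, hgR, hgL, hgs, hgF⟩ := exists_gauge hK hKc ho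
  -- a direction which is not taken by the other arc
  set m := γ ((t + s) / 2) with hm
  have hmo : m - o ≠ 0 := fun h => by
    rw [sub_eq_zero] at h
    exact notMem_of_mem_frontier hΩ (hγ.mem_frontier _) (show γ ((t + s) / 2) ∈ Ω from hm ▸ h ▸ hoΩ)
  have hmo' : 0 < ‖m - o‖ := norm_pos_iff.2 hmo
  set v : Plane := -(‖m - o‖⁻¹ • (m - o)) with hv
  have hv1 : ‖v‖ = 1 := by rw [hv, norm_neg, norm_smul, norm_inv, norm_norm, inv_mul_cancel₀ hmo'.ne']
  have hmv : m = o + ‖m - o‖ • (-v) := by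
    rw [hv, neg_neg, smul_smul, mul_inv_cancel₀ hmo'.ne', one_smul]; abel
  have hγo τ : γ τ - o ≠ 0 := fun h =>
    notMem_of_mem_frontier hΩ (hγ.mem_frontier τ) (by rw [sub_eq_zero.1 h]; exact hoΩ)
  have hpos : ∀ τ ∈ Icc s (t + 1), 0 < ‖γ τ - o‖ + inner ℝ v (γ τ - o) := by
    intro τ hτ
    refine norm_add_inner_pos hv1 fun h => ?_
    have e1 : γ τ = o + ‖γ τ - o‖ • (-v) := by rw [← h]; abel
    have e2 : ‖γ τ - o‖ = ‖m - o‖ := frontier_ray_unique hΩ hc hoΩ (norm_pos_iff.2 (hγo τ)) hmo'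
      (e1 ▸ hγ.mem_frontier τ) (hmv ▸ hγ.mem_frontier _)
    have e3 : γ τ = m := by rw [e1, hmv, e2]
    have := hγ.eq_of_eq (a := (t + s) / 2) ⟨by linarith [hτ.1], by linarith [hτ.2]⟩
      ⟨le_rfl, by linarith⟩ e3
    linarith [hτ.1]
  have hsm : s ∈ Icc s (t + 1) := ⟨le_rfl, hst.le⟩
  have htm : t + 1 ∈ Icc s (t + 1) := ⟨hst.le, le_rfl⟩
  -- The direction, seen from `o`, of the points on the remaining arc of `∂Ω`. It is injective
  -- because a ray from `o` meets `∂Ω` only once, hence monotone with values between `a` and `b`.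
  set θ : ℝ → ℝ := fun τ => halfAngleTan v (γ τ - o) with hθ
  have hθc : ContinuousOn θ (Icc s (t + 1)) := by
    have h1 := hγ.1
    refine ContinuousOn.div (by fun_prop) (by fun_prop) fun τ hτ => (hpos τ hτ).ne'
  have hθinj : InjOn θ (Icc s (t + 1)) := by
    intro x hx y hy h
    have e := congrArg (dirOfTan v) h
    simp only [hθ] at e
    rw [dirOfTan_halfAngleTan hv1 (hpos x hx), dirOfTan_halfAngleTan hv1 (hpos y hy)] at e
    have a1 : 0 < 2 / (‖γ x - o‖ + inner ℝ v (γ x - o)) := div_pos two_pos (hpos x hx)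
    have a2 : 0 < 2 / (‖γ y - o‖ + inner ℝ v (γ y - o)) := div_pos two_pos (hpos y hy)
    generalize 2 / (‖γ x - o‖ + inner ℝ v (γ x - o)) = c1 at *
    generalize 2 / (‖γ y - o‖ + inner ℝ v (γ y - o)) = c2 at *
    have e1 : γ x = o + c1⁻¹ • (c1 • (γ x - o)) := by
      rw [smul_smul, inv_mul_cancel₀ a1.ne', one_smul]; abel
    have e2 : γ y = o + c2⁻¹ • (c1 • (γ x - o)) := by
      rw [e, smul_smul, inv_mul_cancel₀ a2.ne', one_smul]; abel
    have e3 : c1⁻¹ = c2⁻¹ := frontier_ray_unique hΩ hc hoΩ (inv_pos.2 a1) (inv_pos.2 a2)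
      (e1 ▸ hγ.mem_frontier x) (e2 ▸ hγ.mem_frontier y)
    exact hγ.eq_of_eq (a := s) ⟨hx.1, by linarith [hx.2]⟩ ⟨hy.1, by linarith [hy.2]⟩
      (by rw [e1, e2, e3])
  set a := θ (t + 1) with ha
  set b := θ s with hbb
  have hab : a ≠ b := fun h => hst.ne' (hθinj htm hsm h)
  have hθab : ∀ τ ∈ Icc s (t + 1), θ τ ∈ segment ℝ a b := by
    intro τ hτ
    rw [segment_eq_uIcc]
    rcases hθc.strictMonoOn_of_injOn_Icc' hst.le hθinj with hm' | hm'
    · exact mem_uIcc.2 (Or.inr ⟨hm'.monotoneOn hsm hτ hτ.1, hm'.monotoneOn hτ htm hτ.2⟩)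
    · exact mem_uIcc.2 (Or.inl ⟨hm'.antitoneOn hτ htm hτ.2, hm'.antitoneOn hsm hτ hτ.1⟩)
  -- the radial projection
  set P : ℝ → Plane := fun x => (g (dirOfTan v x))⁻¹ • dirOfTan v x with hP
  have hD1 x : 1 ≤ ‖dirOfTan v x‖ := by rw [norm_dirOfTan hv1]; nlinarith
  have hgpos x : 0 < g (dirOfTan v x) := by
    by_contra! h
    nlinarith [hgR (dirOfTan v x), hD1 x]
  have hPF x : o + P x ∈ frontier K := by
    rw [← hgF, hP, hgs _ (inv_nonneg.2 (hgpos x).le), inv_mul_cancel₀ (hgpos x).ne']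
  have hPh x : halfAngleTan v (P x) = x := by
    rw [hP, halfAngleTan_smul v (inv_pos.2 (hgpos x)), halfAngleTan_dirOfTan hv1]
  have hPθ {τ} (hτ : τ ∈ Icc s (t + 1)) {c : ℝ} (hc : 0 < c)
      (hF : o + c • (γ τ - o) ∈ frontier K) : P (θ τ) = c • (γ τ - o) := by
    have h1 := (hgF _).2 hF
    rw [hgs c hc.le] at h1
    have h2 : 0 < 2 / (‖γ τ - o‖ + inner ℝ v (γ τ - o)) := div_pos two_pos (hpos τ hτ)
    simp only [hP, hθ]
    rw [dirOfTan_halfAngleTan hv1 (hpos τ hτ)]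
    generalize 2 / (‖γ τ - o‖ + inner ℝ v (γ τ - o)) = c1 at *
    have hg0 : g (γ τ - o) ≠ 0 := fun h => by rw [h, mul_zero] at h1; exact zero_ne_one h1
    rw [hgs c1 h2.le, smul_smul]
    congr 1
    field_simp
    linarith
  have hend {τ} (hτ : τ ∈ Icc s (t + 1)) (hF : γ τ ∈ frontier K) : o + P (θ τ) = γ τ := by
    rw [hPθ hτ one_pos (by rwa [one_smul, add_sub_cancel]), one_smul, add_sub_cancel]
  -- The half-angle parameter runs linearly from the direction of `γ (t + 1) = γ t` to that of `γ
  -- s`; the point is then projected radially to the frontier of `K`.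
  set σ : unitInterval → Plane := fun r => o + P (AffineMap.lineMap a b (r : ℝ)) with hσ
  have hσF r : σ r ∈ frontier K := hPF _
  -- Follow the ray from `o` through `y` to `∂Ω`. If it ends on the given arc, that endpoint also
  -- lies on the frontier of `K` and is `y` itself. Otherwise it ends on the remaining arc, and `y`
  -- is the radial projection of that point, hence on the curve.
  have hunion : γ '' Icc t s ∪ range σ = frontier K := by
    refine (union_subset hAF (range_subset_iff.2 hσF)).antisymm fun y hy => ?_
    have hyo : y - o ≠ 0 := fun h => hy.2 (by rw [sub_eq_zero.1 h]; exact ho)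
    obtain ⟨r, hr, hrF⟩ := exists_frontier_on_ray hΩ hb hoΩ hyo
    obtain ⟨τ, hτ, hτe⟩ := hγ.exists_mem_Ico t hrF
    have hy1 : g (y - o) = 1 := (hgF _).2 (by rwa [add_sub_cancel])
    rcases le_or_gt τ s with h | h
    · have h1 : γ τ ∈ frontier K := hAF (mem_image_of_mem _ ⟨hτ.1, h⟩)
      rw [hτe, ← hgF, hgs _ hr.le, hy1, mul_one] at h1
      refine Or.inl ⟨τ, ⟨hτ.1, h⟩, ?_⟩
      rw [hτe, h1, one_smul, add_sub_cancel]
    · refine Or.inr ?_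
      have hτ' : τ ∈ Icc s (t + 1) := ⟨h.le, hτ.2.le⟩
      have e : y - o = r⁻¹ • (γ τ - o) := by
        rw [hτe, add_sub_cancel_left, smul_smul, inv_mul_cancel₀ hr.ne', one_smul]
      have h1 := hPθ hτ' (inv_pos.2 hr) (by rw [← e, add_sub_cancel]; exact hy)
      have h2 := hθab τ hτ'
      rw [segment_eq_image_lineMap] at h2
      obtain ⟨ρ, hρ, hρe⟩ := h2
      refine ⟨⟨ρ, hρ⟩, ?_⟩
      simp only [hσ]
      rw [hρe, h1, ← e, add_sub_cancel]
  have hE : enclosed (γ '' Icc t s ∪ range σ) = K := by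
    rw [hunion, enclosed_frontier hK hKc ⟨o, interior_subset ho⟩]
  refine ⟨σ, ?_, fun r => hKΩ (hK.isClosed.frontier_subset (hσF r)), ?_, ?_, ?_, ?_, ?_, ?_⟩
  · set M := max |a| |b| with hM
    have hMl (r : unitInterval) : |AffineMap.lineMap a b (r : ℝ)| ≤ M := by
      have h1 : AffineMap.lineMap a b (r : ℝ) ∈ segment ℝ a b := by
        rw [segment_eq_image_lineMap]; exact mem_image_of_mem _ r.2
      have h2 : Convex ℝ (Metric.closedBall (0 : ℝ) M) := convex_closedBall _ _
      have h3 := h2.segment_subset (x := a) (y := b)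
        (mem_closedBall_zero_iff.2 (le_max_left _ _)) (mem_closedBall_zero_iff.2 (le_max_right _ _)) h1
      exact mem_closedBall_zero_iff.1 h3
    have hM0 : 0 ≤ M := (abs_nonneg _).trans (le_max_left _ _)
    refine ⟨((R + R * L * R) * ((2 * M + 2) * dist a b)).toNNReal, LipschitzWith.of_dist_le_mul fun x y => ?_⟩
    rw [Real.coe_toNNReal _ (by positivity)]
    simp only [hσ, dist_add_left, hP]
    rw [dist_eq_norm]
    refine (norm_radial_sub_le hR hgR hgL (hD1 _) (hD1 _)).trans ?_
    have h1 := norm_dirOfTan_sub_le hv1 (hMl x) (hMl y)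
    have h2 : |AffineMap.lineMap a b (x : ℝ) - AffineMap.lineMap a b (y : ℝ)| = dist x y * dist a b := by
      rw [← Real.dist_eq, dist_lineMap_lineMap]
      rfl
    rw [h2] at h1
    calc (R + R * L * R) * _ ≤ (R + R * L * R) * ((2 * M + 2) * (dist x y * dist a b)) := by gcongr
      _ = _ := by ring
  · intro x y h
    have h1 := congrArg (halfAngleTan v) (add_left_cancel h)
    rw [hPh, hPh] at h1
    exact Subtype.ext (AffineMap.lineMap_injective ℝ hab h1)
  · have h0 : σ 0 = o + P a := by simp [hσ]
    have hper : γ (t + 1) = γ t := hγ.2.1 t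
    rw [h0, hend htm (by rw [hper]; exact hAF (mem_image_of_mem _ ⟨le_rfl, hts.le⟩)), hper]
  · have h1 : σ 1 = o + P b := by simp [hσ]
    rw [h1, hend hsm (hAF (mem_image_of_mem _ ⟨hts.le, le_rfl⟩))]
  · rwa [hE]
  · rw [hE]
  · rw [hE]; exact interior_subset

theorem exists_boundingCurve {Ω : Set Plane} (hΩ : IsOpen Ω)
    (hc : Convex ℝ Ω) (hb : Bornology.IsBounded Ω) {γ : ℝ → Plane}
    (hγ : IsBoundaryParam Ω γ) {t s : ℝ} (hts : t < s) (hst : s < t + 1) {K : Set Plane}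
    (hK : IsCompact K) (hKc : Convex ℝ K) (hAK : γ '' Icc t s ⊆ K) (hKΩ : K ⊆ closure Ω) :
    ∃ σ, IsBoundingCurve Ω (γ '' Icc t s) K (γ t) (γ s) σ := by
  rcases (interior K).eq_empty_or_nonempty with h | h
  · exact exists_boundingCurve_of_interior_eq_empty hγ hts hst hKc hAK hKΩ h
  · exact exists_boundingCurve_of_interior_nonempty hΩ hc hb hγ hts hst hK hKc hAK hKΩ h

variable {n : ℕ}

/-! ### Admissible families of regions -/

/-- The curves are chosen for each `K i` separately. The regions lie inside the sets `K i`, so they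
inherit the disjointness of the interiors; they can be strictly smaller when `K i` has no interior.
-/
theorem exists_curvesConv {Ω : Set Plane} (hΩ : IsOpen Ω) (hc : Convex ℝ Ω)
    (hb : Bornology.IsBounded Ω) {γ : ℝ → Plane} (hγ : IsBoundaryParam Ω γ)
    {s : Fin (n + 1) → ℝ} {t : Fin n → ℝ}
    (hst : ∀ i : Fin n, s i.castSucc < t i ∧ t i < s i.succ)
    (hs : s (Fin.last n) = s 0 + 1) {K : Fin n → Set Plane} (hK : ∀ i, IsCompact (K i))
    (hKc : ∀ i, Convex ℝ (K i)) (hAK : ∀ i, γ '' Icc (t i) (s i.succ) ⊆ K i)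
    (hKΩ : ∀ i, K i ⊆ closure Ω)
    (hdisj : ∀ i j, i ≠ j → interior (K i) ∩ interior (K j) = ∅) :
    ∃ σ ∈ CurvesConv Ω γ s t, ∀ i, region γ s t σ i ⊆ K i ∧ interior (K i) ⊆ region γ s t σ i := by
  choose σ hL hcl hinj h0 h1 hconv hsub hint using fun i =>
    exists_boundingCurve hΩ hc hb hγ (hst i).2 (arc_length_lt_one hst hs i) (hK i) (hKc i) (hAK i)
      (hKΩ i)
  refine ⟨σ, ⟨⟨fun i => ⟨hL i, hcl i, hinj i, h0 i, h1 i⟩, fun i j hij => ?_⟩, hconv⟩,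
    fun i => ⟨hsub i, hint i⟩⟩
  rw [← subset_empty_iff, ← hdisj i j hij]
  exact inter_subset_inter (interior_mono (hsub i)) (interior_mono (hsub j))

/-- The closed convex hulls of the arcs serve as regions, since chords of the boundary separate
them. -/
theorem curvesConv_nonempty {Ω : Set Plane} (hΩ : IsOpen Ω) (hc : Convex ℝ Ω)
    (hb : Bornology.IsBounded Ω) {γ : ℝ → Plane} (hγ : IsBoundaryParam Ω γ)
    {s : Fin (n + 1) → ℝ} {t : Fin n → ℝ}
    (hst : ∀ i : Fin n, s i.castSucc < t i ∧ t i < s i.succ)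
    (hs : s (Fin.last n) = s 0 + 1) : (CurvesConv Ω γ s t).Nonempty := by
  have hsub i : closure (convexHull ℝ (γ '' Icc (t i) (s i.succ))) ⊆ closure Ω := by
    refine closure_minimal (convexHull_min ?_ hc.closure) isClosed_closure
    rintro _ ⟨τ, -, rfl⟩
    exact frontier_subset_closure (hγ.mem_frontier τ)
  obtain ⟨σ, hσ, -⟩ := exists_curvesConv hΩ hc hb hγ hst hs
    (K := fun i => closure (convexHull ℝ (γ '' Icc (t i) (s i.succ))))
    (fun i => hb.isCompact_closure.of_isClosed_subset isClosed_closure (hsub i))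
    (fun i => (convex_convexHull ℝ _).closure)
    (fun i => (subset_convexHull ℝ _).trans subset_closure) hsub
    fun i j hij => hull_interior_disjoint hΩ hc hb hγ hst hs hij
  exact ⟨σ, hσ⟩

/-! ### Regions and finiteness of the energy -/

section Region

variable {Ω : Set Plane} {γ : ℝ → Plane} {s : Fin (n + 1) → ℝ} {t : Fin n → ℝ}
  {σ : Fin n → unitInterval → Plane}

theorem isClosed_region (hγ : IsBoundaryParam Ω γ) (hσ : σ ∈ Curves Ω γ s t) (i : Fin n) :
    IsClosed (region γ s t σ i) := by
  obtain ⟨L, hL⟩ := (hσ.1 i).1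
  exact isClosed_enclosed
    ((isCompact_Icc.image hγ.1).union (isCompact_range hL.continuous)).isClosed

theorem region_subset_closure (hc : Convex ℝ Ω) (hγ : IsBoundaryParam Ω γ)
    (hσ : σ ∈ Curves Ω γ s t) (i : Fin n) : region γ s t σ i ⊆ closure Ω := by
  refine enclosed_subset isClosed_closure hc.closure
    ⟨γ 0, frontier_subset_closure (hγ.mem_frontier 0)⟩
    (union_subset ?_ (range_subset_iff.2 (hσ.1 i).2.1))
  rintro _ ⟨τ, -, rfl⟩
  exact frontier_subset_closure (hγ.mem_frontier τ)

theorem arc_subset_region (i : Fin n) : γ '' Icc (t i) (s i.succ) ⊆ region γ s t σ i :=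
  subset_union_left.trans (subset_enclosed _)

theorem volume_regionUnion_lt_top (hc : Convex ℝ Ω) (hb : Bornology.IsBounded Ω)
    (hγ : IsBoundaryParam Ω γ) (hσ : σ ∈ Curves Ω γ s t) :
    volume (regionUnion γ s t σ) < ⊤ :=
  (measure_mono (iUnion_subset fun i => region_subset_closure hc hγ hσ i)).trans_lt
    hb.isCompact_closure.measure_lt_top

theorem energy_eq_coe {φ : Plane → ℝ} {ψ : Plane → ℝ} (hψ : boundaryArea Ω φ ψ ≠ ⊤)
    (hσ : volume (regionUnion γ s t σ) ≠ ⊤) :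
    energy Ω φ γ s t (σ, ψ) =
      (((boundaryArea Ω φ ψ).toReal - (volume (regionUnion γ s t σ)).toReal : ℝ) : EReal) := by
  have h1 : area Ω ψ ≠ ⊤ := ne_top_of_le_ne_top hψ le_self_add
  have h2 : ∫⁻ x in frontier Ω, ENNReal.ofReal |trace Ω ψ x - φ x| ∂μH[1] ≠ ⊤ :=
    ne_top_of_le_ne_top hψ le_add_self
  rw [energy, boundaryArea, ENNReal.toReal_add h1 h2]
  simp only
  rw [← EReal.coe_ennreal_toReal h1, ← EReal.coe_ennreal_toReal h2, ← EReal.coe_ennreal_toReal hσ]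
  norm_cast
  ring_nf

/-- For `ψ` in `BV` only the boundary term can be infinite. Such competitors have energy `⊤` and may
be ignored in the minimization. -/
theorem energy_eq_top {φ : Plane → ℝ} {ψ : Plane → ℝ} (hψ : boundaryArea Ω φ ψ = ⊤)
    (ha : area Ω ψ ≠ ⊤) (hσ : volume (regionUnion γ s t σ) ≠ ⊤) :
    energy Ω φ γ s t (σ, ψ) = ⊤ := by
  have h2 : ∫⁻ x in frontier Ω, ENNReal.ofReal |trace Ω ψ x - φ x| ∂μH[1] = ⊤ :=
    (ENNReal.add_eq_top.1 hψ).resolve_left ha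
  rw [energy]
  simp only
  rw [h2, ← EReal.coe_ennreal_toReal ha, ← EReal.coe_ennreal_toReal hσ, EReal.coe_ennreal_top,
    ← EReal.coe_sub, EReal.coe_add_top]

end Region

/-! ### A competitor of finite energy and the minimization -/

theorem memBV_zero (Ω : Set Plane) : MemBV Ω fun _ => 0 := by
  refine ⟨integrableOn_zero, 0, by simp, fun η _ _ _ => ?_⟩
  simp

theorem trace_zero {Ω : Set Plane} (hΩ : IsOpen Ω) {x : Plane} (hx : x ∈ closure Ω) :
    trace Ω (fun _ => 0) x = 0 :=
  IsTraceAt.trace_eq hΩ integrableOn_zero hx (by simp [IsTraceAt])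

theorem boundaryArea_zero_lt_top {Ω : Set Plane} (hΩ : IsOpen Ω) (hc : Convex ℝ Ω)
    (hb : Bornology.IsBounded Ω) {φ : Plane → ℝ} (hφ : ContinuousOn φ (frontier Ω)) :
    boundaryArea Ω φ (fun _ => 0) < ⊤ := by
  have hcomp : IsCompact (frontier Ω) :=
    hb.isCompact_closure.of_isClosed_subset isClosed_frontier frontier_subset_closure
  obtain ⟨M, hM⟩ := hcomp.exists_bound_of_continuousOn hφ
  have hfin := frontier_finite_restrict hΩ hc hb subset_rfl
  refine ENNReal.add_lt_top.2 ⟨?_, ?_⟩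
  · rw [area_eq_areaMeasure hΩ.measurableSet]
    exact areaMeasure_lt_top hΩ hb (memBV_zero Ω) subset_rfl
  · calc _ ≤ ∫⁻ _ in frontier Ω, ENNReal.ofReal M ∂μH[1] := by
          refine setLIntegral_mono' isClosed_frontier.measurableSet fun x hx => ?_
          rw [trace_zero hΩ (frontier_subset_closure hx), zero_sub, abs_neg]
          exact ENNReal.ofReal_le_ofReal (hM x hx)
      _ < ⊤ := by
          rw [lintegral_const]
          exact ENNReal.mul_lt_top ENNReal.ofReal_lt_top (measure_lt_top _ _)

theorem exists_minimizer {Ω : Set Plane} (hΩ : IsOpen Ω) (hc : Convex ℝ Ω)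
    (hb : Bornology.IsBounded Ω) {γ : ℝ → Plane} (hγ : IsBoundaryParam Ω γ)
    {s : Fin (n + 1) → ℝ} {t : Fin n → ℝ}
    (hst : ∀ i : Fin n, s i.castSucc < t i ∧ t i < s i.succ)
    (hs : s (Fin.last n) = s 0 + 1) {φ : Plane → ℝ} (hφ : ContinuousOn φ (frontier Ω))
    (hφ0 : ∀ x ∈ frontier Ω, 0 ≤ φ x) :
    ∃ w ∈ Wconv Ω γ s t, (∃ m : ℝ, energy Ω φ γ s t w = (m : EReal)) ∧
      ∀ w' ∈ Wconv Ω γ s t, energy Ω φ γ s t w ≤ energy Ω φ γ s t w' := by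
  have hne : Ω.Nonempty := by
    have := frontier_subset_closure (hγ.mem_frontier 0)
    exact closure_nonempty_iff.1 ⟨_, this⟩
  set v : (Fin n → unitInterval → Plane) → ℝ := fun σ => (volume (regionUnion γ s t σ)).toReal with hv
  set e : (Fin n → unitInterval → Plane) × (Plane → ℝ) → ℝ := fun w =>
    (boundaryArea Ω φ w.2).toReal - v w.1 with he
  have hvfin {σ} (hσ : σ ∈ CurvesConv Ω γ s t) : volume (regionUnion γ s t σ) ≠ ⊤ :=
    (volume_regionUnion_lt_top hc hb hγ hσ.1).ne
  -- The infimum is taken over competitors with finite `boundaryArea`, where the energy is a real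
  -- number; the others are compared at the end.
  set S := e '' {w | w ∈ Wconv Ω γ s t ∧ boundaryArea Ω φ w.2 ≠ ⊤} with hS
  have hSne : S.Nonempty := by
    obtain ⟨σ, hσ⟩ := curvesConv_nonempty hΩ hc hb hγ hst hs
    exact ⟨_, (σ, fun _ => 0), ⟨⟨hσ, memBV_zero Ω, by simp⟩,
      (boundaryArea_zero_lt_top hΩ hc hb hφ).ne⟩, rfl⟩
  have hSb : BddBelow S := by
    refine ⟨-(volume (closure Ω)).toReal, ?_⟩
    rintro _ ⟨w, ⟨hw, -⟩, rfl⟩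
    have : v w.1 ≤ (volume (closure Ω)).toReal :=
      ENNReal.toReal_mono hb.isCompact_closure.measure_lt_top.ne
        (measure_mono (iUnion_subset fun i => region_subset_closure hc hγ hw.1.1 i))
    have h0 : 0 ≤ (boundaryArea Ω φ w.2).toReal := ENNReal.toReal_nonneg
    simp only [he]
    linarith
  set m := sInf S with hm
  obtain ⟨u, -, hu, huS⟩ := exists_seq_tendsto_sInf hSne hSb
  choose w hwS hwu using huS
  obtain ⟨K, g, hg, hK, hKΩ, hKc, hAK, hKd, hKint, hKvol⟩ :=
    exists_limit_regions hb.isCompact_closure (fun k i => region γ s t (w k).1 i)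
      (fun k i => isClosed_region hγ (hwS k).1.1.1 i)
      (fun k i => region_subset_closure hc hγ (hwS k).1.1.1 i)
      (fun k i => (hwS k).1.1.2 i) (A := fun i => γ '' Icc (t i) (s i.succ))
      (fun i => (nonempty_Icc.2 (hst i).2.le).image γ) (fun k i => arc_subset_region i)
      (fun k i j hij => (hwS k).1.1.1.2 i j hij)
  set V := (volume (⋃ i, K i)).toReal with hV
  have hVfin : volume (⋃ i, K i) ≠ ⊤ := (isCompact_iUnion hK).measure_lt_top.ne
  -- The energies tend to `m` and the areas are eventually at most `V + δ / 2`. The part depending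
  -- on `ψ` is thus asymptotically at most `m + V`, the level used for the limit function.
  have hbound : ∀ δ : ℝ≥0, 0 < δ → ∀ᶠ k in atTop,
      (boundaryArea Ω φ (w (g k)).2).toReal ≤ m + V + δ := by
    intro δ hδ
    have hδ2 : (0 : ℝ) < δ / 2 := by positivity
    have h1 : ∀ᶠ k in atTop, u (g k) < m + δ / 2 :=
      (hu.comp hg.tendsto_atTop).eventually_lt_const (by linarith)
    filter_upwards [h1, hKvol (ENNReal.ofReal (δ / 2)) (ENNReal.ofReal_pos.2 hδ2).ne'] with k h1 h2
    have h3 : v (w (g k)).1 ≤ V + δ / 2 := by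
      have := ENNReal.toReal_mono (by finiteness) h2
      rwa [ENNReal.toReal_add hVfin ENNReal.ofReal_ne_top, ENNReal.toReal_ofReal hδ2.le] at this
    rw [← hwu] at h1
    simp only [he] at h1
    linarith
  have hmV : 0 ≤ m + V := by
    refine le_of_forall_pos_le_add fun δ hδ => ?_
    obtain ⟨k, hk⟩ := (hbound ⟨δ, hδ.le⟩ hδ).exists
    exact ENNReal.toReal_nonneg.trans hk
  obtain ⟨ψ, hψ, hψL, hψ0⟩ := exists_limit_function hΩ hc hne hb hφ hφ0
    (f := fun k => (w (g k)).2) (fun k => (hwS _).1.2.1)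
    (E := fun k => ⋃ i, region γ s t (w (g k)).1 i)
    (fun k => by
      rw [ae_restrict_iff' hΩ.measurableSet]
      filter_upwards [(hwS (g k)).1.2.2] with x hx hxΩ hxE using hx ⟨hxΩ, hxE⟩)
    (L := (m + V).toNNReal) (fun δ hδ => by
      filter_upwards [hbound δ hδ] with k hk
      have hfin := (hwS (g k)).2
      rw [← ENNReal.ofReal_toReal hfin, ENNReal.ofReal, ENNReal.coe_le_coe,
        Real.toNNReal_le_iff_le_coe, NNReal.coe_add, Real.coe_toNNReal _ hmV]
      exact hk)
  obtain ⟨σ, hσ, hσK⟩ := exists_curvesConv hΩ hc hb hγ hst hs hK hKc hAK hKΩ hKd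
  -- The frontier of a convex set is a null set, so `K i` and the region built from it agree almost
  -- everywhere, and almost every point of a region is interior to `K i`.
  have hnull : ∀ᵐ x ∂(volume : Measure Plane), ∀ i, x ∉ frontier (K i) :=
    ae_all_iff.2 fun i => measure_eq_zero_iff_ae_notMem.1 ((hKc i).addHaar_frontier volume)
  have hvol : volume (regionUnion γ s t σ) = volume (⋃ i, K i) := by
    refine measure_congr ?_
    filter_upwards [hnull] with x hx
    refine propext ⟨fun h => ?_, fun h => ?_⟩
    · obtain ⟨i, hi⟩ := mem_iUnion.1 h
      exact mem_iUnion.2 ⟨i, (hσK i).1 hi⟩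
    · obtain ⟨i, hi⟩ := mem_iUnion.1 h
      refine mem_iUnion.2 ⟨i, (hσK i).2 ?_⟩
      by_contra hcon
      exact hx i ⟨subset_closure hi, hcon⟩
  have hψfin : boundaryArea Ω φ ψ ≠ ⊤ := ne_top_of_le_ne_top ENNReal.coe_ne_top hψL
  have hmin : e (σ, ψ) ≤ m := by
    have h1 := ENNReal.toReal_mono ENNReal.coe_ne_top hψL
    rw [ENNReal.coe_toReal, Real.coe_toNNReal _ hmV] at h1
    simp only [he, hv, hvol]
    linarith
  refine ⟨(σ, ψ), ⟨hσ, hψ, ?_⟩, ⟨_, energy_eq_coe hψfin (hvfin hσ)⟩, fun w' hw' => ?_⟩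
  · have h0 : ∀ᵐ x ∂(volume : Measure Plane), ∀ k, x ∈ Ω →
        (∀ j ≥ k, x ∈ ⋃ i, region γ s t (w (g j)).1 i) → ψ x = 0 :=
      ae_all_iff.2 fun k => (ae_restrict_iff' hΩ.measurableSet).1 (hψ0 k)
    filter_upwards [h0, hnull] with x hx hxn ⟨hxΩ, hxE⟩
    obtain ⟨i, hi⟩ := mem_iUnion.1 hxE
    have hxi : x ∈ interior (K i) := by
      by_contra hcon
      exact hxn i ⟨subset_closure ((hσK i).1 hi), hcon⟩
    -- An interior point of `K i` belongs to all late regions, which is where the limit function is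
    -- known to vanish.
    obtain ⟨k, hk⟩ := eventually_atTop.1 (hKint i x hxi)
    exact hx k hxΩ fun j hj => mem_iUnion.2 ⟨i, hk j hj⟩
  · by_cases hfin : boundaryArea Ω φ w'.2 = ⊤
    · have ha : area Ω w'.2 ≠ ⊤ := by
        rw [area_eq_areaMeasure hΩ.measurableSet]
        exact (areaMeasure_lt_top hΩ hb hw'.2.1 subset_rfl).ne
      rw [energy_eq_top (σ := w'.1) (ψ := w'.2) hfin ha (hvfin hw'.1)]
      exact le_top
    · rw [energy_eq_coe hψfin (hvfin hσ), energy_eq_coe (σ := w'.1) (ψ := w'.2) hfin (hvfin hw'.1),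
        EReal.coe_le_coe_iff]
      exact hmin.trans (csInf_le hSb ⟨w', ⟨hw', hfin⟩, rfl⟩)

end RelaxedArea

end

/-- The points `p_i = γ (s i)`, `q_i = γ (t i)` follow each other along `∂Ω` in the order
`p_1, q_1, p_2, …, p_n, q_n, p_{n+1} = p_1`. The functional has a minimizer in `𝒲_conv`, and the
minimum is a real number. -/
theorem theorem3p1
    (Ω : Set RelaxedArea.Plane) (hΩ_open : IsOpen Ω) (hΩ_bdd : Bornology.IsBounded Ω)
    (hΩ_conv : Convex ℝ Ω)
    (γ : ℝ → RelaxedArea.Plane) (hγ : RelaxedArea.IsBoundaryParam Ω γ)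
    (n : ℕ) (hn : 1 ≤ n) (s : Fin (n + 1) → ℝ) (t : Fin n → ℝ)
    (hst : ∀ i : Fin n, s i.castSucc < t i ∧ t i < s i.succ)
    (hs : s (Fin.last n) = s 0 + 1)
    (φ : RelaxedArea.Plane → ℝ) (hφ_cont : ContinuousOn φ (frontier Ω))
    (hφ_nonneg : ∀ x ∈ frontier Ω, 0 ≤ φ x)
    (hφ_zero : ∀ i : Fin n, ∀ x ∈ γ '' Set.Ioo (t i) (s i.succ), φ x = 0)
    (hφ_pos : ∀ i : Fin n, ∀ x ∈ γ '' Set.Ioo (s i.castSucc) (t i), 0 < φ x)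
    (hφ_lip : ∀ i : Fin n, RelaxedArea.HasLipschitzGraph φ (γ '' Set.Ioo (s i.castSucc) (t i))) :
    ∃ w ∈ RelaxedArea.Wconv Ω γ s t,
      (∃ m : ℝ, RelaxedArea.energy Ω φ γ s t w = (m : EReal)) ∧
      ∀ w' ∈ RelaxedArea.Wconv Ω γ s t,
        RelaxedArea.energy Ω φ γ s t w ≤ RelaxedArea.energy Ω φ γ s t w' := by
  exact RelaxedArea.exists_minimizer hΩ_open hΩ_conv hΩ_bdd hγ hst hs hφ_cont hφ_nonneg
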